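/- **Proposition 3.5 (spectral sequence for the IIb move).** Let $k$ be a field. *The bicomplex of a diagram.* Let $D$ be an oriented tangle diagram; strands may carry marks, and every component without crossings carries at least one. Let $S_D$ be the polynomial ring over $k$ with one variable of degree 2 for each flag (crossing, adjacent edge), each mark and each end. An edge running from the flag (or mark, or end) $\alpha$ to $\beta$ gives the horizontal Koszul complex $S_D\xrightarrow{\,t_\alpha-t_\beta\,}S_D$. At a crossing, let $i,j$ be its left and right outgoing flags and $l,k$ its left and right incoming flags; let $L'$, $L''$ be the horizontal Koszul complexes of $(t_i+t_j-t_k-t_l,\;t_it_j-t_kt_l)$ and of $(t_i-t_l,\;t_j-t_k)$. A positive crossing gives the vertical two-term complex $L'\to L''$ lifting the projection $S_D/(t_i+t_j-t_k-t_l,\,t_it_j-t_kt_l)\to S_D/(t_i-t_l,\,t_j-t_k)$; a negative one gives $L''\to L'\{-2\}$ lifting multiplication by $t_i-t_k$. In both cases $L''$ is in vertical degree 0. The bicomplex $KR_0(D)$ is the tensor product over $S_D$ of the complexes of all edges and crossings. It is graded, with the internal degrees of the Koszul generators normalised so that all differentials have internal degree 0; everything below is understood in each internal degree separately. For a bicomplex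 $C$, let $H_{hv}^{i,j}(C)$ be the $j$-th vertical (cohomological) homology of the $i$-th horizontal (homological) homology of $C$. It depends only on the class of $C$ in the homotopy category $\mathcal K$ of complexes in the derived category of $k$-vector spaces. Write $H_{hv}^{i,j}(D)=H_{hv}^{i,j}(KR_0(D))$ for a link diagram $D$. *The move.* Let $K$ and $K'$ be oriented link diagrams related by a Reidemeister IIb move: $K$ consists of a tangle diagram $W$ and two antiparallel strands that do not cross, and $K'$ consists of the same $W$ and two antiparallel strands that cross each other twice. Strand $0$ leads from the outgoing end $a$ of $W$ to its incoming end $c$, and strand $1$ from the outgoing end $d$ to the incoming end $b$. Put $R'=k[t_a,t_b,t_c,t_d]$ and $N_2=R'\{-2\}/(t_a-t_b,\,t_c-t_d)$. *Existence of $\iota$.* There are bounded bicomplexes $C$ and $C'$, isomorphic in $\mathcal K$ to $KR_0(K)$ and $KR_0(K')$ respectively, and an injective morphism of bicomplexes $\iota:C\to C'$ with cokernel $$\operatorname{coker}\iota\;\cong\; KR_0(W)\otimes_{R'}\bigl(N_2\xrightarrow{\ \mathrm{id}\ }N_2\bigr),$$ where the two-term complex is vertical, in degrees $0$ and $1$.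 *The spectral sequence.* For every such $(C,C',\iota)$, with induced maps $H_{hv}^{i,j}(\iota):H_{hv}^{i,j}(K)\to H_{hv}^{i,j}(K')$, there is a cohomological spectral sequence $(E_r^{p,q},\,d_r)_{r\ge 2}$, with $d_r:E_r^{p,q}\to E_r^{p+r,\,q-r+1}$, such that for all $i,j\in\mathbb Z$ $$E_2^{-3i,\,j}\cong\ker H_{hv}^{i,j}(\iota),\qquad E_2^{-3i+1,\,j}\cong\operatorname{coker} H_{hv}^{i,j}(\iota),\qquad E_2^{-3i+2,\,j}=0,$$ and which converges to $0$, i.e. $E_\infty^{p,q}=0$ for all $p,q$. Let $$\alpha_{i,j}:H_{hv}^{i,j}(K')\twoheadrightarrow\operatorname{coker}H_{hv}^{i,j}(\iota)\xrightarrow{\ d_2\ }\ker H_{hv}^{i-1,j-1}(\iota)\hookrightarrow H_{hv}^{i-1,j-1}(K).$$ Then $$\cdots\to H_{hv}^{i,j}(K)\xrightarrow{H_{hv}^{i,j}(\iota)}H_{hv}^{i,j}(K')\xrightarrow{\ \alpha_{i,j}\ }H_{hv}^{i-1,j-1}(K)\xrightarrow{H_{hv}^{i-1,j-1}(\iota)}H_{hv}^{i-1,j-1}(K')\to\cdots$$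 is a complex for all $i,j$, and these complexes are all exact if and only if the spectral sequence collapses at the $E_3$-page, i.e. $d_r=0$ for all $r\ge3$. -/

import Mathlib

open CategoryTheory CategoryTheory.Limits
open scoped Kronecker

universe w u

namespace TripleLink

/-! ## Bicomplexes of graded vector spaces and the category `K(D^b)` -/

/-- Bicomplexes: (vertical) cochain complexes of (horizontal) cochain complexes of `k`-vector
spaces.  If `C` is a bicomplex, `(C.X j).X i` is the term in vertical degree `j` and horizontal
(cohomological) degree `i`. -/
abbrev Bicomplex (k : Type u) [Field k] : Type (u + 1) :=
  CochainComplex (CochainComplex (ModuleCat.{u} k) ℤ) ℤ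

/-- Only finitely many rows and columns are nonzero. -/
def Bicomplex.IsBounded {k : Type u} [Field k] (C : Bicomplex k) : Prop :=
  ∃ N : ℤ, ∀ j i : ℤ, (N < |j| ∨ N < |i|) → IsZero ((C.X j).X i)

/-- The homotopy category of (vertical) complexes in the derived category of `k`-vector spaces. -/
abbrev KD (k : Type u) [Field k] [HasDerivedCategory.{w} (ModuleCat.{u} k)] : Type (max w (u + 1)) :=
  HomotopyCategory (DerivedCategory (ModuleCat.{u} k)) (ComplexShape.up ℤ)

/-- The functor sending a bicomplex to its class in `K(D)`. -/
noncomputable def toKD (k : Type u) [Field k] [HasDerivedCategory.{w} (ModuleCat.{u} k)] :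
    Bicomplex k ⥤ KD.{w} k :=
  (DerivedCategory.Q (C := ModuleCat.{u} k)).mapHomologicalComplex (ComplexShape.up ℤ) ⋙
    HomotopyCategory.quotient _ _

/-- "Horizontal then vertical" homology `H_{hv}^{i,j}`, as a functor on `K(D)`.  The horizontal
index `i` is homological (so the `i`-th horizontal homology sits in cohomological degree `-i`), and
the vertical index `j` is cohomological. -/
noncomputable def Hhv (k : Type u) [Field k] [HasDerivedCategory.{w} (ModuleCat.{u} k)] (i j : ℤ) :
    KD.{w} k ⥤ ModuleCat.{u} k :=
  (DerivedCategory.homologyFunctor (ModuleCat.{u} k) (-i)).mapHomotopyCategory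
      (ComplexShape.up ℤ) ⋙ HomotopyCategory.homologyFunctor _ _ j

/-! ## Bicomplexes of free graded modules with a homogeneous basis -/

section FreeBicomplex

variable {k Q : Type u} [Field k] [CommRing Q] [Algebra k Q]

/-- A bicomplex of finitely generated free graded modules over the graded ring `(Q, 𝒜)`, with a
homogeneous basis `B`.  The entry `(b, b')` of a matrix is the coefficient of `b` in the
differential of `b'`.  The horizontal differential `dh` has bidegree `(1, 0)`, the vertical one
`dv` has bidegree `(0, 1)`, the two commute, and both preserve the internal degree `pdeg`. -/
structure FreeBicomplex (𝒜 : ℤ → Submodule k Q) where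
  B : Type
  [fintypeB : Fintype B]
  [decEqB : DecidableEq B]
  hdeg : B → ℤ
  vdeg : B → ℤ
  pdeg : B → ℤ
  dh : Matrix B B Q
  dv : Matrix B B Q
  dh_deg : ∀ b b', dh b b' ≠ 0 → hdeg b = hdeg b' + 1 ∧ vdeg b = vdeg b'
  dv_deg : ∀ b b', dv b b' ≠ 0 → hdeg b = hdeg b' ∧ vdeg b = vdeg b' + 1
  dh_mem : ∀ b b', dh b b' ∈ 𝒜 (pdeg b' - pdeg b)
  dv_mem : ∀ b b', dv b b' ∈ 𝒜 (pdeg b' - pdeg b)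
  dh_sq : dh * dh = 0
  dv_sq : dv * dv = 0
  comm : dh * dv = dv * dh

attribute [instance] FreeBicomplex.fintypeB FreeBicomplex.decEqB

namespace FreeBicomplex

section ToBicomplex

variable {𝒜 : ℤ → Submodule k Q} (P : FreeBicomplex 𝒜)

/-- The part of the free module `B → Q` of internal degree `n`, vertical degree `j` and horizontal
degree `i`. -/
def piece (n j i : ℤ) : Submodule k (P.B → Q) where
  carrier := {f | ∀ b, f b ∈ 𝒜 (n - P.pdeg b) ∧ (f b ≠ 0 → P.vdeg b = j ∧ P.hdeg b = i)}
  zero_mem' b := ⟨Submodule.zero_mem _, fun h => (h rfl).elim⟩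
  add_mem' {f g} hf hg b := by
    refine ⟨Submodule.add_mem _ (hf b).1 (hg b).1, fun h => ?_⟩
    by_cases h0 : f b = 0
    · exact (hg b).2 (by simpa [h0] using h)
    · exact (hf b).2 h0
  smul_mem' c f hf b := by
    refine ⟨Submodule.smul_mem _ _ (hf b).1, fun h => (hf b).2 fun h0 => h ?_⟩
    simp [h0]

variable [SetLike.GradedMonoid 𝒜]

lemma mulVec_mem {n j i j' i' : ℤ} (D : Matrix P.B P.B Q)
    (hm : ∀ b b', D b b' ∈ 𝒜 (P.pdeg b' - P.pdeg b))
    (hd : ∀ b b', D b b' ≠ 0 → P.vdeg b' = j → P.hdeg b' = i → P.vdeg b = j' ∧ P.hdeg b = i')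
    {f : P.B → Q} (hf : f ∈ P.piece n j i) : D.mulVec f ∈ P.piece n j' i' := by
  intro b
  constructor
  · refine Submodule.sum_mem _ fun b' _ => ?_
    have := SetLike.GradedMul.mul_mem (hm b b') (hf b').1
    rwa [show P.pdeg b' - P.pdeg b + (n - P.pdeg b') = n - P.pdeg b by ring] at this
  · intro h
    obtain ⟨b', -, hb'⟩ := Finset.exists_ne_zero_of_sum_ne_zero h
    have h1 : D b b' ≠ 0 := left_ne_zero_of_mul hb'
    have h2 := (hf b').2 (right_ne_zero_of_mul hb')
    exact hd b b' h1 h2.1 h2.2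

/-- The horizontal differential on the homogeneous pieces. -/
def hmap (n j : ℤ) {i i' : ℤ} (h : i + 1 = i') : P.piece n j i →ₗ[k] P.piece n j i' :=
  (P.dh.mulVecLin.restrictScalars k).restrict fun _ hf =>
    P.mulVec_mem P.dh P.dh_mem (fun b b' hb hj hi => by
      have := P.dh_deg b b' hb
      constructor <;> lia) hf

/-- The vertical differential on the homogeneous pieces. -/
def vmap (n i : ℤ) {j j' : ℤ} (h : j + 1 = j') : P.piece n j i →ₗ[k] P.piece n j' i :=
  (P.dv.mulVecLin.restrictScalars k).restrict fun _ hf =>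
    P.mulVec_mem P.dv P.dv_mem (fun b b' hb hj hi => by
      have := P.dv_deg b b' hb
      constructor <;> lia) hf

/-- The `j`-th row, in internal degree `n`. -/
def row (n j : ℤ) : CochainComplex (ModuleCat.{u} k) ℤ where
  X i := ModuleCat.of k (P.piece n j i)
  d i i' := if h : i + 1 = i' then ModuleCat.ofHom (P.hmap n j h) else 0
  shape i i' h := dif_neg h
  d_comp_d' i i' i'' h h' := by
    have h : i + 1 = i' := h
    have h' : i' + 1 = i'' := h'
    rw [dif_pos h, dif_pos h']
    refine ModuleCat.hom_ext (LinearMap.ext fun f => Subtype.ext ?_)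
    change P.dh.mulVec (P.dh.mulVec f.1) = 0
    rw [Matrix.mulVec_mulVec, P.dh_sq, Matrix.zero_mulVec]

/-- The bicomplex of `k`-vector spaces given by the part of internal degree `n`. -/
def toBicomplex (n : ℤ) : Bicomplex k where
  X j := P.row n j
  d j j' := if h : j + 1 = j' then
    { f := fun i => ModuleCat.ofHom (P.vmap n i h)
      comm' := fun i i' hi => by
        have hi : i + 1 = i' := hi
        dsimp only [row]
        rw [dif_pos hi, dif_pos hi]
        refine ModuleCat.hom_ext (LinearMap.ext fun f => Subtype.ext ?_)
        change P.dh.mulVec (P.dv.mulVec f.1) = P.dv.mulVec (P.dh.mulVec f.1)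
        rw [Matrix.mulVec_mulVec, Matrix.mulVec_mulVec, P.comm] } else 0
  shape j j' h := dif_neg h
  d_comp_d' j j' j'' h h' := by
    have h : j + 1 = j' := h
    have h' : j' + 1 = j'' := h'
    rw [dif_pos h, dif_pos h']
    refine HomologicalComplex.hom_ext _ _ fun i =>
      ModuleCat.hom_ext (LinearMap.ext fun f => Subtype.ext ?_)
    change P.dv.mulVec (P.dv.mulVec f.1) = 0
    rw [Matrix.mulVec_mulVec, P.dv_sq, Matrix.zero_mulVec]

end ToBicomplex

/-- Extension of scalars along a homomorphism of graded rings. -/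
def baseChange {𝒜 : ℤ → Submodule k Q} {Q' : Type u} [CommRing Q'] [Algebra k Q']
    {ℬ : ℤ → Submodule k Q'} (P : FreeBicomplex 𝒜) (φ : Q →+* Q')
    (hφ : ∀ n a, a ∈ 𝒜 n → φ a ∈ ℬ n) : FreeBicomplex ℬ where
  B := P.B
  hdeg := P.hdeg
  vdeg := P.vdeg
  pdeg := P.pdeg
  dh := P.dh.map φ
  dv := P.dv.map φ
  dh_deg b b' h := P.dh_deg b b' fun h0 => h (by simp [h0])
  dv_deg b b' h := P.dv_deg b b' fun h0 => h (by simp [h0])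
  dh_mem b b' := hφ _ _ (P.dh_mem b b')
  dv_mem b b' := hφ _ _ (P.dv_mem b b')
  dh_sq := by rw [← Matrix.map_mul, P.dh_sq]; ext; simp
  dv_sq := by rw [← Matrix.map_mul, P.dv_sq]; ext; simp
  comm := by rw [← Matrix.map_mul, ← Matrix.map_mul, P.comm]

section Tensor

variable {𝒜 : ℤ → Submodule k Q}

/-- The sign operator attached to a degree function. -/
def sgn {B : Type} [DecidableEq B] (Q : Type u) [CommRing Q] (deg : B → ℤ) : Matrix B B Q :=
  Matrix.diagonal fun b => (((deg b).negOnePow : ℤ) : Q)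

lemma sgn_sq {B : Type} [DecidableEq B] [Fintype B] (deg : B → ℤ) :
    sgn Q deg * sgn Q deg = 1 := by
  rw [sgn, Matrix.diagonal_mul_diagonal, ← Matrix.diagonal_one]
  congr 1
  ext b
  rw [← Int.cast_mul, ← Units.val_mul, Int.units_mul_self]
  simp

lemma sgn_comm {B : Type} [DecidableEq B] [Fintype B] (deg : B → ℤ) (D : Matrix B B Q)
    (h : ∀ b b', D b b' ≠ 0 → deg b = deg b') : sgn Q deg * D = D * sgn Q deg := by
  ext b b'
  rw [sgn, Matrix.diagonal_mul, Matrix.mul_diagonal]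
  by_cases h0 : D b b' = 0
  · simp [h0]
  · rw [h b b' h0, mul_comm]

lemma sgn_anticomm {B : Type} [DecidableEq B] [Fintype B] (deg : B → ℤ) (D : Matrix B B Q)
    (h : ∀ b b', D b b' ≠ 0 → deg b = deg b' + 1) : sgn Q deg * D = -(D * sgn Q deg) := by
  ext b b'
  rw [sgn, Matrix.neg_apply, Matrix.diagonal_mul, Matrix.mul_diagonal]
  by_cases h0 : D b b' = 0
  · simp [h0]
  · rw [h b b' h0, Int.negOnePow_succ]
    push_cast
    ring

lemma sgn_comm_sgn {B : Type} [DecidableEq B] [Fintype B] (deg deg' : B → ℤ) :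
    sgn Q deg * sgn Q deg' = sgn Q deg' * sgn Q deg := by
  rw [sgn, sgn, Matrix.diagonal_mul_diagonal, Matrix.diagonal_mul_diagonal]
  congr 1
  ext b
  rw [mul_comm]

lemma kron_sq {A B : Type} [Fintype A] [DecidableEq A] [Fintype B] [DecidableEq B]
    (X S : Matrix A A Q) (Y : Matrix B B Q) (hX : X * X = 0) (hY : Y * Y = 0)
    (hXS : S * X = -(X * S)) : (X ⊗ₖ (1 : Matrix B B Q) + S ⊗ₖ Y) * (X ⊗ₖ 1 + S ⊗ₖ Y) = 0 := by
  simp only [add_mul, mul_add, ← Matrix.mul_kronecker_mul, hX, hY, hXS, Matrix.zero_kronecker,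
    Matrix.kronecker_zero, one_mul, mul_one, add_zero, zero_add]
  ext ⟨a, b⟩ ⟨a', b'⟩
  simp [Matrix.kroneckerMap_apply]

lemma tensor_deg {A B : Type} [DecidableEq A] [DecidableEq B] {X : Matrix A A Q}
    {Y : Matrix B B Q} (deg : A → ℤ) {p p' : A × B}
    (h : (X ⊗ₖ (1 : Matrix B B Q) + sgn Q deg ⊗ₖ Y) p p' ≠ 0) :
    (X p.1 p'.1 ≠ 0 ∧ p.2 = p'.2) ∨ (p.1 = p'.1 ∧ Y p.2 p'.2 ≠ 0) := by
  by_contra! hc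
  refine h ?_
  have h1 : X p.1 p'.1 * (1 : Matrix B B Q) p.2 p'.2 = 0 := by
    by_cases h0 : X p.1 p'.1 = 0
    · rw [h0, zero_mul]
    · rw [Matrix.one_apply_ne (hc.1 h0), mul_zero]
  have h2 : sgn Q deg p.1 p'.1 * Y p.2 p'.2 = 0 := by
    by_cases h0 : p.1 = p'.1
    · rw [hc.2 h0, mul_zero]
    · rw [sgn, Matrix.diagonal_apply_ne _ h0, zero_mul]
  rw [Matrix.add_apply, Matrix.kroneckerMap_apply, Matrix.kroneckerMap_apply, h1, h2, add_zero]

lemma tensor_mem {A B : Type} [DecidableEq A] [DecidableEq B] {X : Matrix A A Q}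
    {Y : Matrix B B Q} (deg : A → ℤ) (w : A → ℤ) (w' : B → ℤ)
    (hX : ∀ b b', X b b' ∈ 𝒜 (w b' - w b)) (hY : ∀ b b', Y b b' ∈ 𝒜 (w' b' - w' b))
    (p p' : A × B) : (X ⊗ₖ (1 : Matrix B B Q) + sgn Q deg ⊗ₖ Y) p p' ∈
      𝒜 (w p'.1 + w' p'.2 - (w p.1 + w' p.2)) := by
  rw [Matrix.add_apply, Matrix.kroneckerMap_apply, Matrix.kroneckerMap_apply]
  refine Submodule.add_mem _ ?_ ?_
  · by_cases h : p.2 = p'.2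
    · rw [h, Matrix.one_apply_eq, mul_one, add_sub_add_right_eq_sub]
      exact hX _ _
    · rw [Matrix.one_apply_ne h, mul_zero]
      exact Submodule.zero_mem _
  · by_cases h : p.1 = p'.1
    · rw [h, sgn, Matrix.diagonal_apply_eq, add_sub_add_left_eq_sub, ← zsmul_eq_mul]
      exact zsmul_mem (hY _ _) _
    · rw [sgn, Matrix.diagonal_apply_ne _ h, zero_mul]
      exact Submodule.zero_mem _

/-- The tensor product over `Q` of two bicomplexes, with the usual sign rule in each direction. -/
def tensor (P R : FreeBicomplex 𝒜) : FreeBicomplex 𝒜 where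
  B := P.B × R.B
  hdeg b := P.hdeg b.1 + R.hdeg b.2
  vdeg b := P.vdeg b.1 + R.vdeg b.2
  pdeg b := P.pdeg b.1 + R.pdeg b.2
  dh := P.dh ⊗ₖ 1 + sgn Q P.hdeg ⊗ₖ R.dh
  dv := P.dv ⊗ₖ 1 + sgn Q P.vdeg ⊗ₖ R.dv
  dh_deg b b' h := by
    rcases tensor_deg _ h with ⟨h1, h2⟩ | ⟨h1, h2⟩
    · have := P.dh_deg _ _ h1
      rw [h2]
      constructor <;> lia
    · have := R.dh_deg _ _ h2
      rw [h1]
      constructor <;> lia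
  dv_deg b b' h := by
    rcases tensor_deg _ h with ⟨h1, h2⟩ | ⟨h1, h2⟩
    · have := P.dv_deg _ _ h1
      rw [h2]
      constructor <;> lia
    · have := R.dv_deg _ _ h2
      rw [h1]
      constructor <;> lia
  dh_mem := tensor_mem _ _ _ P.dh_mem R.dh_mem
  dv_mem := tensor_mem _ _ _ P.dv_mem R.dv_mem
  dh_sq := kron_sq _ _ _ P.dh_sq R.dh_sq
    (sgn_anticomm _ _ fun b b' h => (P.dh_deg b b' h).1)
  dv_sq := kron_sq _ _ _ P.dv_sq R.dv_sq
    (sgn_anticomm _ _ fun b b' h => (P.dv_deg b b' h).2)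
  comm := by
    simp only [add_mul, mul_add, ← Matrix.mul_kronecker_mul, one_mul, mul_one, P.comm, R.comm,
      sgn_comm_sgn P.hdeg P.vdeg,
      sgn_comm P.hdeg P.dv fun b b' h => (P.dv_deg b b' h).1,
      sgn_comm P.vdeg P.dh fun b b' h => (P.dh_deg b b' h).2]
    abel

variable [SetLike.GradedMonoid 𝒜]

/-- The ring `Q` itself, in bidegree `(0, 0)`. -/
def unit (𝒜 : ℤ → Submodule k Q) : FreeBicomplex 𝒜 where
  B := Unit
  hdeg _ := 0
  vdeg _ := 0
  pdeg _ := 0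
  dh := 0
  dv := 0
  dh_deg _ _ h := (h rfl).elim
  dv_deg _ _ h := (h rfl).elim
  dh_mem _ _ := Submodule.zero_mem _
  dv_mem _ _ := Submodule.zero_mem _
  dh_sq := mul_zero _
  dv_sq := mul_zero _
  comm := rfl

/-- Tensor product of a list of bicomplexes. -/
def tensorList (l : List (FreeBicomplex 𝒜)) : FreeBicomplex 𝒜 :=
  l.foldr tensor (unit 𝒜)

/-- The horizontal two-term Koszul complex `Q → Q` given by multiplication by an element `x` of
degree 2 (basis: `0 ↦ 1` in degree 0, `1 ↦ e` in degree `-1`, `d e = x`).  Degrees of Koszul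
generators are normalised so that the differential has internal degree 0. -/
def koszulOne (x : Q) (hx : x ∈ 𝒜 2) : FreeBicomplex 𝒜 where
  B := Fin 2
  hdeg := ![0, -1]
  vdeg _ := 0
  pdeg := ![0, 2]
  dh := !![0, x; 0, 0]
  dv := 0
  dh_deg b b' h := by fin_cases b <;> fin_cases b' <;> simp at h ⊢
  dv_deg _ _ h := (h rfl).elim
  dh_mem b b' := by fin_cases b <;> fin_cases b' <;> simp [hx]
  dv_mem _ _ := Submodule.zero_mem _
  dh_sq := by ext b b'; fin_cases b <;> fin_cases b' <;> simp [Matrix.mul_apply]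
  dv_sq := mul_zero _
  comm := by simp

/-- The vertical two-term complex `Q{a} → Q{a}` with the identity map, in vertical degrees 0 and 1;
here `{a}` is the shift for which the generator of `Q{a}` has degree `a`. -/
def idTwoTerm (𝒜 : ℤ → Submodule k Q) [SetLike.GradedMonoid 𝒜] (a : ℤ) : FreeBicomplex 𝒜 where
  B := Fin 2
  hdeg _ := 0
  vdeg := ![0, 1]
  pdeg _ := a
  dh := 0
  dv := !![0, 0; 1, 0]
  dh_deg _ _ h := (h rfl).elim
  dv_deg b b' h := by fin_cases b <;> fin_cases b' <;> simp at h ⊢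
  dh_mem _ _ := Submodule.zero_mem _
  dv_mem b b' := by
    have : (1 : Q) ∈ 𝒜 0 := SetLike.GradedOne.one_mem
    fin_cases b <;> fin_cases b' <;> simp [this]
  dh_sq := mul_zero _
  dv_sq := by ext b b'; fin_cases b <;> fin_cases b' <;> simp [Matrix.mul_apply]
  comm := by simp

end Tensor

/-! ### The complex of a crossing -/

section Crossing

/-- The Koszul complex of a pair `(x, y)`, in the basis `1, e₁, e₂, e₁e₂`:
`e₁ ↦ x`, `e₂ ↦ y`, `e₁e₂ ↦ x e₂ - y e₁`. -/
def koszulTwo (x y : Q) : Matrix (Fin 4) (Fin 4) Q :=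
  !![0, x, y, 0;
     0, 0, 0, -y;
     0, 0, 0, x;
     0, 0, 0, 0]

/-- Cohomological degrees of `1, e₁, e₂, e₁e₂`. -/
def koszulDeg : Fin 4 → ℤ := ![0, -1, -1, -2]

/-- The Koszul complex of `(t_i + t_j - t_k - t_l, t_i t_j - t_k t_l)`. -/
def singDiff (ti tj tk tl : Q) : Matrix (Fin 4) (Fin 4) Q :=
  koszulTwo (ti + tj - tk - tl) (ti * tj - tk * tl)

/-- The Koszul complex of `(t_i - t_l, t_j - t_k)`. -/
def smoothDiff (ti tj tk tl : Q) : Matrix (Fin 4) (Fin 4) Q :=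
  koszulTwo (ti - tl) (tj - tk)

/-- The map of Koszul complexes lifting the projection
`Q/(t_i+t_j-t_k-t_l, t_it_j-t_kt_l) → Q/(t_i-t_l, t_j-t_k)`. -/
def rhoPos (tj tl : Q) : Matrix (Fin 4) (Fin 4) Q :=
  !![1, 0, 0, 0;
     0, 1, tj, 0;
     0, 1, tl, 0;
     0, 0, 0, tl - tj]

/-- The map of Koszul complexes lifting the map
`Q/(t_i-t_l, t_j-t_k) → Q/(t_i+t_j-t_k-t_l, t_it_j-t_kt_l)` induced by multiplication by
`t_i - t_k`. -/
def rhoNeg (ti tk : Q) : Matrix (Fin 4) (Fin 4) Q :=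
  !![ti - tk, 0, 0, 0;
     0, ti, -tk, 0;
     0, -1, 1, 0;
     0, 0, 0, 1]

lemma koszulTwo_deg (x y : Q) (b b' : Fin 4) (h : koszulTwo x y b b' ≠ 0) :
    koszulDeg b = koszulDeg b' + 1 := by
  fin_cases b <;> fin_cases b' <;> simp [koszulTwo, koszulDeg] at h ⊢

lemma koszulTwo_sq (x y : Q) : koszulTwo x y * koszulTwo x y = 0 := by
  ext b b'
  fin_cases b <;> fin_cases b' <;> simp [koszulTwo, Matrix.mul_apply, Fin.sum_univ_four]
  ring

lemma rhoPos_deg (tj tl : Q) (b b' : Fin 4) (h : rhoPos tj tl b b' ≠ 0) :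
    koszulDeg b = koszulDeg b' := by
  fin_cases b <;> fin_cases b' <;> simp [rhoPos, koszulDeg] at h ⊢

lemma rhoNeg_deg (ti tk : Q) (b b' : Fin 4) (h : rhoNeg ti tk b b' ≠ 0) :
    koszulDeg b = koszulDeg b' := by
  fin_cases b <;> fin_cases b' <;> simp [rhoNeg, koszulDeg] at h ⊢

lemma rhoPos_comm (ti tj tk tl : Q) :
    smoothDiff ti tj tk tl * rhoPos tj tl = rhoPos tj tl * singDiff ti tj tk tl := by
  ext b b'
  fin_cases b <;> fin_cases b' <;>
    simp [rhoPos, smoothDiff, singDiff, koszulTwo, Matrix.mul_apply, Fin.sum_univ_four] <;> ring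

lemma rhoNeg_comm (ti tj tk tl : Q) :
    singDiff ti tj tk tl * rhoNeg ti tk = rhoNeg ti tk * smoothDiff ti tj tk tl := by
  ext b b'
  fin_cases b <;> fin_cases b' <;>
    simp [rhoNeg, smoothDiff, singDiff, koszulTwo, Matrix.mul_apply, Fin.sum_univ_four] <;> ring

variable {𝒜 : ℤ → Submodule k Q}

/-- The two-term vertical complex (with first term in vertical degree `v`) given by a morphism `ρ`
between horizontal complexes with basis `1, e₁, e₂, e₁e₂`. -/
def twoTerm (v : ℤ) (w w' : Fin 4 → ℤ) (D D' ρ : Matrix (Fin 4) (Fin 4) Q)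
    (hD : ∀ b b', D b b' ≠ 0 → koszulDeg b = koszulDeg b' + 1)
    (hD' : ∀ b b', D' b b' ≠ 0 → koszulDeg b = koszulDeg b' + 1)
    (hρ : ∀ b b', ρ b b' ≠ 0 → koszulDeg b = koszulDeg b')
    (mD : ∀ b b', D b b' ∈ 𝒜 (w b' - w b)) (mD' : ∀ b b', D' b b' ∈ 𝒜 (w' b' - w' b))
    (mρ : ∀ b b', ρ b b' ∈ 𝒜 (w b' - w' b))
    (sD : D * D = 0) (sD' : D' * D' = 0) (hc : D' * ρ = ρ * D) : FreeBicomplex 𝒜 where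
  B := Fin 4 ⊕ Fin 4
  hdeg := Sum.elim koszulDeg koszulDeg
  vdeg := Sum.elim (fun _ => v) (fun _ => v + 1)
  pdeg := Sum.elim w w'
  dh := Matrix.fromBlocks D 0 0 D'
  dv := Matrix.fromBlocks 0 0 ρ 0
  dh_deg b b' h := by
    rcases b with b | b <;> rcases b' with b' | b' <;> simp at h ⊢
    · exact hD b b' h
    · exact hD' b b' h
  dv_deg b b' h := by
    rcases b with b | b <;> rcases b' with b' | b' <;> simp at h ⊢
    exact hρ b b' h
  dh_mem b b' := by
    rcases b with b | b <;> rcases b' with b' | b' <;> simp [mD, mD']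
  dv_mem b b' := by
    rcases b with b | b <;> rcases b' with b' | b' <;> simp [mρ]
  dh_sq := by simp [Matrix.fromBlocks_multiply, sD, sD']
  dv_sq := by simp [Matrix.fromBlocks_multiply]
  comm := by simp [Matrix.fromBlocks_multiply, hc]

lemma smoothDiff_mem {ti tj tk tl : Q} (hi : ti ∈ 𝒜 2) (hj : tj ∈ 𝒜 2) (hk : tk ∈ 𝒜 2)
    (hl : tl ∈ 𝒜 2) (b b' : Fin 4) : smoothDiff ti tj tk tl b b' ∈
      𝒜 (![0, 2, 2, 4] b' - ![0, 2, 2, 4] b) := by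
  have h2 : ti - tl ∈ 𝒜 2 := sub_mem hi hl
  have h4 : tj - tk ∈ 𝒜 2 := sub_mem hj hk
  have h4' : tk - tj ∈ 𝒜 2 := sub_mem hk hj
  fin_cases b <;> fin_cases b' <;> simp [smoothDiff, koszulTwo, h2, h4, h4']

variable [SetLike.GradedMonoid 𝒜]

lemma mul_mem_four {x y : Q} (hx : x ∈ 𝒜 2) (hy : y ∈ 𝒜 2) : x * y ∈ 𝒜 4 :=
  SetLike.GradedMul.mul_mem hx hy

lemma singDiff_mem (a : ℤ) {ti tj tk tl : Q} (hi : ti ∈ 𝒜 2) (hj : tj ∈ 𝒜 2) (hk : tk ∈ 𝒜 2)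
    (hl : tl ∈ 𝒜 2) (b b' : Fin 4) : singDiff ti tj tk tl b b' ∈
      𝒜 (![a, a + 2, a + 4, a + 6] b' - ![a, a + 2, a + 4, a + 6] b) := by
  have h2 : ti + tj - tk - tl ∈ 𝒜 2 := sub_mem (sub_mem (add_mem hi hj) hk) hl
  have h4 : ti * tj - tk * tl ∈ 𝒜 4 := sub_mem (mul_mem_four hi hj) (mul_mem_four hk hl)
  have h4' := neg_mem h4
  rw [neg_sub] at h4'
  fin_cases b <;> fin_cases b' <;> simp [singDiff, koszulTwo, h2, h4]
  convert h4' using 2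

lemma rhoPos_mem {tj tl : Q} (hj : tj ∈ 𝒜 2) (hl : tl ∈ 𝒜 2) (b b' : Fin 4) :
    rhoPos tj tl b b' ∈ 𝒜 (![0, 2, 4, 6] b' - ![0, 2, 2, 4] b) := by
  have h1 : (1 : Q) ∈ 𝒜 0 := SetLike.GradedOne.one_mem
  have h2 : tl - tj ∈ 𝒜 2 := sub_mem hl hj
  fin_cases b <;> fin_cases b' <;> simp [rhoPos, h1, h2, hj, hl]

lemma rhoNeg_mem {ti tk : Q} (hi : ti ∈ 𝒜 2) (hk : tk ∈ 𝒜 2) (b b' : Fin 4) :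
    rhoNeg ti tk b b' ∈ 𝒜 (![0, 2, 2, 4] b' - ![-2, 0, 2, 4] b) := by
  have h1 : (1 : Q) ∈ 𝒜 0 := SetLike.GradedOne.one_mem
  have h2 : ti - tk ∈ 𝒜 2 := sub_mem hi hk
  fin_cases b <;> fin_cases b' <;> simp [rhoNeg, h1, h2, hi, hk]

/-- The bicomplex `L_x` of a positive crossing: the Koszul complex of
`(t_i+t_j-t_k-t_l, t_it_j-t_kt_l)` in vertical degree `-1`, mapping to the Koszul complex of
`(t_i-t_l, t_j-t_k)` in vertical degree `0`. -/
def crossingPos (ti tj tk tl : Q) (hi : ti ∈ 𝒜 2) (hj : tj ∈ 𝒜 2) (hk : tk ∈ 𝒜 2)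
    (hl : tl ∈ 𝒜 2) : FreeBicomplex 𝒜 :=
  twoTerm (-1) ![0, 2, 4, 6] ![0, 2, 2, 4]
    (singDiff ti tj tk tl) (smoothDiff ti tj tk tl) (rhoPos tj tl)
    (koszulTwo_deg _ _) (koszulTwo_deg _ _) (rhoPos_deg _ _)
    (singDiff_mem 0 hi hj hk hl) (smoothDiff_mem hi hj hk hl) (rhoPos_mem hj hl)
    (koszulTwo_sq _ _) (koszulTwo_sq _ _) (rhoPos_comm _ _ _ _)

/-- The bicomplex `L_x` of a negative crossing: the Koszul complex of
`(t_i-t_l, t_j-t_k)` in vertical degree `0`, mapping to the Koszul complex of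
`(t_i+t_j-t_k-t_l, t_it_j-t_kt_l)`, shifted by `{-2}`, in vertical degree `1`. -/
def crossingNeg (ti tj tk tl : Q) (hi : ti ∈ 𝒜 2) (hj : tj ∈ 𝒜 2) (hk : tk ∈ 𝒜 2)
    (hl : tl ∈ 𝒜 2) : FreeBicomplex 𝒜 :=
  twoTerm 0 ![0, 2, 2, 4] ![-2, 0, 2, 4]
    (smoothDiff ti tj tk tl) (singDiff ti tj tk tl) (rhoNeg ti tk)
    (koszulTwo_deg _ _) (koszulTwo_deg _ _) (rhoNeg_deg _ _)
    (smoothDiff_mem hi hj hk hl) (singDiff_mem (-2) hi hj hk hl) (rhoNeg_mem hi hk)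
    (koszulTwo_sq _ _) (koszulTwo_sq _ _) (rhoNeg_comm _ _ _ _)

end Crossing

end FreeBicomplex

end FreeBicomplex

/-! ## Graded polynomial rings and their quotients -/

section Grading

variable (k : Type u) [Field k]

/-- The grading of a polynomial ring in which all variables have degree 2. -/
noncomputable abbrev polyGr (σ : Type) : ℤ → Submodule k (MvPolynomial σ k) :=
  MvPolynomial.weightedHomogeneousSubmodule k fun _ : σ => (2 : ℤ)

instance (σ : Type) : SetLike.GradedMonoid (polyGr k σ) :=
  MvPolynomial.WeightedHomogeneousSubmodule.gradedMonoid

lemma X_mem_polyGr {σ : Type} (f : σ) : (MvPolynomial.X f : MvPolynomial σ k) ∈ polyGr k σ 2 :=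
  MvPolynomial.isWeightedHomogeneous_X k _ f

/-- The induced grading on a quotient of a polynomial ring: the degree `n` part is the image of
the polynomials of degree `n`. -/
noncomputable def quotGr {σ : Type} (J : Ideal (MvPolynomial σ k)) (n : ℤ) :
    Submodule k (MvPolynomial σ k ⧸ J) :=
  (polyGr k σ n).map (Ideal.Quotient.mkₐ k J).toLinearMap

instance {σ : Type} (J : Ideal (MvPolynomial σ k)) : SetLike.GradedMonoid (quotGr k J) where
  one_mem := ⟨1, SetLike.GradedOne.one_mem, map_one (Ideal.Quotient.mkₐ k J)⟩
  mul_mem := by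
    rintro _ _ _ _ ⟨x, hx, rfl⟩ ⟨y, hy, rfl⟩
    exact ⟨x * y, SetLike.GradedMul.mul_mem hx hy, map_mul (Ideal.Quotient.mkₐ k J) x y⟩

end Grading

/-! ## Link and tangle diagrams -/

/-- Combinatorial data of an oriented tangle diagram with `p` incoming and `p` outgoing ends.

* `X` is the (finite, enumerated) set of crossings, `pos x` says whether `x` is positive.
* `M` is the (finite, enumerated) set of marks: points on the diagram that are neither crossings
  nor ends.  They subdivide the strands; a component without crossings has to carry a mark.
* At a crossing `x`, seen in the direction of the flow, the two outgoing flags are `(x, false)` (on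
  the left) and `(x, true)` (on the right), and the two incoming flags are `(x, false)` (on the
  left) and `(x, true)` (on the right).  Thus the oriented smoothing joins flags with the same
  label, whereas the strands of the link join flags with different labels.
* The edges are the segments of the diagram between crossings, marks and ends.  An edge starts at
  an outgoing flag of a crossing, at a mark, or at an incoming end of the tangle, and it finishes
  at an incoming flag of a crossing, at a mark, or at an outgoing end.  The bijection `next` sends
  the start of each edge to its finish.

Every planar diagram gives such data.  Planarity is not imposed. -/
structure TangleDiagram (p : ℕ) where
  X : Type
  M : Type
  xs : List X
  ms : List M
  xs_nodup : xs.Nodup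
  ms_nodup : ms.Nodup
  mem_xs : ∀ x, x ∈ xs
  mem_ms : ∀ m, m ∈ ms
  pos : X → Bool
  next : (X × Bool) ⊕ (M ⊕ Fin p) ≃ (X × Bool) ⊕ (M ⊕ Fin p)

/-- A link diagram is a tangle diagram without ends. -/
abbrev LinkDiagram := TangleDiagram 0

/-- The index set of the variables: flags at the crossings, marks and ends. -/
inductive Flag (X M : Type) (p : ℕ) : Type
  | outgoing (x : X) (s : Bool)
  | incoming (x : X) (s : Bool)
  | mark (m : M)
  | start (a : Fin p)
  | finish (a : Fin p)

namespace TangleDiagram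

section Invariant

variable (k : Type u) [Field k] {p : ℕ} (D : TangleDiagram p)

/-- The flags of a diagram. -/
abbrev Flags : Type := Flag D.X D.M p

/-- The flag at the start of an edge. -/
def startFlag : (D.X × Bool) ⊕ (D.M ⊕ Fin p) → D.Flags
  | .inl (x, s) => .outgoing x s
  | .inr (.inl m) => .mark m
  | .inr (.inr a) => .start a

/-- The flag at the finish of an edge. -/
def finishFlag : (D.X × Bool) ⊕ (D.M ⊕ Fin p) → D.Flags
  | .inl (x, s) => .incoming x s
  | .inr (.inl m) => .mark m
  | .inr (.inr a) => .finish a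

/-- The list of all edges, given by their starts. -/
def edges : List ((D.X × Bool) ⊕ (D.M ⊕ Fin p)) :=
  (D.xs ×ˢ [false, true]).map Sum.inl ++ D.ms.map (Sum.inr ∘ Sum.inl) ++
    (List.finRange p).map (Sum.inr ∘ Sum.inr)

/-- The polynomial ring on the flags. -/
abbrev Ring : Type u := MvPolynomial D.Flags k

/-- The bicomplex of an edge. -/
noncomputable def edgeComplex (e : (D.X × Bool) ⊕ (D.M ⊕ Fin p)) :
    FreeBicomplex (polyGr k D.Flags) :=
  FreeBicomplex.koszulOne
    (MvPolynomial.X (D.startFlag e) - MvPolynomial.X (D.finishFlag (D.next e)))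
    (sub_mem (X_mem_polyGr k _) (X_mem_polyGr k _))

/-- The bicomplex of a crossing, with `i`, `j` the outgoing flags (left and right) and `l`, `k` the
incoming flags (left and right). -/
noncomputable def crossingComplex (x : D.X) : FreeBicomplex (polyGr k D.Flags) :=
  if D.pos x then
    FreeBicomplex.crossingPos
      (MvPolynomial.X (.outgoing x false)) (MvPolynomial.X (.outgoing x true))
      (MvPolynomial.X (.incoming x true)) (MvPolynomial.X (.incoming x false))
      (X_mem_polyGr k _) (X_mem_polyGr k _) (X_mem_polyGr k _) (X_mem_polyGr k _)
  else
    FreeBicomplex.crossingNeg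
      (MvPolynomial.X (.outgoing x false)) (MvPolynomial.X (.outgoing x true))
      (MvPolynomial.X (.incoming x true)) (MvPolynomial.X (.incoming x false))
      (X_mem_polyGr k _) (X_mem_polyGr k _) (X_mem_polyGr k _) (X_mem_polyGr k _)

/-- The bicomplex `KR₀(D)`: the tensor product of the bicomplexes of all edges and crossings, over
the polynomial ring on the flags. -/
noncomputable def KR : FreeBicomplex (polyGr k D.Flags) :=
  FreeBicomplex.tensorList (D.edges.map (D.edgeComplex k) ++ D.xs.map (D.crossingComplex k))

end Invariant

/-! ### The IIb move -/

section Move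

variable (W : TangleDiagram 2)

/-- The link diagram obtained from `W` by closing it with two antiparallel strands that do not
cross: the strand `a` leads from the outgoing end `a` of `W` to the incoming end `a` of `W`, and
carries one mark. -/
def closeTrivial : LinkDiagram where
  X := W.X
  M := W.M ⊕ Fin 2
  xs := W.xs
  ms := W.ms.map Sum.inl ++ (List.finRange 2).map Sum.inr
  xs_nodup := W.xs_nodup
  ms_nodup := (W.ms_nodup.map Sum.inl_injective).append
    ((List.nodup_finRange 2).map Sum.inr_injective) (by
      intro a h1 h2
      simp only [List.mem_map] at h1 h2
      obtain ⟨x, -, rfl⟩ := h1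
      obtain ⟨y, -, hy⟩ := h2
      exact Sum.inr_ne_inl hy)
  mem_xs := W.mem_xs
  mem_ms m := by rcases m with m | m <;> simp [W.mem_ms]
  pos := W.pos
  next := ((Equiv.sumCongr (Equiv.refl _) (Equiv.sumEmpty _ (Fin 0))).trans W.next).trans
    (Equiv.sumCongr (Equiv.refl _) (Equiv.sumEmpty _ (Fin 0))).symm

/-- Bookkeeping for `closeBigon`.  The two new crossings are the elements of `Fin 2`; their flags on
the side `s` are inner flags, and the flag on the other side at the crossing `i` takes the place of
the end `π i` of `W`. -/
def bigonEquiv (X M : Type) (s : Bool) (π : Equiv.Perm (Fin 2)) :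
    ((X ⊕ Fin 2) × Bool) ⊕ (M ⊕ Fin 0) ≃ ((X × Bool) ⊕ (M ⊕ Fin 2)) ⊕ Fin 2 where
  toFun
    | .inl (.inl x, b) => .inl (.inl (x, b))
    | .inl (.inr i, b) => if b = s then .inr i else .inl (.inr (.inr (π i)))
    | .inr (.inl m) => .inl (.inr (.inl m))
    | .inr (.inr a) => a.elim0
  invFun
    | .inl (.inl (x, b)) => .inl (.inl x, b)
    | .inl (.inr (.inl m)) => .inr (.inl m)
    | .inl (.inr (.inr i)) => .inl (.inr (π.symm i), !s)
    | .inr i => .inl (.inr i, s)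
  left_inv := by
    rintro (⟨x | i, b⟩ | m | a)
    · rfl
    · cases b <;> cases s <;> simp
    · rfl
    · exact a.elim0
  right_inv := by
    rintro ((⟨x, b⟩ | m | i) | i) <;> simp

/-- The link diagram obtained from `W` by closing it with two antiparallel strands that cross each
other twice.  The crossing `0` is positive and the crossing `1` is negative.  Strand `0` comes from
the outgoing end `0` of `W`, passes through the crossings `0` and `1` and leads to the incoming end
`0` of `W`; strand `1` comes from the outgoing end `1` of `W`, passes through the crossings `1` and
`0` and leads to the incoming end `1` of `W`.  The bigon between the strands is bounded by the two
edges from `0` to `1` and from `1` to `0`, which form an oriented cycle, and lies on the side `s`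
(`false`: left, `true`: right) of both edges.  The choice of the strand that is on top amounts to
the numbering of the strands. -/
def closeBigon (s : Bool) : LinkDiagram where
  X := W.X ⊕ Fin 2
  M := W.M
  xs := W.xs.map Sum.inl ++ (List.finRange 2).map Sum.inr
  ms := W.ms
  xs_nodup := (W.xs_nodup.map Sum.inl_injective).append
    ((List.nodup_finRange 2).map Sum.inr_injective) (by
      intro a h1 h2
      simp only [List.mem_map] at h1 h2
      obtain ⟨x, -, rfl⟩ := h1
      obtain ⟨y, -, hy⟩ := h2
      exact Sum.inr_ne_inl hy)
  ms_nodup := W.ms_nodup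
  mem_xs m := by rcases m with m | m <;> simp [W.mem_xs]
  mem_ms := W.mem_ms
  pos := Sum.elim W.pos ![true, false]
  next := ((bigonEquiv W.X W.M s (Equiv.swap 0 1)).trans
    (Equiv.sumCongr W.next (Equiv.swap 0 1))).trans (bigonEquiv W.X W.M s (Equiv.refl _)).symm

variable (k : Type u) [Field k]

/-- The ideal `(a - b, c - d)` of the polynomial ring of `W`, where `a`, `c` are the variables of the
ends of `W` at strand `0` and `b`, `d` those at strand `1`, such that `a` and `d` are outgoing ends
of `W` and `b` and `c` are incoming ends. -/
noncomputable def turnbackIdeal : Ideal (W.Ring k) :=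
  Ideal.span {MvPolynomial.X (.finish 0) - MvPolynomial.X (.start 1),
    MvPolynomial.X (.start 0) - MvPolynomial.X (.finish 1)}

/-- The bicomplex `KR₀(W) ⊗ (N₂ → N₂)` over `R' = k[a,b,c,d]`, where `N₂ = R'{-2}/(a-b, c-d)` and the
arrow is the identity, from vertical degree `0` to vertical degree `1`.  It is obtained from `KR₀(W)`
by extension of scalars to the quotient ring by `(a-b, c-d)`, and tensor product with the two-term
complex. -/
noncomputable def cokernelComplex : FreeBicomplex (quotGr k (W.turnbackIdeal k)) :=
  ((W.KR k).baseChange (Ideal.Quotient.mk (W.turnbackIdeal k))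
    (fun _ _ ha => Submodule.mem_map_of_mem ha)).tensor (FreeBicomplex.idTwoTerm _ (-2))

end Move

end TangleDiagram

/-- In internal degree `n`: representatives `C` and `C'` of `KR₀(K)` and `KR₀(K')` in `K(D^b)`, where
`K` and `K'` are related by a IIb move and `W` is the common part of `K` and `K'`, and an injective
morphism of bicomplexes `ι : C → C'` with cokernel `KR₀(W) ⊗ (N₂ → N₂)`. -/
structure IIbInjection (k : Type u) [Field k] [HasDerivedCategory.{w} (ModuleCat.{u} k)]
    (W : TangleDiagram 2) (s : Bool) (n : ℤ) where
  C : Bicomplex k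
  C' : Bicomplex k
  bounded : C.IsBounded
  bounded' : C'.IsBounded
  repr : (toKD.{w} k).obj C ≅ (toKD k).obj ((W.closeTrivial.KR k).toBicomplex n)
  repr' : (toKD.{w} k).obj C' ≅ (toKD k).obj (((W.closeBigon s).KR k).toBicomplex n)
  ι : C ⟶ C'
  mono : Mono ι
  coker : Nonempty (cokernel ι ≅ (W.cokernelComplex k).toBicomplex n)

/-- `H_{hv}^{i,j}(D)`, the "horizontal then vertical" homology of `KR₀(D)`, in internal
degree `n`. -/
noncomputable def linkHomology (k : Type u) [Field k] [HasDerivedCategory.{w} (ModuleCat.{u} k)]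
    (D : LinkDiagram) (n i j : ℤ) : ModuleCat.{u} k :=
  (Hhv.{w} k i j).obj ((toKD k).obj ((D.KR k).toBicomplex n))

/-- The map `H_{hv}^{i,j}(ι) : H_{hv}^{i,j}(K) → H_{hv}^{i,j}(K')`. -/
noncomputable def IIbInjection.map {k : Type u} [Field k]
    [HasDerivedCategory.{w} (ModuleCat.{u} k)] {W : TangleDiagram 2} {s : Bool} {n : ℤ}
    (I : IIbInjection.{w} k W s n) (i j : ℤ) :
    linkHomology.{w} k W.closeTrivial n i j ⟶ linkHomology.{w} k (W.closeBigon s) n i j :=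
  (Hhv.{w} k i j).map (I.repr.inv ≫ (toKD k).map I.ι ≫ I.repr'.hom)

/-- The spectral sequence converges to zero: `E_∞ = 0`. -/
def ConvergesToZero {A : Type*} [Category A] [Abelian A]
    (E : E₂CohomologicalSpectralSequence A) : Prop :=
  ∀ pq : ℤ × ℤ, ∃ r₀ : ℤ, ∀ (r : ℤ) (_ : 2 ≤ r), r₀ ≤ r → IsZero ((E.page r).X pq)

/-- All differentials `d_r` with `r ≥ r₀` vanish. -/
def CollapsesAt {A : Type*} [Category A] [Abelian A]
    (E : E₂CohomologicalSpectralSequence A) (r₀ : ℤ) : Prop :=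
  ∀ (r : ℤ) (_ : 2 ≤ r), r₀ ≤ r → ∀ pq pq' : ℤ × ℤ, (E.page r).d pq pq' = 0

end TripleLink

/-! Let R be the ring of W modulo c − d + b − a, and put u = b − a, z = c − a (`EndRing`, `endU`,
`endZ`). Everything happens in a fixed internal degree.

Existence of ι. Two operations do not change the class of a bicomplex in K(D): replacing the
horizontal Koszul complex of a nonzerodivisor by the quotient ring
(`koszulProj_isAcyclicSurjection`), and passing to a vertical deformation retract that respects the
horizontal differential (`kdIso_of_slice_retract`). Modulo t_i + t_j = t_k + t_l the quadratic
relation of a crossing factors as a product r·t. Hence a crossing is the Koszul complex of its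
linear relation tensored with a complex of rank two (`koszulSplit`), which stands for Q/(rt) → Q/(t)
at a positive crossing and for Q/(t) → Q/(rt){−2}, multiplication by r, at a negative one. In K' the
relations of the two inner edges and the two linear relations of the new crossings form a regular
sequence with quotient R[X] (`presents_bigonHom`, `mem_bigonIdeal_of_mul_mem`). Over R[X] both
crossings have t = u, while r is X for one and z − X for the other. Their tensor product retracts
vertically onto its reduction at X = 0 (`kdIso_bigon_retract`), which represents R/(zu) → R/(u),
shifted by {−2}, in vertical degrees 0 and 1. So KR₀(K') becomes the cone of the projection from
KR₀(W) over R/(zu) to KR₀(W) over R/(u) (`posTermProj_isAcyclicSurjection`). On the other hand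
KR₀(K) is KR₀(W) over R/(z) (`closeTrivial_KR`, `presents_trivialHom`). Since u and z are regular in
R, the sequence 0 → R/(z) → R/(zu) → R/(u) → 0, with multiplication by u as its first map, is exact.
Its first map is ι, and the cokernel of ι is the cone of the identity over R/(u)
(`exists_injection`).

The spectral sequence. For any ι as required, the cokernel is vertically contractible
(`tensorIdTwoTermHomotopy`). Horizontal homology turns 0 → C → C' → coker ι → 0 into a long exact
sequence of vertical complexes. It is read as one acyclic complex whose columns 3h, 3h+1, 3h+2
belong to C, C' and coker ι (`longExact`). The short exact sequences 0 → Z^p → K^p → Z^{p+1} → 0 of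
its cycles give an exact couple (`coupleOfAcyclic`), whose first page is the vertical homology of
the columns with differential induced by the maps of the long exact sequence. The columns 3h+2
vanish on this page, and the only remaining differential is H_hv(ι), so the second page consists of
its kernels and cokernels. Boundedness gives convergence to 0.

The criterion. A spectral sequence with limit 0 collapses at page 3 exactly if page 3 is zero, that
is, if page 2 is exact (`collapsesAt_iff`). Every third column of page 2 is zero, so exactness says
that all d₂ from a cokernel to a kernel are isomorphisms (`exactAt_iff_isIso`). Injectivity and
surjectivity of d₂ are the two exactness statements of the sequence with the maps α
(`exact_comp_connecting_iff`, `exact_connecting_comp_iff`). -/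

namespace TripleLink

/-! ### Bicomplexes as bigraded modules; two criteria for isomorphism in K(D) -/

/-- A vector space with two commuting differentials, and a family of bihomogeneous subspaces
(`piece j i` in vertical degree `j` and horizontal degree `i`). -/
structure BigradedModule (k : Type u) [Field k] where
  V : Type u
  [addCommGroup : AddCommGroup V]
  [module : Module k V]
  piece : ℤ → ℤ → Submodule k V
  dh : V →ₗ[k] V
  dv : V →ₗ[k] V
  dh_mem {j i : ℤ} {x : V} : x ∈ piece j i → dh x ∈ piece j (i + 1)
  dv_mem {j i : ℤ} {x : V} : x ∈ piece j i → dv x ∈ piece (j + 1) i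
  dh_sq (x : V) : dh (dh x) = 0
  dv_sq (x : V) : dv (dv x) = 0
  comm (x : V) : dh (dv x) = dv (dh x)

namespace BigradedModule

attribute [instance] addCommGroup module

variable {k : Type u} [Field k]

/-- The horizontal differential on the pieces. -/
def hmap (M : BigradedModule k) (j : ℤ) {i i' : ℤ} (h : i + 1 = i') :
    M.piece j i →ₗ[k] M.piece j i' :=
  M.dh.restrict fun _ hx => h ▸ M.dh_mem hx

/-- The vertical differential on the pieces. -/
def vmap (M : BigradedModule k) (i : ℤ) {j j' : ℤ} (h : j + 1 = j') :
    M.piece j i →ₗ[k] M.piece j' i :=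
  M.dv.restrict fun _ hx => h ▸ M.dv_mem hx

/-- The `j`-th row. -/
def row (M : BigradedModule k) (j : ℤ) : CochainComplex (ModuleCat.{u} k) ℤ where
  X i := ModuleCat.of k (M.piece j i)
  d i i' := if h : i + 1 = i' then ModuleCat.ofHom (M.hmap j h) else 0
  shape i i' h := dif_neg h
  d_comp_d' i i' i'' h h' := by
    have h : i + 1 = i' := h
    have h' : i' + 1 = i'' := h'
    rw [dif_pos h, dif_pos h']
    exact ModuleCat.hom_ext (LinearMap.ext fun f => Subtype.ext (M.dh_sq f.1))

/-- The bicomplex formed by the pieces. -/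
def toBicomplex (M : BigradedModule k) : Bicomplex k where
  X j := M.row j
  d j j' := if h : j + 1 = j' then
    { f := fun i => ModuleCat.ofHom (M.vmap i h)
      comm' := fun i i' hi => by
        have hi : i + 1 = i' := hi
        dsimp only [row]
        rw [dif_pos hi, dif_pos hi]
        exact ModuleCat.hom_ext (LinearMap.ext fun f => Subtype.ext (M.comm f.1)) } else 0
  shape j j' h := dif_neg h
  d_comp_d' j j' j'' h h' := by
    have h : j + 1 = j' := h
    have h' : j' + 1 = j'' := h'
    rw [dif_pos h, dif_pos h']
    exact HomologicalComplex.hom_ext _ _ fun i =>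
      ModuleCat.hom_ext (LinearMap.ext fun f => Subtype.ext (M.dv_sq f.1))

lemma row_d_apply (M : BigradedModule k) (j i i' : ℤ) (h : i + 1 = i') (x : M.piece j i) :
    ((M.row j).d i i').hom x = M.hmap j h x := by
  have : (M.row j).d i i' = ModuleCat.ofHom (M.hmap j h) := dif_pos h
  rw [this]; rfl

/-- A morphism preserves the pieces and commutes with the differentials. -/
structure Hom (M N : BigradedModule k) where
  f : M.V →ₗ[k] N.V
  mem {j i : ℤ} {x : M.V} : x ∈ M.piece j i → f x ∈ N.piece j i
  dh (x : M.V) : f (M.dh x) = N.dh (f x)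
  dv (x : M.V) : f (M.dv x) = N.dv (f x)

namespace Hom

variable {M N : BigradedModule k}

/-- The induced morphism on rows. -/
def rowMap (φ : Hom M N) (j : ℤ) : M.row j ⟶ N.row j where
  f i := ModuleCat.ofHom (φ.f.restrict fun _ hx => φ.mem hx)
  comm' i i' h := by
    have h : i + 1 = i' := h
    dsimp only [row]
    rw [dif_pos h, dif_pos h]
    exact ModuleCat.hom_ext (LinearMap.ext fun f => Subtype.ext (φ.dh f.1).symm)

/-- The induced morphism of bicomplexes. -/
def toMor (φ : Hom M N) : M.toBicomplex ⟶ N.toBicomplex where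
  f j := φ.rowMap j
  comm' j j' h := by
    have h : j + 1 = j' := h
    dsimp only [toBicomplex]
    rw [dif_pos h, dif_pos h]
    exact HomologicalComplex.hom_ext _ _ fun i =>
      ModuleCat.hom_ext (LinearMap.ext fun f => Subtype.ext (φ.dv f.1).symm)

/-- Horizontal acyclicity of the kernel and surjectivity on all pieces. -/
structure IsAcyclicSurjection (φ : Hom M N) : Prop where
  surj {j i : ℤ} {y : N.V} : y ∈ N.piece j i → ∃ x ∈ M.piece j i, φ.f x = y
  acyclic {j i : ℤ} {x : M.V} : x ∈ M.piece j (i + 1) → φ.f x = 0 → M.dh x = 0 →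
    ∃ z ∈ M.piece j i, φ.f z = 0 ∧ M.dh z = x


/-- The kernel of a morphism. -/
def ker (φ : Hom M N) : BigradedModule k where
  V := M.V
  piece j i := M.piece j i ⊓ LinearMap.ker φ.f
  dh := M.dh
  dv := M.dv
  dh_mem := fun ⟨h, h'⟩ => ⟨M.dh_mem h, by
    rw [SetLike.mem_coe, LinearMap.mem_ker] at h' ⊢; rw [φ.dh, h', map_zero]⟩
  dv_mem := fun ⟨h, h'⟩ => ⟨M.dv_mem h, by
    rw [SetLike.mem_coe, LinearMap.mem_ker] at h' ⊢; rw [φ.dv, h', map_zero]⟩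
  dh_sq := M.dh_sq
  dv_sq := M.dv_sq
  comm := M.comm

/-- The inclusion of the kernel. -/
def kerι (φ : Hom M N) : Hom φ.ker M where
  f := LinearMap.id
  mem h := h.1
  dh _ := rfl
  dv _ := rfl

/-- The hypotheses speak of elements of the pieces only, because the ambient spaces `V` are mere
containers. For `kerι`, say, the underlying linear map is the identity of `M.V`. -/
lemma shortExact_row {L : BigradedModule k} (ι : Hom L M) (φ : Hom M N)
    (hinj : ∀ j i, ∀ x ∈ L.piece j i, ι.f x = 0 → x = 0)
    (hzero : ∀ j i, ∀ x ∈ L.piece j i, φ.f (ι.f x) = 0)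
    (hex : ∀ j i, ∀ x ∈ M.piece j i, φ.f x = 0 → ∃ y ∈ L.piece j i, ι.f y = x)
    (hsurj : ∀ j i, ∀ y ∈ N.piece j i, ∃ x ∈ M.piece j i, φ.f x = y) (j : ℤ) :
    (ShortComplex.mk (ι.rowMap j) (φ.rowMap j) (HomologicalComplex.hom_ext _ _ fun _ =>
      ModuleCat.hom_ext (LinearMap.ext fun x => Subtype.ext (hzero _ _ x.1 x.2)))).ShortExact := by
  refine HomologicalComplex.shortExact_of_degreewise_shortExact _ fun i => ?_
  refine ModuleCat.shortComplex_shortExact _ ?_ ?_ ?_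
  · intro x
    constructor
    · intro h
      obtain ⟨y, hy, hyx⟩ := hex j i x.1 x.2 (congrArg Subtype.val h)
      exact ⟨⟨y, hy⟩, Subtype.ext hyx⟩
    · rintro ⟨y, rfl⟩
      exact Subtype.ext (hzero _ _ y.1 y.2)
  · refine (injective_iff_map_eq_zero (ModuleCat.Hom.hom _)).2 fun x hx => ?_
    exact Subtype.ext (hinj j i x.1 x.2 (congrArg Subtype.val hx))
  · rintro ⟨y, hy⟩
    obtain ⟨x, hx, rfl⟩ := hsurj j i y hy
    exact ⟨⟨x, hx⟩, rfl⟩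

end Hom

lemma row_acyclic (M : BigradedModule k) (j : ℤ)
    (h : ∀ i, ∀ x ∈ M.piece j (i + 1), M.dh x = 0 → ∃ z ∈ M.piece j i, M.dh z = x) :
    (M.row j).Acyclic := by
  intro i
  rw [HomologicalComplex.exactAt_iff' _ (i - 1) i (i + 1) (by simp) (by simp),
    ShortComplex.moduleCat_exact_iff]
  rintro ⟨x, hx⟩ hx0
  have hx0 : ((M.row j).d i (i + 1)).hom ⟨x, hx⟩ = 0 := hx0
  rw [row_d_apply _ _ _ _ rfl] at hx0
  obtain ⟨z, hz, hzx⟩ := h (i - 1) x (by simpa using hx) (congrArg Subtype.val hx0)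
  refine ⟨⟨z, hz⟩, ?_⟩
  change ((M.row j).d (i - 1) i).hom ⟨z, hz⟩ = _
  rw [row_d_apply _ _ _ _ (by lia)]
  exact Subtype.ext hzx

end BigradedModule

/-- In the long exact homology sequence, the terms on both sides of the map induced by `S.g` are
homology objects of the acyclic complex `S.X₁`. -/
lemma quasiIso_of_shortExact {C : Type*} [Category C] [Abelian C]
    {S : ShortComplex (CochainComplex C ℤ)} (hS : S.ShortExact) (h : S.X₁.Acyclic) :
    QuasiIso S.g := by
  refine (quasiIso_iff _).2 fun i => (quasiIsoAt_iff_isIso_homologyMap _ _).2 ?_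
  have h1 : Mono (HomologicalComplex.homologyMap S.g i) :=
    (hS.homology_exact₂ i).mono_g ((h i).isZero_homology.eq_of_src _ _)
  have h2 : Epi (HomologicalComplex.homologyMap S.g i) :=
    (hS.homology_exact₃ i (i + 1) rfl).epi_f ((h _).isZero_homology.eq_of_tgt _ _)
  exact isIso_of_mono_of_epi _

namespace BigradedModule

variable {k : Type u} [Field k] {M N : BigradedModule k}

/-- The short exact sequence used is that of the rows of `φ.ker`, `M` and `N`, whose first term is
acyclic. -/
lemma Hom.IsAcyclicSurjection.quasiIso {φ : Hom M N} (h : φ.IsAcyclicSurjection) (j : ℤ) :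
    QuasiIso (φ.rowMap j) := by
  refine quasiIso_of_shortExact (φ.kerι.shortExact_row φ ?_ ?_ ?_ ?_ j) ?_
  · exact fun _ _ x _ h => h
  · exact fun _ _ x hx => hx.2
  · exact fun _ _ x hx h => ⟨x, ⟨hx, h⟩, rfl⟩
  · exact fun _ _ y hy => h.surj hy
  · refine row_acyclic _ j fun i x hx hdx => ?_
    obtain ⟨z, hz, hz0, rfl⟩ := h.acyclic hx.1 hx.2 hdx
    exact ⟨z, ⟨hz, hz0⟩, rfl⟩

/-- A vertical homotopy between two morphisms. -/
def Hom.homotopy (φ ψ : Hom M N) (h : M.V →ₗ[k] N.V)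
    (hmem : ∀ j i, ∀ x ∈ M.piece (j + 1) i, h x ∈ N.piece j i)
    (hdh : ∀ x, h (M.dh x) = N.dh (h x))
    (hdv : ∀ x, φ.f x = h (M.dv x) + N.dv (h x) + ψ.f x) : Homotopy φ.toMor ψ.toMor where
  hom j' j := if hj : j + 1 = j' then
    { f := fun i => ModuleCat.ofHom (h.restrict fun x hx => hmem j i x (hj ▸ hx))
      comm' := fun i i' hi => by
        have hi : i + 1 = i' := hi
        dsimp only [toBicomplex, row]
        rw [dif_pos hi, dif_pos hi]
        exact ModuleCat.hom_ext (LinearMap.ext fun f => Subtype.ext (hdh f.1).symm) } else 0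
  zero j' j hj := dif_neg hj
  comm j := by
    rw [dNext_eq _ (show (ComplexShape.up ℤ).Rel j (j + 1) from rfl),
      prevD_eq _ (show (ComplexShape.up ℤ).Rel (j - 1) j by simp), dif_pos rfl,
      dif_pos (sub_add_cancel j 1)]
    dsimp only [toBicomplex]
    rw [dif_pos rfl, dif_pos (sub_add_cancel j 1)]
    exact HomologicalComplex.hom_ext _ _ fun i =>
      ModuleCat.hom_ext (LinearMap.ext fun x => Subtype.ext (hdv x.1))

end BigradedModule

section KD

variable {k : Type u} [Field k] [HasDerivedCategory.{w} (ModuleCat.{u} k)]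

/-- After localization each row map is invertible, and a morphism of complexes that is invertible in
each degree is invertible. No vertical homotopy is needed here. -/
lemma isIso_toKD_map_of_quasiIso {B B' : Bicomplex k} (f : B ⟶ B')
    (hf : ∀ j, QuasiIso (f.f j)) : IsIso ((toKD.{w} k).map f) := by
  have : IsIso (((DerivedCategory.Q (C := ModuleCat.{u} k)).mapHomologicalComplex
      (ComplexShape.up ℤ)).map f) := by
    have : ∀ j, IsIso ((((DerivedCategory.Q (C := ModuleCat.{u} k)).mapHomologicalComplex
      (ComplexShape.up ℤ)).map f).f j) := fun j =>
        (DerivedCategory.isIso_Q_map_iff_quasiIso _ _).2 (hf j)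
    exact HomologicalComplex.Hom.isIso_of_components _
  exact Functor.map_isIso (HomotopyCategory.quotient _ _) _

lemma toKD_map_eq_of_homotopy {B B' : Bicomplex k} {f g : B ⟶ B'} (h : Homotopy f g) :
    (toKD.{w} k).map f = (toKD k).map g :=
  HomotopyCategory.eq_of_homotopy _ _ (Functor.mapHomotopy _ h)

/-- Isomorphism of two bicomplexes in the homotopy category of complexes in the derived
category. -/
def KDIso (B B' : Bicomplex k) : Prop :=
  Nonempty ((toKD.{w} k).obj B ≅ (toKD.{w} k).obj B')

lemma KDIso.symm {B B' : Bicomplex k} (h : KDIso.{w} B B') : KDIso.{w} B' B := ⟨h.some.symm⟩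

lemma KDIso.trans {B B' B'' : Bicomplex k} (h : KDIso.{w} B B') (h' : KDIso.{w} B' B'') :
    KDIso.{w} B B'' := ⟨h.some ≪≫ h'.some⟩

namespace BigradedModule

variable {M N : BigradedModule k}

lemma Hom.IsAcyclicSurjection.kdIso {φ : Hom M N} (h : φ.IsAcyclicSurjection) :
    KDIso.{w} M.toBicomplex N.toBicomplex :=
  have := isIso_toKD_map_of_quasiIso.{w} φ.toMor h.quasiIso
  ⟨asIso ((toKD.{w} k).map φ.toMor)⟩

/-- The complementary source of isomorphisms, by vertical homotopy instead of horizontal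
quasi-isomorphism. Since `h` commutes with `dh`, it consists of morphisms of rows, and so defines a
homotopy of vertical complexes. -/
lemma kdIso_of_retract (φ : Hom M N) (ψ : Hom N M) (hφψ : ∀ x, φ.f (ψ.f x) = x)
    (h : M.V →ₗ[k] M.V)
    (hmem : ∀ j i, ∀ x ∈ M.piece (j + 1) i, h x ∈ M.piece j i)
    (hdh : ∀ x, h (M.dh x) = M.dh (h x))
    (hdv : ∀ x, x = h (M.dv x) + M.dv (h x) + ψ.f (φ.f x)) :
    KDIso.{w} M.toBicomplex N.toBicomplex := by
  let e : Hom M M := ⟨LinearMap.id, fun h => h, fun _ => rfl, fun _ => rfl⟩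
  let g : Hom M M := ⟨ψ.f ∘ₗ φ.f, fun h => ψ.mem (φ.mem h),
    fun x => by simp [φ.dh, ψ.dh], fun x => by simp [φ.dv, ψ.dv]⟩
  have h1 : e.toMor = 𝟙 _ := rfl
  have h2 : g.toMor = φ.toMor ≫ ψ.toMor := rfl
  have h3 : ψ.toMor ≫ φ.toMor = 𝟙 _ := HomologicalComplex.hom_ext _ _ fun j =>
    HomologicalComplex.hom_ext _ _ fun i =>
      ModuleCat.hom_ext (LinearMap.ext fun x => Subtype.ext (hφψ x.1))
  have h4 := toKD_map_eq_of_homotopy.{w} (Hom.homotopy e g h hmem hdh hdv)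
  refine ⟨⟨(toKD k).map φ.toMor, (toKD k).map ψ.toMor, ?_, ?_⟩⟩
  · rw [← Functor.map_comp, ← h2, ← h4, h1, CategoryTheory.Functor.map_id]
  · rw [← Functor.map_comp, h3, CategoryTheory.Functor.map_id]

end BigradedModule

end KD

namespace FreeBicomplex

variable {k Q : Type u} [Field k] [CommRing Q] [Algebra k Q] {𝒜 : ℤ → Submodule k Q}
  [SetLike.GradedMonoid 𝒜]

/-- The bigraded module given by the part of internal degree `n`. -/
def toBigraded (P : FreeBicomplex 𝒜) (n : ℤ) : BigradedModule k where
  V := P.B → Q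
  piece j i := P.piece n j i
  dh := P.dh.mulVecLin.restrictScalars k
  dv := P.dv.mulVecLin.restrictScalars k
  dh_mem hx := (P.hmap n _ rfl ⟨_, hx⟩).2
  dv_mem hx := (P.vmap n _ rfl ⟨_, hx⟩).2
  dh_sq x := by
    change P.dh.mulVec (P.dh.mulVec x) = 0
    rw [Matrix.mulVec_mulVec, P.dh_sq, Matrix.zero_mulVec]
  dv_sq x := by
    change P.dv.mulVec (P.dv.mulVec x) = 0
    rw [Matrix.mulVec_mulVec, P.dv_sq, Matrix.zero_mulVec]
  comm x := by
    change P.dh.mulVec (P.dv.mulVec x) = P.dv.mulVec (P.dh.mulVec x)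
    rw [Matrix.mulVec_mulVec, Matrix.mulVec_mulVec, P.comm]

end FreeBicomplex

end TripleLink

/-! ### Isomorphisms of free bicomplexes, and the symmetric monoidal structure -/

namespace TripleLink
namespace FreeBicomplex

variable {k Q : Type u} [Field k] [CommRing Q] [Algebra k Q] {𝒜 : ℤ → Submodule k Q}

/-- An isomorphism of free bicomplexes, given by mutually inverse homogeneous matrices. -/
structure Iso (P R : FreeBicomplex 𝒜) where
  U : Matrix R.B P.B Q
  V : Matrix P.B R.B Q
  UV : U * V = 1
  VU : V * U = 1
  U_deg : ∀ b b', U b b' ≠ 0 → R.hdeg b = P.hdeg b' ∧ R.vdeg b = P.vdeg b'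
  V_deg : ∀ b b', V b b' ≠ 0 → P.hdeg b = R.hdeg b' ∧ P.vdeg b = R.vdeg b'
  U_mem : ∀ b b', U b b' ∈ 𝒜 (P.pdeg b' - R.pdeg b)
  V_mem : ∀ b b', V b b' ∈ 𝒜 (R.pdeg b' - P.pdeg b)
  dh : R.dh * U = U * P.dh
  dv : R.dv * U = U * P.dv

namespace Iso

variable {P R T P' R' : FreeBicomplex 𝒜}

/-- The inverse isomorphism. -/
def symm (e : Iso P R) : Iso R P where
  U := e.V
  V := e.U
  UV := e.VU
  VU := e.UV
  U_deg := e.V_deg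
  V_deg := e.U_deg
  U_mem := e.V_mem
  V_mem := e.U_mem
  dh := by
    have := congrArg (fun M => e.V * M * e.V) e.dh
    simp only [Matrix.mul_assoc, e.UV, Matrix.mul_one] at this
    rw [this, ← Matrix.mul_assoc, e.VU, Matrix.one_mul]
  dv := by
    have := congrArg (fun M => e.V * M * e.V) e.dv
    simp only [Matrix.mul_assoc, e.UV, Matrix.mul_one] at this
    rw [this, ← Matrix.mul_assoc, e.VU, Matrix.one_mul]

section

variable [SetLike.GradedMonoid 𝒜]

lemma mul_deg {X Y Z : Type} [Fintype Y] {A : Matrix X Y Q} {B : Matrix Y Z Q}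
    {dx : X → ℤ} {dy : Y → ℤ} {dz : Z → ℤ} {ex : X → ℤ} {ey : Y → ℤ} {ez : Z → ℤ}
    (hA : ∀ b b', A b b' ≠ 0 → dx b = dy b' ∧ ex b = ey b')
    (hB : ∀ b b', B b b' ≠ 0 → dy b = dz b' ∧ ey b = ez b') (b : X) (b' : Z)
    (h : (A * B) b b' ≠ 0) : dx b = dz b' ∧ ex b = ez b' := by
  obtain ⟨c, -, hc⟩ := Finset.exists_ne_zero_of_sum_ne_zero h
  have h1 := hA b c (left_ne_zero_of_mul hc)
  have h2 := hB c b' (right_ne_zero_of_mul hc)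
  exact ⟨h1.1.trans h2.1, h1.2.trans h2.2⟩

lemma mul_mem {X Y Z : Type} [Fintype Y] {A : Matrix X Y Q} {B : Matrix Y Z Q}
    {wx : X → ℤ} {wy : Y → ℤ} {wz : Z → ℤ} (hA : ∀ b b', A b b' ∈ 𝒜 (wy b' - wx b))
    (hB : ∀ b b', B b b' ∈ 𝒜 (wz b' - wy b)) (b : X) (b' : Z) :
    (A * B) b b' ∈ 𝒜 (wz b' - wx b) := by
  refine Submodule.sum_mem _ fun c _ => ?_
  have := SetLike.GradedMul.mul_mem (hA b c) (hB c b')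
  rwa [show wy c - wx b + (wz b' - wy c) = wz b' - wx b by ring] at this

/-- Composition of isomorphisms. -/
def trans (e : Iso P R) (f : Iso R T) : Iso P T where
  U := f.U * e.U
  V := e.V * f.V
  UV := by rw [Matrix.mul_assoc, ← Matrix.mul_assoc e.U, e.UV, Matrix.one_mul, f.UV]
  VU := by rw [Matrix.mul_assoc, ← Matrix.mul_assoc f.V, f.VU, Matrix.one_mul, e.VU]
  U_deg := mul_deg f.U_deg e.U_deg
  V_deg := mul_deg e.V_deg f.V_deg
  U_mem := mul_mem f.U_mem e.U_mem
  V_mem := mul_mem e.V_mem f.V_mem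
  dh := by rw [← Matrix.mul_assoc, f.dh, Matrix.mul_assoc, e.dh, Matrix.mul_assoc]
  dv := by rw [← Matrix.mul_assoc, f.dv, Matrix.mul_assoc, e.dv, Matrix.mul_assoc]

/-- An isomorphism given by a bijection between the bases and signs. -/
def ofEquiv (e : P.B ≃ R.B) (ε : P.B → ℤˣ)
    (hh : ∀ b, R.hdeg (e b) = P.hdeg b) (hv : ∀ b, R.vdeg (e b) = P.vdeg b)
    (hp : ∀ b, R.pdeg (e b) = P.pdeg b)
    (h : ∀ b b', R.dh (e b) (e b') * ((ε b' : ℤ) : Q) = ((ε b : ℤ) : Q) * P.dh b b')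
    (v : ∀ b b', R.dv (e b) (e b') * ((ε b' : ℤ) : Q) = ((ε b : ℤ) : Q) * P.dv b b') :
    Iso P R where
  U := Matrix.of fun b b' => if b = e b' then ((ε b' : ℤ) : Q) else 0
  V := Matrix.of fun b' b => if b = e b' then ((ε b' : ℤ) : Q) else 0
  UV := by
    ext b b'
    obtain ⟨b, rfl⟩ := e.surjective b
    obtain ⟨b', rfl⟩ := e.surjective b'
    simp only [Matrix.mul_apply, Matrix.of_apply, e.apply_eq_iff_eq, Matrix.one_apply]
    rw [Finset.sum_eq_single b (fun c _ hc => by rw [if_neg (Ne.symm hc), zero_mul]) (by simp)]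
    by_cases hb : b' = b
    · subst hb
      simp [← Int.cast_mul, ← Units.val_mul]
    · simp [hb, Ne.symm hb]
  VU := by
    ext b b'
    simp only [Matrix.mul_apply, Matrix.of_apply, Matrix.one_apply]
    rw [Finset.sum_eq_single (e b) (fun c _ hc => by rw [if_neg hc, zero_mul]) (by simp)]
    by_cases hb : b = b'
    · subst hb
      simp [← Int.cast_mul, ← Units.val_mul]
    · simp [hb]
  U_deg b b' hb := by
    have : b = e b' := by by_contra h0; simp [h0] at hb
    subst this
    exact ⟨hh _, hv _⟩
  V_deg b b' hb := by
    have : b' = e b := by by_contra h0; simp [h0] at hb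
    subst this
    exact ⟨(hh _).symm, (hv _).symm⟩
  U_mem b b' := by
    by_cases h0 : b = e b'
    · subst h0
      rw [hp, sub_self, Matrix.of_apply, if_pos rfl, ← zsmul_one]
      exact zsmul_mem SetLike.GradedOne.one_mem _
    · rw [Matrix.of_apply, if_neg h0]
      exact Submodule.zero_mem _
  V_mem b b' := by
    by_cases h0 : b' = e b
    · subst h0
      rw [hp, sub_self, Matrix.of_apply, if_pos rfl, ← zsmul_one]
      exact zsmul_mem SetLike.GradedOne.one_mem _
    · rw [Matrix.of_apply, if_neg h0]
      exact Submodule.zero_mem _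
  dh := by
    ext b b'
    obtain ⟨b, rfl⟩ := e.surjective b
    simp only [Matrix.mul_apply, Matrix.of_apply, e.apply_eq_iff_eq]
    rw [Finset.sum_eq_single (e b') (fun c _ hc => by rw [if_neg hc, mul_zero]) (by simp),
      Finset.sum_eq_single b (fun c _ hc => by rw [if_neg (Ne.symm hc), zero_mul]) (by simp),
      if_pos rfl, if_pos rfl, h]
  dv := by
    ext b b'
    obtain ⟨b, rfl⟩ := e.surjective b
    simp only [Matrix.mul_apply, Matrix.of_apply, e.apply_eq_iff_eq]
    rw [Finset.sum_eq_single (e b') (fun c _ hc => by rw [if_neg hc, mul_zero]) (by simp),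
      Finset.sum_eq_single b (fun c _ hc => by rw [if_neg (Ne.symm hc), zero_mul]) (by simp),
      if_pos rfl, if_pos rfl, v]

/-- The identity. -/
def refl (P : FreeBicomplex 𝒜) : Iso P P :=
  ofEquiv (Equiv.refl _) (fun _ => 1) (fun _ => rfl) (fun _ => rfl) (fun _ => rfl)
    (fun _ _ => by simp) (fun _ _ => by simp)

lemma sgn_mul_comm {X Y : Type} [Fintype X] [Fintype Y] [DecidableEq X] [DecidableEq Y]
    {U : Matrix X Y Q} {dx : X → ℤ} {dy : Y → ℤ} (h : ∀ b b', U b b' ≠ 0 → dx b = dy b') :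
    sgn Q dx * U = U * sgn Q dy := by
  ext b b'
  rw [sgn, sgn, Matrix.diagonal_mul, Matrix.mul_diagonal]
  by_cases h0 : U b b' = 0
  · simp [h0]
  · rw [h b b' h0, mul_comm]

lemma kron_deg {X Y X' Y' : Type} {A : Matrix X Y Q} {B : Matrix X' Y' Q}
    {dx ex : X → ℤ} {dy ey : Y → ℤ} {dx' ex' : X' → ℤ} {dy' ey' : Y' → ℤ}
    (hA : ∀ b b', A b b' ≠ 0 → dx b = dy b' ∧ ex b = ey b')
    (hB : ∀ b b', B b b' ≠ 0 → dx' b = dy' b' ∧ ex' b = ey' b') (b : X × X') (b' : Y × Y')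
    (h : (A ⊗ₖ B) b b' ≠ 0) :
    dx b.1 + dx' b.2 = dy b'.1 + dy' b'.2 ∧ ex b.1 + ex' b.2 = ey b'.1 + ey' b'.2 := by
  have h1 := hA _ _ (left_ne_zero_of_mul h)
  have h2 := hB _ _ (right_ne_zero_of_mul h)
  rw [h1.1, h1.2, h2.1, h2.2]
  exact ⟨rfl, rfl⟩

lemma kron_mem {X Y X' Y' : Type} {A : Matrix X Y Q} {B : Matrix X' Y' Q}
    {wx : X → ℤ} {wy : Y → ℤ} {wx' : X' → ℤ} {wy' : Y' → ℤ}
    (hA : ∀ b b', A b b' ∈ 𝒜 (wy b' - wx b))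
    (hB : ∀ b b', B b b' ∈ 𝒜 (wy' b' - wx' b)) (b : X × X') (b' : Y × Y') :
    (A ⊗ₖ B) b b' ∈ 𝒜 (wy b'.1 + wy' b'.2 - (wx b.1 + wx' b.2)) := by
  have := SetLike.GradedMul.mul_mem (hA b.1 b'.1) (hB b.2 b'.2)
  rwa [show wy b'.1 - wx b.1 + (wy' b'.2 - wx' b.2) =
    wy b'.1 + wy' b'.2 - (wx b.1 + wx' b.2) by ring] at this

lemma kron_comm {A A' B B' : Type} [Fintype A] [Fintype A'] [Fintype B] [Fintype B']
    [DecidableEq A] [DecidableEq A'] [DecidableEq B] [DecidableEq B']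
    {U : Matrix A' A Q} {V : Matrix B' B Q} {D S : Matrix A A Q} {D' S' : Matrix A' A' Q}
    {E : Matrix B B Q} {E' : Matrix B' B' Q} (h1 : D' * U = U * D) (h2 : E' * V = V * E)
    (h3 : S' * U = U * S) :
    (D' ⊗ₖ (1 : Matrix B' B' Q) + S' ⊗ₖ E') * (U ⊗ₖ V) =
      (U ⊗ₖ V) * (D ⊗ₖ (1 : Matrix B B Q) + S ⊗ₖ E) := by
  rw [Matrix.add_mul, Matrix.mul_add]
  simp only [← Matrix.mul_kronecker_mul, h1, h2, h3, Matrix.one_mul, Matrix.mul_one]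

/-- Tensor product of isomorphisms. -/
def tensor (e : Iso P R) (f : Iso P' R') : Iso (P.tensor P') (R.tensor R') where
  U := e.U ⊗ₖ f.U
  V := e.V ⊗ₖ f.V
  UV := by
    refine (Matrix.mul_kronecker_mul _ _ _ _).symm.trans ?_
    rw [e.UV, f.UV]
    exact Matrix.one_kronecker_one
  VU := by
    refine (Matrix.mul_kronecker_mul _ _ _ _).symm.trans ?_
    rw [e.VU, f.VU]
    exact Matrix.one_kronecker_one
  U_deg := kron_deg e.U_deg f.U_deg
  V_deg := kron_deg e.V_deg f.V_deg
  U_mem := kron_mem e.U_mem f.U_mem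
  V_mem := kron_mem e.V_mem f.V_mem
  dh := kron_comm e.dh f.dh (sgn_mul_comm fun b b' h => (e.U_deg b b' h).1)
  dv := kron_comm e.dv f.dv (sgn_mul_comm fun b b' h => (e.U_deg b b' h).2)

lemma sgn_apply {B : Type} [DecidableEq B] (d : B → ℤ) (b b' : B) :
    sgn Q d b b' = (((d b).negOnePow : ℤ) : Q) * (1 : Matrix B B Q) b b' := by
  rw [sgn, Matrix.diagonal_apply, Matrix.one_apply]
  split_ifs <;> simp

lemma tensor_dh_apply (P R : FreeBicomplex 𝒜) (b b' : (P.tensor R).B) :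
    (P.tensor R).dh b b' = P.dh b.1 b'.1 * (1 : Matrix R.B R.B Q) b.2 b'.2 +
      (((P.hdeg b.1).negOnePow : ℤ) : Q) * (1 : Matrix P.B P.B Q) b.1 b'.1 * R.dh b.2 b'.2 := by
  rw [← sgn_apply]
  rfl

lemma tensor_dv_apply (P R : FreeBicomplex 𝒜) (b b' : (P.tensor R).B) :
    (P.tensor R).dv b b' = P.dv b.1 b'.1 * (1 : Matrix R.B R.B Q) b.2 b'.2 +
      (((P.vdeg b.1).negOnePow : ℤ) : Q) * (1 : Matrix P.B P.B Q) b.1 b'.1 * R.dv b.2 b'.2 := by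
  rw [← sgn_apply]
  rfl

lemma one_prod_apply {A B : Type} [DecidableEq A] [DecidableEq B] (p q : A × B) :
    (1 : Matrix (A × B) (A × B) Q) p q = (1 : Matrix A A Q) p.1 q.1 * (1 : Matrix B B Q) p.2 q.2 := by
  rw [← Matrix.one_kronecker_one]
  rfl

lemma negOnePow_add_cast (m n : ℤ) : (((m + n).negOnePow : ℤ) : Q) =
    ((m.negOnePow : ℤ) : Q) * ((n.negOnePow : ℤ) : Q) := by
  rw [Int.negOnePow_add, Units.val_mul, Int.cast_mul]

/-- Associativity of the tensor product. -/
def assoc (P R T : FreeBicomplex 𝒜) : Iso ((P.tensor R).tensor T) (P.tensor (R.tensor T)) :=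
  ofEquiv (Equiv.prodAssoc _ _ _) (fun _ => 1) (fun _ => (add_assoc _ _ _).symm)
    (fun _ => (add_assoc _ _ _).symm) (fun _ => (add_assoc _ _ _).symm)
    (fun ⟨⟨a, b⟩, c⟩ ⟨⟨a', b'⟩, c'⟩ => by
      change (P.dh a a' * (1 : Matrix (R.B × T.B) (R.B × T.B) Q) (b, c) (b', c') +
        sgn Q P.hdeg a a' * (R.dh b b' * (1 : Matrix T.B T.B Q) c c' +
          sgn Q R.hdeg b b' * T.dh c c')) * ((1 : ℤ) : Q) = ((1 : ℤ) : Q) *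
        ((P.dh a a' * (1 : Matrix R.B R.B Q) b b' + sgn Q P.hdeg a a' * R.dh b b') *
          (1 : Matrix T.B T.B Q) c c' + sgn Q (fun p : P.B × R.B => P.hdeg p.1 + R.hdeg p.2)
            (a, b) (a', b') * T.dh c c')
      simp only [sgn_apply, one_prod_apply, negOnePow_add_cast]
      ring)
    (fun ⟨⟨a, b⟩, c⟩ ⟨⟨a', b'⟩, c'⟩ => by
      change (P.dv a a' * (1 : Matrix (R.B × T.B) (R.B × T.B) Q) (b, c) (b', c') +
        sgn Q P.vdeg a a' * (R.dv b b' * (1 : Matrix T.B T.B Q) c c' +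
          sgn Q R.vdeg b b' * T.dv c c')) * ((1 : ℤ) : Q) = ((1 : ℤ) : Q) *
        ((P.dv a a' * (1 : Matrix R.B R.B Q) b b' + sgn Q P.vdeg a a' * R.dv b b') *
          (1 : Matrix T.B T.B Q) c c' + sgn Q (fun p : P.B × R.B => P.vdeg p.1 + R.vdeg p.2)
            (a, b) (a', b') * T.dv c c')
      simp only [sgn_apply, one_prod_apply, negOnePow_add_cast]
      ring)

lemma negOnePow_cast_sq (n : ℤ) : ((n.negOnePow : ℤ) : Q) * ((n.negOnePow : ℤ) : Q) = 1 := by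
  rw [← Int.cast_mul, ← Units.val_mul, Int.units_mul_self]; simp

/-- The interchange of factors carries the sign (−1)^{hh' + vv'}, with a contribution from each
direction since each has its own sign rule. A differential that raises h and keeps v changes this
sign by exactly the factor that the tensor differential requires. -/
lemma swap_apply {A B : Type} [DecidableEq A] [DecidableEq B] {X : Matrix A A Q}
    {Y : Matrix B B Q} {h v : A → ℤ} {h' v' : B → ℤ}
    (hX : ∀ b b', X b b' ≠ 0 → h b = h b' + 1 ∧ v b = v b')
    (hY : ∀ b b', Y b b' ≠ 0 → h' b = h' b' + 1 ∧ v' b = v' b') (a a' : A) (b b' : B) :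
    (Y b b' * (1 : Matrix A A Q) a a' +
      (((h' b).negOnePow : ℤ) : Q) * (1 : Matrix B B Q) b b' * X a a') *
        (((h a' * h' b' + v a' * v' b').negOnePow : ℤ) : Q) =
    (((h a * h' b + v a * v' b).negOnePow : ℤ) : Q) *
      (X a a' * (1 : Matrix B B Q) b b' +
        (((h a).negOnePow : ℤ) : Q) * (1 : Matrix A A Q) a a' * Y b b') := by
  have h1 : Y b b' * (1 : Matrix A A Q) a a' *
        (((h a' * h' b' + v a' * v' b').negOnePow : ℤ) : Q) =
      (((h a * h' b + v a * v' b).negOnePow : ℤ) : Q) *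
        ((((h a).negOnePow : ℤ) : Q) * (1 : Matrix A A Q) a a' * Y b b') := by
    by_cases h0 : Y b b' = 0
    · simp [h0]
    by_cases h2 : a = a'
    · subst h2
      obtain ⟨h3, h4⟩ := hY _ _ h0
      rw [h3, h4, show h a * (h' b' + 1) + v a * v' b' = h a * h' b' + v a * v' b' + h a by ring,
        negOnePow_add_cast _ (h a), Matrix.one_apply_eq]
      linear_combination -(Y b b' * (((h a * h' b' + v a * v' b').negOnePow : ℤ) : Q)) *
        negOnePow_cast_sq (Q := Q) (h a)
    · simp [Matrix.one_apply_ne h2]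
  have h1' : (((h' b).negOnePow : ℤ) : Q) * (1 : Matrix B B Q) b b' * X a a' *
        (((h a' * h' b' + v a' * v' b').negOnePow : ℤ) : Q) =
      (((h a * h' b + v a * v' b).negOnePow : ℤ) : Q) * (X a a' * (1 : Matrix B B Q) b b') := by
    by_cases h0 : X a a' = 0
    · simp [h0]
    by_cases h2 : b = b'
    · subst h2
      obtain ⟨h3, h4⟩ := hX _ _ h0
      rw [h3, h4, show (h a' + 1) * h' b + v a' * v' b = h a' * h' b + v a' * v' b + h' b by ring,
        negOnePow_add_cast _ (h' b), Matrix.one_apply_eq]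
      ring
    · simp [Matrix.one_apply_ne h2]
  rw [add_mul, mul_add, h1, h1', add_comm]

/-- Commutativity of the tensor product. -/
def comm (P R : FreeBicomplex 𝒜) : Iso (P.tensor R) (R.tensor P) :=
  ofEquiv (Equiv.prodComm _ _)
    (fun b => (P.hdeg b.1 * R.hdeg b.2 + P.vdeg b.1 * R.vdeg b.2).negOnePow)
    (fun _ => add_comm _ _) (fun _ => add_comm _ _) (fun _ => add_comm _ _)
    (fun b b' => by
      rw [tensor_dh_apply, tensor_dh_apply]
      exact swap_apply P.dh_deg R.dh_deg _ _ _ _)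
    (fun b b' => by
      -- For the vertical differential the two degrees exchange their roles, so the summands in the
      -- exponent of the sign are interchanged.
      rw [tensor_dv_apply, tensor_dv_apply, add_comm (P.hdeg _ * _), add_comm (P.hdeg _ * _)]
      exact swap_apply (fun b b' h => (P.dv_deg b b' h).symm) (fun b b' h => (R.dv_deg b b' h).symm)
        _ _ _ _)

/-- The unit of the tensor product. -/
def tensorUnit (P : FreeBicomplex 𝒜) : Iso (P.tensor (unit 𝒜)) P :=
  ofEquiv (Equiv.prodUnique P.B Unit) (fun _ => 1) (fun _ => (add_zero _).symm)
    (fun _ => (add_zero _).symm) (fun _ => (add_zero _).symm)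
    (fun ⟨a, _⟩ ⟨a', _⟩ => by
      change P.dh a a' * ((1 : ℤ) : Q) = ((1 : ℤ) : Q) *
        (P.dh a a' * (1 : Matrix Unit Unit Q) () () + sgn Q P.hdeg a a' * 0)
      simp)
    (fun ⟨a, _⟩ ⟨a', _⟩ => by
      change P.dv a a' * ((1 : ℤ) : Q) = ((1 : ℤ) : Q) *
        (P.dv a a' * (1 : Matrix Unit Unit Q) () () + sgn Q P.vdeg a a' * 0)
      simp)

/-- The unit of the tensor product. -/
def unitTensor (P : FreeBicomplex 𝒜) : Iso ((unit 𝒜).tensor P) P :=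
  (comm _ _).trans (tensorUnit P)

lemma tensorList_append (l l' : List (FreeBicomplex 𝒜)) :
    Nonempty (Iso (tensorList (l ++ l')) ((tensorList l).tensor (tensorList l'))) := by
  induction l with
  | nil => exact ⟨(unitTensor _).symm⟩
  | cons P l ih =>
    obtain ⟨e⟩ := ih
    exact ⟨((refl P).tensor e).trans (assoc P (tensorList l) (tensorList l')).symm⟩

/-- This makes `KR` independent of the enumeration of edges and crossings. -/
lemma tensorList_perm {l l' : List (FreeBicomplex 𝒜)} (h : l.Perm l') :
    Nonempty (Iso (tensorList l) (tensorList l')) := by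
  induction h with
  | nil => exact ⟨refl _⟩
  | cons P _ ih => exact ⟨(refl P).tensor ih.some⟩
  | @swap P R l =>
    exact ⟨((assoc R P (tensorList l)).symm.trans ((comm R P).tensor (refl _))).trans
      (assoc P R (tensorList l))⟩
  | trans _ _ ih ih' => exact ⟨ih.some.trans ih'.some⟩

lemma tensorList_congr {ι : Type*} (l : List ι) (F G : ι → FreeBicomplex 𝒜)
    (h : ∀ x, Nonempty (Iso (F x) (G x))) :
    Nonempty (Iso (tensorList (l.map F)) (tensorList (l.map G))) := by
  induction l with
  | nil => exact ⟨refl _⟩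
  | cons x l ih => exact ⟨(h x).some.tensor ih.some⟩

end

section BaseChange

variable [SetLike.GradedMonoid 𝒜] {Q' : Type u} [CommRing Q'] [Algebra k Q']
  {ℬ : ℤ → Submodule k Q'} (φ : Q →+* Q') (hφ : ∀ n a, a ∈ 𝒜 n → φ a ∈ ℬ n)

variable [SetLike.GradedMonoid ℬ]

/-- Base change is compatible with tensor products. -/
def baseChangeTensor (P R : FreeBicomplex 𝒜) :
    Iso ((P.tensor R).baseChange φ hφ) ((P.baseChange φ hφ).tensor (R.baseChange φ hφ)) :=
  ofEquiv (Equiv.refl _) (fun _ => 1) (fun _ => rfl) (fun _ => rfl) (fun _ => rfl)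
    (fun ⟨a, b⟩ ⟨a', b'⟩ => by
      change (φ (P.dh a a') * (1 : Matrix R.B R.B Q') b b' +
        sgn Q' P.hdeg a a' * φ (R.dh b b')) * ((1 : ℤ) : Q') = ((1 : ℤ) : Q') *
          φ (P.dh a a' * (1 : Matrix R.B R.B Q) b b' + sgn Q P.hdeg a a' * R.dh b b')
      simp [sgn_apply, Matrix.one_apply, apply_ite φ])
    (fun ⟨a, b⟩ ⟨a', b'⟩ => by
      change (φ (P.dv a a') * (1 : Matrix R.B R.B Q') b b' +
        sgn Q' P.vdeg a a' * φ (R.dv b b')) * ((1 : ℤ) : Q') = ((1 : ℤ) : Q') *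
          φ (P.dv a a' * (1 : Matrix R.B R.B Q) b b' + sgn Q P.vdeg a a' * R.dv b b')
      simp [sgn_apply, Matrix.one_apply, apply_ite φ])

/-- Base change is compatible with units. -/
def baseChangeUnit : Iso ((unit 𝒜).baseChange φ hφ) (unit ℬ) :=
  ofEquiv (Equiv.refl _) (fun _ => 1) (fun _ => rfl) (fun _ => rfl) (fun _ => rfl)
    (fun _ _ => by
      change (0 : Q') * ((1 : ℤ) : Q') = ((1 : ℤ) : Q') * φ 0
      simp)
    (fun _ _ => by
      change (0 : Q') * ((1 : ℤ) : Q') = ((1 : ℤ) : Q') * φ 0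
      simp)

lemma baseChange_tensorList (l : List (FreeBicomplex 𝒜)) :
    Nonempty (Iso ((tensorList l).baseChange φ hφ)
      (tensorList (l.map fun P => P.baseChange φ hφ))) := by
  induction l with
  | nil => exact ⟨baseChangeUnit φ hφ⟩
  | cons P l ih =>
    exact ⟨(baseChangeTensor φ hφ P (tensorList l)).trans ((refl _).tensor ih.some)⟩

end BaseChange

section KD

variable [SetLike.GradedMonoid 𝒜]

lemma mulVec_mem_piece (U : Matrix R.B P.B Q)
    (hd : ∀ b b', U b b' ≠ 0 → R.hdeg b = P.hdeg b' ∧ R.vdeg b = P.vdeg b')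
    (hm : ∀ b b', U b b' ∈ 𝒜 (P.pdeg b' - R.pdeg b)) {n j i : ℤ} {f : P.B → Q}
    (hf : f ∈ P.piece n j i) : U.mulVec f ∈ R.piece n j i := by
  intro b
  constructor
  · refine Submodule.sum_mem _ fun b' _ => ?_
    have := SetLike.GradedMul.mul_mem (hm b b') (hf b').1
    rwa [show P.pdeg b' - R.pdeg b + (n - P.pdeg b') = n - R.pdeg b by ring] at this
  · intro h
    obtain ⟨b', -, hb'⟩ := Finset.exists_ne_zero_of_sum_ne_zero h
    have h1 := hd b b' (left_ne_zero_of_mul hb')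
    have h2 := (hf b').2 (right_ne_zero_of_mul hb')
    exact ⟨h1.2.trans h2.1, h1.1.trans h2.2⟩

lemma mulVec_comm (e : Iso P R) (x : P.B → Q) :
    e.U.mulVec (P.dh.mulVec x) = R.dh.mulVec (e.U.mulVec x) ∧
      e.U.mulVec (P.dv.mulVec x) = R.dv.mulVec (e.U.mulVec x) := by
  simp only [Matrix.mulVec_mulVec, e.dh, e.dv, and_self]

lemma mulVec_cancel (e : Iso P R) (x : P.B → Q) : e.V.mulVec (e.U.mulVec x) = x := by
  rw [Matrix.mulVec_mulVec, e.VU, Matrix.one_mulVec]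

/-- The morphism of bigraded modules given by an isomorphism. -/
def toHom (e : Iso P R) (n : ℤ) : (P.toBigraded n).Hom (R.toBigraded n) where
  f := e.U.mulVecLin.restrictScalars k
  mem hf := mulVec_mem_piece e.U e.U_deg e.U_mem hf
  dh x := (e.mulVec_comm x).1
  dv x := (e.mulVec_comm x).2

lemma kdIso [HasDerivedCategory.{w} (ModuleCat.{u} k)] (e : Iso P R) (n : ℤ) :
    KDIso.{w} (P.toBicomplex n) (R.toBicomplex n) := by
  -- An isomorphism is a surjection with zero, hence acyclic, kernel.
  refine (?_ : (e.toHom n).IsAcyclicSurjection).kdIso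
  refine ⟨fun {j i y} hy => ⟨e.V.mulVec y, mulVec_mem_piece e.V e.V_deg e.V_mem hy,
    e.symm.mulVec_cancel y⟩, fun {j i x} _ hx _ =>
      ⟨0, Submodule.zero_mem _, map_zero _, (map_zero _).trans ?_⟩⟩
  have := (e.mulVec_cancel x).symm.trans (congrArg e.V.mulVec hx)
  exact (this.trans (Matrix.mulVec_zero _)).symm

end KD

end Iso
end FreeBicomplex
end TripleLink

/-! ### Replacing the Koszul complex of a regular element by the quotient ring -/

namespace TripleLink
namespace FreeBicomplex

variable {k Q : Type u} [Field k] [CommRing Q] [Algebra k Q] {𝒜 : ℤ → Submodule k Q}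

lemma sgn_mul_self_cast (n : ℤ) (x : Q) :
    ((n.negOnePow : ℤ) : Q) * (((n.negOnePow : ℤ) : Q) * x) = x := by
  rw [← mul_assoc, ← Int.cast_mul, ← Units.val_mul, Int.units_mul_self]; simp

lemma sgn_mul_mem (n m : ℤ) {x : Q} (hx : x ∈ 𝒜 m) : ((n.negOnePow : ℤ) : Q) * x ∈ 𝒜 m := by
  rw [← zsmul_eq_mul]
  exact zsmul_mem hx _

lemma sgn_mul_ne_zero {n : ℤ} {x : Q} (h : ((n.negOnePow : ℤ) : Q) * x ≠ 0) : x ≠ 0 :=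
  right_ne_zero_of_mul h

/-- The differential of a tensor product is evaluated on the slices of `f` with one index fixed. All
later computations with tensor products go through this formula. -/
lemma kron_mulVec {A B : Type} [Fintype A] [DecidableEq A] [Fintype B] [DecidableEq B]
    (X : Matrix A A Q) (d : A → ℤ) (Y : Matrix B B Q) (f : A × B → Q) (p : A × B) :
    (X ⊗ₖ (1 : Matrix B B Q) + sgn Q d ⊗ₖ Y).mulVec f p =
      X.mulVec (fun a => f (a, p.2)) p.1 +
        (((d p.1).negOnePow : ℤ) : Q) * Y.mulVec (fun b => f (p.1, b)) p.2 := by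
  rw [Matrix.add_mulVec, Pi.add_apply]
  congr 1
  · simp only [Matrix.mulVec, dotProduct, Fintype.sum_prod_type, Matrix.kroneckerMap_apply]
    refine Finset.sum_congr rfl fun a _ => ?_
    rw [Finset.sum_eq_single p.2 (fun b _ hb => by simp [Matrix.one_apply_ne (Ne.symm hb)])
      (by simp)]
    simp
  · simp only [Matrix.mulVec, dotProduct, Fintype.sum_prod_type, Matrix.kroneckerMap_apply]
    rw [Finset.sum_eq_single p.1 (fun a _ ha => Finset.sum_eq_zero fun b _ => by
      simp [sgn, Matrix.diagonal_apply_ne _ (Ne.symm ha)]) (by simp), Finset.mul_sum]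
    exact Finset.sum_congr rfl fun b _ => by simp [sgn, mul_assoc]

lemma tensor_dh_mulVec (P R : FreeBicomplex 𝒜) (f : P.B × R.B → Q) (p : P.B × R.B) :
    (P.tensor R).dh.mulVec f p = P.dh.mulVec (fun a => f (a, p.2)) p.1 +
      (((P.hdeg p.1).negOnePow : ℤ) : Q) * R.dh.mulVec (fun b => f (p.1, b)) p.2 :=
  kron_mulVec _ _ _ _ _

lemma tensor_dv_mulVec (P R : FreeBicomplex 𝒜) (f : P.B × R.B → Q) (p : P.B × R.B) :
    (P.tensor R).dv.mulVec f p = P.dv.mulVec (fun a => f (a, p.2)) p.1 +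
      (((P.vdeg p.1).negOnePow : ℤ) : Q) * R.dv.mulVec (fun b => f (p.1, b)) p.2 :=
  kron_mulVec _ _ _ _ _

/-- `dh` raises `hdeg` by one, so it anticommutes with the sign operator. -/
lemma dh_mulVec_sgn (P : FreeBicomplex 𝒜) (f : P.B → Q) (b : P.B) :
    P.dh.mulVec (fun b' => (((P.hdeg b').negOnePow : ℤ) : Q) * f b') b =
      -((((P.hdeg b).negOnePow : ℤ) : Q) * P.dh.mulVec f b) := by
  simp only [Matrix.mulVec, dotProduct, Finset.mul_sum, ← Finset.sum_neg_distrib]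
  refine Finset.sum_congr rfl fun b' _ => ?_
  by_cases h : P.dh b b' = 0
  · simp [h]
  · rw [(P.dh_deg _ _ h).1, Int.negOnePow_succ]
    push_cast
    ring

lemma dv_mulVec_sgn (P : FreeBicomplex 𝒜) (f : P.B → Q) (b : P.B) :
    P.dv.mulVec (fun b' => (((P.vdeg b').negOnePow : ℤ) : Q) * f b') b =
      -((((P.vdeg b).negOnePow : ℤ) : Q) * P.dv.mulVec f b) := by
  simp only [Matrix.mulVec, dotProduct, Finset.mul_sum, ← Finset.sum_neg_distrib]
  refine Finset.sum_congr rfl fun b' _ => ?_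
  by_cases h : P.dv b b' = 0
  · simp [h]
  · rw [(P.dv_deg _ _ h).2, Int.negOnePow_succ]
    push_cast
    ring

lemma dh_mulVec_sgn_vdeg (P : FreeBicomplex 𝒜) (f : P.B → Q) (b : P.B) :
    P.dh.mulVec (fun b' => (((P.vdeg b').negOnePow : ℤ) : Q) * f b') b =
      (((P.vdeg b).negOnePow : ℤ) : Q) * P.dh.mulVec f b := by
  simp only [Matrix.mulVec, dotProduct, Finset.mul_sum]
  refine Finset.sum_congr rfl fun b' _ => ?_
  by_cases h : P.dh b b' = 0
  · simp [h]
  · rw [(P.dh_deg _ _ h).2]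
    ring

lemma map_mulVec {Q' : Type u} [CommRing Q'] (χ : Q →+* Q') {A B : Type} [Fintype B]
    (M : Matrix A B Q) (f : B → Q) (a : A) :
    χ (M.mulVec f a) = (M.map χ).mulVec (fun b => χ (f b)) a := by
  simp [Matrix.mulVec, dotProduct, map_sum]

section Kill

variable [SetLike.GradedMonoid 𝒜] {Q' : Type u} [CommRing Q'] [Algebra k Q']
  {ℬ : ℤ → Submodule k Q'} [SetLike.GradedMonoid ℬ]

/-- `χ` is a surjection of graded rings whose kernel is generated by the homogeneous non zero
divisor `x` of degree `m`. -/
structure IsQuotientBy (𝒜 : ℤ → Submodule k Q) (ℬ : ℤ → Submodule k Q') (χ : Q →ₐ[k] Q')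
    (x : Q) (m : ℤ) : Prop where
  mem_of_mem : ∀ n a, a ∈ 𝒜 n → χ.toRingHom a ∈ ℬ n
  surj : ∀ n b, b ∈ ℬ n → ∃ a ∈ 𝒜 n, χ a = b
  mem : x ∈ 𝒜 m
  map_eq_zero : χ x = 0
  exists_of_map_eq_zero : ∀ n y, y ∈ 𝒜 n → χ y = 0 → ∃ g ∈ 𝒜 (n - m), y = x * g
  eq_zero_of_mul : ∀ g, x * g = 0 → g = 0

lemma koszulOne_mulVec_zero (x : Q) (hx : x ∈ 𝒜 2) (f : Fin 2 → Q) :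
    (koszulOne x hx).dh.mulVec f (0 : Fin 2) = x * f 1 := by
  change (!![0, x; 0, 0] : Matrix (Fin 2) (Fin 2) Q).mulVec f 0 = x * f 1
  simp [Matrix.mulVec, dotProduct, Fin.sum_univ_two]

lemma koszulOne_mulVec_one (x : Q) (hx : x ∈ 𝒜 2) (f : Fin 2 → Q) :
    (koszulOne x hx).dh.mulVec f (1 : Fin 2) = 0 := by
  change (!![0, x; 0, 0] : Matrix (Fin 2) (Fin 2) Q).mulVec f 1 = 0
  simp [Matrix.mulVec, dotProduct, Fin.sum_univ_two]

lemma tensor_koszulOne_dh_zero (P : FreeBicomplex 𝒜) (x : Q) (hx : x ∈ 𝒜 2)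
    (f : P.B × Fin 2 → Q) (b : P.B) :
    (P.tensor (koszulOne x hx)).dh.mulVec f (b, (0 : Fin 2)) =
      P.dh.mulVec (fun a => f (a, 0)) b + (((P.hdeg b).negOnePow : ℤ) : Q) * (x * f (b, 1)) :=
  (tensor_dh_mulVec P (koszulOne x hx) f (b, (0 : Fin 2))).trans
    (congrArg (fun y => P.dh.mulVec (fun a => f (a, 0)) b + (((P.hdeg b).negOnePow : ℤ) : Q) * y)
      (koszulOne_mulVec_zero x hx _))

lemma tensor_koszulOne_dh_one (P : FreeBicomplex 𝒜) (x : Q) (hx : x ∈ 𝒜 2)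
    (f : P.B × Fin 2 → Q) (b : P.B) :
    (P.tensor (koszulOne x hx)).dh.mulVec f (b, (1 : Fin 2)) =
      P.dh.mulVec (fun a => f (a, 1)) b :=
  (tensor_dh_mulVec P (koszulOne x hx) f (b, (1 : Fin 2))).trans
    ((congrArg (fun y => P.dh.mulVec (fun a => f (a, 1)) b + (((P.hdeg b).negOnePow : ℤ) : Q) * y)
      (koszulOne_mulVec_one x hx _)).trans (by rw [mul_zero, add_zero]))

lemma tensor_koszulOne_dv (P : FreeBicomplex 𝒜) (x : Q) (hx : x ∈ 𝒜 2)
    (f : P.B × Fin 2 → Q) (b : P.B) (c : Fin 2) :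
    (P.tensor (koszulOne x hx)).dv.mulVec f (b, c) = P.dv.mulVec (fun a => f (a, c)) b :=
  (tensor_dv_mulVec P (koszulOne x hx) f (b, c)).trans
    ((congrArg (fun y => P.dv.mulVec (fun a => f (a, c)) b + (((P.vdeg b).negOnePow : ℤ) : Q) * y)
      (congrFun (Matrix.zero_mulVec (fun c => f (b, c))) c)).trans
        (by rw [Pi.zero_apply, mul_zero, add_zero]))

/-- The projection from `P ⊗ K(x)` to the reduction of `P` modulo `x`. -/
def koszulProj {χ : Q →ₐ[k] Q'} {x : Q} (h : IsQuotientBy 𝒜 ℬ χ x 2) (P : FreeBicomplex 𝒜)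
    (n : ℤ) : ((P.tensor (koszulOne x h.mem)).toBigraded n).Hom
      ((P.baseChange χ.toRingHom h.mem_of_mem).toBigraded n) where
  f := 
    { toFun := fun (f : P.B × Fin 2 → Q) (b : P.B) => χ (f (b, (0 : Fin 2)))
      map_add' := fun f g => funext fun b => map_add χ _ _
      map_smul' := fun c f => funext fun b => map_smul χ c _ }
  mem {j i f} hf b := by
    obtain ⟨h1, h2⟩ := hf (b, (0 : Fin 2))
    change f (b, (0 : Fin 2)) ∈ 𝒜 (n - (P.pdeg b + 0)) at h1
    change f (b, (0 : Fin 2)) ≠ 0 → P.vdeg b + 0 = j ∧ P.hdeg b + 0 = i at h2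
    rw [add_zero] at h1
    rw [add_zero, add_zero] at h2
    exact ⟨h.mem_of_mem _ _ h1, fun h0 => h2 fun h3 => h0 ((congrArg χ h3).trans (map_zero χ))⟩
  dh f := funext fun b => by
    refine (congrArg χ (tensor_koszulOne_dh_zero P x h.mem f b)).trans ?_
    rw [map_add, map_mul, map_mul, h.map_eq_zero, zero_mul, mul_zero, add_zero]
    exact map_mulVec χ.toRingHom _ _ _
  dv f := funext fun b =>
    (congrArg χ (tensor_koszulOne_dv P x h.mem f b 0)).trans (map_mulVec χ.toRingHom _ _ _)

/-- An element of P ⊗ K(x) is a pair f₀ + f₁e. If it is a cycle in the kernel, then f₀ = xg, and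
cancelling x in the cycle condition identifies f₁ with the differential of g up to sign; thus ±ge is
a primitive. -/
lemma koszulProj_isAcyclicSurjection {χ : Q →ₐ[k] Q'} {x : Q} (h : IsQuotientBy 𝒜 ℬ χ x 2)
    (P : FreeBicomplex 𝒜) (n : ℤ) : (koszulProj h P n).IsAcyclicSurjection := by
  constructor
  · intro j i y hy
    change P.B → Q' at y
    -- The lift of 0 is chosen to be 0, because a nonzero component of an element of a piece must
    -- have the right bidegree.
    have h1 : ∀ b, ∃ a ∈ 𝒜 (n - P.pdeg b), χ a = y b ∧ (y b = 0 → a = 0) := fun b => by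
      by_cases h0 : y b = 0
      · exact ⟨0, Submodule.zero_mem _, by rw [map_zero, h0], fun _ => rfl⟩
      · obtain ⟨a, ha, hay⟩ := h.surj _ _ (hy b).1
        exact ⟨a, ha, hay, fun h1 => (h0 h1).elim⟩
    choose a ha hay h0 using h1
    refine ⟨fun (p : P.B × Fin 2) => if p.2 = 0 then a p.1 else 0, ?_, funext fun b => ?_⟩
    · rintro ⟨b, c⟩
      fin_cases c
      · refine ⟨?_, fun h1 => ?_⟩
        · change a b ∈ 𝒜 (n - (P.pdeg b + 0))
          rw [add_zero]
          exact ha b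
        · change P.vdeg b + 0 = j ∧ P.hdeg b + 0 = i
          rw [add_zero, add_zero]
          exact (hy b).2 fun h2 => h1 (h0 b h2)
      · exact ⟨Submodule.zero_mem _, fun h1 => (h1 rfl).elim⟩
    · exact hay b
  · intro j i f hf hf0 hdf
    change P.B × Fin 2 → Q at f
    have h1 : ∀ b, ∃ g ∈ 𝒜 (n - P.pdeg b - 2), f (b, (0 : Fin 2)) = x * g := fun b => by
      have h2 : f (b, (0 : Fin 2)) ∈ 𝒜 (n - (P.pdeg b + 0)) := (hf (b, (0 : Fin 2))).1
      rw [add_zero] at h2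
      exact h.exists_of_map_eq_zero _ _ h2 (congrFun hf0 b)
    choose g hg hfg using h1
    -- This is the component of the cycle condition without e, divided by x.
    have h3 : ∀ b, P.dh.mulVec g b = -((((P.hdeg b).negOnePow : ℤ) : Q) * f (b, (1 : Fin 2))) := by
      intro b
      refine eq_neg_of_add_eq_zero_left (h.eq_zero_of_mul _ ?_)
      have h4 := (tensor_koszulOne_dh_zero P x h.mem f b).symm.trans
        (congrFun hdf (b, (0 : Fin 2)))
      refine Eq.trans ?_ h4
      rw [mul_add]
      congr 1
      · simp only [hfg, Matrix.mulVec, dotProduct, Finset.mul_sum]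
        exact Finset.sum_congr rfl fun _ _ => by ring
      · ring
    refine ⟨fun (p : P.B × Fin 2) =>
      if p.2 = 0 then 0 else (((P.hdeg p.1).negOnePow : ℤ) : Q) * g p.1, ?_, ?_, ?_⟩
    · rintro ⟨b, c⟩
      fin_cases c
      · exact ⟨Submodule.zero_mem _, fun h1 => (h1 rfl).elim⟩
      · refine ⟨?_, fun h1 => ?_⟩
        · change _ * g b ∈ 𝒜 (n - (P.pdeg b + 2))
          rw [← sub_sub]
          exact sgn_mul_mem _ _ (hg b)
        · change P.vdeg b + 0 = j ∧ P.hdeg b + -1 = i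
          have h2 : f (b, (0 : Fin 2)) ≠ 0 → P.vdeg b + 0 = j ∧ P.hdeg b + 0 = i + 1 := (hf (b, (0 : Fin 2))).2
          have h4 := h2 fun h5 => sgn_mul_ne_zero h1
            (h.eq_zero_of_mul _ ((hfg b).symm.trans h5))
          constructor <;> lia
    · exact funext fun b => map_zero χ
    · refine funext fun ⟨b, c⟩ => ?_
      fin_cases c
      · refine (tensor_koszulOne_dh_zero P x h.mem _ b).trans ?_
        change P.dh.mulVec 0 b + _ * (x * (_ * g b)) = f (b, (0 : Fin 2))
        rw [hfg, Matrix.mulVec_zero, Pi.zero_apply, zero_add, mul_left_comm, sgn_mul_self_cast]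
      · refine (tensor_koszulOne_dh_one P x h.mem _ b).trans ?_
        change P.dh.mulVec (fun b => (((P.hdeg b).negOnePow : ℤ) : Q) * g b) b =
          f (b, (1 : Fin 2))
        rw [dh_mulVec_sgn, h3, mul_neg, neg_neg, sgn_mul_self_cast]

lemma kdIso_koszul [HasDerivedCategory.{w} (ModuleCat.{u} k)] {χ : Q →ₐ[k] Q'} {x : Q}
    (h : IsQuotientBy 𝒜 ℬ χ x 2) (P : FreeBicomplex 𝒜) (n : ℤ) :
    KDIso.{w} ((P.tensor (koszulOne x h.mem)).toBicomplex n)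
      ((P.baseChange χ.toRingHom h.mem_of_mem).toBicomplex n) :=
  (koszulProj_isAcyclicSurjection h P n).kdIso

end Kill

end FreeBicomplex
end TripleLink

/-! ### Splitting the linear relation off the complex of a crossing -/

namespace TripleLink
namespace FreeBicomplex

variable {k Q : Type u} [Field k] [CommRing Q] [Algebra k Q] {𝒜 : ℤ → Submodule k Q}

/-- The vertical two-term complex from the horizontal Koszul complex of `q` to that of `q'`, given
by `1 ↦ α`, `e ↦ β e`. -/
def twoTermOne (v : ℤ) (w w' : Fin 2 → ℤ) (q q' α β : Q) (hq : q ∈ 𝒜 (w 1 - w 0))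
    (hq' : q' ∈ 𝒜 (w' 1 - w' 0)) (hα : α ∈ 𝒜 (w 0 - w' 0)) (hβ : β ∈ 𝒜 (w 1 - w' 1))
    (h : q' * β = α * q) : FreeBicomplex 𝒜 where
  B := Fin 2 ⊕ Fin 2
  hdeg := Sum.elim ![0, -1] ![0, -1]
  vdeg := Sum.elim (fun _ => v) (fun _ => v + 1)
  pdeg := Sum.elim w w'
  dh := Matrix.fromBlocks !![0, q; 0, 0] 0 0 !![0, q'; 0, 0]
  dv := Matrix.fromBlocks 0 0 !![α, 0; 0, β] 0
  dh_deg b b' hb := by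
    rcases b with b | b <;> rcases b' with b' | b' <;> fin_cases b <;> fin_cases b' <;>
      simp at hb ⊢
  dv_deg b b' hb := by
    rcases b with b | b <;> rcases b' with b' | b' <;> fin_cases b <;> fin_cases b' <;>
      simp at hb ⊢
  dh_mem b b' := by
    rcases b with b | b <;> rcases b' with b' | b' <;> fin_cases b <;> fin_cases b' <;>
      simp [hq, hq']
  dv_mem b b' := by
    rcases b with b | b <;> rcases b' with b' | b' <;> fin_cases b <;> fin_cases b' <;>
      simp [hα, hβ]
  dh_sq := by
    have (x : Q) : (!![0, x; 0, 0] : Matrix (Fin 2) (Fin 2) Q) * !![0, x; 0, 0] = 0 := by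
      ext b b'
      fin_cases b <;> fin_cases b' <;> simp [Matrix.mul_apply]
    simp [Matrix.fromBlocks_multiply, -Matrix.cons_mul, this]
  dv_sq := by simp [Matrix.fromBlocks_multiply, -Matrix.cons_mul]
  comm := by
    have : (!![0, q'; 0, 0] : Matrix (Fin 2) (Fin 2) Q) * !![α, 0; 0, β] =
        !![α, 0; 0, β] * !![0, q; 0, 0] := by
      ext b b'
      fin_cases b <;> fin_cases b' <;> simp [Matrix.mul_apply, Fin.sum_univ_two, h]
    simp [Matrix.fromBlocks_multiply, -Matrix.cons_mul, this]

namespace Iso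

/-- Isomorphism of two-term complexes of rank four, given by isomorphisms of both terms. -/
def twoTerm {v : ℤ} {w w' w₁ w₁' : Fin 4 → ℤ} {D D' ρ D₁ D₁' ρ₁ : Matrix (Fin 4) (Fin 4) Q}
    {hD : ∀ b b', D b b' ≠ 0 → koszulDeg b = koszulDeg b' + 1}
    {hD' : ∀ b b', D' b b' ≠ 0 → koszulDeg b = koszulDeg b' + 1}
    {hρ : ∀ b b', ρ b b' ≠ 0 → koszulDeg b = koszulDeg b'}
    {mD : ∀ b b', D b b' ∈ 𝒜 (w b' - w b)} {mD' : ∀ b b', D' b b' ∈ 𝒜 (w' b' - w' b)}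
    {mρ : ∀ b b', ρ b b' ∈ 𝒜 (w b' - w' b)}
    {sD : D * D = 0} {sD' : D' * D' = 0} {hc : D' * ρ = ρ * D}
    {hD₁ : ∀ b b', D₁ b b' ≠ 0 → koszulDeg b = koszulDeg b' + 1}
    {hD₁' : ∀ b b', D₁' b b' ≠ 0 → koszulDeg b = koszulDeg b' + 1}
    {hρ₁ : ∀ b b', ρ₁ b b' ≠ 0 → koszulDeg b = koszulDeg b'}
    {mD₁ : ∀ b b', D₁ b b' ∈ 𝒜 (w₁ b' - w₁ b)} {mD₁' : ∀ b b', D₁' b b' ∈ 𝒜 (w₁' b' - w₁' b)}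
    {mρ₁ : ∀ b b', ρ₁ b b' ∈ 𝒜 (w₁ b' - w₁' b)}
    {sD₁ : D₁ * D₁ = 0} {sD₁' : D₁' * D₁' = 0} {hc₁ : D₁' * ρ₁ = ρ₁ * D₁}
    (A A' B B' : Matrix (Fin 4) (Fin 4) Q) (hAA : A * A' = 1) (hBB : B * B' = 1)
    (dA : ∀ b b', A b b' ≠ 0 → koszulDeg b = koszulDeg b')
    (dA' : ∀ b b', A' b b' ≠ 0 → koszulDeg b = koszulDeg b')
    (dB : ∀ b b', B b b' ≠ 0 → koszulDeg b = koszulDeg b')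
    (dB' : ∀ b b', B' b b' ≠ 0 → koszulDeg b = koszulDeg b')
    (mA : ∀ b b', A b b' ∈ 𝒜 (w b' - w₁ b)) (mA' : ∀ b b', A' b b' ∈ 𝒜 (w₁ b' - w b))
    (mB : ∀ b b', B b b' ∈ 𝒜 (w' b' - w₁' b)) (mB' : ∀ b b', B' b b' ∈ 𝒜 (w₁' b' - w' b))
    (h1 : D₁ * A = A * D) (h2 : D₁' * B = B * D') (h3 : ρ₁ * A = B * ρ) :
    Iso (FreeBicomplex.twoTerm v w w' D D' ρ hD hD' hρ mD mD' mρ sD sD' hc)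
      (FreeBicomplex.twoTerm v w₁ w₁' D₁ D₁' ρ₁ hD₁ hD₁' hρ₁ mD₁ mD₁' mρ₁ sD₁ sD₁' hc₁) where
  U := Matrix.fromBlocks A 0 0 B
  V := Matrix.fromBlocks A' 0 0 B'
  UV := by
    refine (Matrix.fromBlocks_multiply A 0 0 B A' 0 0 B').trans ?_
    simp only [hAA, hBB, Matrix.mul_zero, Matrix.zero_mul, add_zero, zero_add]
    exact Matrix.fromBlocks_one
  VU := by
    refine (Matrix.fromBlocks_multiply A' 0 0 B' A 0 0 B).trans ?_
    simp only [mul_eq_one_comm.1 hAA, mul_eq_one_comm.1 hBB, Matrix.mul_zero,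
      Matrix.zero_mul, add_zero, zero_add]
    exact Matrix.fromBlocks_one
  U_deg b b' h := by
    rcases b with b | b <;> rcases b' with b' | b'
    · exact ⟨dA b b' h, rfl⟩
    · exact (h rfl).elim
    · exact (h rfl).elim
    · exact ⟨dB b b' h, rfl⟩
  V_deg b b' h := by
    rcases b with b | b <;> rcases b' with b' | b'
    · exact ⟨dA' b b' h, rfl⟩
    · exact (h rfl).elim
    · exact (h rfl).elim
    · exact ⟨dB' b b' h, rfl⟩
  U_mem b b' := by
    rcases b with b | b <;> rcases b' with b' | b'
    · exact mA b b'
    · exact Submodule.zero_mem _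
    · exact Submodule.zero_mem _
    · exact mB b b'
  V_mem b b' := by
    rcases b with b | b <;> rcases b' with b' | b'
    · exact mA' b b'
    · exact Submodule.zero_mem _
    · exact Submodule.zero_mem _
    · exact mB' b b'
  dh := by
    refine (Matrix.fromBlocks_multiply D₁ 0 0 D₁' A 0 0 B).trans
      (Eq.trans ?_ (Matrix.fromBlocks_multiply A 0 0 B D 0 0 D').symm)
    simp [h1, h2]
  dv := by
    refine (Matrix.fromBlocks_multiply 0 0 ρ₁ 0 A 0 0 B).trans
      (Eq.trans ?_ (Matrix.fromBlocks_multiply A 0 0 B 0 0 ρ 0).symm)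
    simp [h3]

end Iso

lemma koszulTwo_mem {σ q : Q} {m a : ℤ} (hσ : σ ∈ 𝒜 2) (hq : q ∈ 𝒜 m) (b b' : Fin 4) :
    koszulTwo σ q b b' ∈ 𝒜 (![a, a + 2, a + m, a + m + 2] b' - ![a, a + 2, a + m, a + m + 2] b) := by
  have hq' := neg_mem hq
  fin_cases b <;> fin_cases b' <;> simp [koszulTwo, hσ, hq, add_assoc]

/-- The basis `1, e₁, e₂, e₁e₂` of a Koszul complex of a pair as a product. -/
def koszulEquiv : Fin 2 × (Fin 2 ⊕ Fin 2) ≃ Fin 4 ⊕ Fin 4 where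
  toFun p := p.2.elim (fun b => .inl (![![0, 2], ![1, 3]] p.1 b))
    (fun b => .inr (![![0, 2], ![1, 3]] p.1 b))
  invFun := Sum.elim ![(0, .inl 0), (1, .inl 0), (0, .inl 1), (1, .inl 1)]
    ![(0, .inr 0), (1, .inr 0), (0, .inr 1), (1, .inr 1)]
  left_inv := by decide
  right_inv := by decide

/-- The map of Koszul complexes that multiplies `1`, `e₁` by `α` and `e₂`, `e₁e₂` by `β`. -/
def diagMap (α β : Q) : Matrix (Fin 4) (Fin 4) Q := Matrix.diagonal ![α, α, β, β]

lemma diagMap_deg (α β : Q) (b b' : Fin 4) (h : diagMap α β b b' ≠ 0) :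
    koszulDeg b = koszulDeg b' := by
  by_cases h0 : b = b'
  · rw [h0]
  · exact (h (Matrix.diagonal_apply_ne _ h0)).elim

lemma diagMap_mem {α β : Q} {a a' m m' : ℤ} (hα : α ∈ 𝒜 (a - a'))
    (hβ : β ∈ 𝒜 (a + m - (a' + m'))) (b b' : Fin 4) :
    diagMap α β b b' ∈ 𝒜 (![a, a + 2, a + m, a + m + 2] b' -
      ![a', a' + 2, a' + m', a' + m' + 2] b) := by
  fin_cases b <;> fin_cases b' <;> simp [diagMap, hα, hβ]

lemma diagMap_comm {σ q q' α β : Q} (h : q' * β = α * q) :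
    koszulTwo σ q' * diagMap α β = diagMap α β * koszulTwo σ q := by
  ext b b'
  rw [diagMap, Matrix.mul_diagonal, Matrix.diagonal_mul]
  fin_cases b <;> fin_cases b' <;> simp [koszulTwo, h, mul_comm]
 
variable [SetLike.GradedMonoid 𝒜]

lemma koszulEquiv_hdeg : ∀ b, Sum.elim koszulDeg koszulDeg (koszulEquiv b) =
    (![0, -1] : Fin 2 → ℤ) b.1 + Sum.elim (![0, -1] : Fin 2 → ℤ) ![0, -1] b.2 := by
  decide

lemma koszulEquiv_pdeg (a a' m m' : ℤ) (b : Fin 2 × (Fin 2 ⊕ Fin 2)) :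
    Sum.elim (![a, a + 2, a + m, a + m + 2] : Fin 4 → ℤ) ![a', a' + 2, a' + m', a' + m' + 2]
      (koszulEquiv b) = (![0, 2] : Fin 2 → ℤ) b.1 +
        Sum.elim (![a, a + m] : Fin 2 → ℤ) ![a', a' + m'] b.2 := by
  obtain ⟨b, c | c⟩ := b <;> fin_cases b <;> fin_cases c <;> simp [koszulEquiv, add_comm]

lemma koszulEquiv_dh (σ q q' : Q) (b b' : Fin 2 × (Fin 2 ⊕ Fin 2)) :
    (Matrix.fromBlocks (koszulTwo σ q) 0 0 (koszulTwo σ q')) (koszulEquiv b) (koszulEquiv b') =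
      (!![0, σ; 0, 0] : Matrix (Fin 2) (Fin 2) Q) b.1 b'.1 *
        (1 : Matrix (Fin 2 ⊕ Fin 2) (Fin 2 ⊕ Fin 2) Q) b.2 b'.2 +
      ((((![0, -1] : Fin 2 → ℤ) b.1).negOnePow : ℤ) : Q) * (1 : Matrix (Fin 2) (Fin 2) Q) b.1 b'.1 *
        (Matrix.fromBlocks !![0, q; 0, 0] 0 0 !![0, q'; 0, 0] :
          Matrix (Fin 2 ⊕ Fin 2) (Fin 2 ⊕ Fin 2) Q) b.2 b'.2 := by
  obtain ⟨b, c | c⟩ := b <;> obtain ⟨b', c' | c'⟩ := b' <;> fin_cases b <;> fin_cases c <;>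
    fin_cases b' <;> fin_cases c' <;>
      simp [koszulEquiv, koszulTwo, Matrix.one_apply]

lemma koszulEquiv_dv (α β : Q) (b b' : Fin 2 × (Fin 2 ⊕ Fin 2)) :
    (Matrix.fromBlocks 0 0 (diagMap α β) 0) (koszulEquiv b) (koszulEquiv b') =
      (0 : Matrix (Fin 2) (Fin 2) Q) b.1 b'.1 *
        (1 : Matrix (Fin 2 ⊕ Fin 2) (Fin 2 ⊕ Fin 2) Q) b.2 b'.2 +
      (((0 : ℤ).negOnePow : ℤ) : Q) * (1 : Matrix (Fin 2) (Fin 2) Q) b.1 b'.1 *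
        (Matrix.fromBlocks 0 0 !![α, 0; 0, β] 0 :
          Matrix (Fin 2 ⊕ Fin 2) (Fin 2 ⊕ Fin 2) Q) b.2 b'.2 := by
  obtain ⟨b, c | c⟩ := b <;> obtain ⟨b', c' | c'⟩ := b' <;> fin_cases b <;> fin_cases c <;>
    fin_cases b' <;> fin_cases c' <;>
      simp [koszulEquiv, diagMap, Matrix.one_apply]

/-- A two-term complex of Koszul complexes of pairs with a common first element splits off the
Koszul complex of this element. -/
def koszulSplit (v a a' m m' : ℤ) {σ q q' α β : Q} (hσ : σ ∈ 𝒜 2) (hq : q ∈ 𝒜 m) (hq' : q' ∈ 𝒜 m')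
    (hα : α ∈ 𝒜 (a - a')) (hβ : β ∈ 𝒜 (a + m - (a' + m'))) (h : q' * β = α * q) :
    Iso ((koszulOne σ hσ).tensor (twoTermOne v ![a, a + m] ![a', a' + m'] q q' α β
      (by simpa using hq) (by simpa using hq') (by simpa using hα) (by simpa using hβ) h))
    (twoTerm v ![a, a + 2, a + m, a + m + 2] ![a', a' + 2, a' + m', a' + m' + 2]
      (koszulTwo σ q) (koszulTwo σ q') (diagMap α β) (koszulTwo_deg _ _) (koszulTwo_deg _ _)
      (diagMap_deg _ _) (koszulTwo_mem hσ hq) (koszulTwo_mem hσ hq') (diagMap_mem hα hβ)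
      (koszulTwo_sq _ _) (koszulTwo_sq _ _) (diagMap_comm h)) :=
  Iso.ofEquiv koszulEquiv (fun _ => 1)
    koszulEquiv_hdeg
    (fun b => by
      obtain ⟨b, c | c⟩ := b <;> exact (zero_add _).symm)
    (koszulEquiv_pdeg a a' m m')
    (fun b b' => by
      rw [Iso.tensor_dh_apply, Units.val_one, Int.cast_one, mul_one, one_mul]
      exact koszulEquiv_dh σ q q' b b')
    (fun b b' => by
      rw [Iso.tensor_dv_apply, Units.val_one, Int.cast_one, mul_one, one_mul]
      exact koszulEquiv_dv α β b b')

/-- The rank-two part of the complex of a positive crossing. -/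
abbrev posTerm (v a : ℤ) (r s : Q) (hr : r ∈ 𝒜 2) (hs : s ∈ 𝒜 2) : FreeBicomplex 𝒜 :=
  twoTermOne v ![a, a + 4] ![a, a + 2] (r * s) s 1 r (by simpa using mul_mem_four hr hs)
    (by simpa using hs) (by simpa using SetLike.GradedOne.one_mem) (by simpa using hr) (by ring)

/-- The rank-two part of the complex of a negative crossing. -/
abbrev negTerm (r s : Q) (hr : r ∈ 𝒜 2) (hs : s ∈ 𝒜 2) : FreeBicomplex 𝒜 :=
  twoTermOne 0 ![0, 0 + 2] ![-2, -2 + 4] s (r * s) r 1 (by simpa using hs)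
    (by simpa using mul_mem_four hr hs) (by simpa using hr)
    (by simpa using SetLike.GradedOne.one_mem) (by ring)

lemma add_sub_sub_mem {ti tj tk tl : Q} (hi : ti ∈ 𝒜 2) (hj : tj ∈ 𝒜 2) (hk : tk ∈ 𝒜 2)
    (hl : tl ∈ 𝒜 2) : ti + tj - tk - tl ∈ 𝒜 2 := sub_mem (sub_mem (add_mem hi hj) hk) hl

section Crossing

variable {ti tj tk tl : Q} (hi : ti ∈ 𝒜 2) (hj : tj ∈ 𝒜 2) (hk : tk ∈ 𝒜 2) (hl : tl ∈ 𝒜 2)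

/-- With σ = t_i + t_j − t_k − t_l, r = t_j − t_l and s = t_k − t_j one has t_i t_j − t_k t_l = t_j
σ + rs, t_i − t_l = σ + s and t_j − t_k = −s. So both Koszul complexes can be rewritten with σ as
their first element. The four versions choose r and s adapted to the sign of the crossing and to the
side on which its inner flags lie. -/
lemma crossingPos_iso_right : Nonempty (Iso (crossingPos ti tj tk tl hi hj hk hl)
    ((koszulOne _ (add_sub_sub_mem hi hj hk hl)).tensor
      (posTerm (-1) 0 (tj - tl) (tk - tj) (sub_mem hj hl) (sub_mem hk hj)))) := by
  have h1 : (1 : Q) ∈ 𝒜 0 := SetLike.GradedOne.one_mem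
  have hr := sub_mem hj hl
  have hs := sub_mem hk hj
  refine ⟨Iso.trans ?_ (koszulSplit (-1) 0 0 4 2 (add_sub_sub_mem hi hj hk hl) (mul_mem_four hr hs) hs
    (by simpa using h1) (by simpa using hr) (by ring)).symm⟩
  -- The columns of the first and third matrix express the old Koszul generators by the new ones
  -- through the identities above; the second and fourth matrix are their inverses.
  refine Iso.twoTerm !![1, 0, 0, 0; 0, 1, tj, 0; 0, 0, 1, 0; 0, 0, 0, 1]
    !![1, 0, 0, 0; 0, 1, -tj, 0; 0, 0, 1, 0; 0, 0, 0, 1]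
    !![1, 0, 0, 0; 0, 1, 0, 0; 0, 1, -1, 0; 0, 0, 0, -1]
    !![1, 0, 0, 0; 0, 1, 0, 0; 0, 1, -1, 0; 0, 0, 0, -1] ?_ ?_ ?_ ?_ ?_ ?_ ?_ ?_ ?_ ?_ ?_ ?_ ?_
  all_goals first
    | (intro b b' h; fin_cases b <;> fin_cases b' <;> simp [koszulDeg] at h ⊢; done)
    | (intro b b'; fin_cases b <;> fin_cases b' <;> simp [h1, hi, hj, hk, hl]; done)
    | (ext b b'
       fin_cases b <;> fin_cases b' <;>
         simp [Matrix.mul_apply, Fin.sum_univ_four, koszulTwo, singDiff, smoothDiff, diagMap,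
           rhoPos, rhoNeg, Matrix.one_apply] <;> ring)

/-- With r = t_l − t_j and s = t_l − t_i the identities are t_i t_j − t_k t_l = t_l σ + rs, t_i −
t_l = −s and t_j − t_k = σ + s. -/
lemma crossingPos_iso_left : Nonempty (Iso (crossingPos ti tj tk tl hi hj hk hl)
    ((koszulOne _ (add_sub_sub_mem hi hj hk hl)).tensor
      (posTerm (-1) 0 (tl - tj) (tl - ti) (sub_mem hl hj) (sub_mem hl hi)))) := by
  have h1 : (1 : Q) ∈ 𝒜 0 := SetLike.GradedOne.one_mem
  have hr := sub_mem hl hj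
  have hs := sub_mem hl hi
  refine ⟨Iso.trans ?_ (koszulSplit (-1) 0 0 4 2 (add_sub_sub_mem hi hj hk hl) (mul_mem_four hr hs) hs
    (by simpa using h1) (by simpa using hr) (by ring)).symm⟩
  refine Iso.twoTerm !![1, 0, 0, 0; 0, 1, tl, 0; 0, 0, 1, 0; 0, 0, 0, 1]
    !![1, 0, 0, 0; 0, 1, -tl, 0; 0, 0, 1, 0; 0, 0, 0, 1]
    !![1, 0, 0, 0; 0, 0, 1, 0; 0, -1, 1, 0; 0, 0, 0, 1]
    !![1, 0, 0, 0; 0, 1, -1, 0; 0, 1, 0, 0; 0, 0, 0, 1] ?_ ?_ ?_ ?_ ?_ ?_ ?_ ?_ ?_ ?_ ?_ ?_ ?_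
  all_goals first
    | (intro b b' h; fin_cases b <;> fin_cases b' <;> simp [koszulDeg] at h ⊢; done)
    | (intro b b'; fin_cases b <;> fin_cases b' <;> simp [h1, hi, hj, hk, hl]; done)
    | (ext b b'
       fin_cases b <;> fin_cases b' <;>
         simp [Matrix.mul_apply, Fin.sum_univ_four, koszulTwo, singDiff, smoothDiff, diagMap,
           rhoPos, rhoNeg, Matrix.one_apply] <;> ring)

/-- With r = t_i − t_k and s = t_j − t_k the identities are t_i t_j − t_k t_l = t_k σ + rs and t_i −
t_l = σ − s. The vertical map is multiplication by r itself. -/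
lemma crossingNeg_iso_right : Nonempty (Iso (crossingNeg ti tj tk tl hi hj hk hl)
    ((koszulOne _ (add_sub_sub_mem hi hj hk hl)).tensor
      (negTerm (ti - tk) (tj - tk) (sub_mem hi hk) (sub_mem hj hk)))) := by
  have h1 : (1 : Q) ∈ 𝒜 0 := SetLike.GradedOne.one_mem
  have hr := sub_mem hi hk
  have hs := sub_mem hj hk
  refine ⟨Iso.trans ?_ (koszulSplit 0 0 (-2) 2 4 (add_sub_sub_mem hi hj hk hl) hs (mul_mem_four hr hs)
    (by simpa using hr) (by simpa using h1) (by ring)).symm⟩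
  refine Iso.twoTerm !![1, 0, 0, 0; 0, 1, 0, 0; 0, -1, 1, 0; 0, 0, 0, 1]
    !![1, 0, 0, 0; 0, 1, 0, 0; 0, 1, 1, 0; 0, 0, 0, 1]
    !![1, 0, 0, 0; 0, 1, tk, 0; 0, 0, 1, 0; 0, 0, 0, 1]
    !![1, 0, 0, 0; 0, 1, -tk, 0; 0, 0, 1, 0; 0, 0, 0, 1] ?_ ?_ ?_ ?_ ?_ ?_ ?_ ?_ ?_ ?_ ?_ ?_ ?_
  all_goals first
    | (intro b b' h; fin_cases b <;> fin_cases b' <;> simp [koszulDeg] at h ⊢; done)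
    | (intro b b'; fin_cases b <;> fin_cases b' <;> simp [h1, hi, hj, hk, hl]; done)
    | (ext b b'
       fin_cases b <;> fin_cases b' <;>
         simp [Matrix.mul_apply, Fin.sum_univ_four, koszulTwo, singDiff, smoothDiff, diagMap,
           rhoPos, rhoNeg, Matrix.one_apply] <;> ring)

/-- With r = t_k − t_i and s = t_i − t_l the identities are t_i t_j − t_k t_l = t_i σ + rs and t_j −
t_k = σ − s. -/
lemma crossingNeg_iso_left : Nonempty (Iso (crossingNeg ti tj tk tl hi hj hk hl)
    ((koszulOne _ (add_sub_sub_mem hi hj hk hl)).tensor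
      (negTerm (tk - ti) (ti - tl) (sub_mem hk hi) (sub_mem hi hl)))) := by
  have h1 : (1 : Q) ∈ 𝒜 0 := SetLike.GradedOne.one_mem
  have hr := sub_mem hk hi
  have hs := sub_mem hi hl
  refine ⟨Iso.trans ?_ (koszulSplit 0 0 (-2) 2 4 (add_sub_sub_mem hi hj hk hl) hs (mul_mem_four hr hs)
    (by simpa using hr) (by simpa using h1) (by ring)).symm⟩
  -- The vertical map is multiplication by t_i − t_k = −r; the minus signs on the diagonal of the
  -- third matrix absorb this sign.
  refine Iso.twoTerm !![1, 0, 0, 0; 0, 0, 1, 0; 0, 1, -1, 0; 0, 0, 0, -1]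
    !![1, 0, 0, 0; 0, 1, 1, 0; 0, 1, 0, 0; 0, 0, 0, -1]
    !![-1, 0, 0, 0; 0, -1, -ti, 0; 0, 0, -1, 0; 0, 0, 0, -1]
    !![-1, 0, 0, 0; 0, -1, ti, 0; 0, 0, -1, 0; 0, 0, 0, -1] ?_ ?_ ?_ ?_ ?_ ?_ ?_ ?_ ?_ ?_ ?_ ?_ ?_
  all_goals first
    | (intro b b' h; fin_cases b <;> fin_cases b' <;> simp [koszulDeg] at h ⊢; done)
    | (intro b b'; fin_cases b <;> fin_cases b' <;> simp [h1, hi, hj, hk, hl]; done)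
    | (ext b b'
       fin_cases b <;> fin_cases b' <;>
         simp [Matrix.mul_apply, Fin.sum_univ_four, koszulTwo, singDiff, smoothDiff, diagMap,
           rhoPos, rhoNeg, Matrix.one_apply] <;> ring)

end Crossing

end FreeBicomplex
end TripleLink

/-! ### Extension of scalars for the elementary complexes -/

namespace TripleLink
namespace FreeBicomplex

section BaseChange

variable {k Q Q' Q'' : Type u} [Field k] [CommRing Q] [Algebra k Q] [CommRing Q'] [Algebra k Q']
  [CommRing Q''] [Algebra k Q''] {𝒜 : ℤ → Submodule k Q} {ℬ : ℤ → Submodule k Q'}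
  {𝒞 : ℤ → Submodule k Q''} [SetLike.GradedMonoid 𝒜] [SetLike.GradedMonoid ℬ]
  [SetLike.GradedMonoid 𝒞]

/-- Extension of scalars in stages. -/
def baseChangeBaseChange (φ : Q →+* Q') (hφ : ∀ n a, a ∈ 𝒜 n → φ a ∈ ℬ n) (χ : Q' →+* Q'')
    (hχ : ∀ n a, a ∈ ℬ n → χ a ∈ 𝒞 n) (ψ : Q →+* Q'') (hψ : ∀ n a, a ∈ 𝒜 n → ψ a ∈ 𝒞 n)
    (h : ∀ x, χ (φ x) = ψ x) (P : FreeBicomplex 𝒜) :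
    Iso ((P.baseChange φ hφ).baseChange χ hχ) (P.baseChange ψ hψ) :=
  Iso.ofEquiv (Equiv.refl _) (fun _ => 1) (fun _ => rfl) (fun _ => rfl) (fun _ => rfl)
    (fun b b' => by
      rw [Units.val_one, Int.cast_one, one_mul, mul_one]
      exact (h _).symm)
    (fun b b' => by
      rw [Units.val_one, Int.cast_one, one_mul, mul_one]
      exact (h _).symm)

/-- Extension of scalars along the identity. -/
def baseChangeId (φ : Q →+* Q) (hφ : ∀ n a, a ∈ 𝒜 n → φ a ∈ 𝒜 n) (h : ∀ x, φ x = x)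
    (P : FreeBicomplex 𝒜) : Iso (P.baseChange φ hφ) P :=
  Iso.ofEquiv (Equiv.refl _) (fun _ => 1) (fun _ => rfl) (fun _ => rfl) (fun _ => rfl)
    (fun b b' => by
      rw [Units.val_one, Int.cast_one, one_mul, mul_one]
      exact (h _).symm)
    (fun b b' => by
      rw [Units.val_one, Int.cast_one, one_mul, mul_one]
      exact (h _).symm)

lemma fin_two_matrix_map (φ : Q →+* Q') (x y z t : Q) (b b' : Fin 2) :
    (!![φ x, φ y; φ z, φ t] : Matrix (Fin 2) (Fin 2) Q') b b' = φ (!![x, y; z, t] b b') := by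
  fin_cases b <;> fin_cases b' <;> rfl

/-- Extension of scalars for a Koszul complex. -/
def baseChangeKoszulOne (φ : Q →+* Q') (hφ : ∀ n a, a ∈ 𝒜 n → φ a ∈ ℬ n) (x : Q) (hx : x ∈ 𝒜 2)
    (y : Q') (hy : y ∈ ℬ 2) (h : φ x = y) :
    Iso ((koszulOne x hx).baseChange φ hφ) (koszulOne y hy) :=
  Iso.ofEquiv (Equiv.refl _) (fun _ => 1) (fun _ => rfl) (fun _ => rfl) (fun _ => rfl)
    (fun b b' => by
      subst h
      rw [Units.val_one, Int.cast_one, one_mul, mul_one]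
      refine Eq.trans ?_ (fin_two_matrix_map φ 0 x 0 0 b b')
      rw [map_zero]
      rfl)
    (fun b b' => by
      rw [Units.val_one, Int.cast_one, one_mul, mul_one]
      exact (map_zero φ).symm)

/-- Extension of scalars for a two-term complex of Koszul complexes. -/
def baseChangeTwoTermOne (φ : Q →+* Q') (hφ : ∀ n a, a ∈ 𝒜 n → φ a ∈ ℬ n) (v : ℤ)
    (w w' : Fin 2 → ℤ) {q q' α β : Q} {q₁ q₁' α₁ β₁ : Q'} (hq hq' hα hβ h hq₁ hq₁' hα₁ hβ₁ h₁)
    (eq : φ q = q₁) (eq' : φ q' = q₁') (eα : φ α = α₁) (eβ : φ β = β₁) :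
    Iso ((twoTermOne (𝒜 := 𝒜) v w w' q q' α β hq hq' hα hβ h).baseChange φ hφ)
      (twoTermOne (𝒜 := ℬ) v w w' q₁ q₁' α₁ β₁ hq₁ hq₁' hα₁ hβ₁ h₁) :=
  Iso.ofEquiv (Equiv.refl _) (fun _ => 1) (fun _ => rfl) (fun _ => rfl) (fun _ => rfl)
    (fun b b' => by
      subst eq eq'
      rw [Units.val_one, Int.cast_one, one_mul, mul_one]
      rcases b with b | b <;> rcases b' with b' | b'
      · refine Eq.trans ?_ (fin_two_matrix_map φ 0 q 0 0 b b')
        rw [map_zero]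
        rfl
      · exact (map_zero φ).symm
      · exact (map_zero φ).symm
      · refine Eq.trans ?_ (fin_two_matrix_map φ 0 q' 0 0 b b')
        rw [map_zero]
        rfl)
    (fun b b' => by
      subst eα eβ
      rw [Units.val_one, Int.cast_one, one_mul, mul_one]
      rcases b with b | b <;> rcases b' with b' | b'
      · exact (map_zero φ).symm
      · exact (map_zero φ).symm
      · refine Eq.trans ?_ (fin_two_matrix_map φ α 0 0 β b b')
        rw [map_zero]
        rfl
      · exact (map_zero φ).symm)

end BaseChange

end FreeBicomplex

/-! ### Graded presentations, and regularity modulo a homogeneous ideal -/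

section Presentation

variable {k : Type u} [Field k] {σ : Type}

attribute [local instance] MvPolynomial.weightedGradedAlgebra

/-- Write f = j + gℓ and replace g by its component of degree n − m. The difference becomes the
component of j of degree n, which stays in J because J is homogeneous. -/
lemma exists_homogeneous_of_mem_sup {J : Ideal (MvPolynomial σ k)}
    (hJ : J.IsHomogeneous (polyGr k σ)) {ℓ : MvPolynomial σ k} {m n : ℤ} (hℓ : ℓ ∈ polyGr k σ m)
    {f : MvPolynomial σ k} (hf : f ∈ polyGr k σ n) (h : f ∈ J ⊔ Ideal.span {ℓ}) :
    ∃ g ∈ polyGr k σ (n - m), f - ℓ * g ∈ J := by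
  obtain ⟨j, hj, y, hy, rfl⟩ := Submodule.mem_sup.1 h
  obtain ⟨g, rfl⟩ := Ideal.mem_span_singleton'.1 hy
  refine ⟨DirectSum.decompose (polyGr k σ) g (n - m), SetLike.coe_mem _, ?_⟩
  have h1 := DirectSum.coe_decompose_mul_add_of_left_mem (polyGr k σ) (b := g) (j := n - m) hℓ
  rw [add_sub_cancel] at h1
  have h2 := DirectSum.decompose_of_mem_same (polyGr k σ) hf
  rw [DirectSum.decompose_add, DirectSum.add_apply, Submodule.coe_add, mul_comm g ℓ, h1] at h2
  rw [mul_comm g ℓ, ← h2, add_sub_cancel_right]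
  exact hJ n hj

/-- A presentation of a graded ring as a quotient of a polynomial ring by a homogeneous ideal. -/
structure Presents {Q : Type u} [CommRing Q] [Algebra k Q] (𝒜 : ℤ → Submodule k Q)
    (π : MvPolynomial σ k →ₐ[k] Q) (J : Ideal (MvPolynomial σ k)) : Prop where
  surj : Function.Surjective π
  ker : RingHom.ker π = J
  gr : ∀ n, 𝒜 n = (polyGr k σ n).map π.toLinearMap
  homogeneous : J.IsHomogeneous (polyGr k σ)

namespace Presents

variable {Q Q' : Type u} [CommRing Q] [Algebra k Q] [CommRing Q'] [Algebra k Q']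
  {𝒜 : ℤ → Submodule k Q} {ℬ : ℤ → Submodule k Q'}
  {π : MvPolynomial σ k →ₐ[k] Q} {π' : MvPolynomial σ k →ₐ[k] Q'}
  {J J' : Ideal (MvPolynomial σ k)}

lemma map_eq_zero_iff (h : Presents 𝒜 π J) (f : MvPolynomial σ k) : π f = 0 ↔ f ∈ J := by
  rw [← h.ker, RingHom.mem_ker]

lemma mem (h : Presents 𝒜 π J) : ∀ (n : ℤ) (a : MvPolynomial σ k), a ∈ polyGr k σ n →
    π.toRingHom a ∈ 𝒜 n := fun n a ha => by
  rw [h.gr]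
  exact ⟨a, ha, rfl⟩

lemma exists_of_mem (h : Presents 𝒜 π J) {n : ℤ} {a : Q} (ha : a ∈ 𝒜 n) :
    ∃ f ∈ polyGr k σ n, π f = a := by
  rw [h.gr] at ha
  exact ha

lemma id : Presents (polyGr k σ) (AlgHom.id k _) ⊥ where
  surj := Function.surjective_id
  ker := (RingHom.injective_iff_ker_eq_bot _).1 Function.injective_id
  gr n := (Submodule.map_id _).symm
  homogeneous := Ideal.IsHomogeneous.bot _

lemma quotient (hJ : J.IsHomogeneous (polyGr k σ)) :
    Presents (quotGr k J) (Ideal.Quotient.mkₐ k J) J where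
  surj := Ideal.Quotient.mkₐ_surjective k J
  ker := Ideal.Quotient.mkₐ_ker k J
  gr _ := rfl
  homogeneous := hJ

/-- Regularity is required only as a statement about polynomials modulo J. Successive eliminations
thus pass between presented rings, and no quotient of a quotient is formed. -/
lemma isQuotientBy (h : Presents 𝒜 π J) (h' : Presents ℬ π' J') {ℓ : MvPolynomial σ k} {m : ℤ}
    (hℓ : ℓ ∈ polyGr k σ m) (hJ : J' = J ⊔ Ideal.span {ℓ}) (hnzd : ∀ g, ℓ * g ∈ J → g ∈ J) :
    ∃ χ : Q →ₐ[k] Q', (∀ f, χ (π f) = π' f) ∧ FreeBicomplex.IsQuotientBy 𝒜 ℬ χ (π ℓ) m := by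
  have hle : RingHom.ker π.toRingHom ≤ RingHom.ker π' := fun f hf => by
    rw [h'.ker, hJ]
    have hf : π f = 0 := hf
    exact le_sup_left (a := J) ((h.map_eq_zero_iff f).1 hf)
  let χ : Q →ₐ[k] Q' := AlgHom.liftOfSurjective π h.surj π' hle
  have hχ : ∀ f, χ (π f) = π' f := fun f => AlgHom.liftOfSurjective_apply π h.surj π' hle f
  refine ⟨χ, hχ, ?_, ?_, ?_, ?_, ?_, ?_⟩
  · intro n a ha
    obtain ⟨f, hf, rfl⟩ := h.exists_of_mem ha
    have : χ.toRingHom (π f) = π'.toRingHom f := hχ f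
    rw [this]
    exact h'.mem n f hf
  · intro n b hb
    obtain ⟨f, hf, rfl⟩ := h'.exists_of_mem hb
    exact ⟨π f, h.mem n f hf, hχ f⟩
  · exact h.mem m ℓ hℓ
  · rw [hχ, h'.map_eq_zero_iff, hJ]
    exact le_sup_right (a := J) (Ideal.mem_span_singleton_self ℓ)
  · intro n y hy hy0
    obtain ⟨f, hf, rfl⟩ := h.exists_of_mem hy
    rw [hχ, h'.map_eq_zero_iff, hJ] at hy0
    obtain ⟨g, hg, hgJ⟩ := exists_homogeneous_of_mem_sup h.homogeneous hℓ hf hy0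
    refine ⟨π g, h.mem _ g hg, ?_⟩
    rw [← map_mul, ← sub_eq_zero, ← map_sub]
    exact (h.map_eq_zero_iff _).2 hgJ
  · intro g hg
    obtain ⟨g, rfl⟩ := h.surj g
    rw [← map_mul, h.map_eq_zero_iff] at hg
    exact (h.map_eq_zero_iff _).2 (hnzd g hg)

variable [SetLike.GradedMonoid 𝒜] [SetLike.GradedMonoid ℬ]
  [HasDerivedCategory.{w} (ModuleCat.{u} k)]

open FreeBicomplex in
/-- Tensoring with the Koszul complex of `ℓ` amounts to reduction modulo `ℓ`. -/
lemma kdIso (h : Presents 𝒜 π J) (h' : Presents ℬ π' J') {ℓ : MvPolynomial σ k}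
    (hℓ : ℓ ∈ polyGr k σ 2) (hJ : J' = J ⊔ Ideal.span {ℓ}) (hnzd : ∀ g, ℓ * g ∈ J → g ∈ J)
    (P : FreeBicomplex (polyGr k σ)) (n : ℤ) :
    KDIso.{w} (((P.tensor (koszulOne ℓ hℓ)).baseChange π.toRingHom h.mem).toBicomplex n)
      ((P.baseChange π'.toRingHom h'.mem).toBicomplex n) := by
  obtain ⟨χ, hχ, hq⟩ := h.isQuotientBy h' hℓ hJ hnzd
  refine (FreeBicomplex.Iso.kdIso ((FreeBicomplex.Iso.baseChangeTensor π.toRingHom h.mem P (koszulOne ℓ hℓ)).trans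
    ((FreeBicomplex.Iso.refl _).tensor (baseChangeKoszulOne π.toRingHom h.mem ℓ hℓ _ hq.mem rfl))) n).trans ?_
  refine (kdIso_koszul hq (P.baseChange π.toRingHom h.mem) n).trans (FreeBicomplex.Iso.kdIso ?_ n)
  exact baseChangeBaseChange _ _ _ _ _ _ hχ P

end Presents

/-- An ideal is the kernel of a homomorphism that is injective modulo the ideal. -/
lemma ker_eq_of_section {Q : Type u} [CommRing Q] [Algebra k Q]
    {J : Ideal (MvPolynomial σ k)} (π : MvPolynomial σ k →ₐ[k] Q)
    (hJ : ∀ f ∈ J, π f = 0) (s : Q →ₐ[k] MvPolynomial σ k ⧸ J)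
    (hs : ∀ v, s (π (MvPolynomial.X v)) = Ideal.Quotient.mkₐ k J (MvPolynomial.X v)) :
    RingHom.ker π = J := by
  refine le_antisymm (fun f hf => ?_) fun f hf => hJ f hf
  have h1 : s.comp π = Ideal.Quotient.mkₐ k J := MvPolynomial.algHom_ext hs
  have h2 := DFunLike.congr_fun h1 f
  rw [AlgHom.comp_apply, (RingHom.mem_ker).1 hf, map_zero] at h2
  exact Ideal.Quotient.eq_zero_iff_mem.1 h2.symm

/-- If a substitution kills an ideal and is the identity modulo this ideal, then elements that are
not killed by the substitution are not zero divisors modulo the ideal. -/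
lemma mem_of_mul_mem_of_substitution {J : Ideal (MvPolynomial σ k)}
    (θ : MvPolynomial σ k →ₐ[k] MvPolynomial σ k) (hJ : ∀ f ∈ J, θ f = 0)
    (hθ : ∀ v, θ (MvPolynomial.X v) - MvPolynomial.X v ∈ J) {ℓ : MvPolynomial σ k} (hℓ : θ ℓ ≠ 0)
    (g : MvPolynomial σ k) (hg : ℓ * g ∈ J) : g ∈ J := by
  -- Since θ is the identity modulo J and kills J, its kernel is exactly J. Its target is a domain,
  -- so θ ℓ ≠ 0 can be cancelled.
  have hker := ker_eq_of_section θ hJ (Ideal.Quotient.mkₐ k J) fun v =>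
    (Ideal.Quotient.mk_eq_mk_iff_sub_mem _ _).2 (hθ v)
  have h1 := hJ _ hg
  rw [map_mul] at h1
  rw [← hker]
  exact (mul_eq_zero.1 h1).resolve_left hℓ

lemma isHomogeneous_span {s : Set (MvPolynomial σ k)} (hs : ∀ x ∈ s, ∃ n, x ∈ polyGr k σ n) :
    (Ideal.span s).IsHomogeneous (polyGr k σ) :=
  Ideal.homogeneous_span _ _ hs

/-- A homomorphism that sends all variables to elements of degree 2 preserves the degrees. -/
lemma aeval_mem {Q : Type u} [CommRing Q] [Algebra k Q] {𝒜 : ℤ → Submodule k Q}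
    [SetLike.GradedMonoid 𝒜] (π : MvPolynomial σ k →ₐ[k] Q)
    (hπ : ∀ v, π (MvPolynomial.X v) ∈ 𝒜 2) (n : ℤ) (f : MvPolynomial σ k)
    (hf : f ∈ polyGr k σ n) : π f ∈ 𝒜 n := by
  classical
  rw [f.as_sum, map_sum]
  refine Submodule.sum_mem _ fun d hd => ?_
  have hdn : Finsupp.weight (fun _ : σ => (2 : ℤ)) d = n := hf (MvPolynomial.mem_support_iff.1 hd)
  rw [MvPolynomial.monomial_eq, map_mul, ← MvPolynomial.algebraMap_eq, AlgHom.commutes,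
    ← Algebra.smul_def, Finsupp.prod, map_prod]
  refine Submodule.smul_mem _ _ ?_
  rw [← hdn, Finsupp.weight_apply, Finsupp.sum]
  refine SetLike.prod_mem_graded _ _ _ fun v _ => ?_
  rw [map_pow]
  exact SetLike.pow_mem_graded _ (hπ v)

end Presentation
end TripleLink

/-! ### The ring of the bigon modulo its linear relations -/

namespace TripleLink

section PolynomialGrading

variable {k R : Type u} [Field k] [CommRing R] [Algebra k R]

/-- The grading of the polynomial ring in one variable of degree 2 over a graded ring. -/
def polynomialGr (ℬ : ℤ → Submodule k R) (n : ℤ) : Submodule k (Polynomial R) where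
  carrier := {p | ∀ m : ℕ, p.coeff m ∈ ℬ (n - 2 * m)}
  zero_mem' m := by simp
  add_mem' {p q} hp hq m := by
    rw [Polynomial.coeff_add]
    exact add_mem (hp m) (hq m)
  smul_mem' c p hp m := by
    rw [Polynomial.coeff_smul]
    exact Submodule.smul_mem _ _ (hp m)

variable {ℬ : ℤ → Submodule k R}

lemma monomial_mem_polynomialGr {n : ℤ} {a : R} (m : ℕ) (ha : a ∈ ℬ (n - 2 * m)) :
    Polynomial.monomial m a ∈ polynomialGr ℬ n := fun m' => by
  rw [Polynomial.coeff_monomial]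
  split_ifs with h
  · rwa [← h]
  · exact Submodule.zero_mem _

lemma C_mem_polynomialGr {n : ℤ} {a : R} (ha : a ∈ ℬ n) :
    Polynomial.C a ∈ polynomialGr ℬ n :=
  monomial_mem_polynomialGr 0 (by simpa using ha)

variable [SetLike.GradedMonoid ℬ]

lemma X_mem_polynomialGr : (Polynomial.X : Polynomial R) ∈ polynomialGr ℬ 2 :=
  monomial_mem_polynomialGr 1 (by simpa using SetLike.GradedOne.one_mem)

instance : SetLike.GradedMonoid (polynomialGr ℬ) where
  one_mem := C_mem_polynomialGr SetLike.GradedOne.one_mem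
  mul_mem {n n' p q} hp hq m := by
    rw [Polynomial.coeff_mul]
    refine Submodule.sum_mem _ fun ij hij => ?_
    have := SetLike.GradedMul.mul_mem (hp ij.1) (hq ij.2)
    rwa [show n - 2 * (ij.1 : ℤ) + (n' - 2 * (ij.2 : ℤ)) = n + n' - 2 * (m : ℤ) by
      rw [← Finset.HasAntidiagonal.mem_antidiagonal.1 hij]; push_cast; ring] at this

end PolynomialGrading

namespace TangleDiagram

section Rings

variable (k : Type u) [Field k] (W : TangleDiagram 2) (s : Bool)

/-- The relation `c - d + b - a` between the ends of `W`. -/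
noncomputable def endRel : W.Ring k :=
  MvPolynomial.X (.start 0) - MvPolynomial.X (.finish 1) + MvPolynomial.X (.start 1) -
    MvPolynomial.X (.finish 0)

lemma endRel_mem : W.endRel k ∈ polyGr k W.Flags 2 :=
  sub_mem (add_mem (sub_mem (X_mem_polyGr k _) (X_mem_polyGr k _)) (X_mem_polyGr k _))
    (X_mem_polyGr k _)

/-- The ideal generated by the relation between the ends of `W`. -/
noncomputable def endIdeal : Ideal (W.Ring k) := Ideal.span {W.endRel k}

/-- The quotient of the ring of `W` by the relation between the ends. -/
abbrev EndRing : Type u := W.Ring k ⧸ W.endIdeal k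

/-- The element of `EndRing` given by a flag. -/
noncomputable def endVar (v : W.Flags) : W.EndRing k :=
  Ideal.Quotient.mkₐ k (W.endIdeal k) (MvPolynomial.X v)

lemma endVar_mem (v : W.Flags) : W.endVar k v ∈ quotGr k (W.endIdeal k) 2 :=
  Submodule.mem_map_of_mem (X_mem_polyGr k v)

lemma endVar_rel : W.endVar k (.start 0) - W.endVar k (.finish 1) + W.endVar k (.start 1) -
    W.endVar k (.finish 0) = 0 := by
  have : Ideal.Quotient.mkₐ k (W.endIdeal k) (W.endRel k) = 0 :=
    Ideal.Quotient.eq_zero_iff_mem.2 (Ideal.mem_span_singleton_self _)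
  simpa [endRel, endVar] using this

/-- The flag of `closeBigon` corresponding to a flag of `W`. -/
def bigonFlag : W.Flags → (W.closeBigon s).Flags
  | .outgoing x b => .outgoing (.inl x) b
  | .incoming x b => .incoming (.inl x) b
  | .mark m => .mark m
  | .start i => .outgoing (.inr (Equiv.swap 0 1 i)) (!s)
  | .finish i => .incoming (.inr i) (!s)

/-- The images of the flags of `closeBigon` in the polynomial ring over `EndRing`. -/
noncomputable def bigonVar : (W.closeBigon s).Flags → Polynomial (W.EndRing k)
  | .outgoing (.inl x) b => Polynomial.C (W.endVar k (.outgoing x b))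
  | .incoming (.inl x) b => Polynomial.C (W.endVar k (.incoming x b))
  | .mark m => Polynomial.C (W.endVar k (.mark m))
  -- X is the inner flag leaving the crossing 0, minus a. The linear relation of this crossing then
  -- forces its incoming inner flag to be X + b, and the two inner edges determine the inner flags
  -- of the crossing 1.
  | .outgoing (.inr i) b => if b = s then
      Polynomial.X + Polynomial.C (W.endVar k (![.finish 0, .start 1] i))
      else Polynomial.C (W.endVar k (.start (Equiv.swap 0 1 i)))
  | .incoming (.inr i) b => if b = s then
      Polynomial.X + Polynomial.C (W.endVar k (![.start 1, .finish 0] i))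
      else Polynomial.C (W.endVar k (.finish i))
  | .start i => i.elim0
  | .finish i => i.elim0

/-- The homomorphism from the ring of `closeBigon` to the polynomial ring over `EndRing`. -/
noncomputable def bigonHom : (W.closeBigon s).Ring k →ₐ[k] Polynomial (W.EndRing k) :=
  MvPolynomial.aeval (W.bigonVar k s)

lemma bigonHom_X (v : (W.closeBigon s).Flags) :
    W.bigonHom k s (MvPolynomial.X v) = W.bigonVar k s v := MvPolynomial.aeval_X _ _

lemma bigonHom_bigonFlag (v : W.Flags) :
    W.bigonVar k s (W.bigonFlag s v) = Polynomial.C (W.endVar k v) := by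
  rcases v with ⟨x, b⟩ | ⟨x, b⟩ | m | i | i
  · rfl
  · rfl
  · rfl
  · simp [bigonFlag, bigonVar]
  · simp [bigonFlag, bigonVar]

lemma bigonVar_mem (v : (W.closeBigon s).Flags) :
    W.bigonVar k s v ∈ polynomialGr (quotGr k (W.endIdeal k)) 2 := by
  rcases v with ⟨x | i, b⟩ | ⟨x | i, b⟩ | m | i | i
  · exact C_mem_polynomialGr (W.endVar_mem k _)
  · rw [bigonVar]
    split_ifs
    · exact add_mem X_mem_polynomialGr (C_mem_polynomialGr (W.endVar_mem k _))
    · exact C_mem_polynomialGr (W.endVar_mem k _)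
  · exact C_mem_polynomialGr (W.endVar_mem k _)
  · rw [bigonVar]
    split_ifs
    · exact add_mem X_mem_polynomialGr (C_mem_polynomialGr (W.endVar_mem k _))
    · exact C_mem_polynomialGr (W.endVar_mem k _)
  · exact C_mem_polynomialGr (W.endVar_mem k _)
  · exact i.elim0
  · exact i.elim0

/-- The relations between the flags of the bigon: the two inner edges and the linear relations of the
two crossings. -/
noncomputable def bigonRel : Fin 4 → (W.closeBigon s).Ring k :=
  ![MvPolynomial.X (.outgoing (.inr 0) s) - MvPolynomial.X (.incoming (.inr 1) s),
    MvPolynomial.X (.outgoing (.inr 1) s) - MvPolynomial.X (.incoming (.inr 0) s),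
    MvPolynomial.X (.outgoing (.inr 0) false) + MvPolynomial.X (.outgoing (.inr 0) true) -
      MvPolynomial.X (.incoming (.inr 0) true) - MvPolynomial.X (.incoming (.inr 0) false),
    MvPolynomial.X (.outgoing (.inr 1) false) + MvPolynomial.X (.outgoing (.inr 1) true) -
      MvPolynomial.X (.incoming (.inr 1) true) - MvPolynomial.X (.incoming (.inr 1) false)]

lemma bigonRel_mem (i : Fin 4) : W.bigonRel k s i ∈ polyGr k (W.closeBigon s).Flags 2 := by
  fin_cases i
  · exact sub_mem (X_mem_polyGr k _) (X_mem_polyGr k _)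
  · exact sub_mem (X_mem_polyGr k _) (X_mem_polyGr k _)
  · exact sub_mem (sub_mem (add_mem (X_mem_polyGr k _) (X_mem_polyGr k _)) (X_mem_polyGr k _))
      (X_mem_polyGr k _)
  · exact sub_mem (sub_mem (add_mem (X_mem_polyGr k _) (X_mem_polyGr k _)) (X_mem_polyGr k _))
      (X_mem_polyGr k _)

/-- The ideal generated by the first `m` relations between the flags of the bigon. -/
noncomputable def bigonIdeal (m : ℕ) : Ideal ((W.closeBigon s).Ring k) :=
  Ideal.span {f | ∃ i : Fin 4, i.1 < m ∧ W.bigonRel k s i = f}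

lemma bigonIdeal_zero : W.bigonIdeal k s 0 = ⊥ := by
  simp [bigonIdeal]

lemma bigonIdeal_succ (i : Fin 4) : W.bigonIdeal k s (i.1 + 1) =
    W.bigonIdeal k s i.1 ⊔ Ideal.span {W.bigonRel k s i} := by
  rw [bigonIdeal, bigonIdeal, ← Ideal.span_union]
  congr 1
  ext f
  simp only [Set.mem_ofPred_eq, Set.mem_union, Set.mem_singleton_iff]
  constructor
  · rintro ⟨j, hj, rfl⟩
    rcases Nat.lt_succ_iff_lt_or_eq.1 hj with h | h
    · exact Or.inl ⟨j, h, rfl⟩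
    · exact Or.inr (by rw [Fin.ext h])
  · rintro (⟨j, hj, rfl⟩ | rfl)
    · exact ⟨j, by lia, rfl⟩
    · exact ⟨i, by lia, rfl⟩

lemma bigonRel_mem_bigonIdeal {m : ℕ} (i : Fin 4) (hi : i.1 < m) :
    W.bigonRel k s i ∈ W.bigonIdeal k s m := Ideal.subset_span ⟨i, hi, rfl⟩

attribute [local instance] MvPolynomial.weightedGradedAlgebra

lemma bigonIdeal_homogeneous (m : ℕ) :
    (W.bigonIdeal k s m).IsHomogeneous (polyGr k (W.closeBigon s).Flags) :=
  isHomogeneous_span (by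
    rintro _ ⟨i, -, rfl⟩
    exact ⟨2, W.bigonRel_mem k s i⟩)

lemma bigonHom_eq_zero {f : (W.closeBigon s).Ring k} (hf : f ∈ W.bigonIdeal k s 4) :
    W.bigonHom k s f = 0 := by
  suffices W.bigonIdeal k s 4 ≤ RingHom.ker (W.bigonHom k s) from this hf
  refine Ideal.span_le.2 ?_
  rintro _ ⟨i, -, rfl⟩
  refine RingHom.mem_ker.2 ?_
  have h := W.endVar_rel k
  have h' : Polynomial.C (W.endVar k (.start 0)) - Polynomial.C (W.endVar k (.finish 1)) +
      Polynomial.C (W.endVar k (.start 1)) - Polynomial.C (W.endVar k (.finish 0)) = 0 := by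
    rw [← map_sub, ← map_add, ← map_sub, h, map_zero]
  fin_cases i <;> cases s <;>
    simp [bigonRel, bigonHom_X, bigonVar] <;> first | linear_combination h' | ring

/-- In the sum of the linear relations of both crossings, the inner flags cancel by the relations of
the inner edges. What remains is the relation between the four ends. -/
lemma rename_endRel : MvPolynomial.rename (W.bigonFlag s) (W.endRel k) ∈ W.bigonIdeal k s 4 := by
  have h : MvPolynomial.rename (W.bigonFlag s) (W.endRel k) =
      W.bigonRel k s 2 + W.bigonRel k s 3 - W.bigonRel k s 0 - W.bigonRel k s 1 := by
    cases s <;> simp [endRel, bigonFlag, bigonRel] <;> ring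
  have h (i : Fin 4) : W.bigonRel k s i ∈ W.bigonIdeal k s 4 :=
    W.bigonRel_mem_bigonIdeal k s i i.2
  rw [‹MvPolynomial.rename _ _ = _›]
  exact sub_mem (sub_mem (add_mem (h 2) (h 3)) (h 0)) (h 1)

/-- The homomorphism from `EndRing` to the ring of `closeBigon` modulo the relations. -/
noncomputable def endSection : W.EndRing k →ₐ[k]
    (W.closeBigon s).Ring k ⧸ W.bigonIdeal k s 4 :=
  Ideal.Quotient.liftₐ (W.endIdeal k)
    ((Ideal.Quotient.mkₐ k (W.bigonIdeal k s 4)).comp (MvPolynomial.rename (W.bigonFlag s)))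
    (fun f hf => by
      suffices W.endIdeal k ≤ RingHom.ker ((Ideal.Quotient.mkₐ k (W.bigonIdeal k s 4)).comp
        (MvPolynomial.rename (W.bigonFlag s))) from this hf
      exact (Ideal.span_singleton_le_iff_mem _).2
        (Ideal.Quotient.eq_zero_iff_mem.2 (W.rename_endRel k s)))

lemma endSection_endVar (v : W.Flags) : W.endSection k s (W.endVar k v) =
    Ideal.Quotient.mkₐ k (W.bigonIdeal k s 4) (MvPolynomial.X (W.bigonFlag s v)) := by
  refine Eq.trans ?_ (congrArg (Ideal.Quotient.mkₐ k (W.bigonIdeal k s 4))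
    (MvPolynomial.rename_X (R := k) (W.bigonFlag s) v))
  rfl

/-- The inverse of `bigonHom` modulo the relations. -/
noncomputable def bigonSection : Polynomial (W.EndRing k) →ₐ[k]
    (W.closeBigon s).Ring k ⧸ W.bigonIdeal k s 4 :=
  Polynomial.aevalTower (W.endSection k s)
    (Ideal.Quotient.mkₐ k _ (MvPolynomial.X (.outgoing (.inr 0) s) -
      MvPolynomial.X (.incoming (.inr 0) (!s))))

lemma bigonSection_bigonVar (v : (W.closeBigon s).Flags) :
    W.bigonSection k s (W.bigonVar k s v) =
      Ideal.Quotient.mkₐ k (W.bigonIdeal k s 4) (MvPolynomial.X v) := by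
  have hX : W.bigonSection k s Polynomial.X = _ := Polynomial.aevalTower_X _ _
  have hC (v : W.Flags) : W.bigonSection k s (Polynomial.C (W.endVar k v)) = _ :=
    (Polynomial.aevalTower_C _ _ _).trans (W.endSection_endVar k s v)
  have h (i : Fin 4) : W.bigonRel k s i ∈ W.bigonIdeal k s 4 :=
    W.bigonRel_mem_bigonIdeal k s i i.2
  -- For the inner flags the claim amounts to writing a linear form as a combination of the four
  -- relations; the combinations are given case by case below.
  have hXC (v : W.Flags) {v' : (W.closeBigon s).Flags} (h : MvPolynomial.X (.outgoing (.inr 0) s) -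
      MvPolynomial.X (.incoming (.inr 0) (!s)) + MvPolynomial.X (W.bigonFlag s v) -
        MvPolynomial.X v' ∈ W.bigonIdeal k s 4) :
      W.bigonSection k s (Polynomial.X + Polynomial.C (W.endVar k v)) =
        Ideal.Quotient.mkₐ k (W.bigonIdeal k s 4) (MvPolynomial.X v') := by
    rw [map_add, hX, hC, ← map_add]
    exact (Ideal.Quotient.mk_eq_mk_iff_sub_mem _ _).2 h
  have hin (v : W.Flags) : W.bigonSection k s (W.bigonVar k s (W.bigonFlag s v)) =
      Ideal.Quotient.mkₐ k (W.bigonIdeal k s 4) (MvPolynomial.X (W.bigonFlag s v)) := by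
    rw [bigonHom_bigonFlag, hC]
  rcases v with ⟨x | i, b⟩ | ⟨x | i, b⟩ | m | i | i
  · exact hin (.outgoing x b)
  · by_cases hb : b = s
    · subst hb
      rw [bigonVar, if_pos rfl]
      refine hXC _ ?_
      fin_cases i
      · convert Submodule.zero_mem (W.bigonIdeal k b 4) using 1
        simp [bigonFlag]
      · convert sub_mem (h 2) (h 1) using 1
        cases b <;> simp [bigonFlag, bigonRel] <;> ring
    · obtain rfl : b = !s := by cases b <;> cases s <;> simp_all
      have := hin (.start (Equiv.swap 0 1 i))
      rwa [bigonFlag, Equiv.swap_apply_self] at this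
  · exact hin (.incoming x b)
  · by_cases hb : b = s
    · subst hb
      rw [bigonVar, if_pos rfl]
      refine hXC _ ?_
      fin_cases i
      · convert h 2 using 1
        cases b <;> simp [bigonFlag, bigonRel] <;> ring
      · convert h 0 using 1
        cases b <;> simp [bigonFlag, bigonRel]
    · obtain rfl : b = !s := by cases b <;> cases s <;> simp_all
      exact hin (.finish i)
  · exact hin (.mark m)
  · exact i.elim0
  · exact i.elim0

lemma ker_bigonHom : RingHom.ker (W.bigonHom k s) = W.bigonIdeal k s 4 :=
  ker_eq_of_section (Q := Polynomial (W.EndRing k)) (W.bigonHom k s)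
    (fun _ hf => W.bigonHom_eq_zero k s hf) (W.bigonSection k s) fun v => by
    rw [bigonHom_X, bigonSection_bigonVar]

lemma bigonHom_rename (f : W.Ring k) : W.bigonHom k s (MvPolynomial.rename (W.bigonFlag s) f) =
    Polynomial.C (Ideal.Quotient.mkₐ k (W.endIdeal k) f) := by
  have : (W.bigonHom k s).comp (MvPolynomial.rename (W.bigonFlag s)) =
      Polynomial.CAlgHom.comp (Ideal.Quotient.mkₐ k (W.endIdeal k)) :=
    MvPolynomial.algHom_ext fun v => by
      rw [AlgHom.comp_apply, MvPolynomial.rename_X, bigonHom_X, bigonHom_bigonFlag]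
      rfl
  exact DFunLike.congr_fun this f

/-- The coefficients lift to homogeneous polynomials in the flags of W and X lifts to a difference
of two flags of degree 2, so the lift can be taken in the same degree. -/
lemma exists_bigonHom_eq (n : ℤ) (p : Polynomial (W.EndRing k))
    (hp : p ∈ polynomialGr (quotGr k (W.endIdeal k)) n) :
    ∃ f ∈ polyGr k (W.closeBigon s).Flags n, W.bigonHom k s f = p := by
  choose g hg hgp using hp
  let X₀ : (W.closeBigon s).Ring k := MvPolynomial.X (.outgoing (.inr 0) s) -
      MvPolynomial.X (.incoming (.inr 0) (!s))
  have hX₀ : X₀ ∈ polyGr k (W.closeBigon s).Flags 2 :=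
    sub_mem (X_mem_polyGr k _) (X_mem_polyGr k _)
  have hX : W.bigonHom k s X₀ = Polynomial.X := by
    simp [X₀, bigonHom_X, bigonVar]
  refine ⟨∑ m ∈ p.support, MvPolynomial.rename (W.bigonFlag s) (g m) * X₀ ^ m,
    Submodule.sum_mem _ fun m _ => ?_, ?_⟩
  · have h1 := SetLike.GradedMul.mul_mem (aeval_mem (MvPolynomial.rename (W.bigonFlag s))
      (fun v => by rw [MvPolynomial.rename_X]; exact X_mem_polyGr k _) _ _ (hg m))
      (SetLike.pow_mem_graded m hX₀)
    rwa [show n - 2 * (m : ℤ) + m • 2 = n by rw [nsmul_eq_mul]; ring] at h1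
  · conv_rhs => rw [p.as_sum_support_C_mul_X_pow]
    rw [map_sum]
    refine Finset.sum_congr rfl fun m _ => ?_
    rw [map_mul, map_pow, hX, bigonHom_rename]
    congr 2
    exact hgp m

/-- The four relations eliminate every flag of the bigon except one inner flag, and they impose c −
d + b − a = 0 on the ends: the quotient is a polynomial ring in one variable over `EndRing`. -/
lemma presents_bigonHom : Presents (polynomialGr (quotGr k (W.endIdeal k))) (W.bigonHom k s)
    (W.bigonIdeal k s 4) where
  surj p := by
    induction p using Polynomial.induction_on' with
    | add p q hp hq =>
      obtain ⟨f, rfl⟩ := hp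
      obtain ⟨g, rfl⟩ := hq
      exact ⟨f + g, map_add _ _ _⟩
    | monomial m a =>
      obtain ⟨g, rfl⟩ := Ideal.Quotient.mkₐ_surjective k (W.endIdeal k) a
      refine ⟨MvPolynomial.rename (W.bigonFlag s) g * (MvPolynomial.X (.outgoing (.inr 0) s) -
        MvPolynomial.X (.incoming (.inr 0) (!s))) ^ m, ?_⟩
      rw [map_mul, map_pow, bigonHom_rename, ← Polynomial.C_mul_X_pow_eq_monomial]
      simp [bigonHom_X, bigonVar]
  ker := W.ker_bigonHom k s
  gr n := by
    refine le_antisymm (fun p hp => W.exists_bigonHom_eq k s n p hp) ?_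
    rintro _ ⟨f, hf, rfl⟩
    exact aeval_mem (Q := Polynomial (W.EndRing k)) (W.bigonHom k s) (fun v => by
      rw [bigonHom_X]
      exact W.bigonVar_mem k s v) n f hf
  homogeneous := W.bigonIdeal_homogeneous k s 4

end Rings

end TangleDiagram

end TripleLink

/-! ### The four relations form a regular sequence -/

namespace TripleLink
namespace TangleDiagram

variable (k : Type u) [Field k] (W : TangleDiagram 2) (s : Bool)

/-- The substitution that eliminates the first `m` relations between the flags of the bigon. -/
noncomputable def bigonSubst (m : ℕ) : (W.closeBigon s).Ring k →ₐ[k] (W.closeBigon s).Ring k :=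
  MvPolynomial.aeval fun v => match v with
    | .outgoing (.inr i) b =>
      if i = 0 ∧ b = s ∧ 1 ≤ m then MvPolynomial.X (.incoming (.inr 1) s) else
      if i = 1 ∧ b = s ∧ 2 ≤ m then MvPolynomial.X (.incoming (.inr 0) s) else
        MvPolynomial.X (.outgoing (.inr i) b)
    | .incoming (.inr i) b =>
      if i = 0 ∧ b = (!s) ∧ 3 ≤ m then MvPolynomial.X (.outgoing (.inr 0) (!s)) +
        MvPolynomial.X (.incoming (.inr 1) s) - MvPolynomial.X (.incoming (.inr 0) s) else
        MvPolynomial.X (.incoming (.inr i) b)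
    | v => MvPolynomial.X v

lemma bigonSubst_bigonRel (m i : Fin 4) (h : i < m) :
    W.bigonSubst k s m (W.bigonRel k s i) = 0 := by
  fin_cases m <;> fin_cases i <;> cases s <;> simp at h <;>
    simp [bigonSubst, bigonRel] <;> ring

/-- The flag that is set to 1 occurs in the relation `m`, survives the first `m` substitutions and
does not cancel; so the value at this point is nonzero. -/
lemma bigonSubst_bigonRel_ne_zero (m : Fin 4) : W.bigonSubst k s m (W.bigonRel k s m) ≠ 0 := by
  intro h
  have h1 := congrArg (MvPolynomial.eval (fun v : (W.closeBigon s).Flags => match v with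
    | .outgoing (.inr j) b =>
      if j = ![0, 1, 0, 1] m ∧ b = ![s, s, !s, !s] m then (1 : k) else 0
    | _ => 0)) h
  fin_cases m <;> cases s <;> simp [bigonSubst, bigonRel] at h1

lemma bigonSubst_sub_mem (m : Fin 4) (v : (W.closeBigon s).Flags) :
    W.bigonSubst k s m (MvPolynomial.X v) - MvPolynomial.X v ∈ W.bigonIdeal k s m := by
  rw [bigonSubst, MvPolynomial.aeval_X]
  have h (i : Fin 4) (hi : i < m) : W.bigonRel k s i ∈ W.bigonIdeal k s m :=
    W.bigonRel_mem_bigonIdeal k s i hi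
  have h0 (f : (W.closeBigon s).Ring k) : f - f ∈ W.bigonIdeal k s m := by
    rw [sub_self]
    exact Submodule.zero_mem _
  rcases v with ⟨x | i, b⟩ | ⟨x | i, b⟩ | m | i | i
  · exact h0 _
  · dsimp only
    split_ifs with h1 h2
    · obtain ⟨rfl, rfl, h3⟩ := h1
      have := neg_mem (h 0 h3)
      rwa [bigonRel, Matrix.cons_val_zero, neg_sub] at this
    · obtain ⟨rfl, rfl, h3⟩ := h2
      have := neg_mem (h 1 h3)
      rwa [bigonRel, Matrix.cons_val_one, Matrix.cons_val_zero, neg_sub] at this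
    · exact h0 _
  · exact h0 _
  · dsimp only
    split_ifs with h1
    · obtain ⟨rfl, rfl, h3⟩ := h1
      -- The third substitution is written with the first one already applied to it, hence the
      -- correction by the relation 0.
      have := sub_mem (h 2 h3) (h 0 (Nat.lt_of_lt_of_le (by norm_num) h3))
      convert this using 1
      cases s <;> simp [bigonRel] <;> ring
    · exact h0 _
  · exact h0 _
  · exact h0 _
  · exact h0 _

/-- `bigonSubst` embeds the quotient by the first `m` relations into a domain, where the next
relation does not vanish. -/
lemma mem_bigonIdeal_of_mul_mem (m : Fin 4) (g : (W.closeBigon s).Ring k)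
    (hg : W.bigonRel k s m * g ∈ W.bigonIdeal k s m) : g ∈ W.bigonIdeal k s m := by
  refine mem_of_mul_mem_of_substitution (W.bigonSubst k s m) (fun f hf => ?_)
    (W.bigonSubst_sub_mem k s m) (W.bigonSubst_bigonRel_ne_zero k s m) g hg
  suffices W.bigonIdeal k s m ≤ RingHom.ker (W.bigonSubst k s m) from this hf
  refine Ideal.span_le.2 ?_
  rintro _ ⟨i, hi, rfl⟩
  exact W.bigonSubst_bigonRel k s m i hi

open FreeBicomplex

variable [HasDerivedCategory.{w} (ModuleCat.{u} k)]

/-- The Koszul complexes of the relations between the flags of the bigon can be eliminated. -/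
lemma kdIso_bigonHom (P : FreeBicomplex (polyGr k (W.closeBigon s).Flags)) (n : ℤ) :
    KDIso.{w} (((((P.tensor (koszulOne _ (W.bigonRel_mem k s 3))).tensor
        (koszulOne _ (W.bigonRel_mem k s 2))).tensor (koszulOne _ (W.bigonRel_mem k s 1))).tensor
          (koszulOne _ (W.bigonRel_mem k s 0))).toBicomplex n)
      ((P.baseChange (Q' := Polynomial (W.EndRing k)) (W.bigonHom k s).toRingHom (W.presents_bigonHom k s).mem).toBicomplex n) := by
  have h0 := Presents.id (k := k) (σ := (W.closeBigon s).Flags)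
  rw [← W.bigonIdeal_zero k s] at h0
  have hq (m : ℕ) := Presents.quotient (W.bigonIdeal_homogeneous k s m)
  have nzd := W.mem_bigonIdeal_of_mul_mem k s
  refine (FreeBicomplex.Iso.kdIso (baseChangeId _ h0.mem (fun _ => rfl) _).symm n).trans ?_
  refine (h0.kdIso (hq 1) (W.bigonRel_mem k s 0) (W.bigonIdeal_succ k s 0) (nzd 0) _ n).trans ?_
  refine ((hq 1).kdIso (hq 2) (W.bigonRel_mem k s 1) (W.bigonIdeal_succ k s 1) (nzd 1) _ n).trans ?_
  refine ((hq 2).kdIso (hq 3) (W.bigonRel_mem k s 2) (W.bigonIdeal_succ k s 2) (nzd 2) _ n).trans ?_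
  exact (hq 3).kdIso (W.presents_bigonHom k s) (W.bigonRel_mem k s 3) (W.bigonIdeal_succ k s 3)
    (nzd 3) _ n

end TangleDiagram
end TripleLink

/-! ### Comparing the complexes of both closures with the complex of W -/

namespace TripleLink
namespace FreeBicomplex

section

variable {k Q Q' : Type u} [Field k] [CommRing Q] [Algebra k Q] [CommRing Q'] [Algebra k Q']
  {𝒜 : ℤ → Submodule k Q} {ℬ : ℤ → Submodule k Q'}
  [SetLike.GradedMonoid 𝒜] [SetLike.GradedMonoid ℬ]

lemma map_koszulTwo (φ : Q →+* Q') (x y : Q) :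
    (koszulTwo x y).map φ = koszulTwo (φ x) (φ y) := by
  ext b b'
  fin_cases b <;> fin_cases b' <;> simp [koszulTwo]

lemma map_rhoPos (φ : Q →+* Q') (x y : Q) : (rhoPos x y).map φ = rhoPos (φ x) (φ y) := by
  ext b b'
  fin_cases b <;> fin_cases b' <;> simp [rhoPos]

lemma map_rhoNeg (φ : Q →+* Q') (x y : Q) : (rhoNeg x y).map φ = rhoNeg (φ x) (φ y) := by
  ext b b'
  fin_cases b <;> fin_cases b' <;> simp [rhoNeg]

/-- An isomorphism of bicomplexes with the same bases and degrees and with equal matrices. -/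
def Iso.ofEq {B : Type} [Fintype B] [DecidableEq B] (hdeg vdeg pdeg : B → ℤ)
    {dh dv dh' dv' : Matrix B B Q} (h₁ h₂ h₃ h₄ h₅ h₆ h₇) (h₁' h₂' h₃' h₄' h₅' h₆' h₇')
    (h : dh = dh') (v : dv = dv') :
    Iso (⟨B, hdeg, vdeg, pdeg, dh, dv, h₁, h₂, h₃, h₄, h₅, h₆, h₇⟩ : FreeBicomplex 𝒜)
      ⟨B, hdeg, vdeg, pdeg, dh', dv', h₁', h₂', h₃', h₄', h₅', h₆', h₇'⟩ := by
  subst h v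
  exact Iso.refl _

variable (φ : Q →+* Q') (hφ : ∀ n a, a ∈ 𝒜 n → φ a ∈ ℬ n) {ti tj tk tl : Q} (hi : ti ∈ 𝒜 2)
  (hj : tj ∈ 𝒜 2) (hk : tk ∈ 𝒜 2) (hl : tl ∈ 𝒜 2)

/-- Extension of scalars for the complex of a positive crossing. -/
def baseChangeCrossingPos : Iso ((crossingPos ti tj tk tl hi hj hk hl).baseChange φ hφ)
    (crossingPos (φ ti) (φ tj) (φ tk) (φ tl) (hφ _ _ hi) (hφ _ _ hj) (hφ _ _ hk) (hφ _ _ hl)) := by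
  refine Iso.ofEq _ _ _ _ _ _ _ _ _ _ _ _ _ _ _ _ _ ?_ ?_
  · refine (Matrix.fromBlocks_map _ _ _ _ φ).trans ?_
    rw [singDiff, smoothDiff, map_koszulTwo, map_koszulTwo, Matrix.map_zero _ (map_zero φ)]
    simp [singDiff, smoothDiff]
  · refine (Matrix.fromBlocks_map _ _ _ _ φ).trans ?_
    rw [map_rhoPos, Matrix.map_zero _ (map_zero φ)]

/-- Extension of scalars for the complex of a negative crossing. -/
def baseChangeCrossingNeg : Iso ((crossingNeg ti tj tk tl hi hj hk hl).baseChange φ hφ)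
    (crossingNeg (φ ti) (φ tj) (φ tk) (φ tl) (hφ _ _ hi) (hφ _ _ hj) (hφ _ _ hk) (hφ _ _ hl)) := by
  refine Iso.ofEq _ _ _ _ _ _ _ _ _ _ _ _ _ _ _ _ _ ?_ ?_
  · refine (Matrix.fromBlocks_map _ _ _ _ φ).trans ?_
    rw [singDiff, smoothDiff, map_koszulTwo, map_koszulTwo, Matrix.map_zero _ (map_zero φ)]
    simp [singDiff, smoothDiff]
  · refine (Matrix.fromBlocks_map _ _ _ _ φ).trans ?_
    rw [map_rhoNeg, Matrix.map_zero _ (map_zero φ)]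

lemma crossingPos_congr {ti' tj' tk' tl' : Q} (hi' hj' hk' hl') (h1 : ti = ti') (h2 : tj = tj')
    (h3 : tk = tk') (h4 : tl = tl') :
    crossingPos ti tj tk tl hi hj hk hl = crossingPos ti' tj' tk' tl' hi' hj' hk' hl' := by
  subst h1 h2 h3 h4
  rfl

lemma crossingNeg_congr {ti' tj' tk' tl' : Q} (hi' hj' hk' hl') (h1 : ti = ti') (h2 : tj = tj')
    (h3 : tk = tk') (h4 : tl = tl') :
    crossingNeg ti tj tk tl hi hj hk hl = crossingNeg ti' tj' tk' tl' hi' hj' hk' hl' := by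
  subst h1 h2 h3 h4
  rfl

lemma koszulOne_congr {x y : Q} (hx : x ∈ 𝒜 2) (hy : y ∈ 𝒜 2) (h : x = y) :
    koszulOne x hx = koszulOne y hy := by
  subst h
  rfl

/-- The last two factors of a tensor product can be interchanged. -/
def Iso.tensorRightComm (P R T : FreeBicomplex 𝒜) :
    Iso ((P.tensor R).tensor T) ((P.tensor T).tensor R) :=
  ((assoc P R T).trans ((refl P).tensor (comm R T))).trans (assoc P T R).symm

lemma tensorList_concat (l : List (FreeBicomplex 𝒜)) (P : FreeBicomplex 𝒜) :
    Nonempty (Iso (tensorList (l ++ [P])) ((tensorList l).tensor P)) := by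
  obtain ⟨e⟩ := Iso.tensorList_append l [P]
  exact ⟨e.trans ((Iso.refl _).tensor (Iso.tensorUnit P))⟩

end

end FreeBicomplex

namespace TangleDiagram

open FreeBicomplex

variable (k : Type u) [Field k]

/-- Together with `mem_edges`, this reduces a comparison of edge lists up to permutation to a
bijection between the edges. -/
lemma edges_nodup {p : ℕ} (D : TangleDiagram p) : D.edges.Nodup := by
  refine List.Nodup.append (List.Nodup.append ?_ ?_ ?_) ?_ ?_
  · exact (D.xs_nodup.product (by decide)).map Sum.inl_injective
  · exact D.ms_nodup.map (Sum.inr_injective.comp Sum.inl_injective)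
  · intro a h1 h2
    simp only [List.mem_map] at h1 h2
    obtain ⟨x, -, rfl⟩ := h1
    obtain ⟨y, -, hy⟩ := h2
    simp at hy
  · exact (List.nodup_finRange p).map (Sum.inr_injective.comp Sum.inr_injective)
  · intro a h1 h2
    simp only [List.mem_append, List.mem_map] at h1 h2
    obtain ⟨y, -, rfl⟩ := h2
    simp at h1

lemma mem_edges {p : ℕ} (D : TangleDiagram p) (e) : e ∈ D.edges := by
  rcases e with ⟨x, b⟩ | m | i
  · simp [edges, D.mem_xs]
  · simp [edges, D.mem_ms]
  · simp [edges]

section Rename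

variable {p q : ℕ} (W : TangleDiagram p) (D : TangleDiagram q) (g : W.Flags → D.Flags)

lemma rename_mem : ∀ (n : ℤ) (f : W.Ring k), f ∈ polyGr k W.Flags n →
    (MvPolynomial.rename g : W.Ring k →ₐ[k] D.Ring k).toRingHom f ∈ polyGr k D.Flags n :=
  fun n f hf => aeval_mem (MvPolynomial.rename g : W.Ring k →ₐ[k] D.Ring k)
    (fun v => by rw [MvPolynomial.rename_X]; exact X_mem_polyGr k _) n f hf

lemma rename_edgeComplex (e : (W.X × Bool) ⊕ (W.M ⊕ Fin p)) (e' : (D.X × Bool) ⊕ (D.M ⊕ Fin q))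
    (h1 : D.startFlag e' = g (W.startFlag e))
    (h2 : D.finishFlag (D.next e') = g (W.finishFlag (W.next e))) :
    Nonempty (FreeBicomplex.Iso ((W.edgeComplex k e).baseChange _ (W.rename_mem k D g))
      (D.edgeComplex k e')) := by
  refine ⟨baseChangeKoszulOne _ _ _ _ _ _ ?_⟩
  rw [h1, h2, map_sub]
  exact congrArg₂ _ (MvPolynomial.rename_X g _) (MvPolynomial.rename_X g _)

lemma rename_crossingComplex (x : W.X) (x' : D.X) (h : D.pos x' = W.pos x)
    (h1 : ∀ b, g (.outgoing x b) = .outgoing x' b) (h2 : ∀ b, g (.incoming x b) = .incoming x' b) :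
    Nonempty (FreeBicomplex.Iso ((W.crossingComplex k x).baseChange _ (W.rename_mem k D g))
      (D.crossingComplex k x')) := by
  have h3 (b : Bool) : (MvPolynomial.rename g : W.Ring k →ₐ[k] D.Ring k).toRingHom
      (MvPolynomial.X (.outgoing x b)) = MvPolynomial.X (.outgoing x' b) :=
    (MvPolynomial.rename_X g _).trans (congrArg _ (h1 b))
  have h4 (b : Bool) : (MvPolynomial.rename g : W.Ring k →ₐ[k] D.Ring k).toRingHom
      (MvPolynomial.X (.incoming x b)) = MvPolynomial.X (.incoming x' b) :=
    (MvPolynomial.rename_X g _).trans (congrArg _ (h2 b))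
  rw [crossingComplex, crossingComplex, h]
  split_ifs with h0
  · refine ⟨(baseChangeCrossingPos _ _ _ _ _ _).trans ?_⟩
    rw [crossingPos_congr _ _ _ _ (X_mem_polyGr k _) (X_mem_polyGr k _) (X_mem_polyGr k _)
      (X_mem_polyGr k _) (h3 false) (h3 true) (h4 true) (h4 false)]
    exact FreeBicomplex.Iso.refl _
  · refine ⟨(baseChangeCrossingNeg _ _ _ _ _ _).trans ?_⟩
    rw [crossingNeg_congr _ _ _ _ (X_mem_polyGr k _) (X_mem_polyGr k _) (X_mem_polyGr k _)
      (X_mem_polyGr k _) (h3 false) (h3 true) (h4 true) (h4 false)]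
    exact FreeBicomplex.Iso.refl _

/-- The bicomplex of a diagram that is embedded into another one. -/
lemma rename_KR (e : (W.X × Bool) ⊕ (W.M ⊕ Fin p) → (D.X × Bool) ⊕ (D.M ⊕ Fin q)) (c : W.X → D.X)
    (he : ∀ x, D.startFlag (e x) = g (W.startFlag x))
    (he' : ∀ x, D.finishFlag (D.next (e x)) = g (W.finishFlag (W.next x)))
    (hc : ∀ x, D.pos (c x) = W.pos x)
    (hc1 : ∀ x b, g (.outgoing x b) = .outgoing (c x) b)
    (hc2 : ∀ x b, g (.incoming x b) = .incoming (c x) b) :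
    Nonempty (FreeBicomplex.Iso ((W.KR k).baseChange _ (W.rename_mem k D g))
      (tensorList ((W.edges.map e).map (D.edgeComplex k) ++
        (W.xs.map c).map (D.crossingComplex k)))) := by
  obtain ⟨e1⟩ := FreeBicomplex.Iso.baseChange_tensorList _ (W.rename_mem k D g)
    (W.edges.map (W.edgeComplex k) ++ W.xs.map (W.crossingComplex k))
  refine ⟨e1.trans (Nonempty.some ?_)⟩
  rw [List.map_append, List.map_map, List.map_map, List.map_map, List.map_map]
  obtain ⟨e2⟩ := FreeBicomplex.Iso.tensorList_congr W.edges _ (D.edgeComplex k ∘ e) fun x =>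
    W.rename_edgeComplex k D g x (e x) (he x) (he' x)
  obtain ⟨e3⟩ := FreeBicomplex.Iso.tensorList_congr W.xs _ (D.crossingComplex k ∘ c) fun x =>
    W.rename_crossingComplex k D g x (c x) (hc x) (hc1 x) (hc2 x)
  obtain ⟨e4⟩ := FreeBicomplex.Iso.tensorList_append
    (W.edges.map ((fun P => P.baseChange _ (W.rename_mem k D g)) ∘ W.edgeComplex k))
    (W.xs.map ((fun P => P.baseChange _ (W.rename_mem k D g)) ∘ W.crossingComplex k))
  obtain ⟨e5⟩ := FreeBicomplex.Iso.tensorList_append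
    (W.edges.map (D.edgeComplex k ∘ e)) (W.xs.map (D.crossingComplex k ∘ c))
  exact ⟨e4.trans ((e2.tensor e3).trans e5.symm)⟩

end Rename

variable (W : TangleDiagram 2) (s : Bool)

/-- The flag of `closeTrivial` corresponding to a flag of `W`. -/
def trivialFlag : W.Flags → W.closeTrivial.Flags
  | .outgoing x b => .outgoing x b
  | .incoming x b => .incoming x b
  | .mark m => .mark (.inl m)
  | .start i => .mark (.inr i)
  | .finish i => .mark (.inr i)

/-- The edge of `closeTrivial` corresponding to an edge of `W`. -/
def trivialEdge : (W.X × Bool) ⊕ (W.M ⊕ Fin 2) ≃ (W.X × Bool) ⊕ ((W.M ⊕ Fin 2) ⊕ Fin 0) :=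
  (Equiv.sumCongr (Equiv.refl _) (Equiv.sumEmpty _ (Fin 0))).symm

lemma finishFlag_trivialEdge (x : (W.X × Bool) ⊕ (W.M ⊕ Fin 2)) :
    W.closeTrivial.finishFlag (W.trivialEdge x) = W.trivialFlag (W.finishFlag x) := by
  rcases x with ⟨x, b⟩ | m | i <;> rfl

lemma closeTrivial_next_trivialEdge (x : (W.X × Bool) ⊕ (W.M ⊕ Fin 2)) :
    W.closeTrivial.next (W.trivialEdge x) = W.trivialEdge (W.next x) := by
  change W.trivialEdge (W.next (W.trivialEdge.symm (W.trivialEdge x))) = _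
  rw [Equiv.symm_apply_apply]

lemma edges_perm_trivialEdge : (W.edges.map W.trivialEdge).Perm W.closeTrivial.edges :=
  (List.perm_ext_iff_of_nodup (W.edges_nodup.map W.trivialEdge.injective)
    W.closeTrivial.edges_nodup).2 fun e => by
      refine iff_of_true (List.mem_map.2 ⟨W.trivialEdge.symm e, W.mem_edges _, ?_⟩)
        (mem_edges _ _)
      rw [Equiv.apply_symm_apply]

/-- The mark on each strand takes the place of both of its ends, so the closure has the same edges
as W. Only the variables change: t_a and t_c are identified, and likewise t_b and t_d. -/
lemma closeTrivial_KR : Nonempty (FreeBicomplex.Iso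
    ((W.KR k).baseChange _ (W.rename_mem k W.closeTrivial W.trivialFlag))
    (W.closeTrivial.KR k)) := by
  obtain ⟨e1⟩ := W.rename_KR k W.closeTrivial W.trivialFlag W.trivialEdge id
    (fun x => by rcases x with ⟨x, b⟩ | m | i <;> rfl)
    (fun x => by rw [closeTrivial_next_trivialEdge, finishFlag_trivialEdge])
    (fun _ => rfl) (fun _ _ => rfl) (fun _ _ => rfl)
  refine ⟨e1.trans (Nonempty.some (FreeBicomplex.Iso.tensorList_perm (List.Perm.append
    (W.edges_perm_trivialEdge.map _) ?_)))⟩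
  exact List.Perm.of_eq (congrArg (List.map _) (List.map_id W.xs))

/-- The edge of `closeBigon` corresponding to an edge of `W`. -/
def bigonEdge (e : (W.X × Bool) ⊕ (W.M ⊕ Fin 2)) : ((W.X ⊕ Fin 2) × Bool) ⊕ (W.M ⊕ Fin 0) :=
  (bigonEquiv W.X W.M s (Equiv.swap 0 1)).symm (.inl e)

lemma finishFlag_bigonEquiv (x : (W.X × Bool) ⊕ (W.M ⊕ Fin 2)) :
    (W.closeBigon s).finishFlag ((bigonEquiv W.X W.M s (Equiv.refl _)).symm (.inl x)) =
      W.bigonFlag s (W.finishFlag x) := by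
  rcases x with ⟨x, b⟩ | m | i <;> rfl

lemma startFlag_bigonEdge (x : (W.X × Bool) ⊕ (W.M ⊕ Fin 2)) :
    (W.closeBigon s).startFlag (W.bigonEdge s x) = W.bigonFlag s (W.startFlag x) := by
  rcases x with ⟨x, b⟩ | m | i <;> rfl

lemma closeBigon_next_bigonEdge (x : (W.X × Bool) ⊕ (W.M ⊕ Fin 2)) :
    (W.closeBigon s).next (W.bigonEdge s x) =
      (bigonEquiv W.X W.M s (Equiv.refl _)).symm (.inl (W.next x)) := by
  change (bigonEquiv W.X W.M s (Equiv.refl _)).symm (Equiv.sumCongr W.next (Equiv.swap 0 1)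
    ((bigonEquiv W.X W.M s (Equiv.swap 0 1)) ((bigonEquiv W.X W.M s (Equiv.swap 0 1)).symm _))) = _
  rw [Equiv.apply_symm_apply]
  rfl

lemma closeBigon_next_inner (i : Fin 2) :
    (W.closeBigon s).next (.inl (.inr i, s)) = .inl (.inr (Equiv.swap 0 1 i), s) := by
  change (bigonEquiv W.X W.M s (Equiv.refl _)).symm (Equiv.sumCongr W.next (Equiv.swap 0 1)
    ((bigonEquiv W.X W.M s (Equiv.swap 0 1)) ((bigonEquiv W.X W.M s (Equiv.swap 0 1)).symm
      (.inr i)))) = _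
  rw [Equiv.apply_symm_apply]
  rfl

lemma edges_perm_bigonEdge : (W.edges.map (W.bigonEdge s) ++
    [Sum.inl (Sum.inr 1, s), Sum.inl (Sum.inr 0, s)]).Perm (W.closeBigon s).edges := by
  have h (i : Fin 2) : (.inl (.inr i, s) : ((W.X ⊕ Fin 2) × Bool) ⊕ (W.M ⊕ Fin 0)) =
    (bigonEquiv W.X W.M s (Equiv.swap 0 1)).symm (.inr i) := rfl
  have hinj : Function.Injective (W.bigonEdge s) := (Equiv.injective _).comp Sum.inl_injective
  refine (List.perm_ext_iff_of_nodup (List.Nodup.append (W.edges_nodup.map hinj) ?_ ?_)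
    (W.closeBigon s).edges_nodup).2 fun e => iff_of_true ?_ ((W.closeBigon s).mem_edges e)
  · simp
  · intro a h1 h2
    obtain ⟨x, -, rfl⟩ := List.mem_map.1 h1
    rw [h, h, List.mem_cons, List.mem_singleton, bigonEdge] at h2
    rcases h2 with h2 | h2 <;> exact Sum.inl_ne_inr ((Equiv.injective _) h2)
  · obtain ⟨x, rfl⟩ := (bigonEquiv W.X W.M s (Equiv.swap 0 1)).symm.surjective e
    refine List.mem_append.2 ?_
    rcases x with x | i
    · exact Or.inl (List.mem_map.2 ⟨x, W.mem_edges x, rfl⟩)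
    · refine Or.inr ?_
      rw [← h]
      fin_cases i <;> simp

lemma perm_append_pairs {α : Type*} (l l' : List α) (a b c d : α) :
    (l ++ l' ++ [a] ++ [b] ++ [c] ++ [d]).Perm (l ++ [c, d] ++ (l' ++ [a, b])) := by
  simp only [List.append_assoc]
  refine List.Perm.append_left _ ?_
  refine (?_ : (l' ++ ([a, b] ++ [c, d])).Perm _)
  rw [← List.append_assoc]
  exact List.perm_append_comm

/-- The four outer pieces of the strands are no new edges: they are the edges of W at its ends,
which are renamed as outer flags of the two new crossings. Only the crossings and the two inner
edges are added to W. -/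
lemma closeBigon_KR : Nonempty (FreeBicomplex.Iso ((W.closeBigon s).KR k)
    ((((((W.KR k).baseChange _ (W.rename_mem k (W.closeBigon s) (W.bigonFlag s))).tensor
      ((W.closeBigon s).crossingComplex k (.inr 0))).tensor
        ((W.closeBigon s).crossingComplex k (.inr 1))).tensor
          (koszulOne _ (W.bigonRel_mem k s 1))).tensor (koszulOne _ (W.bigonRel_mem k s 0)))) := by
  obtain ⟨e1⟩ := W.rename_KR k (W.closeBigon s) (W.bigonFlag s) (W.bigonEdge s) Sum.inl
    (W.startFlag_bigonEdge s)
    (fun x => by rw [closeBigon_next_bigonEdge, finishFlag_bigonEquiv])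
    (fun _ => rfl) (fun _ _ => rfl) (fun _ _ => rfl)
  have h0 : (W.closeBigon s).edgeComplex k (.inl (.inr 0, s)) =
      koszulOne _ (W.bigonRel_mem k s 0) := by
    refine koszulOne_congr _ _ ?_
    rw [closeBigon_next_inner]
    rfl
  have h1 : (W.closeBigon s).edgeComplex k (.inl (.inr 1, s)) =
      koszulOne _ (W.bigonRel_mem k s 1) := by
    refine koszulOne_congr _ _ ?_
    rw [closeBigon_next_inner]
    rfl
  set E := (W.edges.map (W.bigonEdge s)).map ((W.closeBigon s).edgeComplex k) with hE
  set Y := (W.xs.map Sum.inl).map ((W.closeBigon s).crossingComplex k) with hY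
  set c := (W.closeBigon s).crossingComplex k with hc
  obtain ⟨e2⟩ := tensorList_concat (E ++ Y) (c (.inr 0))
  obtain ⟨e3⟩ := tensorList_concat (E ++ Y ++ [c (.inr 0)]) (c (.inr 1))
  obtain ⟨e4⟩ := tensorList_concat (E ++ Y ++ [c (.inr 0)] ++ [c (.inr 1)])
    (koszulOne _ (W.bigonRel_mem k s 1))
  obtain ⟨e5⟩ := tensorList_concat (E ++ Y ++ [c (.inr 0)] ++ [c (.inr 1)] ++
    [koszulOne _ (W.bigonRel_mem k s 1)]) (koszulOne _ (W.bigonRel_mem k s 0))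
  -- The Koszul complexes of the inner edges come last, ready to be eliminated.
  have hperm : (E ++ Y ++ [c (.inr 0)] ++ [c (.inr 1)] ++ [koszulOne _ (W.bigonRel_mem k s 1)] ++
      [koszulOne _ (W.bigonRel_mem k s 0)]).Perm
      ((W.closeBigon s).edges.map ((W.closeBigon s).edgeComplex k) ++
        (W.closeBigon s).xs.map c) := by
    refine List.Perm.trans ?_ (((W.edges_perm_bigonEdge s).map _).append_right _)
    have h2 : (W.closeBigon s).xs.map c = Y ++ [c (.inr 0), c (.inr 1)] := by
      exact List.map_append (f := c) (l₁ := W.xs.map Sum.inl)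
        (l₂ := (List.finRange 2).map Sum.inr)
    have h3 : (W.edges.map (W.bigonEdge s) ++ [Sum.inl (Sum.inr 1, s), Sum.inl (Sum.inr 0, s)]).map
        ((W.closeBigon s).edgeComplex k) = E ++ [koszulOne _ (W.bigonRel_mem k s 1),
          koszulOne _ (W.bigonRel_mem k s 0)] :=
      (List.map_append (f := (W.closeBigon s).edgeComplex k) (l₁ := W.edges.map (W.bigonEdge s))
        (l₂ := [Sum.inl (Sum.inr 1, s), Sum.inl (Sum.inr 0, s)])).trans
          (congrArg (E ++ ·) (congrArg₂ (fun x y => [x, y]) h1 h0))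
    exact (perm_append_pairs E Y _ _ _ _).trans (List.Perm.of_eq (congrArg₂ (· ++ ·) h3 h2).symm)
  obtain ⟨e6⟩ := FreeBicomplex.Iso.tensorList_perm hperm
  exact ⟨e6.symm.trans (e5.trans ((e4.trans ((e3.trans ((e2.trans (e1.symm.tensor
    (FreeBicomplex.Iso.refl _))).tensor (FreeBicomplex.Iso.refl _))).tensor
      (FreeBicomplex.Iso.refl _))).tensor (FreeBicomplex.Iso.refl _)))⟩

end TangleDiagram
end TripleLink

/-! ### Reducing the bigon to two complexes of rank two -/

namespace TripleLink
namespace TangleDiagram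

open FreeBicomplex

variable (k : Type u) [Field k] (W : TangleDiagram 2) (s : Bool)

/-- The bicomplex of `W` over `EndRing`. -/
noncomputable def endKR : FreeBicomplex (quotGr k (W.endIdeal k)) :=
  (W.KR k).baseChange (Ideal.Quotient.mkₐ k (W.endIdeal k)).toRingHom
    fun _ _ ha => Submodule.mem_map_of_mem ha

/-- The difference `b - a` in `EndRing`. -/
noncomputable def endU : W.EndRing k := W.endVar k (.start 1) - W.endVar k (.finish 0)

/-- The difference `c - a` in `EndRing`. -/
noncomputable def endZ : W.EndRing k := W.endVar k (.start 0) - W.endVar k (.finish 0)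

lemma endU_mem : W.endU k ∈ quotGr k (W.endIdeal k) 2 :=
  sub_mem (W.endVar_mem k _) (W.endVar_mem k _)

lemma endZ_mem : W.endZ k ∈ quotGr k (W.endIdeal k) 2 :=
  sub_mem (W.endVar_mem k _) (W.endVar_mem k _)

/-- The splitting is chosen according to the side `s`, so that r becomes X and t becomes b − a in
both cases. From here on, together with `crossingComplex_one_iso`, the side of the bigon plays no
role. -/
lemma crossingComplex_zero_iso : ∃ (r t : (W.closeBigon s).Ring k)
    (hr : r ∈ polyGr k (W.closeBigon s).Flags 2) (ht : t ∈ polyGr k (W.closeBigon s).Flags 2),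
    Nonempty (FreeBicomplex.Iso ((W.closeBigon s).crossingComplex k (.inr 0))
      ((koszulOne _ (W.bigonRel_mem k s 2)).tensor (posTerm (-1) 0 r t hr ht))) ∧
    W.bigonHom k s r = Polynomial.X ∧ W.bigonHom k s t = Polynomial.C (W.endU k) := by
  have h : (W.closeBigon s).crossingComplex k (.inr 0) = crossingPos _ _ _ _ _ _ _ _ := if_pos rfl
  have hX (v : (W.closeBigon s).Flags) := X_mem_polyGr k v
  rw [h]
  cases s
  · refine ⟨_, _, sub_mem (hX (.incoming (.inr 0) false)) (hX (.outgoing (.inr 0) true)),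
      sub_mem (hX (.incoming (.inr 0) false)) (hX (.outgoing (.inr 0) false)),
      crossingPos_iso_left _ _ (hX (.incoming (.inr 0) true)) _, ?_⟩
    simp [bigonHom_X, bigonVar, endU]
  · refine ⟨_, _, sub_mem (hX (.outgoing (.inr 0) true)) (hX (.incoming (.inr 0) false)),
      sub_mem (hX (.incoming (.inr 0) true)) (hX (.outgoing (.inr 0) true)),
      crossingPos_iso_right (hX (.outgoing (.inr 0) false)) _ _ _, ?_⟩
    simp [bigonHom_X, bigonVar, endU]

lemma crossingComplex_one_iso : ∃ (r t : (W.closeBigon s).Ring k)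
    (hr : r ∈ polyGr k (W.closeBigon s).Flags 2) (ht : t ∈ polyGr k (W.closeBigon s).Flags 2),
    Nonempty (FreeBicomplex.Iso ((W.closeBigon s).crossingComplex k (.inr 1))
      ((koszulOne _ (W.bigonRel_mem k s 3)).tensor (negTerm r t hr ht))) ∧
    W.bigonHom k s r = Polynomial.C (W.endZ k) - Polynomial.X ∧
      W.bigonHom k s t = Polynomial.C (W.endU k) := by
  have h : (W.closeBigon s).crossingComplex k (.inr 1) = crossingNeg _ _ _ _ _ _ _ _ :=
    if_neg Bool.false_ne_true
  have hX (v : (W.closeBigon s).Flags) := X_mem_polyGr k v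
  rw [h]
  cases s
  · refine ⟨_, _, sub_mem (hX (.incoming (.inr 1) true)) (hX (.outgoing (.inr 1) false)),
      sub_mem (hX (.outgoing (.inr 1) false)) (hX (.incoming (.inr 1) false)),
      crossingNeg_iso_left _ (hX (.outgoing (.inr 1) true)) _ _, ?_⟩
    -- On this side r becomes d − b − X, which equals c − a − X only by the relation between the
    -- ends.
    have h' : Polynomial.C (W.endVar k (.start 0)) - Polynomial.C (W.endVar k (.finish 1)) +
        Polynomial.C (W.endVar k (.start 1)) - Polynomial.C (W.endVar k (.finish 0)) = 0 := by
      rw [← map_sub, ← map_add, ← map_sub, W.endVar_rel k, map_zero]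
    simp only [map_sub, bigonHom_X, bigonVar, endU, endZ]
    simp
    linear_combination -h'
  · refine ⟨_, _, sub_mem (hX (.outgoing (.inr 1) false)) (hX (.incoming (.inr 1) true)),
      sub_mem (hX (.outgoing (.inr 1) true)) (hX (.incoming (.inr 1) true)),
      crossingNeg_iso_right _ _ _ (hX (.incoming (.inr 1) false)), ?_⟩
    simp [bigonHom_X, bigonVar, endU, endZ]
    ring

/-- The bicomplex of `W` over the polynomial ring over `EndRing`. -/
noncomputable def polyKR : FreeBicomplex (polynomialGr (quotGr k (W.endIdeal k))) :=
  (W.endKR k).baseChange Polynomial.C fun _ _ => C_mem_polynomialGr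

lemma C_endZ_sub_X_mem : Polynomial.C (W.endZ k) - Polynomial.X ∈
    polynomialGr (quotGr k (W.endIdeal k)) 2 :=
  sub_mem (C_mem_polynomialGr (W.endZ_mem k)) X_mem_polynomialGr

variable [HasDerivedCategory.{w} (ModuleCat.{u} k)]

/-- Elimination of the inner edges and of the linear relations of the crossings. -/
lemma closeBigon_kdIso (n : ℤ) : KDIso.{w} (((W.closeBigon s).KR k).toBicomplex n)
    ((((W.polyKR k).tensor (posTerm (-1) 0 Polynomial.X (Polynomial.C (W.endU k))
      X_mem_polynomialGr (C_mem_polynomialGr (W.endU_mem k)))).tensor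
        (negTerm (Polynomial.C (W.endZ k) - Polynomial.X) (Polynomial.C (W.endU k))
          (W.C_endZ_sub_X_mem k) (C_mem_polynomialGr (W.endU_mem k)))).toBicomplex n) := by
  obtain ⟨e⟩ := W.closeBigon_KR k s
  obtain ⟨r, t, hr, ht, ⟨e0⟩, hr', ht'⟩ := W.crossingComplex_zero_iso k s
  obtain ⟨r₁, t₁, hr₁, ht₁, ⟨e1⟩, hr₁', ht₁'⟩ := W.crossingComplex_one_iso k s
  set P := (W.KR k).baseChange _ (W.rename_mem k (W.closeBigon s) (W.bigonFlag s))
  -- The Koszul factors of the two linear relations are moved to the end, to match the order of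
  -- elimination in `kdIso_bigonHom`.
  have f0 : FreeBicomplex.Iso (P.tensor ((W.closeBigon s).crossingComplex k (.inr 0)))
      ((P.tensor (posTerm (-1) 0 r t hr ht)).tensor (koszulOne _ (W.bigonRel_mem k s 2))) :=
    ((FreeBicomplex.Iso.refl P).tensor (e0.trans (FreeBicomplex.Iso.comm _ _))).trans
      (FreeBicomplex.Iso.assoc _ _ _).symm
  have f1 : FreeBicomplex.Iso ((P.tensor (posTerm (-1) 0 r t hr ht)).tensor
      ((W.closeBigon s).crossingComplex k (.inr 1)))
      (((P.tensor (posTerm (-1) 0 r t hr ht)).tensor (negTerm r₁ t₁ hr₁ ht₁)).tensor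
        (koszulOne _ (W.bigonRel_mem k s 3))) :=
    ((FreeBicomplex.Iso.refl _).tensor (e1.trans (FreeBicomplex.Iso.comm _ _))).trans
      (FreeBicomplex.Iso.assoc _ _ _).symm
  have f2 := (f0.tensor (FreeBicomplex.Iso.refl
    ((W.closeBigon s).crossingComplex k (.inr 1)))).trans
      ((FreeBicomplex.Iso.tensorRightComm _ _ _).trans
        (f1.tensor (FreeBicomplex.Iso.refl (koszulOne _ (W.bigonRel_mem k s 2)))))
  refine (FreeBicomplex.Iso.kdIso (e.trans ((f2.tensor (FreeBicomplex.Iso.refl _)).tensor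
    (FreeBicomplex.Iso.refl _))) n).trans ?_
  refine (W.kdIso_bigonHom k s _ n).trans (FreeBicomplex.Iso.kdIso ?_ n)
  have hm := (W.presents_bigonHom k s).mem
  refine (FreeBicomplex.Iso.baseChangeTensor (Q' := Polynomial (W.EndRing k)) _ hm _ _).trans
    (FreeBicomplex.Iso.tensor ?_ ?_)
  · refine (FreeBicomplex.Iso.baseChangeTensor (Q' := Polynomial (W.EndRing k)) _ hm _ _).trans
      (FreeBicomplex.Iso.tensor ?_ ?_)
    · refine (baseChangeBaseChange (Q'' := Polynomial (W.EndRing k)) _ _ _ _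
        ((Polynomial.C : W.EndRing k →+* Polynomial (W.EndRing k)).comp
          (Ideal.Quotient.mkₐ k (W.endIdeal k)).toRingHom)
        (fun n a ha => C_mem_polynomialGr (Submodule.mem_map_of_mem ha))
        (W.bigonHom_rename k s) (W.KR k)).trans ?_
      exact (baseChangeBaseChange (Q'' := Polynomial (W.EndRing k)) _ _ _ _ _ _
        (fun _ => rfl) (W.KR k)).symm
    · refine baseChangeTwoTermOne (Q' := Polynomial (W.EndRing k)) _ _ _ _ _ _ _ _ _ _ _ _ _ _ _
        ?_ ht' (map_one _) hr'
      exact (map_mul (W.bigonHom k s) r t).trans (congrArg₂ _ hr' ht')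
  · refine baseChangeTwoTermOne (Q' := Polynomial (W.EndRing k)) _ _ _ _ _ _ _ _ _ _ _ _ _ _ _
        ht₁' ?_ hr₁' (map_one _)
    exact (map_mul (W.bigonHom k s) r₁ t₁).trans (congrArg₂ _ hr₁' ht₁')

end TangleDiagram
end TripleLink

/-! ### Tensoring a vertical deformation retract with a bicomplex -/

namespace TripleLink
namespace FreeBicomplex

variable {k R Q Q' : Type u} [Field k] [CommRing R] [Algebra k R] [CommRing Q] [Algebra k Q]
  [CommRing Q'] [Algebra k Q'] {ℛ : ℤ → Submodule k R} {𝒜 : ℤ → Submodule k Q}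
  {ℬ : ℤ → Submodule k Q'}

/-- Homogeneity in a tensor product can be tested separately for each basis element of P, with
degrees shifted by those of this element. -/
lemma mem_tensor_piece (P T : FreeBicomplex 𝒜) (f : P.B × T.B → Q) (n j i : ℤ) :
    f ∈ (P.tensor T).piece n j i ↔ ∀ b, (fun c => f (b, c)) ∈
      T.piece (n - P.pdeg b) (j - P.vdeg b) (i - P.hdeg b) := by
  have h (b : P.B) (c : T.B) : (f (b, c) ∈ 𝒜 (n - (P.pdeg b + T.pdeg c)) ∧
      (f (b, c) ≠ 0 → P.vdeg b + T.vdeg c = j ∧ P.hdeg b + T.hdeg c = i)) ↔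
      (f (b, c) ∈ 𝒜 (n - P.pdeg b - T.pdeg c) ∧
      (f (b, c) ≠ 0 → T.vdeg c = j - P.vdeg b ∧ T.hdeg c = i - P.hdeg b)) := by
    rw [sub_sub, eq_sub_iff_add_eq', eq_sub_iff_add_eq']
  exact ⟨fun hf b c => (h b c).1 (hf (b, c)), fun hf bc => (h bc.1 bc.2).2 (hf bc.1 bc.2)⟩

lemma sgn_mul_mem_piece (P : FreeBicomplex 𝒜) {n j i : ℤ} (m : ℤ) {f : P.B → Q}
    (hf : f ∈ P.piece n j i) : (fun b => ((m.negOnePow : ℤ) : Q) * f b) ∈ P.piece n j i :=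
  fun b => ⟨sgn_mul_mem _ _ (hf b).1, fun h => (hf b).2 (sgn_mul_ne_zero h)⟩

/-- L acts on one tensor factor and is linear over R, while the entries of M come from R and act on
the other factor. -/
lemma slice_mulVec {A B B' : Type} [Fintype A] (φ : R →+* Q) (φ' : R →+* Q')
    (L : (B → Q) →ₗ[k] (B' → Q'))
    (hL : ∀ r f, L (fun c => φ r * f c) = fun c => φ' r * L f c) (M : Matrix A A R)
    (f : A → B → Q) (b : A) : L (fun c => (M.map φ).mulVec (fun a => f a c) b) =
      fun c => (M.map φ').mulVec (fun a => L (f a) c) b := by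
  have h : (fun c => (M.map φ).mulVec (fun a => f a c) b) = ∑ a, fun c => φ (M b a) * f a c := by
    ext c
    rw [Finset.sum_apply]
    rfl
  rw [h, map_sum]
  ext c
  rw [Finset.sum_apply]
  simp only [hL]
  rfl

lemma slice_sgn {B B' : Type} (φ : R →+* Q) (φ' : R →+* Q') (L : (B → Q) →ₗ[k] (B' → Q'))
    (hL : ∀ r f, L (fun c => φ r * f c) = fun c => φ' r * L f c) (m : ℤ) (f : B → Q) :
    L (fun c => ((m.negOnePow : ℤ) : Q) * f c) = fun c => ((m.negOnePow : ℤ) : Q') * L f c := by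
  have := hL (((m.negOnePow : ℤ) : R)) f
  rwa [map_intCast, map_intCast] at this

section Slice

variable [SetLike.GradedMonoid ℛ] [SetLike.GradedMonoid 𝒜] [SetLike.GradedMonoid ℬ]
  (P : FreeBicomplex ℛ) (T : FreeBicomplex 𝒜) (N : FreeBicomplex ℬ)
  (φ : R →+* Q) (hφ : ∀ n a, a ∈ ℛ n → φ a ∈ 𝒜 n)
  (φ' : R →+* Q') (hφ' : ∀ n a, a ∈ ℛ n → φ' a ∈ ℬ n)

/-- The extension of a linear map to the tensor product with the identity. -/
def sliceMap (L : (T.B → Q) →ₗ[k] (N.B → Q')) : (P.B × T.B → Q) →ₗ[k] (P.B × N.B → Q') where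
  toFun f p := L (fun c => f (p.1, c)) p.2
  map_add' f g := funext fun p => congrFun (map_add L (fun c => f (p.1, c)) fun c => g (p.1, c)) p.2
  map_smul' r f := funext fun p => congrFun (map_smul L r fun c => f (p.1, c)) p.2

/-- The tensor product of a bicomplex with a morphism. -/
def sliceHom (L : (T.B → Q) →ₗ[k] (N.B → Q'))
    (hL : ∀ r f, L (fun c => φ r * f c) = fun c => φ' r * L f c)
    (hmem : ∀ n j i, ∀ f ∈ T.piece n j i, L f ∈ N.piece n j i)
    (hdh : ∀ f, L (T.dh.mulVec f) = N.dh.mulVec (L f))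
    (hdv : ∀ f, L (T.dv.mulVec f) = N.dv.mulVec (L f)) (n : ℤ) :
    (((P.baseChange φ hφ).tensor T).toBigraded n).Hom
      (((P.baseChange φ' hφ').tensor N).toBigraded n) where
  f := sliceMap P T N L
  mem {j i f} hf := (mem_tensor_piece _ _ _ _ _ _).2 fun b =>
    hmem _ _ _ _ ((mem_tensor_piece (P.baseChange φ hφ) T f n j i).1 hf b)
  dh (f : P.B × T.B → Q) := funext fun p => by
    refine Eq.trans ?_ (tensor_dh_mulVec (P.baseChange φ' hφ') N (sliceMap P T N L f) p).symm
    refine (congrFun (congrArg L (funext fun c =>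
      tensor_dh_mulVec (P.baseChange φ hφ) T f (p.1, c))) p.2).trans ?_
    refine (congrFun (map_add L (fun c => (P.dh.map φ).mulVec (fun a => f (a, c)) p.1)
      fun c => (((P.hdeg p.1).negOnePow : ℤ) : Q) * T.dh.mulVec (fun b => f (p.1, b)) c) p.2).trans ?_
    refine congrArg₂ (· + ·) (congrFun (slice_mulVec φ φ' L hL P.dh (fun a c => f (a, c)) p.1) p.2) ?_
    rw [slice_sgn φ φ' L hL, hdh]
    rfl
  dv (f : P.B × T.B → Q) := funext fun p => by
    refine Eq.trans ?_ (tensor_dv_mulVec (P.baseChange φ' hφ') N (sliceMap P T N L f) p).symm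
    refine (congrFun (congrArg L (funext fun c =>
      tensor_dv_mulVec (P.baseChange φ hφ) T f (p.1, c))) p.2).trans ?_
    refine (congrFun (map_add L (fun c => (P.dv.map φ).mulVec (fun a => f (a, c)) p.1)
      fun c => (((P.vdeg p.1).negOnePow : ℤ) : Q) * T.dv.mulVec (fun b => f (p.1, b)) c) p.2).trans ?_
    refine congrArg₂ (· + ·) (congrFun (slice_mulVec φ φ' L hL P.dv (fun a c => f (a, c)) p.1) p.2) ?_
    rw [slice_sgn φ φ' L hL, hdv]
    rfl

/-- The extension of a vertical homotopy to the tensor product. -/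
def sliceHomotopy (h : (T.B → Q) →ₗ[k] (T.B → Q)) : (P.B × T.B → Q) →ₗ[k] (P.B × T.B → Q) where
  toFun f p := (((P.vdeg p.1).negOnePow : ℤ) : Q) * h (fun c => f (p.1, c)) p.2
  map_add' f g := funext fun p =>
    (congrArg _ (congrFun (map_add h (fun c => f (p.1, c)) fun c => g (p.1, c)) p.2)).trans
      (mul_add _ _ _)
  map_smul' r f := funext fun p =>
    (congrArg _ (congrFun (map_smul h r fun c => f (p.1, c)) p.2)).trans
      (mul_smul_comm _ _ _)

variable {P T N φ φ'}

/-- A vertical deformation retract gives one after tensor product. -/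
lemma kdIso_of_slice_retract [HasDerivedCategory.{w} (ModuleCat.{u} k)]
    (Φ : (T.B → Q) →ₗ[k] (N.B → Q')) (Ψ : (N.B → Q') →ₗ[k] (T.B → Q))
    (h : (T.B → Q) →ₗ[k] (T.B → Q))
    (Φ_mul : ∀ r f, Φ (fun c => φ r * f c) = fun c => φ' r * Φ f c)
    (Ψ_mul : ∀ r f, Ψ (fun c => φ' r * f c) = fun c => φ r * Ψ f c)
    (h_mul : ∀ r f, h (fun c => φ r * f c) = fun c => φ r * h f c)
    (Φ_mem : ∀ n j i, ∀ f ∈ T.piece n j i, Φ f ∈ N.piece n j i)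
    (Ψ_mem : ∀ n j i, ∀ f ∈ N.piece n j i, Ψ f ∈ T.piece n j i)
    (h_mem : ∀ n j i, ∀ f ∈ T.piece n (j + 1) i, h f ∈ T.piece n j i)
    (Φ_dh : ∀ f, Φ (T.dh.mulVec f) = N.dh.mulVec (Φ f))
    (Φ_dv : ∀ f, Φ (T.dv.mulVec f) = N.dv.mulVec (Φ f))
    (Ψ_dh : ∀ f, Ψ (N.dh.mulVec f) = T.dh.mulVec (Ψ f))
    (Ψ_dv : ∀ f, Ψ (N.dv.mulVec f) = T.dv.mulVec (Ψ f))
    (h_dh : ∀ f, h (T.dh.mulVec f) = T.dh.mulVec (h f))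
    (ΦΨ : ∀ f, Φ (Ψ f) = f)
    (h_dv : ∀ f, f = h (T.dv.mulVec f) + T.dv.mulVec (h f) + Ψ (Φ f)) (n : ℤ) :
    KDIso.{w} (((P.baseChange φ hφ).tensor T).toBicomplex n)
      (((P.baseChange φ' hφ').tensor N).toBicomplex n) := by
  refine BigradedModule.kdIso_of_retract
    (sliceHom P T N φ hφ φ' hφ' Φ Φ_mul Φ_mem Φ_dh Φ_dv n)
    (sliceHom P N T φ' hφ' φ hφ Ψ Ψ_mul Ψ_mem Ψ_dh Ψ_dv n) ?_ (sliceHomotopy P T h) ?_ ?_ ?_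
  · intro (f : P.B × N.B → Q')
    exact funext fun p => congrFun (ΦΨ fun c => f (p.1, c)) p.2
  · intro j i f hf
    refine (mem_tensor_piece (P.baseChange φ hφ) T _ n j i).2 fun b => ?_
    have h1 := (mem_tensor_piece (P.baseChange φ hφ) T f n (j + 1) i).1 hf b
    rw [add_sub_right_comm] at h1
    exact sgn_mul_mem_piece T (P.vdeg b) (h_mem _ _ _ _ h1)
  · intro (f : P.B × T.B → Q)
    refine funext fun p => ?_
    refine Eq.trans ?_ (tensor_dh_mulVec (P.baseChange φ hφ) T (sliceHomotopy P T h f) p).symm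
    refine (congrArg ((((P.vdeg p.1).negOnePow : ℤ) : Q) * ·)
      (congrFun (congrArg h (funext fun c =>
        tensor_dh_mulVec (P.baseChange φ hφ) T f (p.1, c))) p.2)).trans ?_
    refine (congrArg ((((P.vdeg p.1).negOnePow : ℤ) : Q) * ·) (congrFun (map_add h
      (fun c => (P.dh.map φ).mulVec (fun a => f (a, c)) p.1)
      fun c => (((P.hdeg p.1).negOnePow : ℤ) : Q) * T.dh.mulVec (fun b => f (p.1, b)) c) p.2)).trans ?_
    rw [slice_sgn φ φ h h_mul, h_dh, slice_mulVec φ φ h h_mul P.dh (fun a c => f (a, c)) p.1]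
    refine (mul_add _ _ _).trans (congrArg₂ (· + ·) ?_ ?_)
    · exact (dh_mulVec_sgn_vdeg (P.baseChange φ hφ) (fun a => h (fun c => f (a, c)) p.2) p.1).symm
    · refine (mul_left_comm _ _ _).trans (congrArg _ ?_)
      have := congrFun (Matrix.mulVec_smul T.dh (((P.vdeg p.1).negOnePow : ℤ) : Q)
        (h fun c => f (p.1, c))) p.2
      exact this.symm
  · intro (f : P.B × T.B → Q)
    refine funext fun p => ?_
    -- The terms with `P.dv` in `h1` and `h2` have opposite signs and cancel. This is the reason for
    -- the sign in `sliceHomotopy`.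
    have h1 : sliceHomotopy P T h (((P.baseChange φ hφ).tensor T).dv.mulVec f) p =
        (((P.vdeg p.1).negOnePow : ℤ) : Q) * (P.dv.map φ).mulVec
          (fun a => h (fun c => f (a, c)) p.2) p.1 +
        h (T.dv.mulVec fun c => f (p.1, c)) p.2 := by
      refine (congrArg ((((P.vdeg p.1).negOnePow : ℤ) : Q) * ·)
        (congrFun (congrArg h (funext fun c =>
          tensor_dv_mulVec (P.baseChange φ hφ) T f (p.1, c))) p.2)).trans ?_
      refine (congrArg ((((P.vdeg p.1).negOnePow : ℤ) : Q) * ·) (congrFun (map_add h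
        (fun c => (P.dv.map φ).mulVec (fun a => f (a, c)) p.1)
        fun c => (((P.vdeg p.1).negOnePow : ℤ) : Q) * T.dv.mulVec (fun b => f (p.1, b)) c)
          p.2)).trans ?_
      rw [slice_sgn φ φ h h_mul, slice_mulVec φ φ h h_mul P.dv (fun a c => f (a, c)) p.1]
      exact (mul_add _ _ _).trans (congrArg _ (sgn_mul_self_cast _ _))
    have h2 : ((P.baseChange φ hφ).tensor T).dv.mulVec (sliceHomotopy P T h f) p =
        -((((P.vdeg p.1).negOnePow : ℤ) : Q) * (P.dv.map φ).mulVec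
          (fun a => h (fun c => f (a, c)) p.2) p.1) +
        T.dv.mulVec (h fun c => f (p.1, c)) p.2 := by
      refine (tensor_dv_mulVec (P.baseChange φ hφ) T (sliceHomotopy P T h f) p).trans
        (congrArg₂ (· + ·) ?_ ?_)
      · exact dv_mulVec_sgn (P.baseChange φ hφ) (fun a => h (fun c => f (a, c)) p.2) p.1
      · refine (congrArg ((((P.vdeg p.1).negOnePow : ℤ) : Q) * ·) (congrFun (Matrix.mulVec_smul
          T.dv (((P.vdeg p.1).negOnePow : ℤ) : Q) (h fun c => f (p.1, c))) p.2)).trans ?_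
        exact sgn_mul_self_cast _ _
    have h3 := congrFun (h_dv fun c => f (p.1, c)) p.2
    refine h3.trans ?_
    refine Eq.trans ?_ (congrArg₂ (fun x y => x + y + Ψ (Φ fun c => f (p.1, c)) p.2) h1 h2).symm
    have h4 (x y z t : Q) : y + z + t = x + y + (-x + z) + t := by ring
    exact h4 _ _ _ _

end Slice

end FreeBicomplex
end TripleLink

/-! ### The deformation retract of the bigon: setting X = 0 -/

namespace TripleLink

section Gate

variable {k V : Type u} [Field k] [AddCommGroup V] [Module k V]

/-- The elements of a submodule, if a condition holds, and zero otherwise. -/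
def gate (S : Submodule k V) (c : Prop) : Submodule k V where
  carrier := {x | x ∈ S ∧ (x ≠ 0 → c)}
  zero_mem' := ⟨S.zero_mem, fun h => (h rfl).elim⟩
  add_mem' {x y} hx hy := ⟨S.add_mem hx.1 hy.1, fun h => by
    by_cases h0 : x = 0
    · exact hy.2 (by simpa [h0] using h)
    · exact hx.2 h0⟩
  smul_mem' r x hx := ⟨S.smul_mem r hx.1, fun h => hx.2 fun h0 => h (by rw [h0, smul_zero])⟩

lemma mem_gate_of {S S' : Submodule k V} {c c' : Prop} {x : V} (hx : x ∈ gate S c) (hS : S = S')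
    (hc : c → c') : x ∈ gate S' c' := ⟨hS ▸ hx.1, fun h => hc (hx.2 h)⟩

/-- Each component of an element of a `piece` lies in a `gate`. As L fixes 0, the condition on the
bidegree is inherited, and only the internal degree has to be checked. -/
lemma map_mem_gate {V' : Type u} [AddCommGroup V'] [Module k V'] {S : Submodule k V}
    {S' : Submodule k V'} {c : Prop} {x : V} (L : V → V') (hL : L 0 = 0)
    (h : ∀ y ∈ S, L y ∈ S') (hx : x ∈ gate S c) : L x ∈ gate S' c :=
  ⟨h _ hx.1, fun h0 => hx.2 fun h1 => h0 (by rw [h1, hL])⟩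

end Gate

section

variable {k R : Type u} [Field k] [CommRing R] [Algebra k R] {ℬ : ℤ → Submodule k R}
  {n : ℤ} {c : Prop} {p : Polynomial R}

lemma coeff_zero_mem_gate (h : p ∈ gate (polynomialGr ℬ n) c) : p.coeff 0 ∈ gate (ℬ n) c :=
  map_mem_gate (fun p : Polynomial R => p.coeff 0) (Polynomial.coeff_zero 0)
    (fun q hq => by simpa using hq 0) h

lemma C_coeff_zero_mem_gate (h : p ∈ gate (polynomialGr ℬ n) c) :
    Polynomial.C (p.coeff 0) ∈ gate (polynomialGr ℬ n) c :=
  map_mem_gate Polynomial.C (map_zero _) (fun _ => C_mem_polynomialGr) (coeff_zero_mem_gate h)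

lemma divX_mem_polynomialGr (h : p ∈ polynomialGr ℬ n) : p.divX ∈ polynomialGr ℬ (n - 2) :=
  fun m => by
    rw [Polynomial.coeff_divX]
    have := h (m + 1)
    rwa [show n - 2 * ((m + 1 : ℕ) : ℤ) = n - 2 - 2 * m by push_cast; ring] at this

lemma divX_mem_gate (h : p ∈ gate (polynomialGr ℬ n) c) :
    p.divX ∈ gate (polynomialGr ℬ (n - 2)) c :=
  map_mem_gate Polynomial.divX Polynomial.divX_zero (fun _ => divX_mem_polynomialGr) h

lemma X_mul_divX_mem_gate (h : p ∈ gate (polynomialGr ℬ n) c) :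
    Polynomial.X * p.divX ∈ gate (polynomialGr ℬ n) c := by
  rw [eq_sub_of_add_eq (Polynomial.X_mul_divX_add p)]
  exact sub_mem h (C_coeff_zero_mem_gate h)

lemma mul_mem_gate [SetLike.GradedMonoid ℬ] {z : R} (hz : z ∈ ℬ 2) {x : R}
    (h : x ∈ gate (ℬ n) c) : z * x ∈ gate (ℬ (2 + n)) c :=
  map_mem_gate (fun x => z * x) (mul_zero z) (fun _ => SetLike.GradedMul.mul_mem hz) h

lemma divX_X_mul (p : Polynomial R) : (Polynomial.X * p).divX = p := by
  ext m
  rw [Polynomial.coeff_divX, Polynomial.coeff_X_mul]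

lemma divX_neg (p : Polynomial R) : (-p).divX = -p.divX := map_neg Polynomial.divX_hom p

lemma divX_sub (p q : Polynomial R) : (p - q).divX = p.divX - q.divX :=
  map_sub Polynomial.divX_hom p q

end

namespace FreeBicomplex

section TwoTerm

variable {k Q : Type u} [Field k] [CommRing Q] [Algebra k Q] {𝒜 : ℤ → Submodule k Q}

lemma twoTermOne_hdeg (v : ℤ) (w w' : Fin 2 → ℤ) {q q' α β : Q} (hq hq' hα hβ h) :
    (twoTermOne (𝒜 := 𝒜) v w w' q q' α β hq hq' hα hβ h).hdeg = Sum.elim ![0, -1] ![0, -1] := rfl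

lemma twoTermOne_vdeg (v : ℤ) (w w' : Fin 2 → ℤ) {q q' α β : Q} (hq hq' hα hβ h) :
    (twoTermOne (𝒜 := 𝒜) v w w' q q' α β hq hq' hα hβ h).vdeg =
      Sum.elim (fun _ => v) fun _ => v + 1 := rfl

lemma twoTermOne_dh_mulVec (v : ℤ) (w w' : Fin 2 → ℤ) {q q' α β : Q} (hq hq' hα hβ h)
    (f : Fin 2 ⊕ Fin 2 → Q) : (twoTermOne (𝒜 := 𝒜) v w w' q q' α β hq hq' hα hβ h).dh.mulVec f =
      Sum.elim ![q * f (.inl 1), 0] ![q' * f (.inr 1), 0] := by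
  change (Matrix.fromBlocks !![0, q; 0, 0] 0 0 !![0, q'; 0, 0]).mulVec f = _
  ext (b | b) <;> fin_cases b <;> simp [Matrix.mulVec, dotProduct, Fin.sum_univ_two]

lemma twoTermOne_dv_mulVec (v : ℤ) (w w' : Fin 2 → ℤ) {q q' α β : Q} (hq hq' hα hβ h)
    (f : Fin 2 ⊕ Fin 2 → Q) : (twoTermOne (𝒜 := 𝒜) v w w' q q' α β hq hq' hα hβ h).dv.mulVec f =
      Sum.elim ![0, 0] ![α * f (.inl 0), β * f (.inl 1)] := by
  change (Matrix.fromBlocks 0 0 !![α, 0; 0, β] 0).mulVec f = _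
  ext (b | b) <;> fin_cases b <;> simp [Matrix.mulVec, dotProduct, Fin.sum_univ_two]

/-- Functions on the product of two bases of two-term complexes, given by a matrix. -/
def grid (M : Matrix (Fin 4) (Fin 4) Q) (p : (Fin 2 ⊕ Fin 2) × (Fin 2 ⊕ Fin 2)) : Q :=
  M (Sum.elim ![0, 1] ![2, 3] p.1) (Sum.elim ![0, 1] ![2, 3] p.2)

variable [SetLike.GradedMonoid 𝒜] {x y t : Q} (hx : x ∈ 𝒜 2) (hy : y ∈ 𝒜 2) (ht : t ∈ 𝒜 2)

/-- The rows of the matrix are indexed by the basis of the positive crossing and the columns by that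
of the negative one, both in the order `inl 0`, `inl 1`, `inr 0`, `inr 1`. -/
lemma pos_tensor_neg_dv (f : (Fin 2 ⊕ Fin 2) × (Fin 2 ⊕ Fin 2) → Q) :
    ((posTerm (-1) 0 x t hx ht).tensor (negTerm y t hy ht)).dv.mulVec f = grid
      !![0, 0, -(y * f (.inl 0, .inl 0)), -f (.inl 0, .inl 1);
        0, 0, -(y * f (.inl 1, .inl 0)), -f (.inl 1, .inl 1);
        f (.inl 0, .inl 0), f (.inl 0, .inl 1), f (.inl 0, .inr 0) + y * f (.inr 0, .inl 0),
          f (.inl 0, .inr 1) + f (.inr 0, .inl 1);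
        x * f (.inl 1, .inl 0), x * f (.inl 1, .inl 1),
          x * f (.inl 1, .inr 0) + y * f (.inr 1, .inl 0),
          x * f (.inl 1, .inr 1) + f (.inr 1, .inl 1)] := by
  funext p
  refine (tensor_dv_mulVec (posTerm (-1) 0 x t hx ht) (negTerm y t hy ht) f p).trans ?_
  refine (congrArg₂ (fun u v => u + _ * v)
    (congrFun (twoTermOne_dv_mulVec _ _ _ _ _ _ _ _ fun a => f (a, p.2)) p.1)
    (congrFun (twoTermOne_dv_mulVec _ _ _ _ _ _ _ _ fun b => f (p.1, b)) p.2)).trans ?_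
  obtain ⟨b | b, c | c⟩ := p <;> fin_cases b <;> fin_cases c <;> simp [grid, twoTermOne_hdeg, twoTermOne_vdeg]

lemma pos_tensor_neg_dh (f : (Fin 2 ⊕ Fin 2) × (Fin 2 ⊕ Fin 2) → Q) :
    ((posTerm (-1) 0 x t hx ht).tensor (negTerm y t hy ht)).dh.mulVec f = grid
      !![x * t * f (.inl 1, .inl 0) + t * f (.inl 0, .inl 1), x * t * f (.inl 1, .inl 1),
          x * t * f (.inl 1, .inr 0) + y * t * f (.inl 0, .inr 1), x * t * f (.inl 1, .inr 1);
        -(t * f (.inl 1, .inl 1)), 0, -(y * t * f (.inl 1, .inr 1)), 0;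
        t * f (.inr 1, .inl 0) + t * f (.inr 0, .inl 1), t * f (.inr 1, .inl 1),
          t * f (.inr 1, .inr 0) + y * t * f (.inr 0, .inr 1), t * f (.inr 1, .inr 1);
        -(t * f (.inr 1, .inl 1)), 0, -(y * t * f (.inr 1, .inr 1)), 0] := by
  funext p
  refine (tensor_dh_mulVec (posTerm (-1) 0 x t hx ht) (negTerm y t hy ht) f p).trans ?_
  refine (congrArg₂ (fun u v => u + _ * v)
    (congrFun (twoTermOne_dh_mulVec _ _ _ _ _ _ _ _ fun a => f (a, p.2)) p.1)
    (congrFun (twoTermOne_dh_mulVec _ _ _ _ _ _ _ _ fun b => f (p.1, b)) p.2)).trans ?_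
  obtain ⟨b | b, c | c⟩ := p <;> fin_cases b <;> fin_cases c <;> simp [grid, twoTermOne_hdeg, twoTermOne_vdeg]

end TwoTerm

section Retract

open Polynomial (divX)

variable {k R : Type u} [Field k] [CommRing R] [Algebra k R] {ℬ : ℤ → Submodule k R}

/-- The projection onto the deformation retract. -/
def bigonProj (k : Type u) [Field k] [Algebra k R] (z : R) :
    ((Fin 2 ⊕ Fin 2) × (Fin 2 ⊕ Fin 2) → Polynomial R) →ₗ[k] (Fin 2 ⊕ Fin 2 → R) where
  toFun f := Sum.elim
    ![(f (.inl 0, .inr 0)).coeff 0 + z * (f (.inr 0, .inl 0)).coeff 0,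
      (f (.inl 0, .inr 1)).coeff 0 + (f (.inr 0, .inl 1)).coeff 0 + (f (.inr 1, .inl 0)).coeff 0]
    ![(f (.inr 0, .inr 0)).coeff 0,
      (f (.inr 1, .inr 0)).coeff 0 + z * (f (.inr 0, .inr 1)).coeff 0]
  map_add' f g := by
    ext (b | b) <;> fin_cases b <;> simp <;> ring
  map_smul' r f := by
    ext (b | b) <;> fin_cases b <;> simp [smul_add]

/-- The inclusion of the deformation retract. -/
noncomputable def bigonIncl (k R : Type u) [Field k] [CommRing R] [Algebra k R] :
    (Fin 2 ⊕ Fin 2 → R) →ₗ[k] ((Fin 2 ⊕ Fin 2) × (Fin 2 ⊕ Fin 2) → Polynomial R) where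
  toFun g := grid
    !![0, 0, Polynomial.C (g (.inl 0)), Polynomial.C (g (.inl 1));
      0, 0, Polynomial.C (g (.inl 1)), 0;
      0, -Polynomial.C (g (.inl 1)), Polynomial.C (g (.inr 0)), 0;
      Polynomial.C (g (.inl 1)), 0, Polynomial.C (g (.inr 1)), 0]
  map_add' f g := by
    ext ⟨b | b, c | c⟩ : 1 <;> fin_cases b <;> fin_cases c <;> simp [grid] <;> ring
  map_smul' r f := by
    ext ⟨b | b, c | c⟩ : 1 <;> fin_cases b <;> fin_cases c <;>
      simp [grid, ← Polynomial.smul_C]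

/-- The vertical homotopy of the deformation retract. -/
noncomputable def bigonHomotopy (k R : Type u) [Field k] [CommRing R] [Algebra k R] :
    ((Fin 2 ⊕ Fin 2) × (Fin 2 ⊕ Fin 2) → Polynomial R) →ₗ[k]
      ((Fin 2 ⊕ Fin 2) × (Fin 2 ⊕ Fin 2) → Polynomial R) where
  toFun f := grid
    !![f (.inr 0, .inl 0),
        Polynomial.C ((f (.inr 1, .inl 0)).coeff 0) + f (.inr 0, .inl 1),
        Polynomial.X * divX (f (.inr 0, .inr 0)), Polynomial.X * divX (f (.inr 0, .inr 1));
      divX (f (.inr 1, .inl 0)), divX (f (.inr 1, .inl 1)),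
        divX (f (.inr 1, .inr 0)) - Polynomial.C ((f (.inr 0, .inr 1)).coeff 0),
        divX (f (.inr 1, .inr 1));
      0, Polynomial.C ((f (.inr 0, .inr 1)).coeff 0), 0, 0;
      -Polynomial.C ((f (.inr 0, .inr 1)).coeff 0),
        Polynomial.C ((f (.inr 1, .inr 1)).coeff 0), 0, 0]
  map_add' f g := by
    ext ⟨b | b, c | c⟩ : 1 <;> fin_cases b <;> fin_cases c <;>
      simp [grid, Polynomial.divX_add] <;> ring
  map_smul' r f := by
    have h (p : Polynomial R) : divX (r • p) = r • divX p := by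
      ext m
      simp [Polynomial.coeff_divX]
    ext ⟨b | b, c | c⟩ : 1 <;> fin_cases b <;> fin_cases c <;>
      simp [grid, ← Polynomial.smul_C, h, smul_sub]

/-- With each component in the form Xq + a, `divX` and the constant coefficient are read off, and
the identities below become polynomial identities. -/
lemma exists_eq_X_mul_add_C {ι : Type} (f : ι → Polynomial R) :
    ∃ (q : ι → Polynomial R) (a : ι → R),
      f = fun i => Polynomial.X * q i + Polynomial.C (a i) :=
  ⟨fun i => divX (f i), fun i => (f i).coeff 0, funext fun i => (Polynomial.X_mul_divX_add _).symm⟩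

variable [SetLike.GradedMonoid ℬ] {z t : R} (hz : z ∈ ℬ 2) (ht : t ∈ ℬ 2)
  (hzX : Polynomial.C z - Polynomial.X ∈ polynomialGr ℬ 2)

lemma bigonProj_dv (f : (Fin 2 ⊕ Fin 2) × (Fin 2 ⊕ Fin 2) → Polynomial R) :
    bigonProj k z (((posTerm (𝒜 := polynomialGr ℬ) (-1) 0 Polynomial.X (Polynomial.C t)
      X_mem_polynomialGr (C_mem_polynomialGr ht)).tensor (negTerm (Polynomial.C z - Polynomial.X)
        (Polynomial.C t) hzX (C_mem_polynomialGr ht))).dv.mulVec f) =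
      (posTerm 0 (-2) z t hz ht).dv.mulVec (bigonProj k z f) := by
  rw [pos_tensor_neg_dv, twoTermOne_dv_mulVec]
  ext (b | b) <;> fin_cases b <;> simp [bigonProj, grid] <;> ring

lemma bigonProj_dh (f : (Fin 2 ⊕ Fin 2) × (Fin 2 ⊕ Fin 2) → Polynomial R) :
    bigonProj k z (((posTerm (𝒜 := polynomialGr ℬ) (-1) 0 Polynomial.X (Polynomial.C t)
      X_mem_polynomialGr (C_mem_polynomialGr ht)).tensor (negTerm (Polynomial.C z - Polynomial.X)
        (Polynomial.C t) hzX (C_mem_polynomialGr ht))).dh.mulVec f) =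
      (posTerm 0 (-2) z t hz ht).dh.mulVec (bigonProj k z f) := by
  rw [pos_tensor_neg_dh, twoTermOne_dh_mulVec]
  ext (b | b) <;> fin_cases b <;> simp [bigonProj, grid] <;> ring

lemma bigonIncl_dv (g : Fin 2 ⊕ Fin 2 → R) :
    bigonIncl k R ((posTerm 0 (-2) z t hz ht).dv.mulVec g) =
    ((posTerm (𝒜 := polynomialGr ℬ) (-1) 0 Polynomial.X (Polynomial.C t)
      X_mem_polynomialGr (C_mem_polynomialGr ht)).tensor (negTerm (Polynomial.C z - Polynomial.X)
        (Polynomial.C t) hzX (C_mem_polynomialGr ht))).dv.mulVec (bigonIncl k R g) := by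
  rw [pos_tensor_neg_dv, twoTermOne_dv_mulVec]
  ext ⟨b | b, c | c⟩ : 1 <;> fin_cases b <;> fin_cases c <;> simp [bigonIncl, grid] <;> ring

lemma bigonIncl_dh (g : Fin 2 ⊕ Fin 2 → R) :
    bigonIncl k R ((posTerm 0 (-2) z t hz ht).dh.mulVec g) =
    ((posTerm (𝒜 := polynomialGr ℬ) (-1) 0 Polynomial.X (Polynomial.C t)
      X_mem_polynomialGr (C_mem_polynomialGr ht)).tensor (negTerm (Polynomial.C z - Polynomial.X)
        (Polynomial.C t) hzX (C_mem_polynomialGr ht))).dh.mulVec (bigonIncl k R g) := by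
  rw [pos_tensor_neg_dh, twoTermOne_dh_mulVec]
  ext ⟨b | b, c | c⟩ : 1 <;> fin_cases b <;> fin_cases c <;> simp [bigonIncl, grid] <;> ring

/-- Division by X alone does not commute with `dh`. In the first entry, for instance, t·X·`divX` p
is completed to t·p by the constant coefficient of p, which is why such coefficients occur in
`bigonHomotopy`. -/
lemma bigonHomotopy_dh (f : (Fin 2 ⊕ Fin 2) × (Fin 2 ⊕ Fin 2) → Polynomial R) :
    bigonHomotopy k R (((posTerm (𝒜 := polynomialGr ℬ) (-1) 0 Polynomial.X (Polynomial.C t)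
      X_mem_polynomialGr (C_mem_polynomialGr ht)).tensor (negTerm (Polynomial.C z - Polynomial.X)
        (Polynomial.C t) hzX (C_mem_polynomialGr ht))).dh.mulVec f) =
    ((posTerm (𝒜 := polynomialGr ℬ) (-1) 0 Polynomial.X (Polynomial.C t)
      X_mem_polynomialGr (C_mem_polynomialGr ht)).tensor (negTerm (Polynomial.C z - Polynomial.X)
        (Polynomial.C t) hzX (C_mem_polynomialGr ht))).dh.mulVec (bigonHomotopy k R f) := by
  obtain ⟨q, a, rfl⟩ := exists_eq_X_mul_add_C f
  rw [pos_tensor_neg_dh, pos_tensor_neg_dh]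
  ext ⟨b | b, c | c⟩ : 1 <;> fin_cases b <;> fin_cases c <;>
    simp [bigonHomotopy, grid, mul_assoc, sub_mul, Polynomial.divX_add, divX_sub, divX_neg,
      Polynomial.divX_C_mul, divX_X_mul] <;> ring

/-- The decomposition p = X·`divX` p + p(0) contracts multiplication by X in the positive crossing
onto constant coefficients, and at X = 0 the factor z − X of the negative crossing turns into z.
Hence the retract has the shape of a positive crossing with r = z. -/
lemma bigonHomotopy_dv (f : (Fin 2 ⊕ Fin 2) × (Fin 2 ⊕ Fin 2) → Polynomial R) :
    f = fun p => bigonHomotopy k R (((posTerm (𝒜 := polynomialGr ℬ) (-1) 0 Polynomial.X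
        (Polynomial.C t) X_mem_polynomialGr (C_mem_polynomialGr ht)).tensor
          (negTerm (Polynomial.C z - Polynomial.X) (Polynomial.C t) hzX
            (C_mem_polynomialGr ht))).dv.mulVec f) p +
      ((posTerm (𝒜 := polynomialGr ℬ) (-1) 0 Polynomial.X (Polynomial.C t)
        X_mem_polynomialGr (C_mem_polynomialGr ht)).tensor (negTerm (Polynomial.C z - Polynomial.X)
          (Polynomial.C t) hzX (C_mem_polynomialGr ht))).dv.mulVec (bigonHomotopy k R f) p +
      bigonIncl k R (bigonProj k z f) p := by
  obtain ⟨q, a, rfl⟩ := exists_eq_X_mul_add_C f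
  rw [pos_tensor_neg_dv, pos_tensor_neg_dv]
  ext ⟨b | b, c | c⟩ : 1 <;> fin_cases b <;> fin_cases c <;>
    simp [bigonHomotopy, bigonIncl, bigonProj, grid, mul_assoc, sub_mul, Polynomial.divX_add,
      divX_sub, divX_neg, Polynomial.divX_C_mul, divX_X_mul] <;> ring

lemma bigonProj_bigonIncl (g : Fin 2 ⊕ Fin 2 → R) : bigonProj k z (bigonIncl k R g) = g := by
  ext (b | b) <;> fin_cases b <;> simp [bigonProj, bigonIncl, grid]

lemma bigonProj_mul (r : R) (f : (Fin 2 ⊕ Fin 2) × (Fin 2 ⊕ Fin 2) → Polynomial R) :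
    bigonProj k z (fun c => Polynomial.C r * f c) = fun c => r * bigonProj k z f c := by
  ext (b | b) <;> fin_cases b <;> simp [bigonProj] <;> ring

lemma bigonIncl_mul (r : R) (g : Fin 2 ⊕ Fin 2 → R) :
    bigonIncl k R (fun c => r * g c) = fun c => Polynomial.C r * bigonIncl k R g c := by
  ext ⟨b | b, c | c⟩ : 1 <;> fin_cases b <;> fin_cases c <;> simp [bigonIncl, grid]

lemma bigonHomotopy_mul (r : R) (f : (Fin 2 ⊕ Fin 2) × (Fin 2 ⊕ Fin 2) → Polynomial R) :
    bigonHomotopy k R (fun c => Polynomial.C r * f c) =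
      fun c => Polynomial.C r * bigonHomotopy k R f c := by
  ext ⟨b | b, c | c⟩ : 1 <;> fin_cases b <;> fin_cases c <;>
    simp [bigonHomotopy, grid, Polynomial.divX_C_mul] <;> ring

lemma bigonProj_mem (n j i : ℤ) (f : (Fin 2 ⊕ Fin 2) × (Fin 2 ⊕ Fin 2) → Polynomial R)
    (hf : f ∈ ((posTerm (𝒜 := polynomialGr ℬ) (-1) 0 Polynomial.X (Polynomial.C t)
      X_mem_polynomialGr (C_mem_polynomialGr ht)).tensor (negTerm (Polynomial.C z - Polynomial.X)
        (Polynomial.C t) hzX (C_mem_polynomialGr ht))).piece n j i) :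
    bigonProj k z f ∈ (posTerm 0 (-2) z t hz ht).piece n j i := by
  have h00 : f (.inl 0, .inr 0) ∈ gate (polynomialGr ℬ (n - -2)) (0 = j ∧ 0 = i) := hf (.inl 0, .inr 0)
  have h01 : f (.inl 0, .inr 1) ∈ gate (polynomialGr ℬ (n - 2)) (0 = j ∧ -1 = i) := hf (.inl 0, .inr 1)
  have h20 : f (.inr 0, .inl 0) ∈ gate (polynomialGr ℬ (n - 0)) (0 = j ∧ 0 = i) := hf (.inr 0, .inl 0)
  have h21 : f (.inr 0, .inl 1) ∈ gate (polynomialGr ℬ (n - 2)) (0 = j ∧ -1 = i) := hf (.inr 0, .inl 1)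
  have h30 : f (.inr 1, .inl 0) ∈ gate (polynomialGr ℬ (n - 2)) (0 = j ∧ -1 = i) := hf (.inr 1, .inl 0)
  have h22 : f (.inr 0, .inr 0) ∈ gate (polynomialGr ℬ (n - -2)) (1 = j ∧ 0 = i) := hf (.inr 0, .inr 0)
  have h32 : f (.inr 1, .inr 0) ∈ gate (polynomialGr ℬ (n - 0)) (1 = j ∧ -1 = i) := hf (.inr 1, .inr 0)
  have h23 : f (.inr 0, .inr 1) ∈ gate (polynomialGr ℬ (n - 2)) (1 = j ∧ -1 = i) := hf (.inr 0, .inr 1)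
  rintro (b | b) <;> fin_cases b
  · exact (add_mem (coeff_zero_mem_gate h00) (mem_gate_of (mul_mem_gate hz (coeff_zero_mem_gate h20))
      (congrArg ℬ (by ring)) id) : _ ∈ gate (ℬ (n - -2)) (0 = j ∧ 0 = i))
  · exact (add_mem (add_mem (coeff_zero_mem_gate h01) (coeff_zero_mem_gate h21))
      (coeff_zero_mem_gate h30) : _ ∈ gate (ℬ (n - 2)) (0 = j ∧ -1 = i))
  · exact (coeff_zero_mem_gate h22 : _ ∈ gate (ℬ (n - -2)) (1 = j ∧ 0 = i))
  · exact (add_mem (coeff_zero_mem_gate h32) (mem_gate_of (mul_mem_gate hz (coeff_zero_mem_gate h23))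
      (congrArg ℬ (by ring)) id) : _ ∈ gate (ℬ (n - 0)) (1 = j ∧ -1 = i))

lemma bigonIncl_mem (n j i : ℤ) (g : Fin 2 ⊕ Fin 2 → R)
    (hg : g ∈ (posTerm 0 (-2) z t hz ht).piece n j i) :
    bigonIncl k R g ∈ ((posTerm (𝒜 := polynomialGr ℬ) (-1) 0 Polynomial.X (Polynomial.C t)
      X_mem_polynomialGr (C_mem_polynomialGr ht)).tensor (negTerm (Polynomial.C z - Polynomial.X)
        (Polynomial.C t) hzX (C_mem_polynomialGr ht))).piece n j i := by
  have hC {m : ℤ} {c : Prop} {x : R} (h : x ∈ gate (ℬ m) c) :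
      Polynomial.C x ∈ gate (polynomialGr ℬ m) c :=
    map_mem_gate Polynomial.C (map_zero _) (fun _ => C_mem_polynomialGr) h
  have h0 : g (.inl 0) ∈ gate (ℬ (n - -2)) (0 = j ∧ 0 = i) := hg (.inl 0)
  have h1 : g (.inl 1) ∈ gate (ℬ (n - 2)) (0 = j ∧ -1 = i) := hg (.inl 1)
  have h2 : g (.inr 0) ∈ gate (ℬ (n - -2)) (1 = j ∧ 0 = i) := hg (.inr 0)
  have h3 : g (.inr 1) ∈ gate (ℬ (n - 0)) (1 = j ∧ -1 = i) := hg (.inr 1)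
  rintro ⟨b | b, c | c⟩ <;> fin_cases b <;> fin_cases c
  · exact zero_mem (gate _ _)
  · exact zero_mem (gate _ _)
  · exact zero_mem (gate _ _)
  · exact zero_mem (gate _ _)
  · exact (hC h0 : _ ∈ gate (polynomialGr ℬ (n - -2)) (0 = j ∧ 0 = i))
  · exact (hC h1 : _ ∈ gate (polynomialGr ℬ (n - 2)) (0 = j ∧ -1 = i))
  · exact (hC h1 : _ ∈ gate (polynomialGr ℬ (n - 2)) (0 = j ∧ -1 = i))
  · exact zero_mem (gate _ _)
  · exact zero_mem (gate _ _)
  · exact (neg_mem (hC h1) : _ ∈ gate (polynomialGr ℬ (n - 2)) (0 = j ∧ -1 = i))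
  · exact (hC h1 : _ ∈ gate (polynomialGr ℬ (n - 2)) (0 = j ∧ -1 = i))
  · exact zero_mem (gate _ _)
  · exact (hC h2 : _ ∈ gate (polynomialGr ℬ (n - -2)) (1 = j ∧ 0 = i))
  · exact zero_mem (gate _ _)
  · exact (hC h3 : _ ∈ gate (polynomialGr ℬ (n - 0)) (1 = j ∧ -1 = i))
  · exact zero_mem (gate _ _)

lemma bigonHomotopy_mem (n j i : ℤ) (f : (Fin 2 ⊕ Fin 2) × (Fin 2 ⊕ Fin 2) → Polynomial R)
    (hf : f ∈ ((posTerm (𝒜 := polynomialGr ℬ) (-1) 0 Polynomial.X (Polynomial.C t)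
      X_mem_polynomialGr (C_mem_polynomialGr ht)).tensor (negTerm (Polynomial.C z - Polynomial.X)
        (Polynomial.C t) hzX (C_mem_polynomialGr ht))).piece n (j + 1) i) :
    bigonHomotopy k R f ∈ ((posTerm (𝒜 := polynomialGr ℬ) (-1) 0 Polynomial.X (Polynomial.C t)
      X_mem_polynomialGr (C_mem_polynomialGr ht)).tensor (negTerm (Polynomial.C z - Polynomial.X)
        (Polynomial.C t) hzX (C_mem_polynomialGr ht))).piece n j i := by
  have h20 : f (.inr 0, .inl 0) ∈ gate (polynomialGr ℬ (n - 0)) (0 = j + 1 ∧ 0 = i) := hf (.inr 0, .inl 0)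
  have h30 : f (.inr 1, .inl 0) ∈ gate (polynomialGr ℬ (n - 2)) (0 = j + 1 ∧ -1 = i) := hf (.inr 1, .inl 0)
  have h21 : f (.inr 0, .inl 1) ∈ gate (polynomialGr ℬ (n - 2)) (0 = j + 1 ∧ -1 = i) := hf (.inr 0, .inl 1)
  have h31 : f (.inr 1, .inl 1) ∈ gate (polynomialGr ℬ (n - 4)) (0 = j + 1 ∧ -2 = i) := hf (.inr 1, .inl 1)
  have h22 : f (.inr 0, .inr 0) ∈ gate (polynomialGr ℬ (n - -2)) (1 = j + 1 ∧ 0 = i) := hf (.inr 0, .inr 0)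
  have h32 : f (.inr 1, .inr 0) ∈ gate (polynomialGr ℬ (n - 0)) (1 = j + 1 ∧ -1 = i) := hf (.inr 1, .inr 0)
  have h23 : f (.inr 0, .inr 1) ∈ gate (polynomialGr ℬ (n - 2)) (1 = j + 1 ∧ -1 = i) := hf (.inr 0, .inr 1)
  have h33 : f (.inr 1, .inr 1) ∈ gate (polynomialGr ℬ (n - 4 + 4 - 4)) (1 = j + 1 ∧ -2 = i) := by
    rw [sub_add_cancel]
    exact hf (.inr 1, .inr 1)
  have e0 {i' : ℤ} : 0 = j + 1 ∧ i' = i → -1 = j ∧ i' = i := fun h => ⟨by lia, h.2⟩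
  have e1 {i' : ℤ} : 1 = j + 1 ∧ i' = i → 0 = j ∧ i' = i := fun h => ⟨by lia, h.2⟩
  have cast {m m' i' a b : ℤ} {p : Polynomial R} (h : p ∈ gate (polynomialGr ℬ m) (a = j + 1 ∧ i' = i))
      (hm : m = m') (hb : b = a - 1) : p ∈ gate (polynomialGr ℬ m') (b = j ∧ i' = i) :=
    mem_gate_of h (by rw [hm]) fun h => ⟨by lia, h.2⟩
  rintro ⟨b | b, c | c⟩ <;> fin_cases b <;> fin_cases c
  · exact (cast h20 rfl rfl : _ ∈ gate (polynomialGr ℬ (n - 0)) (-1 = j ∧ 0 = i))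
  · exact (cast (add_mem (C_coeff_zero_mem_gate h30) h21) rfl rfl :
      _ ∈ gate (polynomialGr ℬ (n - 2)) (-1 = j ∧ -1 = i))
  · exact (cast (divX_mem_gate h30) (by ring) rfl :
      _ ∈ gate (polynomialGr ℬ (n - 4)) (-1 = j ∧ -1 = i))
  · exact (cast (divX_mem_gate h31) (by ring) rfl :
      _ ∈ gate (polynomialGr ℬ (n - 6)) (-1 = j ∧ -2 = i))
  · exact (cast (X_mul_divX_mem_gate h22) rfl rfl :
      _ ∈ gate (polynomialGr ℬ (n - -2)) (0 = j ∧ 0 = i))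
  · exact (cast (X_mul_divX_mem_gate h23) rfl rfl :
      _ ∈ gate (polynomialGr ℬ (n - 2)) (0 = j ∧ -1 = i))
  · exact (cast (sub_mem (mem_gate_of (divX_mem_gate h32) (by rw [sub_zero]) id)
      (C_coeff_zero_mem_gate h23)) rfl rfl : _ ∈ gate (polynomialGr ℬ (n - 2)) (0 = j ∧ -1 = i))
  · exact (cast (divX_mem_gate h33) (by ring) rfl :
      _ ∈ gate (polynomialGr ℬ (n - 6)) (0 = j ∧ -2 = i))
  · exact zero_mem (gate _ _)
  · exact (cast (C_coeff_zero_mem_gate h23) rfl rfl :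
      _ ∈ gate (polynomialGr ℬ (n - 2)) (0 = j ∧ -1 = i))
  · exact (cast (neg_mem (C_coeff_zero_mem_gate h23)) rfl rfl :
      _ ∈ gate (polynomialGr ℬ (n - 2)) (0 = j ∧ -1 = i))
  · exact (cast (C_coeff_zero_mem_gate h33) (by ring) rfl :
      _ ∈ gate (polynomialGr ℬ (n - 4)) (0 = j ∧ -2 = i))
  · exact zero_mem (gate _ _)
  · exact zero_mem (gate _ _)
  · exact zero_mem (gate _ _)
  · exact zero_mem (gate _ _)

/-- The tensor product of the two-term complexes of the two crossings of the bigon can be replaced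
by one two-term complex. -/
lemma kdIso_bigon_retract [HasDerivedCategory.{w} (ModuleCat.{u} k)] (P : FreeBicomplex ℬ) (n : ℤ) :
    KDIso.{w} ((((P.baseChange Polynomial.C fun _ _ => C_mem_polynomialGr).tensor
        (posTerm (𝒜 := polynomialGr ℬ) (-1) 0 Polynomial.X (Polynomial.C t)
          X_mem_polynomialGr (C_mem_polynomialGr ht))).tensor
            (negTerm (Polynomial.C z - Polynomial.X) (Polynomial.C t) hzX
              (C_mem_polynomialGr ht))).toBicomplex n)
      ((P.tensor (posTerm 0 (-2) z t hz ht)).toBicomplex n) := by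
  refine (FreeBicomplex.Iso.kdIso (FreeBicomplex.Iso.assoc _ _ _) n).trans ?_
  refine KDIso.trans ?_ (FreeBicomplex.Iso.kdIso ((baseChangeId (RingHom.id R) (fun _ _ h => h)
    (fun _ => rfl) P).tensor (FreeBicomplex.Iso.refl _)) n)
  exact kdIso_of_slice_retract _ _ (bigonProj k z) (bigonIncl k R) (bigonHomotopy k R)
    bigonProj_mul bigonIncl_mul bigonHomotopy_mul (bigonProj_mem hz ht hzX)
    (bigonIncl_mem hz ht hzX) (bigonHomotopy_mem ht hzX) (bigonProj_dh hz ht hzX)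
    (bigonProj_dv hz ht hzX) (bigonIncl_dh hz ht hzX) (bigonIncl_dv hz ht hzX)
    (bigonHomotopy_dh ht hzX) bigonProj_bigonIncl (bigonHomotopy_dv ht hzX) n

end Retract

end FreeBicomplex
end TripleLink

/-! ### Cones, and the reduction of the remaining two-term complex -/

namespace TripleLink
namespace BigradedModule

section Cone

variable {k : Type u} [Field k] {M N : BigradedModule k}

/-- The vertical cone of a morphism, shifted such that it starts with the source. -/
def cone (θ : Hom M N) : BigradedModule k where
  V := M.V × N.V
  piece j i := (M.piece j i).prod (N.piece (j - 1) i)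
  dh := M.dh.prodMap N.dh
  dv := (M.dv ∘ₗ LinearMap.fst k M.V N.V).prod
    (θ.f ∘ₗ LinearMap.fst k M.V N.V - N.dv ∘ₗ LinearMap.snd k M.V N.V)
  dh_mem h := ⟨M.dh_mem h.1, N.dh_mem h.2⟩
  dv_mem {j i x} h := by
    refine ⟨M.dv_mem h.1, ?_⟩
    have h1 := N.dv_mem h.2
    rw [sub_add_cancel] at h1
    rw [add_sub_cancel_right]
    exact sub_mem (θ.mem h.1) h1
  dh_sq x := Prod.ext (M.dh_sq _) (N.dh_sq _)
  dv_sq x := Prod.ext (M.dv_sq _) (by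
    change θ.f (M.dv x.1) - N.dv (θ.f x.1 - N.dv x.2) = 0
    rw [map_sub, θ.dv, N.dv_sq, sub_zero, sub_self])
  comm x := Prod.ext (M.comm _) (by
    change N.dh (θ.f x.1 - N.dv x.2) = θ.f (M.dh x.1) - N.dv (N.dh x.2)
    rw [map_sub, θ.dh, N.comm])

end Cone

section Cokernel

variable {k : Type u} [Field k] {L M N : BigradedModule k} (ι : Hom L M) (φ : Hom M N)
    (hinj : ∀ j i, ∀ x ∈ L.piece j i, ι.f x = 0 → x = 0)
    (hzero : ∀ j i, ∀ x ∈ L.piece j i, φ.f (ι.f x) = 0)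
    (hex : ∀ j i, ∀ x ∈ M.piece j i, φ.f x = 0 → ∃ y ∈ L.piece j i, ι.f y = x)
    (hsurj : ∀ j i, ∀ y ∈ N.piece j i, ∃ x ∈ M.piece j i, φ.f x = y)

include hinj hex hsurj in
lemma shortExact_toMor : (ShortComplex.mk ι.toMor φ.toMor (HomologicalComplex.hom_ext _ _ fun _ =>
      HomologicalComplex.hom_ext _ _ fun _ =>
        ModuleCat.hom_ext (LinearMap.ext fun x => Subtype.ext (hzero _ _ x.1 x.2)))).ShortExact :=
  HomologicalComplex.shortExact_of_degreewise_shortExact _ fun j =>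
    ι.shortExact_row φ hinj hzero hex hsurj j

include hzero hinj hex hsurj in
lemma mono_toMor : Mono ι.toMor := (shortExact_toMor ι φ hinj hzero hex hsurj).mono_f

include hzero hinj hex hsurj in
lemma cokernel_toMor_iso : Nonempty (cokernel ι.toMor ≅ N.toBicomplex) :=
  ⟨(cokernelIsCokernel ι.toMor).coconePointUniqueUpToIso
    (shortExact_toMor ι φ hinj hzero hex hsurj).gIsCokernel⟩

end Cokernel

end BigradedModule

namespace FreeBicomplex

variable {k Q R A B : Type u} [Field k] [CommRing Q] [Algebra k Q] [CommRing R] [Algebra k R]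
  [CommRing A] [Algebra k A] [CommRing B] [Algebra k B]
  {𝒬 : ℤ → Submodule k Q} {ℛ : ℤ → Submodule k R} {𝒜 : ℤ → Submodule k A} {ℬ : ℤ → Submodule k B}
  [SetLike.GradedMonoid 𝒬] [SetLike.GradedMonoid ℛ] [SetLike.GradedMonoid 𝒜]
  [SetLike.GradedMonoid ℬ]

lemma semilinear_mulVec {X Y : Type} [Fintype Y] (π : Q →+* A) (π' : Q →+* B) (L : A →ₗ[k] B)
    (hL : ∀ q x, L (π q * x) = π' q * L x) (M : Matrix X Y Q) (f : Y → A) (x : X) :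
    L ((M.map π).mulVec f x) = (M.map π').mulVec (fun y => L (f y)) x := by
  simp [Matrix.mulVec, dotProduct, map_sum, hL]

lemma semilinear_mem_piece (P : FreeBicomplex 𝒬) (π : Q →+* A) (hπ : ∀ n a, a ∈ 𝒬 n → π a ∈ 𝒜 n)
    (π' : Q →+* B) (hπ' : ∀ n a, a ∈ 𝒬 n → π' a ∈ ℬ n) (L : A →ₗ[k] B) {n n' : ℤ}
    (hL : ∀ m, ∀ x ∈ 𝒜 (n - m), L x ∈ ℬ (n' - m)) {j i : ℤ} (f : P.B → A)
    (hf : f ∈ (P.baseChange π hπ).piece n j i) :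
    (fun b => L (f b)) ∈ (P.baseChange π' hπ').piece n' j i :=
  fun b => ⟨hL _ _ (hf b).1, fun h => (hf b).2 fun h0 => h ((congrArg L h0).trans (map_zero L))⟩

/-- The morphism induced by a semilinear map of rings of coefficients. -/
def semilinearHom (P : FreeBicomplex 𝒬) (π : Q →+* A) (hπ : ∀ n a, a ∈ 𝒬 n → π a ∈ 𝒜 n)
    (π' : Q →+* B) (hπ' : ∀ n a, a ∈ 𝒬 n → π' a ∈ ℬ n) (L : A →ₗ[k] B)
    (hL : ∀ q x, L (π q * x) = π' q * L x) {n n' : ℤ}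
    (hmem : ∀ m, ∀ x ∈ 𝒜 (n - m), L x ∈ ℬ (n' - m)) :
    ((P.baseChange π hπ).toBigraded n).Hom ((P.baseChange π' hπ').toBigraded n') where
  f := L.compLeft P.B
  mem hx := semilinear_mem_piece P π hπ π' hπ' L hmem _ hx
  dh x := funext fun b => semilinear_mulVec π π' L hL P.dh x b
  dv x := funext fun b => semilinear_mulVec π π' L hL P.dv x b

/-- The cancellation argument of Koszul elimination in isolated form, since it is needed for zt in
the upper row and for t in the lower row. -/
lemma exists_koszul_primitive {χ : R →ₐ[k] A} {x : R} {m : ℤ} (hχ : IsQuotientBy ℛ 𝒜 χ x m)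
    (P : FreeBicomplex ℛ) {n j i : ℤ} (f g : P.B → R) (hf : f ∈ P.piece n j i)
    (hf0 : ∀ b, χ (f b) = 0)
    (h : ∀ b, P.dh.mulVec f b + (((P.hdeg b).negOnePow : ℤ) : R) * (x * g b) = 0) :
    ∃ y ∈ P.piece (n - m) j i, (∀ b, f b = (((P.hdeg b).negOnePow : ℤ) : R) * (x * y b)) ∧
      P.dh.mulVec y = g := by
  have h1 : ∀ b, ∃ y ∈ ℛ (n - P.pdeg b - m), f b = x * y := fun b =>
    hχ.exists_of_map_eq_zero _ _ (hf b).1 (hf0 b)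
  choose y hy hfy using h1
  have h3 : ∀ b, P.dh.mulVec y b = -((((P.hdeg b).negOnePow : ℤ) : R) * g b) := by
    intro b
    refine eq_neg_of_add_eq_zero_left (hχ.eq_zero_of_mul _ (Eq.trans ?_ (h b)))
    rw [mul_add]
    congr 1
    · simp only [hfy, Matrix.mulVec, dotProduct, Finset.mul_sum]
      exact Finset.sum_congr rfl fun _ _ => by ring
    · ring
  refine ⟨fun b => (((P.hdeg b).negOnePow : ℤ) : R) * y b, fun b => ⟨?_, fun h4 => ?_⟩,
    fun b => ?_, funext fun b => ?_⟩
  · rw [sub_right_comm]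
    exact sgn_mul_mem _ _ (hy b)
  · exact (hf b).2 fun h5 => sgn_mul_ne_zero h4 (hχ.eq_zero_of_mul _ ((hfy b).symm.trans h5))
  · rw [hfy, mul_left_comm x, sgn_mul_self_cast]
  · rw [dh_mulVec_sgn, h3, mul_neg, neg_neg, sgn_mul_self_cast]

section PosTerm

variable {z t : R} {χ₁ : R →ₐ[k] A} {χ₂ : R →ₐ[k] B} (h₁ : IsQuotientBy ℛ 𝒜 χ₁ (z * t) 4)
  (h₂ : IsQuotientBy ℛ ℬ χ₂ t 2) (hz : z ∈ ℛ 2) (ht : t ∈ ℛ 2)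
  (τ : A →ₗ[k] B) (hτ : ∀ x, τ (χ₁ x) = χ₂ x) (P : FreeBicomplex ℛ)

lemma tensor_posTerm_dh_inl_zero (f : P.B × (Fin 2 ⊕ Fin 2) → R) (b : P.B) :
    (P.tensor (posTerm 0 (-2) z t hz ht)).dh.mulVec f (b, Sum.inl (0 : Fin 2)) =
      P.dh.mulVec (fun a => f (a, .inl 0)) b +
        (((P.hdeg b).negOnePow : ℤ) : R) * (z * t * f (b, .inl 1)) :=
  (tensor_dh_mulVec P (posTerm 0 (-2) z t hz ht) f (b, Sum.inl (0 : Fin 2))).trans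
    (congrArg (fun y => P.dh.mulVec (fun a => f (a, .inl 0)) b +
      (((P.hdeg b).negOnePow : ℤ) : R) * y) (congrFun (twoTermOne_dh_mulVec _ _ _ _ _ _ _ _
        fun c => f (b, c)) (Sum.inl (0 : Fin 2))))

lemma tensor_posTerm_dh_inr_zero (f : P.B × (Fin 2 ⊕ Fin 2) → R) (b : P.B) :
    (P.tensor (posTerm 0 (-2) z t hz ht)).dh.mulVec f (b, Sum.inr (0 : Fin 2)) =
      P.dh.mulVec (fun a => f (a, .inr 0)) b +
        (((P.hdeg b).negOnePow : ℤ) : R) * (t * f (b, .inr 1)) :=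
  (tensor_dh_mulVec P (posTerm 0 (-2) z t hz ht) f (b, Sum.inr (0 : Fin 2))).trans
    (congrArg (fun y => P.dh.mulVec (fun a => f (a, .inr 0)) b +
      (((P.hdeg b).negOnePow : ℤ) : R) * y) (congrFun (twoTermOne_dh_mulVec _ _ _ _ _ _ _ _
        fun c => f (b, c)) (Sum.inr (0 : Fin 2))))

lemma tensor_posTerm_dh_inl_one (f : P.B × (Fin 2 ⊕ Fin 2) → R) (b : P.B) :
    (P.tensor (posTerm 0 (-2) z t hz ht)).dh.mulVec f (b, Sum.inl (1 : Fin 2)) =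
      P.dh.mulVec (fun a => f (a, .inl 1)) b :=
  (tensor_dh_mulVec P (posTerm 0 (-2) z t hz ht) f (b, Sum.inl (1 : Fin 2))).trans
    ((congrArg (fun y => P.dh.mulVec (fun a => f (a, .inl 1)) b +
      (((P.hdeg b).negOnePow : ℤ) : R) * y) (congrFun (twoTermOne_dh_mulVec _ _ _ _ _ _ _ _
        fun c => f (b, c)) (Sum.inl (1 : Fin 2)))).trans (by simp))

lemma tensor_posTerm_dh_inr_one (f : P.B × (Fin 2 ⊕ Fin 2) → R) (b : P.B) :
    (P.tensor (posTerm 0 (-2) z t hz ht)).dh.mulVec f (b, Sum.inr (1 : Fin 2)) =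
      P.dh.mulVec (fun a => f (a, .inr 1)) b :=
  (tensor_dh_mulVec P (posTerm 0 (-2) z t hz ht) f (b, Sum.inr (1 : Fin 2))).trans
    ((congrArg (fun y => P.dh.mulVec (fun a => f (a, .inr 1)) b +
      (((P.hdeg b).negOnePow : ℤ) : R) * y) (congrFun (twoTermOne_dh_mulVec _ _ _ _ _ _ _ _
        fun c => f (b, c)) (Sum.inr (1 : Fin 2)))).trans (by simp))

lemma tensor_posTerm_dv_inl_zero (f : P.B × (Fin 2 ⊕ Fin 2) → R) (b : P.B) :
    (P.tensor (posTerm 0 (-2) z t hz ht)).dv.mulVec f (b, Sum.inl (0 : Fin 2)) =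
      P.dv.mulVec (fun a => f (a, .inl 0)) b :=
  (tensor_dv_mulVec P (posTerm 0 (-2) z t hz ht) f (b, Sum.inl (0 : Fin 2))).trans
    ((congrArg (fun y => P.dv.mulVec (fun a => f (a, .inl 0)) b +
      (((P.vdeg b).negOnePow : ℤ) : R) * y) (congrFun (twoTermOne_dv_mulVec _ _ _ _ _ _ _ _
        fun c => f (b, c)) (Sum.inl (0 : Fin 2)))).trans (by simp))

lemma tensor_posTerm_dv_inr_zero (f : P.B × (Fin 2 ⊕ Fin 2) → R) (b : P.B) :
    (P.tensor (posTerm 0 (-2) z t hz ht)).dv.mulVec f (b, Sum.inr (0 : Fin 2)) =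
      P.dv.mulVec (fun a => f (a, .inr 0)) b +
        (((P.vdeg b).negOnePow : ℤ) : R) * f (b, .inl 0) :=
  (tensor_dv_mulVec P (posTerm 0 (-2) z t hz ht) f (b, Sum.inr (0 : Fin 2))).trans
    ((congrArg (fun y => P.dv.mulVec (fun a => f (a, .inr 0)) b +
      (((P.vdeg b).negOnePow : ℤ) : R) * y) (congrFun (twoTermOne_dv_mulVec _ _ _ _ _ _ _ _
        fun c => f (b, c)) (Sum.inr (0 : Fin 2)))).trans (by simp))

/-- The morphism between the reductions of a bicomplex given by a homomorphism of the rings of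
coefficients. -/
abbrev reductionHom (n : ℤ) (hτm : ∀ m, ∀ x ∈ 𝒜 m, τ x ∈ ℬ m)
    (hτmul : ∀ q x, τ (χ₁ q * x) = χ₂ q * τ x) :
    ((P.baseChange χ₁.toRingHom h₁.mem_of_mem).toBigraded n).Hom
      ((P.baseChange χ₂.toRingHom h₂.mem_of_mem).toBigraded n) :=
  semilinearHom P χ₁.toRingHom h₁.mem_of_mem χ₂.toRingHom h₂.mem_of_mem τ hτmul
    fun _ => hτm _

/-- The projection from the tensor product with `posTerm` to the cone of the reductions. -/
def posTermProj (n : ℤ) (hτm : ∀ m, ∀ x ∈ 𝒜 m, τ x ∈ ℬ m)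
    (hτmul : ∀ q x, τ (χ₁ q * x) = χ₂ q * τ x) :
    ((P.tensor (posTerm 0 (-2) z t hz ht)).toBigraded n).Hom
      (BigradedModule.cone (reductionHom h₁ h₂ τ P (n + 2) hτm hτmul)) where
  f :=
    { toFun := fun (f : P.B × (Fin 2 ⊕ Fin 2) → R) =>
        ((fun b => χ₁ (f (b, .inl 0)) : P.B → A),
          (fun b => (((P.vdeg b).negOnePow : ℤ) : B) * χ₂ (f (b, .inr 0)) : P.B → B))
      map_add' := fun f g => Prod.ext (funext fun b => map_add χ₁ _ _)
        (funext fun b => (congrArg _ (map_add χ₂ _ _)).trans (mul_add _ _ _))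
      map_smul' := fun c f => Prod.ext (funext fun b => map_smul χ₁ c _)
        (funext fun b => (congrArg _ (map_smul χ₂ c _)).trans (mul_smul_comm _ _ _)) }
  mem {j i f} hf := by
    constructor
    · intro b
      obtain ⟨h3, h4⟩ := hf (b, .inl 0)
      change f (b, Sum.inl (0 : Fin 2)) ∈ ℛ (n - (P.pdeg b + -2)) at h3
      change f (b, Sum.inl (0 : Fin 2)) ≠ 0 → P.vdeg b + 0 = j ∧ P.hdeg b + 0 = i at h4
      rw [add_zero, add_zero] at h4
      rw [show n - (P.pdeg b + -2) = n + 2 - P.pdeg b by ring] at h3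
      exact ⟨h₁.mem_of_mem _ _ h3, fun h0 => h4 fun h5 => h0 ((congrArg χ₁ h5).trans (map_zero χ₁))⟩
    · intro b
      obtain ⟨h3, h4⟩ := hf (b, .inr 0)
      change f (b, Sum.inr (0 : Fin 2)) ∈ ℛ (n - (P.pdeg b + -2)) at h3
      change f (b, Sum.inr (0 : Fin 2)) ≠ 0 → P.vdeg b + 1 = j ∧ P.hdeg b + 0 = i at h4
      rw [add_zero, ← eq_sub_iff_add_eq] at h4
      rw [show n - (P.pdeg b + -2) = n + 2 - P.pdeg b by ring] at h3
      exact ⟨sgn_mul_mem _ _ (h₂.mem_of_mem _ _ h3), fun h0 => h4 fun h5 =>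
        sgn_mul_ne_zero h0 ((congrArg χ₂ h5).trans (map_zero χ₂))⟩
  dh f := by
    refine Prod.ext (funext fun b => ?_) (funext fun b => ?_)
    · refine (congrArg χ₁ (tensor_posTerm_dh_inl_zero hz ht P f b)).trans ?_
      rw [map_add, map_mul, map_mul, h₁.map_eq_zero, zero_mul, mul_zero, add_zero]
      exact map_mulVec χ₁.toRingHom _ _ _
    · refine (congrArg (fun y => (((P.vdeg b).negOnePow : ℤ) : B) * χ₂ y)
        (tensor_posTerm_dh_inr_zero hz ht P f b)).trans ?_
      beta_reduce
      rw [map_add, map_mul, map_mul, h₂.map_eq_zero, zero_mul, mul_zero, add_zero]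
      refine Eq.trans (congrArg _ (map_mulVec χ₂.toRingHom _ _ _)) ?_
      exact (dh_mulVec_sgn_vdeg (P.baseChange χ₂.toRingHom h₂.mem_of_mem) _ b).symm
  dv f := by
    refine Prod.ext (funext fun b => ?_) (funext fun b => ?_)
    · refine (congrArg χ₁ (tensor_posTerm_dv_inl_zero hz ht P f b)).trans ?_
      exact map_mulVec χ₁.toRingHom _ _ _
    · refine (congrArg (fun y => (((P.vdeg b).negOnePow : ℤ) : B) * χ₂ y)
        (tensor_posTerm_dv_inr_zero hz ht P f b)).trans ?_
      beta_reduce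
      rw [map_add, map_mul, map_intCast, mul_add, sgn_mul_self_cast]
      have h5 := dv_mulVec_sgn (P.baseChange χ₂.toRingHom h₂.mem_of_mem)
        (fun b => χ₂ (f (b, .inr 0))) b
      have h6 : χ₂ (P.dv.mulVec (fun a => f (a, .inr 0)) b) = (P.dv.map χ₂.toRingHom).mulVec
        (fun a => χ₂ (f (a, .inr 0))) b := map_mulVec χ₂.toRingHom P.dv _ b
      refine Eq.trans ?_ (congrArg (fun y => τ (χ₁ (f (b, .inl 0))) - y) h5.symm)
      rw [hτ, sub_neg_eq_add]
      exact (congrArg (fun y => (((P.vdeg b).negOnePow : ℤ) : B) * y + χ₂ (f (b, .inl 0)))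
        h6).trans (add_comm _ _)

/-- The two Koszul complexes resolve the quotients by the regular elements zt and t, and the
vertical map sends 1 to 1; so they may be replaced by the projection between these quotients. The
sign in the second component of `posTermProj` reconciles the tensor sign rule with that of the cone.
-/
lemma posTermProj_isAcyclicSurjection (n : ℤ) (hτm : ∀ m, ∀ x ∈ 𝒜 m, τ x ∈ ℬ m)
    (hτmul : ∀ q x, τ (χ₁ q * x) = χ₂ q * τ x) :
    (posTermProj h₁ h₂ hz ht τ hτ P n hτm hτmul).IsAcyclicSurjection := by
  -- The generators in Koszul degree 0 have internal degree −2, which accounts for the shift from n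
  -- to n + 2.
  have e1 (b : P.B) : n - (P.pdeg b + -2) = n + 2 - P.pdeg b := by ring
  constructor
  · rintro j i ⟨y₁, y₂⟩ ⟨hy₁, hy₂⟩
    change P.B → A at y₁
    change P.B → B at y₂
    have h3 : ∀ b, ∃ a ∈ ℛ (n + 2 - P.pdeg b), χ₁ a = y₁ b ∧ (y₁ b = 0 → a = 0) := fun b => by
      by_cases h0 : y₁ b = 0
      · exact ⟨0, Submodule.zero_mem _, by rw [map_zero, h0], fun _ => rfl⟩
      · obtain ⟨a, ha, hay⟩ := h₁.surj _ _ (hy₁ b).1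
        exact ⟨a, ha, hay, fun h1 => (h0 h1).elim⟩
    have h4 : ∀ b, ∃ a ∈ ℛ (n + 2 - P.pdeg b), χ₂ a = y₂ b ∧ (y₂ b = 0 → a = 0) := fun b => by
      by_cases h0 : y₂ b = 0
      · exact ⟨0, Submodule.zero_mem _, by rw [map_zero, h0], fun _ => rfl⟩
      · obtain ⟨a, ha, hay⟩ := h₂.surj _ _ (hy₂ b).1
        exact ⟨a, ha, hay, fun h1 => (h0 h1).elim⟩
    choose a₁ ha₁ hay₁ h0₁ using h3
    choose a₂ ha₂ hay₂ h0₂ using h4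
    refine ⟨fun (p : P.B × (Fin 2 ⊕ Fin 2)) => Sum.elim ![a₁ p.1, 0]
      ![(((P.vdeg p.1).negOnePow : ℤ) : R) * a₂ p.1, 0] p.2, ?_,
        Prod.ext (funext fun b => hay₁ b) (funext fun b => ?_)⟩
    · rintro ⟨b, c | c⟩ <;> fin_cases c
      · refine ⟨?_, fun h1 => ?_⟩
        · change a₁ b ∈ ℛ (n - (P.pdeg b + -2))
          rw [e1]
          exact ha₁ b
        · change P.vdeg b + 0 = j ∧ P.hdeg b + 0 = i
          rw [add_zero, add_zero]
          exact (hy₁ b).2 fun h2 => h1 (h0₁ b h2)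
      · exact ⟨Submodule.zero_mem _, fun h1 => (h1 rfl).elim⟩
      · refine ⟨?_, fun h1 => ?_⟩
        · change _ * a₂ b ∈ ℛ (n - (P.pdeg b + -2))
          rw [e1]
          exact sgn_mul_mem _ _ (ha₂ b)
        · change P.vdeg b + 1 = j ∧ P.hdeg b + 0 = i
          rw [add_zero, ← eq_sub_iff_add_eq]
          exact (hy₂ b).2 fun h2 => sgn_mul_ne_zero h1 (h0₂ b h2)
      · exact ⟨Submodule.zero_mem _, fun h1 => (h1 rfl).elim⟩
    · change (((P.vdeg b).negOnePow : ℤ) : B) * χ₂ ((((P.vdeg b).negOnePow : ℤ) : R) * a₂ b) = y₂ b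
      rw [map_mul, map_intCast, sgn_mul_self_cast]
      exact hay₂ b
  · intro j i f hf hf0 hdf
    change P.B × (Fin 2 ⊕ Fin 2) → R at f
    have hf1 (b : P.B) : χ₁ (f (b, .inl 0)) = 0 := congrFun (congrArg Prod.fst hf0) b
    have hf2 (b : P.B) : χ₂ (f (b, .inr 0)) = 0 := by
      have h3 : (((P.vdeg b).negOnePow : ℤ) : B) * χ₂ (f (b, .inr 0)) = 0 :=
        congrFun (congrArg Prod.snd hf0) b
      rw [← sgn_mul_self_cast (P.vdeg b) (χ₂ (f (b, .inr 0))), h3, mul_zero]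
    have hm1 : (fun b => f (b, .inl 0)) ∈ P.piece (n + 2) j (i + 1) := fun b => by
      obtain ⟨h3, h4⟩ := hf (b, .inl 0)
      change f (b, Sum.inl (0 : Fin 2)) ∈ ℛ (n - (P.pdeg b + -2)) at h3
      change f (b, Sum.inl (0 : Fin 2)) ≠ 0 → P.vdeg b + 0 = j ∧ P.hdeg b + 0 = i + 1 at h4
      rw [add_zero, add_zero] at h4
      rw [e1] at h3
      exact ⟨h3, h4⟩
    have hm2 : (fun b => f (b, .inr 0)) ∈ P.piece (n + 2) (j - 1) (i + 1) := fun b => by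
      obtain ⟨h3, h4⟩ := hf (b, .inr 0)
      change f (b, Sum.inr (0 : Fin 2)) ∈ ℛ (n - (P.pdeg b + -2)) at h3
      change f (b, Sum.inr (0 : Fin 2)) ≠ 0 → P.vdeg b + 1 = j ∧ P.hdeg b + 0 = i + 1 at h4
      rw [add_zero, ← eq_sub_iff_add_eq] at h4
      rw [e1] at h3
      exact ⟨h3, h4⟩
    obtain ⟨y₁, hy₁, hfy₁, hdy₁⟩ := exists_koszul_primitive h₁ P _ (fun b => f (b, .inl 1)) hm1 hf1
      fun b => (tensor_posTerm_dh_inl_zero hz ht P f b).symm.trans (congrFun hdf (b, .inl 0))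
    obtain ⟨y₂, hy₂, hfy₂, hdy₂⟩ := exists_koszul_primitive h₂ P _ (fun b => f (b, .inr 1)) hm2 hf2
      fun b => (tensor_posTerm_dh_inr_zero hz ht P f b).symm.trans (congrFun hdf (b, .inr 0))
    refine ⟨fun (p : P.B × (Fin 2 ⊕ Fin 2)) => Sum.elim ![0, y₁ p.1] ![0, y₂ p.1] p.2, ?_, ?_, ?_⟩
    · rintro ⟨b, c | c⟩ <;> fin_cases c
      · exact ⟨Submodule.zero_mem _, fun h1 => (h1 rfl).elim⟩
      · refine ⟨?_, fun h1 => ?_⟩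
        · change y₁ b ∈ ℛ (n - (P.pdeg b + 2))
          rw [show n - (P.pdeg b + 2) = n + 2 - 4 - P.pdeg b by ring]
          exact (hy₁ b).1
        · change P.vdeg b + 0 = j ∧ P.hdeg b + -1 = i
          have := (hy₁ b).2 h1
          constructor <;> lia
      · exact ⟨Submodule.zero_mem _, fun h1 => (h1 rfl).elim⟩
      · refine ⟨?_, fun h1 => ?_⟩
        · change y₂ b ∈ ℛ (n - (P.pdeg b + 0))
          rw [show n - (P.pdeg b + 0) = n + 2 - 2 - P.pdeg b by ring]
          exact (hy₂ b).1
        · change P.vdeg b + 1 = j ∧ P.hdeg b + -1 = i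
          have := (hy₂ b).2 h1
          constructor <;> lia
    · refine Prod.ext (funext fun b => map_zero χ₁) (funext fun b => ?_)
      exact (congrArg _ (map_zero χ₂)).trans (mul_zero _)
    · refine funext fun ⟨b, c⟩ => ?_
      have h0 : P.dh.mulVec (fun _ => (0 : R)) b = 0 := congrFun (Matrix.mulVec_zero P.dh) b
      rcases c with c | c <;> fin_cases c
      · refine (tensor_posTerm_dh_inl_zero hz ht P _ b).trans (Eq.trans ?_ (hfy₁ b).symm)
        exact (congrArg (· + _) h0).trans (zero_add _)
      · exact (tensor_posTerm_dh_inl_one hz ht P _ b).trans (congrFun hdy₁ b)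
      · refine (tensor_posTerm_dh_inr_zero hz ht P _ b).trans (Eq.trans ?_ (hfy₂ b).symm)
        exact (congrArg (· + _) h0).trans (zero_add _)
      · exact (tensor_posTerm_dh_inr_one hz ht P _ b).trans (congrFun hdy₂ b)

end PosTerm

end FreeBicomplex
end TripleLink

/-! ### Boundedness, and an injection into a cone with contractible cokernel -/

namespace TripleLink
namespace BigradedModule

variable {k : Type u} [Field k] (M N : BigradedModule k)

/-- Only finitely many rows and columns are nonzero. -/
def IsBounded : Prop := ∃ n : ℤ, ∀ j i : ℤ, (n < |j| ∨ n < |i|) → M.piece j i = ⊥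

variable {M N}

lemma IsBounded.toBicomplex (h : M.IsBounded) : M.toBicomplex.IsBounded := by
  obtain ⟨n, hn⟩ := h
  refine ⟨n, fun j i hji => ?_⟩
  have : Subsingleton (M.piece j i) := by
    rw [hn j i hji]
    infer_instance
  exact ModuleCat.isZero_of_subsingleton (ModuleCat.of k (M.piece j i))

lemma IsBounded.cone (hM : M.IsBounded) (hN : N.IsBounded) (θ : Hom M N) :
    (cone θ).IsBounded := by
  obtain ⟨m, hm⟩ := hM
  obtain ⟨n, hn⟩ := hN
  -- The second summand of the cone is shifted by one row.
  refine ⟨max m (n + 1), fun j i h => ?_⟩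
  have h1 : M.piece j i = ⊥ := hm j i (h.imp (le_max_left _ _).trans_lt (le_max_left _ _).trans_lt)
  have h2 : N.piece (j - 1) i = ⊥ := hn (j - 1) i (h.imp (fun h => by
    have h3 := (le_max_right _ _).trans_lt h
    have h4 := abs_sub_abs_le_abs_sub j 1
    have h5 := abs_sub_comm j 1
    rw [abs_one] at h4
    lia) fun h => by
      have h3 := (le_max_right _ _).trans_lt h
      lia)
  change (M.piece j i).prod (N.piece (j - 1) i) = ⊥
  rw [h1, h2, Submodule.prod_bot]

end BigradedModule

namespace FreeBicomplex

section Bounded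

variable {k Q : Type u} [Field k] [CommRing Q] [Algebra k Q] {𝒜 : ℤ → Submodule k Q}
  [SetLike.GradedMonoid 𝒜]

lemma isBounded_toBigraded (P : FreeBicomplex 𝒜) (n : ℤ) : (P.toBigraded n).IsBounded := by
  -- The basis is finite, so this sum bounds the degrees of all basis elements.
  refine ⟨∑ b, (|P.vdeg b| + |P.hdeg b|), fun j i h => ?_⟩
  refine (Submodule.eq_bot_iff _).2 fun f hf => funext fun b => ?_
  by_contra h0
  obtain ⟨rfl, rfl⟩ := (hf b).2 h0
  have h1 : |P.vdeg b| + |P.hdeg b| ≤ ∑ b, (|P.vdeg b| + |P.hdeg b|) :=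
    Finset.single_le_sum (f := fun b => |P.vdeg b| + |P.hdeg b|)
      (fun b _ => add_nonneg (abs_nonneg _) (abs_nonneg _)) (Finset.mem_univ b)
  have h2 := abs_nonneg (P.vdeg b)
  have h3 := abs_nonneg (P.hdeg b)
  rcases h with h | h <;> lia

lemma baseChange_congr {Q' : Type u} [CommRing Q'] [Algebra k Q'] {ℬ : ℤ → Submodule k Q'}
    (P : FreeBicomplex 𝒜) {φ ψ : Q →+* Q'} (hφ : ∀ n a, a ∈ 𝒜 n → φ a ∈ ℬ n)
    (hψ : ∀ n a, a ∈ 𝒜 n → ψ a ∈ ℬ n) (h : φ = ψ) : P.baseChange φ hφ = P.baseChange ψ hψ := by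
  subst h
  rfl

lemma tensor_idTwoTerm_dh (P : FreeBicomplex 𝒜) (a : ℤ) (f : P.B × Fin 2 → Q) (b : P.B)
    (c : Fin 2) : (P.tensor (idTwoTerm 𝒜 a)).dh.mulVec f (b, c) =
      P.dh.mulVec (fun a => f (a, c)) b :=
  (tensor_dh_mulVec P (idTwoTerm 𝒜 a) f (b, c)).trans
    ((congrArg (fun y => P.dh.mulVec (fun a => f (a, c)) b + (((P.hdeg b).negOnePow : ℤ) : Q) * y)
      (congrFun (Matrix.zero_mulVec (fun c => f (b, c))) c)).trans
        (by rw [Pi.zero_apply, mul_zero, add_zero]))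

lemma idTwoTerm_dv_mulVec (a : ℤ) (f : Fin 2 → Q) :
    (idTwoTerm 𝒜 a).dv.mulVec f = ![0, f 0] := by
  change (!![0, 0; 1, 0] : Matrix (Fin 2) (Fin 2) Q).mulVec f = _
  ext c
  fin_cases c <;> simp [Matrix.mulVec, dotProduct, Fin.sum_univ_two]

lemma tensor_idTwoTerm_dv_zero (P : FreeBicomplex 𝒜) (a : ℤ) (f : P.B × Fin 2 → Q) (b : P.B) :
    (P.tensor (idTwoTerm 𝒜 a)).dv.mulVec f (b, (0 : Fin 2)) =
      P.dv.mulVec (fun a => f (a, 0)) b :=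
  (tensor_dv_mulVec P (idTwoTerm 𝒜 a) f (b, (0 : Fin 2))).trans
    ((congrArg (fun y => P.dv.mulVec (fun a => f (a, 0)) b + (((P.vdeg b).negOnePow : ℤ) : Q) * y)
      (congrFun (idTwoTerm_dv_mulVec a (fun c => f (b, c))) (0 : Fin 2))).trans (by simp))

lemma tensor_idTwoTerm_dv_one (P : FreeBicomplex 𝒜) (a : ℤ) (f : P.B × Fin 2 → Q) (b : P.B) :
    (P.tensor (idTwoTerm 𝒜 a)).dv.mulVec f (b, (1 : Fin 2)) =
      P.dv.mulVec (fun a => f (a, 1)) b + (((P.vdeg b).negOnePow : ℤ) : Q) * f (b, 0) :=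
  (tensor_dv_mulVec P (idTwoTerm 𝒜 a) f (b, (1 : Fin 2))).trans
    (congrArg (fun y => P.dv.mulVec (fun a => f (a, 1)) b + (((P.vdeg b).negOnePow : ℤ) : Q) * y)
      (congrFun (idTwoTerm_dv_mulVec a (fun c => f (b, c))) (1 : Fin 2)))

end Bounded

section Injection

variable {k Q T A B : Type u} [Field k] [CommRing Q] [Algebra k Q] [CommRing T] [Algebra k T]
  [CommRing A] [Algebra k A] [CommRing B] [Algebra k B]
  {𝒬 : ℤ → Submodule k Q} {𝒯 : ℤ → Submodule k T} {𝒜 : ℤ → Submodule k A} {ℬ : ℤ → Submodule k B}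
  [SetLike.GradedMonoid 𝒬] [SetLike.GradedMonoid 𝒯] [SetLike.GradedMonoid 𝒜]
  [SetLike.GradedMonoid ℬ]
  (P : FreeBicomplex 𝒬) {ρ : Q →+* T} (hρ : ∀ n a, a ∈ 𝒬 n → ρ a ∈ 𝒯 n)
  {π₁ : Q →+* A} (h₁ : ∀ n a, a ∈ 𝒬 n → π₁ a ∈ 𝒜 n)
  {π₂ : Q →+* B} (h₂ : ∀ n a, a ∈ 𝒬 n → π₂ a ∈ ℬ n)
  (L : T →ₗ[k] A) (hL : ∀ q x, L (ρ q * x) = π₁ q * L x) (hLm : ∀ m, ∀ x ∈ 𝒯 m, L x ∈ 𝒜 (m + 2))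
  (τ : A →ₗ[k] B) (hτ : ∀ q x, τ (π₁ q * x) = π₂ q * τ x) (hτm : ∀ m, ∀ x ∈ 𝒜 m, τ x ∈ ℬ m)
  (hτL : ∀ x, τ (L x) = 0)

/-- The first component of the injection into the cone. -/
abbrev injectionHom (n : ℤ) : ((P.baseChange ρ hρ).toBigraded n).Hom
    ((P.baseChange π₁ h₁).toBigraded (n + 2)) :=
  semilinearHom P ρ hρ π₁ h₁ L hL fun m x hx => by
    have := hLm _ x hx
    rwa [show n - m + 2 = n + 2 - m by ring] at this

/-- The inclusion of the kernel of `θ` into the cone of `θ`. -/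
def _root_.TripleLink.BigradedModule.Hom.toCone {L M N : BigradedModule k} (ι : L.Hom M)
    (θ : M.Hom N) (h : ∀ x, θ.f (ι.f x) = 0) : L.Hom (BigradedModule.cone θ) where
  f := LinearMap.inl k M.V N.V ∘ₗ ι.f
  mem hx := ⟨ι.mem hx, Submodule.zero_mem _⟩
  dh x := Prod.ext (ι.dh x) (map_zero N.dh).symm
  dv x := Prod.ext (ι.dv x) (by
    change 0 = θ.f (ι.f x) - N.dv 0
    rw [h, map_zero, sub_zero])

/-- The projection from the cone to the cone of an identity morphism. -/
def coneProj (n : ℤ) : (BigradedModule.cone (semilinearHom P π₁ h₁ π₂ h₂ τ hτ (n := n + 2)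
      (n' := n + 2) fun _ => hτm _)).Hom
    (((P.baseChange π₂ h₂).tensor (idTwoTerm ℬ (-2))).toBigraded n) where
  f :=
    { toFun := fun (f : (P.B → A) × (P.B → B)) => (fun (p : P.B × Fin 2) =>
        ![τ (f.1 p.1), (((P.vdeg p.1).negOnePow : ℤ) : B) * f.2 p.1] p.2 : P.B × Fin 2 → B)
      map_add' := fun f g => funext fun ⟨b, c⟩ => by
        fin_cases c
        · exact map_add τ _ _
        · exact mul_add _ _ _
      map_smul' := fun r f => funext fun ⟨b, c⟩ => by
        fin_cases c
        · exact map_smul τ r _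
        · exact mul_smul_comm _ _ _ }
  mem {j i f} hf := by
    rintro ⟨b, c⟩
    fin_cases c
    · refine ⟨?_, fun h => ?_⟩
      · change τ (f.1 b) ∈ ℬ (n - (P.pdeg b + -2))
        rw [show n - (P.pdeg b + -2) = n + 2 - P.pdeg b by ring]
        exact hτm _ _ (hf.1 b).1
      · change P.vdeg b + 0 = j ∧ P.hdeg b + 0 = i
        rw [add_zero, add_zero]
        exact (hf.1 b).2 fun h0 => h ((congrArg τ h0).trans (map_zero τ))
    · refine ⟨?_, fun h => ?_⟩
      · change _ * f.2 b ∈ ℬ (n - (P.pdeg b + -2))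
        rw [show n - (P.pdeg b + -2) = n + 2 - P.pdeg b by ring]
        exact sgn_mul_mem _ _ (hf.2 b).1
      · change P.vdeg b + 1 = j ∧ P.hdeg b + 0 = i
        rw [add_zero, ← eq_sub_iff_add_eq]
        exact (hf.2 b).2 fun h0 => h ((congrArg _ h0).trans (mul_zero _))
  dh f := funext fun ⟨b, c⟩ => by
    refine Eq.trans ?_ (tensor_idTwoTerm_dh (P.baseChange π₂ h₂) (-2) _ b c).symm
    fin_cases c
    · exact semilinear_mulVec π₁ π₂ τ hτ P.dh f.1 b
    · exact (dh_mulVec_sgn_vdeg (P.baseChange π₂ h₂) f.2 b).symm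
  dv f := funext fun ⟨b, c⟩ => by
    fin_cases c
    · refine Eq.trans ?_ (tensor_idTwoTerm_dv_zero (P.baseChange π₂ h₂) (-2) _ b).symm
      exact semilinear_mulVec π₁ π₂ τ hτ P.dv f.1 b
    · refine Eq.trans ?_ (tensor_idTwoTerm_dv_one (P.baseChange π₂ h₂) (-2) _ b).symm
      refine Eq.trans ?_ (congrArg (· + (((P.vdeg b).negOnePow : ℤ) : B) * τ (f.1 b))
        (dv_mulVec_sgn (P.baseChange π₂ h₂) f.2 b).symm)
      refine Eq.trans (mul_sub _ _ _) ?_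
      rw [sub_eq_add_neg, add_comm]
      rfl

-- The hypotheses say that 0 → T → A → B → 0 is exact, with L of degree 2. For free modules the
-- kernel of the induced map θ is the image of L, and it lies in the first summand of the cone of θ.
-- Dividing by it replaces the first summand by the image of θ, so the quotient is the cone of the
-- identity over B.
include hL hLm hτL hτm in
lemma exists_injection (n : ℤ) (hLinj : ∀ x, L x = 0 → x = 0)
    (hLex : ∀ m, ∀ y ∈ 𝒜 (m + 2), τ y = 0 → ∃ x ∈ 𝒯 m, L x = y)
    (hτs : ∀ m, ∀ y ∈ ℬ m, ∃ x ∈ 𝒜 m, τ x = y) :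
    ∃ ι : (P.baseChange ρ hρ).toBicomplex n ⟶
      (BigradedModule.cone (semilinearHom P π₁ h₁ π₂ h₂ τ hτ (n := n + 2)
        (n' := n + 2) fun _ => hτm _)).toBicomplex,
      Mono ι ∧ Nonempty (cokernel ι ≅
        ((P.baseChange π₂ h₂).tensor (idTwoTerm ℬ (-2))).toBicomplex n) := by
  let ι := (injectionHom P hρ h₁ L hL hLm n).toCone (semilinearHom P π₁ h₁ π₂ h₂ τ hτ (n := n + 2)
        (n' := n + 2) fun _ => hτm _) fun x => funext fun b => hτL _
  let φ := coneProj P h₁ h₂ τ hτ hτm n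
  have hinj : ∀ j i, ∀ x ∈ ((P.baseChange ρ hρ).toBigraded n).piece j i, ι.f x = 0 → x = 0 :=
    fun j i x _ h => funext fun b => hLinj _ (congrFun (congrArg Prod.fst h) b)
  have hzero : ∀ j i, ∀ x ∈ ((P.baseChange ρ hρ).toBigraded n).piece j i, φ.f (ι.f x) = 0 :=
    fun j i x _ => funext fun ⟨b, c⟩ => by
      fin_cases c
      · exact hτL _
      · exact mul_zero _
  have hex : ∀ j i, ∀ x ∈ (BigradedModule.cone (semilinearHom P π₁ h₁ π₂ h₂ τ hτ (n := n + 2)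
      (n' := n + 2) fun _ => hτm _)).piece j i, φ.f x = 0 →
      ∃ y ∈ ((P.baseChange ρ hρ).toBigraded n).piece j i, ι.f y = x := by
    rintro j i ⟨x₁, x₂⟩ hx h
    change P.B → A at x₁
    change P.B → B at x₂
    have e1 : ∀ b, ∃ y ∈ 𝒯 (n - P.pdeg b), L y = x₁ b := fun b => by
      refine hLex _ _ ?_ (congrFun h (b, (0 : Fin 2)))
      rw [show n - P.pdeg b + 2 = n + 2 - P.pdeg b by ring]
      exact (hx.1 b).1
    choose y hy hyx using e1
    refine ⟨y, fun b => ⟨hy b, fun h0 => (hx.1 b).2 fun h1 => h0 (hLinj _ ((hyx b).trans h1))⟩,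
      Prod.ext (funext hyx) (funext fun b => ?_)⟩
    have h2 : (((P.vdeg b).negOnePow : ℤ) : B) * x₂ b = 0 := congrFun h (b, (1 : Fin 2))
    have h3 := sgn_mul_self_cast (P.vdeg b) (x₂ b)
    rw [h2, mul_zero] at h3
    exact h3
  have hsurj : ∀ j i, ∀ y ∈ (((P.baseChange π₂ h₂).tensor (idTwoTerm ℬ (-2))).toBigraded n).piece
      j i, ∃ x ∈ (BigradedModule.cone (semilinearHom P π₁ h₁ π₂ h₂ τ hτ (n := n + 2)
      (n' := n + 2) fun _ => hτm _)).piece j i, φ.f x = y := by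
    intro j i y hy
    change P.B × Fin 2 → B at y
    have e1 : ∀ b, ∃ x ∈ 𝒜 (n + 2 - P.pdeg b), τ x = y (b, 0) ∧ (y (b, 0) = 0 → x = 0) := by
      intro b
      by_cases h0 : y (b, 0) = 0
      · exact ⟨0, Submodule.zero_mem _, by rw [map_zero, h0], fun _ => rfl⟩
      · have h1 : y (b, 0) ∈ ℬ (n - (P.pdeg b + -2)) := (hy (b, (0 : Fin 2))).1
        rw [show n - (P.pdeg b + -2) = n + 2 - P.pdeg b by ring] at h1
        obtain ⟨x, hx, hxy⟩ := hτs _ _ h1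
        exact ⟨x, hx, hxy, fun h => (h0 h).elim⟩
    choose x hx hxy hx0 using e1
    refine ⟨(x, fun b => (((P.vdeg b).negOnePow : ℤ) : B) * y (b, 1)), ⟨fun b => ⟨hx b,
      fun h0 => ?_⟩, fun b => ⟨?_, fun h0 => ?_⟩⟩, funext fun ⟨b, c⟩ => ?_⟩
    · have h1 : P.vdeg b + 0 = j ∧ P.hdeg b + 0 = i :=
        (hy (b, (0 : Fin 2))).2 fun h => h0 (hx0 b h)
      rwa [add_zero, add_zero] at h1
    · have h1 : y (b, 1) ∈ ℬ (n - (P.pdeg b + -2)) := (hy (b, (1 : Fin 2))).1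
      rw [show n - (P.pdeg b + -2) = n + 2 - P.pdeg b by ring] at h1
      exact sgn_mul_mem _ _ h1
    · have h1 : P.vdeg b + 1 = j ∧ P.hdeg b + 0 = i :=
        (hy (b, (1 : Fin 2))).2 (sgn_mul_ne_zero h0)
      rwa [add_zero, ← eq_sub_iff_add_eq] at h1
    · fin_cases c
      · exact hxy b
      · exact sgn_mul_self_cast _ _
  exact ⟨ι.toMor, BigradedModule.mono_toMor ι φ hinj hzero hex hsurj,
    BigradedModule.cokernel_toMor_iso ι φ hinj hzero hex hsurj⟩

end Injection

end FreeBicomplex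
end TripleLink

/-! ### The ideals given by the ends of W, and the existence of ι -/

namespace TripleLink
namespace FreeBicomplex

variable {k Q R A B : Type u} [Field k] [CommRing Q] [Algebra k Q] [CommRing R] [Algebra k R]
  [CommRing A] [Algebra k A] [CommRing B] [Algebra k B]
  {𝒬 : ℤ → Submodule k Q} {ℛ : ℤ → Submodule k R} {𝒜 : ℤ → Submodule k A} {ℬ : ℤ → Submodule k B}
  [SetLike.GradedMonoid 𝒬] [SetLike.GradedMonoid ℛ] [SetLike.GradedMonoid 𝒜]
  [SetLike.GradedMonoid ℬ]

/-- Reducing in two steps through R or in one step gives the same module. This matches the target of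
`posTermProj` with that of `exists_injection`. -/
lemma cone_semilinearHom_baseChange (P : FreeBicomplex 𝒬) (π : Q →+* R)
    (hπ : ∀ n a, a ∈ 𝒬 n → π a ∈ ℛ n) (χ₁ : R →+* A) (h₁ : ∀ n a, a ∈ ℛ n → χ₁ a ∈ 𝒜 n)
    (χ₂ : R →+* B) (h₂ : ∀ n a, a ∈ ℛ n → χ₂ a ∈ ℬ n) (τ : A →ₗ[k] B)
    (hτ : ∀ q x, τ (χ₁ q * x) = χ₂ q * τ x) {n n' : ℤ}
    (hmem : ∀ m, ∀ x ∈ 𝒜 (n - m), τ x ∈ ℬ (n' - m)) :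
    BigradedModule.cone (semilinearHom (P.baseChange π hπ) χ₁ h₁ χ₂ h₂ τ hτ hmem) =
      BigradedModule.cone (semilinearHom P (χ₁.comp π) (fun n a ha => h₁ _ _ (hπ n a ha))
        (χ₂.comp π) (fun n a ha => h₂ _ _ (hπ n a ha)) τ (fun q => hτ (π q)) hmem) :=
  rfl

end FreeBicomplex

namespace TangleDiagram

open FreeBicomplex

section Ideals

variable (k : Type u) [Field k] (W : TangleDiagram 2)

/-- The polynomial `b - a`. -/
noncomputable def polyU : W.Ring k := MvPolynomial.X (.start 1) - MvPolynomial.X (.finish 0)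

/-- The polynomial `c - a`. -/
noncomputable def polyZ : W.Ring k := MvPolynomial.X (.start 0) - MvPolynomial.X (.finish 0)

lemma polyU_mem : W.polyU k ∈ polyGr k W.Flags 2 :=
  sub_mem (X_mem_polyGr k _) (X_mem_polyGr k _)

lemma polyZ_mem : W.polyZ k ∈ polyGr k W.Flags 2 :=
  sub_mem (X_mem_polyGr k _) (X_mem_polyGr k _)

lemma polyZ_mul_polyU_mem : W.polyZ k * W.polyU k ∈ polyGr k W.Flags 4 :=
  SetLike.GradedMul.mul_mem (W.polyZ_mem k) (W.polyU_mem k)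

lemma mk_polyU : Ideal.Quotient.mkₐ k (W.endIdeal k) (W.polyU k) = W.endU k := map_sub _ _ _

lemma mk_polyZ : Ideal.Quotient.mkₐ k (W.endIdeal k) (W.polyZ k) = W.endZ k := map_sub _ _ _

lemma mk_polyZ_mul_polyU : Ideal.Quotient.mkₐ k (W.endIdeal k) (W.polyZ k * W.polyU k) =
    W.endZ k * W.endU k :=
  (map_mul _ _ _).trans (congrArg₂ _ (W.mk_polyZ k) (W.mk_polyU k))

/-- The ideal defining the ring of `closeTrivial`. -/
noncomputable def trivialIdeal : Ideal (W.Ring k) := W.endIdeal k ⊔ Ideal.span {W.polyZ k}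

/-- The ideal defining the first row of the reduction of `closeBigon`. -/
noncomputable def productIdeal : Ideal (W.Ring k) :=
  W.endIdeal k ⊔ Ideal.span {W.polyZ k * W.polyU k}

lemma endRel_mem_endIdeal : W.endRel k ∈ W.endIdeal k := Ideal.mem_span_singleton_self _

lemma turnbackIdeal_eq : W.turnbackIdeal k = W.endIdeal k ⊔ Ideal.span {W.polyU k} := by
  refine le_antisymm (Ideal.span_le.2 ?_) (sup_le (Ideal.span_le.2 ?_) (Ideal.span_le.2 ?_))
  · have hw := Ideal.mem_sup_left (T := Ideal.span {W.polyU k}) (W.endRel_mem_endIdeal k)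
    have hu := Ideal.mem_sup_right (S := W.endIdeal k) (Ideal.mem_span_singleton_self (W.polyU k))
    rintro x (rfl | rfl)
    · have := neg_mem hu
      rwa [polyU, neg_sub] at this
    · have e : MvPolynomial.X (.start 0) - MvPolynomial.X (.finish 1) =
          W.endRel k - W.polyU k := by
        rw [polyU, endRel]
        ring
      rw [SetLike.mem_coe, e]
      exact sub_mem hw hu
  all_goals
    rintro _ rfl
    have h1 : MvPolynomial.X (.finish 0) - MvPolynomial.X (.start 1) ∈ W.turnbackIdeal k :=
      Ideal.subset_span (Or.inl rfl)
    have h2 : MvPolynomial.X (.start 0) - MvPolynomial.X (.finish 1) ∈ W.turnbackIdeal k :=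
      Ideal.subset_span (Or.inr rfl)
  · have := sub_mem h2 h1
    rw [SetLike.mem_coe, endRel]
    convert this using 1
    ring
  · have := neg_mem h1
    rwa [neg_sub] at this

lemma productIdeal_le : W.productIdeal k ≤ W.turnbackIdeal k := by
  rw [turnbackIdeal_eq]
  refine sup_le_sup le_rfl (Ideal.span_le.2 ?_)
  rintro _ rfl
  exact Ideal.mul_mem_left _ _ (Ideal.mem_span_singleton_self _)

lemma turnbackIdeal_eq_productIdeal_sup :
    W.turnbackIdeal k = W.productIdeal k ⊔ Ideal.span {W.polyU k} := by
  refine le_antisymm ?_ (sup_le (W.productIdeal_le k) ?_)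
  · rw [turnbackIdeal_eq]
    exact sup_le_sup le_sup_left le_rfl
  · rw [turnbackIdeal_eq]
    exact le_sup_right

attribute [local instance] MvPolynomial.weightedGradedAlgebra

lemma isHomogeneous_span_singleton {σ : Type} {x : MvPolynomial σ k} {n : ℤ}
    (hx : x ∈ polyGr k σ n) : (Ideal.span {x}).IsHomogeneous (polyGr k σ) :=
  isHomogeneous_span (by rintro _ rfl; exact ⟨n, hx⟩)

lemma endIdeal_isHomogeneous : (W.endIdeal k).IsHomogeneous (polyGr k W.Flags) :=
  isHomogeneous_span_singleton k (W.endRel_mem k)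

lemma trivialIdeal_isHomogeneous : (W.trivialIdeal k).IsHomogeneous (polyGr k W.Flags) :=
  (W.endIdeal_isHomogeneous k).sup (isHomogeneous_span_singleton k (W.polyZ_mem k))

lemma productIdeal_isHomogeneous : (W.productIdeal k).IsHomogeneous (polyGr k W.Flags) :=
  (W.endIdeal_isHomogeneous k).sup (isHomogeneous_span_singleton k (W.polyZ_mul_polyU_mem k))

lemma turnbackIdeal_isHomogeneous : (W.turnbackIdeal k).IsHomogeneous (polyGr k W.Flags) := by
  rw [turnbackIdeal_eq]
  exact (W.endIdeal_isHomogeneous k).sup (isHomogeneous_span_singleton k (W.polyU_mem k))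

/-- The substitution that eliminates the relation between the ends. -/
noncomputable def endSubst : W.Ring k →ₐ[k] W.Ring k :=
  MvPolynomial.aeval fun v => match v with
    | .finish 0 => MvPolynomial.X (.start 0) - MvPolynomial.X (.finish 1) +
        MvPolynomial.X (.start 1)
    | v => MvPolynomial.X v

lemma endSubst_endIdeal (f : W.Ring k) (hf : f ∈ W.endIdeal k) : W.endSubst k f = 0 := by
  suffices W.endIdeal k ≤ RingHom.ker (W.endSubst k) from this hf
  refine Ideal.span_le.2 ?_
  rintro _ rfl
  change W.endSubst k _ = 0
  simp [endSubst, endRel]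

lemma endSubst_sub_mem (v : W.Flags) :
    W.endSubst k (MvPolynomial.X v) - MvPolynomial.X v ∈ W.endIdeal k := by
  have h0 (f : W.Ring k) : f - f ∈ W.endIdeal k := by
    rw [sub_self]
    exact Submodule.zero_mem _
  rw [endSubst, MvPolynomial.aeval_X]
  rcases v with ⟨x, b⟩ | ⟨x, b⟩ | m | i | i
  · exact h0 _
  · exact h0 _
  · exact h0 _
  · exact h0 _
  · fin_cases i
    · exact W.endRel_mem_endIdeal k
    · exact h0 _

/-- Eliminating a turns b − a into d − c, which is nonzero at the point with d = 1 and all other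
flags 0. The same point serves for c − a, which turns into d − b. -/
lemma mem_endIdeal_of_polyU_mul (g : W.Ring k) (hg : W.polyU k * g ∈ W.endIdeal k) :
    g ∈ W.endIdeal k := by
  refine mem_of_mul_mem_of_substitution (W.endSubst k) (W.endSubst_endIdeal k)
    (W.endSubst_sub_mem k) (fun h => ?_) g hg
  have h1 := congrArg (MvPolynomial.eval (fun v : W.Flags => match v with
    | .finish 1 => (1 : k)
    | _ => 0)) h
  simp [endSubst, polyU] at h1

lemma mem_endIdeal_of_polyZ_mul (g : W.Ring k) (hg : W.polyZ k * g ∈ W.endIdeal k) :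
    g ∈ W.endIdeal k := by
  refine mem_of_mul_mem_of_substitution (W.endSubst k) (W.endSubst_endIdeal k)
    (W.endSubst_sub_mem k) (fun h => ?_) g hg
  have h1 := congrArg (MvPolynomial.eval (fun v : W.Flags => match v with
    | .finish 1 => (1 : k)
    | _ => 0)) h
  simp [endSubst, polyZ] at h1

/-- As u is regular in R, ug ∈ (zu) can be divided by u to give g ∈ (z). Hence multiplication by u
embeds R/(z) into R/(zu). -/
lemma polyU_mul_mem_productIdeal_iff (g : W.Ring k) :
    W.polyU k * g ∈ W.productIdeal k ↔ g ∈ W.trivialIdeal k := by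
  constructor
  · intro h
    obtain ⟨e, he, y, hy, h1⟩ := Submodule.mem_sup.1 h
    obtain ⟨a, rfl⟩ := Ideal.mem_span_singleton'.1 hy
    have h2 : W.polyU k * (g - a * W.polyZ k) ∈ W.endIdeal k := by
      rw [show W.polyU k * (g - a * W.polyZ k) = e by linear_combination -h1]
      exact he
    exact Submodule.mem_sup.2 ⟨_, W.mem_endIdeal_of_polyU_mul k _ h2, a * W.polyZ k,
      Ideal.mem_span_singleton'.2 ⟨a, rfl⟩, sub_add_cancel _ _⟩
  · intro h
    obtain ⟨e, he, y, hy, rfl⟩ := Submodule.mem_sup.1 h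
    obtain ⟨a, rfl⟩ := Ideal.mem_span_singleton'.1 hy
    rw [mul_add]
    refine add_mem (Ideal.mem_sup_left (Ideal.mul_mem_left _ _ he)) (Ideal.mem_sup_right ?_)
    exact Ideal.mem_span_singleton'.2 ⟨a, by ring⟩

/-- The homomorphism from the ring of `W` to the ring of `closeTrivial`. -/
noncomputable abbrev trivialHom : W.Ring k →ₐ[k] W.closeTrivial.Ring k :=
  MvPolynomial.rename W.trivialFlag

/-- A section of `trivialFlag`. -/
def trivialSection : W.closeTrivial.Flags → W.Flags
  | .outgoing x b => .outgoing x b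
  | .incoming x b => .incoming x b
  | .mark (.inl m) => .mark m
  | .mark (.inr i) => .start i
  | .start i => i.elim0
  | .finish i => i.elim0

lemma trivialFlag_trivialSection (v : W.closeTrivial.Flags) :
    W.trivialFlag (W.trivialSection v) = v := by
  rcases v with ⟨x, b⟩ | ⟨x, b⟩ | (m | i) | i | i
  · rfl
  · rfl
  · rfl
  · rfl
  · exact i.elim0
  · exact i.elim0

lemma trivialHom_rename (f : W.closeTrivial.Ring k) :
    W.trivialHom k (MvPolynomial.rename W.trivialSection f) = f := by
  rw [trivialHom, MvPolynomial.rename_rename]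
  have : W.trivialFlag ∘ W.trivialSection = id := funext W.trivialFlag_trivialSection
  rw [this, MvPolynomial.rename_id_apply]

/-- Joining the ends along both strands means a = c and b = d. The first relation is z = 0, and the
second is the difference of the relation between the ends and z. -/
lemma presents_trivialHom :
    Presents (polyGr k W.closeTrivial.Flags) (W.trivialHom k) (W.trivialIdeal k) where
  surj f := ⟨_, W.trivialHom_rename k f⟩
  ker := by
    refine ker_eq_of_section _ (fun f hf => ?_)
      ((Ideal.Quotient.mkₐ k (W.trivialIdeal k)).comp (MvPolynomial.rename W.trivialSection))
      fun v => ?_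
    · suffices W.trivialIdeal k ≤ RingHom.ker (W.trivialHom k) from this hf
      refine sup_le (Ideal.span_le.2 ?_) (Ideal.span_le.2 ?_)
      · rintro _ rfl
        change W.trivialHom k _ = 0
        simp [endRel, trivialFlag]
      · rintro _ rfl
        change W.trivialHom k _ = 0
        simp [polyZ, trivialFlag]
    · rw [MvPolynomial.rename_X, AlgHom.comp_apply, MvPolynomial.rename_X]
      rcases v with ⟨x, b⟩ | ⟨x, b⟩ | m | i | i
      · rfl
      · rfl
      · rfl
      · rfl
      · have hw := Ideal.mem_sup_left (T := Ideal.span {W.polyZ k}) (W.endRel_mem_endIdeal k)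
        have hz := Ideal.mem_sup_right (S := W.endIdeal k)
          (Ideal.mem_span_singleton_self (W.polyZ k))
        refine (Ideal.Quotient.mk_eq_mk_iff_sub_mem _ _).2 ?_
        fin_cases i
        · exact hz
        · have := sub_mem hw hz
          have e : (MvPolynomial.X (.start 1) - MvPolynomial.X (.finish 1) : W.Ring k) =
              W.endRel k - W.polyZ k := by
            rw [endRel, polyZ]
            ring
          change (MvPolynomial.X (.start 1) - MvPolynomial.X (.finish 1) : W.Ring k) ∈ _
          rw [e]
          exact this
  gr n := by
    have h (f) (hf : f ∈ polyGr k W.closeTrivial.Flags n) :=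
      aeval_mem (MvPolynomial.rename W.trivialSection : W.closeTrivial.Ring k →ₐ[k] W.Ring k)
        (fun v => by rw [MvPolynomial.rename_X]; exact X_mem_polyGr k _) n f hf
    refine le_antisymm (fun f hf => Submodule.mem_map.2 ⟨_, h f hf, W.trivialHom_rename k f⟩) ?_
    · rintro _ ⟨f, hf, rfl⟩
      exact W.rename_mem k W.closeTrivial W.trivialFlag n f hf
  homogeneous := W.trivialIdeal_isHomogeneous k

/-- The injection given by multiplication by `b - a`. -/
noncomputable def mulPolyU : W.closeTrivial.Ring k →ₗ[k] W.Ring k ⧸ W.productIdeal k :=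
  (Ideal.Quotient.mkₐ k (W.productIdeal k)).toLinearMap ∘ₗ
    LinearMap.mulLeft k (W.polyU k) ∘ₗ
      (MvPolynomial.rename W.trivialSection :
        W.closeTrivial.Ring k →ₐ[k] W.Ring k).toLinearMap

/-- `mulPolyU` lifts along an arbitrary section. The result does not depend on the lift, because u
annihilates z modulo zu. -/
lemma mulPolyU_trivialHom (g : W.Ring k) : W.mulPolyU k (W.trivialHom k g) =
    Ideal.Quotient.mkₐ k (W.productIdeal k) (W.polyU k * g) := by
  refine (Ideal.Quotient.mk_eq_mk_iff_sub_mem _ _).2 ?_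
  change W.polyU k * MvPolynomial.rename W.trivialSection (W.trivialHom k g) - W.polyU k * g ∈ _
  rw [← mul_sub, polyU_mul_mem_productIdeal_iff, ← (W.presents_trivialHom k).map_eq_zero_iff,
    map_sub, trivialHom_rename, sub_self]

end Ideals

variable (k : Type u) [Field k] [HasDerivedCategory.{w} (ModuleCat.{u} k)]
  (W : TangleDiagram 2) (s : Bool) (n : ℤ)

lemma closeBigon_kdIso_posTerm : KDIso.{w} (((W.closeBigon s).KR k).toBicomplex n)
    (((W.endKR k).tensor (posTerm 0 (-2) (W.endZ k) (W.endU k) (W.endZ_mem k)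
      (W.endU_mem k))).toBicomplex n) :=
  (W.closeBigon_kdIso.{w} k s n).trans (kdIso_bigon_retract.{w} (W.endZ_mem k) (W.endU_mem k)
    (W.C_endZ_sub_X_mem k) (W.endKR k) n)

/-- The injection comes from 0 → R/(z) → R/(zu) → R/(u) → 0, with multiplication by u as first map.
The source represents K, and the cone of the second map represents K'. -/
lemma nonempty_iibInjection : Nonempty (IIbInjection.{w} k W s n) := by
  have hR := Presents.quotient (W.endIdeal_isHomogeneous k)
  have hA := Presents.quotient (W.productIdeal_isHomogeneous k)
  have hB := Presents.quotient (W.turnbackIdeal_isHomogeneous k)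
  have hT := W.presents_trivialHom k
  -- The product zu is regular in R since both factors are.
  obtain ⟨χ₁, hχ₁, hq₁⟩ := hR.isQuotientBy hA (W.polyZ_mul_polyU_mem k) rfl fun g hg => by
    rw [mul_comm (W.polyZ k), mul_assoc] at hg
    exact W.mem_endIdeal_of_polyZ_mul k g (W.mem_endIdeal_of_polyU_mul k _ hg)
  obtain ⟨χ₂, hχ₂, hq₂⟩ := hR.isQuotientBy hB (W.polyU_mem k) (W.turnbackIdeal_eq k)
    (W.mem_endIdeal_of_polyU_mul k)
  rw [mk_polyZ_mul_polyU] at hq₁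
  rw [mk_polyU] at hq₂
  let τ : W.Ring k ⧸ W.productIdeal k →ₐ[k] W.Ring k ⧸ W.turnbackIdeal k :=
    Ideal.Quotient.factorₐ k (W.productIdeal_le k)
  have hτ : ∀ x, τ (χ₁ x) = χ₂ x := fun x => by
    obtain ⟨f, rfl⟩ := hR.surj x
    rw [hχ₁, hχ₂]
    rfl
  have hτmul : ∀ q x, τ (χ₁ q * x) = χ₂ q * τ x := fun q x => by rw [map_mul, hτ]
  have hτm : ∀ m, ∀ x ∈ quotGr k (W.productIdeal k) m, τ x ∈ quotGr k (W.turnbackIdeal k) m := by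
    rintro m _ ⟨f, hf, rfl⟩
    exact ⟨f, hf, rfl⟩
  let π : W.Ring k →ₐ[k] W.EndRing k := Ideal.Quotient.mkₐ k (W.endIdeal k)
  obtain ⟨ι, hι, ⟨e⟩⟩ := exists_injection (W.KR k)
    (W.rename_mem k W.closeTrivial W.trivialFlag) (π₁ := χ₁.toRingHom.comp π.toRingHom)
    (fun n a ha => hq₁.mem_of_mem _ _ (hR.mem n a ha)) (π₂ := χ₂.toRingHom.comp π.toRingHom)
    (fun n a ha => hq₂.mem_of_mem _ _ (hR.mem n a ha)) (W.mulPolyU k) (fun q x => by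
      obtain ⟨f, rfl⟩ := hT.surj x
      change W.mulPolyU k (W.trivialHom k q * W.trivialHom k f) =
        χ₁ (π q) * W.mulPolyU k (W.trivialHom k f)
      rw [← map_mul, mulPolyU_trivialHom, mulPolyU_trivialHom, hχ₁, ← map_mul, mul_left_comm])
    -- Multiplication by u raises the degree by 2, which the shift {−2} of the target compensates.
    (fun m x hx => by
      obtain ⟨f, hf, rfl⟩ := hT.exists_of_mem hx
      rw [mulPolyU_trivialHom, add_comm]
      exact Submodule.mem_map_of_mem (SetLike.GradedMul.mul_mem (W.polyU_mem k) hf))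
    τ.toLinearMap (fun q x => hτmul _ _) hτm (fun x => by
      obtain ⟨f, rfl⟩ := hT.surj x
      rw [mulPolyU_trivialHom]
      refine Ideal.Quotient.eq_zero_iff_mem.2 ?_
      rw [turnbackIdeal_eq]
      exact Ideal.mem_sup_right (Ideal.mul_mem_right _ _ (Ideal.mem_span_singleton_self _)))
    n (fun x hx => by
      obtain ⟨f, rfl⟩ := hT.surj x
      rw [mulPolyU_trivialHom] at hx
      have h1 := Ideal.Quotient.eq_zero_iff_mem.1 hx
      rw [polyU_mul_mem_productIdeal_iff] at h1
      exact (hT.map_eq_zero_iff f).2 h1)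
    (fun m y hy hy0 => by
      obtain ⟨f, hf, rfl⟩ := hA.exists_of_mem hy
      have h1 : f ∈ W.turnbackIdeal k := Ideal.Quotient.eq_zero_iff_mem.1 hy0
      -- A homogeneous element of R/(zu) that vanishes in R/(u) is u times a homogeneous cofactor of
      -- degree m, whose class is the required preimage.
      rw [turnbackIdeal_eq_productIdeal_sup] at h1
      obtain ⟨g, hg, h2⟩ := exists_homogeneous_of_mem_sup (W.productIdeal_isHomogeneous k)
        (W.polyU_mem k) hf h1
      rw [add_sub_cancel_right] at hg
      refine ⟨W.trivialHom k g, hT.mem _ _ hg, ?_⟩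
      rw [mulPolyU_trivialHom]
      exact ((Ideal.Quotient.mk_eq_mk_iff_sub_mem _ _).2 h2).symm)
    (fun m y hy => by
      obtain ⟨f, hf, rfl⟩ := hB.exists_of_mem hy
      exact ⟨_, Submodule.mem_map_of_mem hf, rfl⟩)
  have hcone := BigradedModule.Hom.IsAcyclicSurjection.kdIso.{w} (posTermProj_isAcyclicSurjection hq₁ hq₂
    (W.endZ_mem k) (W.endU_mem k) τ.toLinearMap hτ (W.endKR k) n hτm hτmul)
  obtain ⟨e₀⟩ := W.closeTrivial_KR k
  obtain ⟨r⟩ := e₀.kdIso.{w} n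
  obtain ⟨r'⟩ := ((W.closeBigon_kdIso_posTerm.{w} k s n).trans hcone).symm
  have hcoker : ((W.KR k).baseChange (χ₂.toRingHom.comp π.toRingHom)
      (fun n a ha => hq₂.mem_of_mem _ _ (hR.mem n a ha))).tensor (idTwoTerm _ (-2)) =
        W.cokernelComplex k :=
    congrArg (fun P => P.tensor (idTwoTerm (quotGr k (W.turnbackIdeal k)) (-2)))
      (baseChange_congr (W.KR k) _ _ (RingHom.ext hχ₂))
  have hc := congrArg BigradedModule.toBicomplex (cone_semilinearHom_baseChange (W.KR k)
    π.toRingHom hR.mem χ₁.toRingHom hq₁.mem_of_mem χ₂.toRingHom hq₂.mem_of_mem τ.toLinearMap hτmul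
      (n := n + 2) (n' := n + 2) fun _ => hτm _)
  exact ⟨⟨_, _, (isBounded_toBigraded _ n).toBicomplex, BigradedModule.IsBounded.toBicomplex
    ((isBounded_toBigraded _ _).cone (isBounded_toBigraded _ _) _), r,
    eqToIso (congrArg (toKD.{w} k).obj hc.symm) ≪≫ r', ι, hι,
    ⟨e.trans (eqToIso (congrArg (fun P => P.toBicomplex n) hcoker))⟩⟩⟩

end TangleDiagram
end TripleLink

/-! ### Collapse at the third page and exactness -/

namespace TripleLink

section Collapse

variable {A : Type*} [Category A] [Abelian A] (E : E₂CohomologicalSpectralSequence A)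

lemma isZero_page_succ_iff (r : ℤ) (hr : 2 ≤ r) (pq : ℤ × ℤ) :
    IsZero ((E.page (r + 1) (by lia)).X pq) ↔ (E.page r hr).ExactAt pq := by
  rw [HomologicalComplex.exactAt_iff_isZero_homology]
  exact (E.iso r (r + 1) pq rfl hr).isZero_iff.symm

lemma isZero_page_of_le {r₀ : ℤ} (h₀ : 2 ≤ r₀) (h : ∀ pq, IsZero ((E.page r₀ h₀).X pq)) :
    ∀ (r : ℤ) (hr : r₀ ≤ r) (pq : ℤ × ℤ), IsZero ((E.page r (h₀.trans hr)).X pq) := by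
  refine Int.leInduction h fun r hr ih pq => ?_
  rw [isZero_page_succ_iff E r (h₀.trans hr)]
  exact ShortComplex.exact_of_isZero_X₂ _ (ih pq)

/-- If d_r = 0, then page r + 1 is isomorphic to page r, so vanishing at a late page can be carried
back to page r₀. -/
lemma isZero_page_of_collapsesAt {r₀ : ℤ} (h₀ : 2 ≤ r₀) (h : CollapsesAt E r₀)
    (hE : ConvergesToZero E) (pq : ℤ × ℤ) : IsZero ((E.page r₀ h₀).X pq) := by
  have h1 : ∀ (r : ℤ) (hr : r₀ ≤ r), IsZero ((E.page r (h₀.trans hr)).X pq) →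
      IsZero ((E.page r₀ h₀).X pq) := by
    refine Int.leInduction id fun r hr ih h2 => ih ?_
    rw [isZero_page_succ_iff E r (h₀.trans hr)] at h2
    have h3 : ((E.page r (h₀.trans hr)).sc pq).f = 0 := h r (h₀.trans hr) hr _ _
    have h4 : ((E.page r (h₀.trans hr)).sc pq).g = 0 := h r (h₀.trans hr) hr _ _
    have := (ShortComplex.exact_iff_mono _ h3).1 h2
    have h5 : IsZero ((E.page r (h₀.trans hr)).sc pq).X₂ := IsZero.of_mono_eq_zero _ h4
    exact h5
  obtain ⟨r, hr⟩ := hE pq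
  exact h1 (max r r₀) (le_max_right _ _)
    (hr (max r r₀) (h₀.trans (le_max_right _ _)) (le_max_left _ _))

/-- When the limit is 0, a collapse leaves nothing: it means that the page itself vanishes. -/
lemma collapsesAt_iff {r₀ : ℤ} (h₀ : 2 ≤ r₀) (hE : ConvergesToZero E) :
    CollapsesAt E r₀ ↔ ∀ pq, IsZero ((E.page r₀ h₀).X pq) :=
  ⟨fun h pq => isZero_page_of_collapsesAt E h₀ h hE pq, fun h r _ hr pq _ =>
    (isZero_page_of_le E h₀ h r hr pq).eq_of_src _ _⟩

variable (hz : ∀ i j : ℤ, IsZero ((E.page 2 le_rfl).X (-3 * i + 2, j)))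

-- d₂ raises the first index by 2 and the columns −3i + 2 vanish, so the only d₂ that can be nonzero
-- go from −3i + 1 to −3(i − 1). The page is a sum of two-term complexes, and these are exact if and
-- only if their differentials are isomorphisms.
include hz in
lemma exactAt_iff_isIso : (∀ pq, (E.page 2 le_rfl).ExactAt pq) ↔
    ∀ i j : ℤ, IsIso ((E.page 2 le_rfl).d (-3 * i + 1, j) (-3 * (i - 1), j - 1)) := by
  have hm : ∀ i j : ℤ, (E.page 2 le_rfl).ExactAt (-3 * i + 1, j) ↔
      Mono ((E.page 2 le_rfl).d (-3 * i + 1, j) (-3 * (i - 1), j - 1)) := by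
    intro i j
    have h1 : IsZero ((E.page 2 le_rfl).X (-3 * i - 1, j + 1)) := by
      have := hz (i + 1) (j + 1)
      rwa [show -3 * (i + 1) + 2 = -3 * i - 1 by ring] at this
    rw [HomologicalComplex.exactAt_iff' _ (-3 * i - 1, j + 1) (-3 * i + 1, j)
      (-3 * (i - 1), j - 1) ((ComplexShape.up' _).prev_eq' (Prod.ext (by simp; ring) (by simp)))
      ((ComplexShape.up' _).next_eq' (Prod.ext (by simp; ring) (by simp; ring)))]
    exact ShortComplex.exact_iff_mono _ (h1.eq_of_src _ _)
  have he : ∀ i j : ℤ, (E.page 2 le_rfl).ExactAt (-3 * (i - 1), j - 1) ↔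
      Epi ((E.page 2 le_rfl).d (-3 * i + 1, j) (-3 * (i - 1), j - 1)) := by
    intro i j
    rw [HomologicalComplex.exactAt_iff' _ (-3 * i + 1, j)
      (-3 * (i - 1), j - 1) (-3 * (i - 1) + 2, j - 2)
      ((ComplexShape.up' _).prev_eq' (Prod.ext (by simp; ring) (by simp; ring)))
      ((ComplexShape.up' _).next_eq' (Prod.ext (by simp) (by simp; ring)))]
    exact ShortComplex.exact_iff_epi _ ((hz _ _).eq_of_tgt _ _)
  constructor
  · intro h i j
    have := (hm i j).1 (h _)
    have := (he i j).1 (h _)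
    exact isIso_of_mono_of_epi _
  · rintro h ⟨p, q⟩
    have h3 : ∃ i : ℤ, p = -3 * (i - 1) ∨ p = -3 * i + 1 ∨ p = -3 * i + 2 := by
      obtain h | h | h : p % 3 = 0 ∨ p % 3 = 1 ∨ p % 3 = 2 := by lia
      · exact ⟨-(p / 3) + 1, by lia⟩
      · exact ⟨-(p / 3), by lia⟩
      · exact ⟨-(p / 3), by lia⟩
    obtain ⟨i, rfl | rfl | rfl⟩ := h3
    · have := h i (q + 1)
      have h4 := (he i (q + 1)).2 inferInstance
      rwa [add_sub_cancel_right] at h4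
    · have := h i q
      exact (hm i q).2 inferInstance
    · exact ShortComplex.exact_of_isZero_X₂ _ (hz i q)

variable {X Y : ℤ → ℤ → A} (f : ∀ i j, X i j ⟶ Y i j)
  (eKer : ∀ i j : ℤ, (E.page 2 le_rfl).X (-3 * i, j) ≅ kernel (f i j))
  (eCoker : ∀ i j : ℤ, (E.page 2 le_rfl).X (-3 * i + 1, j) ≅ cokernel (f i j))

/-- The connecting morphism given by the differential of the second page. -/
noncomputable def connecting (i j : ℤ) : Y i j ⟶ X (i - 1) (j - 1) :=
  cokernel.π (f i j) ≫ (eCoker i j).inv ≫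
    (E.page 2 le_rfl).d (-3 * i + 1, j) (-3 * (i - 1), j - 1) ≫
      (eKer (i - 1) (j - 1)).hom ≫ kernel.ι (f (i - 1) (j - 1))

lemma comp_connecting (i j : ℤ) : f i j ≫ connecting E f eKer eCoker i j = 0 := by
  rw [connecting, cokernel.condition_assoc, zero_comp]

lemma connecting_comp (i j : ℤ) :
    connecting E f eKer eCoker i j ≫ f (i - 1) (j - 1) = 0 := by
  simp [connecting]

/-- Exactness means that the map induced on the cokernel of `f i j` is injective. Up to isomorphism,
this map is d₂ followed by the inclusion of a kernel. -/
lemma exact_comp_connecting_iff (i j : ℤ) :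
    (ShortComplex.mk _ _ (comp_connecting E f eKer eCoker i j)).Exact ↔
      Mono ((E.page 2 le_rfl).d (-3 * i + 1, j) (-3 * (i - 1), j - 1)) := by
  rw [ShortComplex.exact_iff_mono_cokernel_desc]
  have : cokernel.desc _ _ (comp_connecting E f eKer eCoker i j) = (eCoker i j).inv ≫
      (E.page 2 le_rfl).d (-3 * i + 1, j) (-3 * (i - 1), j - 1) ≫
        (eKer (i - 1) (j - 1)).hom ≫ kernel.ι (f (i - 1) (j - 1)) :=
    (cancel_epi (cokernel.π (f i j))).1 (cokernel.π_desc _ _ _)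
  dsimp only
  rw [this]
  constructor
  · intro h
    have h1 := (mono_comp_iff_of_isIso (eCoker i j).inv _).1 h
    exact mono_of_mono _ ((eKer (i - 1) (j - 1)).hom ≫ kernel.ι (f (i - 1) (j - 1)))
  · intro h
    infer_instance

/-- Dually, the map into the kernel of the next `f` is the projection to a cokernel followed by d₂,
up to isomorphism. -/
lemma exact_connecting_comp_iff (i j : ℤ) :
    (ShortComplex.mk _ _ (connecting_comp E f eKer eCoker i j)).Exact ↔
      Epi ((E.page 2 le_rfl).d (-3 * i + 1, j) (-3 * (i - 1), j - 1)) := by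
  rw [ShortComplex.exact_iff_epi_kernel_lift]
  have : kernel.lift _ _ (connecting_comp E f eKer eCoker i j) = (cokernel.π (f i j) ≫
      (eCoker i j).inv) ≫ (E.page 2 le_rfl).d (-3 * i + 1, j) (-3 * (i - 1), j - 1) ≫
        (eKer (i - 1) (j - 1)).hom :=
    (cancel_mono (kernel.ι (f (i - 1) (j - 1)))).1
      ((kernel.lift_ι _ _ _).trans (by simp [connecting]))
  dsimp only
  rw [this]
  constructor
  · intro h
    have h1 := epi_of_epi (cokernel.π (f i j) ≫ (eCoker i j).inv)
      ((E.page 2 le_rfl).d (-3 * i + 1, j) (-3 * (i - 1), j - 1) ≫ (eKer (i - 1) (j - 1)).hom)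
    exact (epi_comp_iff_of_isIso _ (eKer (i - 1) (j - 1)).hom).1 h1
  · intro h
    infer_instance

include hz in
lemma exact_iff_collapsesAt (hE : ConvergesToZero E) :
    (∀ i j : ℤ, (ShortComplex.mk _ _ (comp_connecting E f eKer eCoker i j)).Exact ∧
      (ShortComplex.mk _ _ (connecting_comp E f eKer eCoker i j)).Exact) ↔ CollapsesAt E 3 := by
  rw [collapsesAt_iff E (by norm_num) hE]
  refine Iff.trans ?_ (forall_congr' (isZero_page_succ_iff E 2 le_rfl)).symm
  rw [exactAt_iff_isIso E hz]
  refine forall_congr' fun i => forall_congr' fun j => ?_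
  rw [exact_comp_connecting_iff, exact_connecting_comp_iff]
  exact ⟨fun ⟨_, _⟩ => isIso_of_mono_of_epi _, fun _ => ⟨inferInstance, inferInstance⟩⟩

end Collapse

end TripleLink

/-! ### Exact couples and their spectral sequences -/

namespace TripleLink

section Subquotient

variable {k V V' : Type u} [Field k] [AddCommGroup V] [Module k V] [AddCommGroup V'] [Module k V']

/-- A linear relation that is compatible with subquotients induces a linear map. -/
lemma exists_subquotientMap (Z B : Submodule k V) (Z' B' : Submodule k V')
    (R : Submodule k (V × V')) (htot : ∀ x ∈ Z, ∃ y ∈ Z', (x, y) ∈ R)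
    (hB : ∀ x ∈ B, ∀ y ∈ Z', (x, y) ∈ R → y ∈ B') :
    ∃ f : (Z ⧸ B.submoduleOf Z) →ₗ[k] (Z' ⧸ B'.submoduleOf Z'),
      ∀ (x : Z) (y : Z'), (x.1, y.1) ∈ R →
        f ((B.submoduleOf Z).mkQ x) = (B'.submoduleOf Z').mkQ y := by
  choose g hg hgR using htot
  have hwell : ∀ (x : V) (y y' : Z'), (x, y.1) ∈ R → (x, y'.1) ∈ R →
      (B'.submoduleOf Z').mkQ y = (B'.submoduleOf Z').mkQ y' := fun x y y' h h' => by
    rw [← sub_eq_zero, ← map_sub, Submodule.mkQ_apply, Submodule.Quotient.mk_eq_zero]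
    have := R.sub_mem h h'
    rw [Prod.mk_sub_mk, sub_self] at this
    exact hB 0 B.zero_mem _ (y - y').2 this
  let f₀ : Z →ₗ[k] (Z' ⧸ B'.submoduleOf Z') :=
    { toFun := fun x => (B'.submoduleOf Z').mkQ ⟨g x.1 x.2, hg _ _⟩
      map_add' := fun x x' => by
        rw [← map_add]
        exact hwell _ _ _ (hgR _ (x + x').2) (R.add_mem (hgR _ x.2) (hgR _ x'.2))
      map_smul' := fun c x => by
        rw [RingHom.id_apply, ← map_smul]
        exact hwell _ _ _ (hgR _ (c • x).2) (R.smul_mem c (hgR _ x.2)) }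
  refine ⟨(B.submoduleOf Z).liftQ f₀ fun x hx => ?_, fun x y hxy => ?_⟩
  · rw [LinearMap.mem_ker]
    refine (Submodule.Quotient.mk_eq_zero _).2 ?_
    exact hB _ hx _ (hg _ _) (hgR _ _)
  · rw [Submodule.mkQ_apply, Submodule.liftQ_apply]
    exact hwell _ _ _ (hgR _ x.2) hxy

lemma nonempty_quotientEquiv {M N : Type u} [AddCommGroup M] [Module k M] [AddCommGroup N]
    [Module k N] (f : M →ₗ[k] N) (hf : Function.Surjective f) (P : Submodule k M)
    (hP : ∀ x, f x = 0 ↔ x ∈ P) : Nonempty ((M ⧸ P) ≃ₗ[k] N) :=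
  ⟨(Submodule.quotEquivOfEq _ _ (Submodule.ext fun x => (hP x).symm)).trans
    (f.quotKerEquivOfSurjective hf)⟩

/-- Identifies a homology object from a parametrization π of the cycles and the preimage N of the
boundaries. This form suits pages that are themselves subquotients. -/
lemma nonempty_homologyIso (S : ShortComplex (ModuleCat.{u} k)) {M : Type u} [AddCommGroup M]
    [Module k M] (N : Submodule k M) (π : M →ₗ[k] S.X₂) (h : ∀ z, S.g.hom (π z) = 0)
    (hs : ∀ y, S.g.hom y = 0 → ∃ z, π z = y)
    (hN : ∀ z, (∃ x, S.f.hom x = π z) ↔ z ∈ N) :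
    Nonempty (S.homology ≅ ModuleCat.of k (M ⧸ N)) := by
  let f : M →ₗ[k] (LinearMap.ker S.g.hom ⧸ LinearMap.range S.moduleCatToCycles) :=
    (LinearMap.range S.moduleCatToCycles).mkQ ∘ₗ π.codRestrict (LinearMap.ker S.g.hom) h
  obtain ⟨e⟩ := nonempty_quotientEquiv f (fun y => by
    obtain ⟨⟨y, hy⟩, rfl⟩ := Submodule.mkQ_surjective _ y
    obtain ⟨z, rfl⟩ := hs y hy
    exact ⟨z, rfl⟩) N fun z => by
      rw [← hN]
      refine (Submodule.Quotient.mk_eq_zero _).trans ?_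
      exact exists_congr fun x => Subtype.ext_iff
  exact ⟨S.moduleCatHomologyIso ≪≫ e.symm.toModuleIso⟩

end Subquotient

/-- An exact couple of bigraded vector spaces. -/
structure ExactCouple (k : Type u) [Field k] where
  D : Type u
  E : Type u
  [addCommGroupD : AddCommGroup D]
  [moduleD : Module k D]
  [addCommGroupE : AddCommGroup E]
  [moduleE : Module k E]
  pieceD : ℤ → ℤ → Submodule k D
  pieceE : ℤ → ℤ → Submodule k E
  i : D →ₗ[k] D
  j : D →ₗ[k] E
  k : E →ₗ[k] D
  i_mem {p q : ℤ} {x : D} : x ∈ pieceD p q → i x ∈ pieceD (p - 1) (q + 1)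
  j_mem {p q : ℤ} {x : D} : x ∈ pieceD p q → j x ∈ pieceE p q
  k_mem {p q : ℤ} {x : E} : x ∈ pieceE p q → k x ∈ pieceD (p + 1) q
  i_k (x : E) : i (k x) = 0
  j_i (x : D) : j (i x) = 0
  k_j (x : D) : k (j x) = 0
  exact_i {p q : ℤ} {x : D} : x ∈ pieceD p q → i x = 0 → ∃ y ∈ pieceE (p - 1) q, k y = x
  exact_j {p q : ℤ} {x : D} : x ∈ pieceD p q → j x = 0 → ∃ y ∈ pieceD (p + 1) (q - 1), i y = x
  exact_k {p q : ℤ} {x : E} : x ∈ pieceE p q → k x = 0 → ∃ y ∈ pieceD p q, j y = x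

namespace ExactCouple

attribute [instance] addCommGroupD moduleD addCommGroupE moduleE

variable {k : Type u} [Field k] (𝒞 : ExactCouple k)

lemma i_pow_mem (m : ℕ) {p q : ℤ} {x : 𝒞.D} (hx : x ∈ 𝒞.pieceD p q) :
    (𝒞.i ^ m) x ∈ 𝒞.pieceD (p - m) (q + m) := by
  induction m with
  | zero => simpa using hx
  | succ m ih =>
    rw [pow_succ', Module.End.mul_apply]
    have := 𝒞.i_mem ih
    rwa [sub_sub, add_assoc, ← Nat.cast_succ] at this

/-- The cycles of the page `m + 1`. -/
def cyc (m : ℕ) (p q : ℤ) : Submodule k 𝒞.E :=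
  𝒞.pieceE p q ⊓ ((𝒞.pieceD (p + m + 1) (q - m)).map (𝒞.i ^ m)).comap 𝒞.k

/-- The boundaries of the page `m + 1`. -/
def bdy (m : ℕ) (p q : ℤ) : Submodule k 𝒞.E :=
  (𝒞.pieceD p q ⊓ LinearMap.ker (𝒞.i ^ m)).map 𝒞.j

lemma mem_cyc {m : ℕ} {p q : ℤ} {x : 𝒞.E} : x ∈ 𝒞.cyc m p q ↔ x ∈ 𝒞.pieceE p q ∧
    ∃ y ∈ 𝒞.pieceD (p + m + 1) (q - m), (𝒞.i ^ m) y = 𝒞.k x := Iff.rfl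

lemma mem_bdy {m : ℕ} {p q : ℤ} {x : 𝒞.E} : x ∈ 𝒞.bdy m p q ↔
    ∃ y, (y ∈ 𝒞.pieceD p q ∧ (𝒞.i ^ m) y = 0) ∧ 𝒞.j y = x := Iff.rfl

lemma j_mem_cyc (m : ℕ) {p q : ℤ} {y : 𝒞.D} (hy : y ∈ 𝒞.pieceD p q) : 𝒞.j y ∈ 𝒞.cyc m p q :=
  ⟨𝒞.j_mem hy, 0, Submodule.zero_mem _, by rw [map_zero, 𝒞.k_j]⟩

/-- The terms of the page `m + 1`. -/
abbrev Term (m : ℕ) (p q : ℤ) : Type u :=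
  𝒞.cyc m p q ⧸ (𝒞.bdy m p q).submoduleOf (𝒞.cyc m p q)

/-- The class of a cycle. -/
abbrev toTerm (m : ℕ) (p q : ℤ) : 𝒞.cyc m p q →ₗ[k] 𝒞.Term m p q :=
  ((𝒞.bdy m p q).submoduleOf (𝒞.cyc m p q)).mkQ

lemma toTerm_eq_zero_iff (m : ℕ) (p q : ℤ) (x : 𝒞.cyc m p q) :
    𝒞.toTerm m p q x = 0 ↔ x.1 ∈ 𝒞.bdy m p q :=
  Submodule.Quotient.mk_eq_zero _

/-- The relation that defines the differential of the page `m + 1`. -/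
def rel (m : ℕ) (p q : ℤ) : Submodule k (𝒞.E × 𝒞.E) where
  carrier := {x | ∃ y ∈ 𝒞.pieceD p q, (𝒞.i ^ m) y = 𝒞.k x.1 ∧ 𝒞.j y = x.2}
  zero_mem' := ⟨0, Submodule.zero_mem _, by simp, by simp⟩
  add_mem' := by
    rintro _ _ ⟨y, hy, h1, h2⟩ ⟨y', hy', h1', h2'⟩
    exact ⟨y + y', add_mem hy hy', by simp [h1, h1'], by simp [h2, h2']⟩
  smul_mem' := by
    rintro c _ ⟨y, hy, h1, h2⟩
    exact ⟨c • y, Submodule.smul_mem _ _ hy, by simp [h1], by simp [h2]⟩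

/-- The differential is j ∘ i^{−m} ∘ k. Another preimage under i^m differs by an element of the
kernel of i^m, whose image under j is a boundary by the definition of `bdy`. -/
lemma exists_diff (m : ℕ) {p q p' q' : ℤ} (hp : p + m + 1 = p') (hq : q - m = q') :
    ∃ f : 𝒞.Term m p q →ₗ[k] 𝒞.Term m p' q', ∀ (x : 𝒞.cyc m p q) (y : 𝒞.cyc m p' q'),
      (x.1, y.1) ∈ 𝒞.rel m p' q' → f (𝒞.toTerm m p q x) = 𝒞.toTerm m p' q' y := by
  subst hp hq
  refine exists_subquotientMap _ _ _ _ (𝒞.rel m _ _) ?_ ?_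
  · rintro x ⟨hx, y, hy, hyx⟩
    exact ⟨𝒞.j y, 𝒞.j_mem_cyc m hy, y, hy, hyx, rfl⟩
  · rintro _ ⟨y₀, ⟨-, -⟩, rfl⟩ x - ⟨y, hy, hyx, rfl⟩
    exact ⟨y, ⟨hy, hyx.trans (𝒞.k_j _)⟩, rfl⟩

/-- The differential of the page `m + 1`. -/
noncomputable def diff (m : ℕ) {p q p' q' : ℤ} (hp : p + m + 1 = p') (hq : q - m = q') :
    𝒞.Term m p q →ₗ[k] 𝒞.Term m p' q' := (𝒞.exists_diff m hp hq).choose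

lemma diff_toTerm (m : ℕ) {p q p' q' : ℤ} (hp : p + m + 1 = p') (hq : q - m = q')
    (x : 𝒞.cyc m p q) {y : 𝒞.D} (hy : y ∈ 𝒞.pieceD p' q') (h : (𝒞.i ^ m) y = 𝒞.k x.1) :
    𝒞.diff m hp hq (𝒞.toTerm m p q x) = 𝒞.toTerm m p' q' ⟨𝒞.j y, 𝒞.j_mem_cyc m hy⟩ :=
  (𝒞.exists_diff m hp hq).choose_spec _ _ ⟨y, hy, h, rfl⟩

lemma exists_of_cyc (m : ℕ) {p q p' q' : ℤ} (hp : p + m + 1 = p') (hq : q - m = q')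
    (x : 𝒞.cyc m p q) : ∃ y ∈ 𝒞.pieceD p' q', (𝒞.i ^ m) y = 𝒞.k x.1 := by
  subst hp hq
  exact x.2.2

lemma diff_diff (m : ℕ) {p q p' q' p'' q'' : ℤ} (hp : p + m + 1 = p') (hq : q - m = q')
    (hp' : p' + m + 1 = p'') (hq' : q' - m = q'') (x : 𝒞.Term m p q) :
    𝒞.diff m hp' hq' (𝒞.diff m hp hq x) = 0 := by
  obtain ⟨x, rfl⟩ := Submodule.mkQ_surjective _ x
  obtain ⟨y, hy, h⟩ := 𝒞.exists_of_cyc m hp hq x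
  refine (congrArg _ (𝒞.diff_toTerm m hp hq x hy h)).trans ?_
  rw [𝒞.diff_toTerm m hp' hq' _ (Submodule.zero_mem _) (by rw [map_zero, 𝒞.k_j]),
    toTerm_eq_zero_iff]
  change 𝒞.j 0 ∈ _
  rw [map_zero]
  exact Submodule.zero_mem _

lemma cyc_succ_le (m : ℕ) (p q : ℤ) : 𝒞.cyc (m + 1) p q ≤ 𝒞.cyc m p q := by
  rintro x ⟨hx, y, hy, h⟩
  refine ⟨hx, 𝒞.i y, ?_, by rw [← h, pow_succ, Module.End.mul_apply]⟩
  have := 𝒞.i_mem hy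
  rwa [show p + (m + 1 : ℕ) + 1 - 1 = p + m + 1 by push_cast; ring,
    show q - (m + 1 : ℕ) + 1 = q - m by push_cast; ring] at this

/-- The next page is the homology of a page. -/
lemma nonempty_homologyIso_term (m : ℕ) {p₀ q₀ p q p' q' : ℤ} (hp₀ : p₀ + m + 1 = p)
    (hq₀ : q₀ - m = q) (hp : p + m + 1 = p') (hq : q - m = q')
    (S : ShortComplex (ModuleCat.{u} k)) (hS : S = ShortComplex.mk
      (ModuleCat.ofHom (𝒞.diff m hp₀ hq₀)) (ModuleCat.ofHom (𝒞.diff m hp hq))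
      (ModuleCat.hom_ext (LinearMap.ext (𝒞.diff_diff m hp₀ hq₀ hp hq)))) :
    Nonempty (S.homology ≅ ModuleCat.of k (𝒞.Term (m + 1) p q)) := by
  subst hS
  refine nonempty_homologyIso _ _
    (𝒞.toTerm m p q ∘ₗ Submodule.inclusion (𝒞.cyc_succ_le m p q)) ?_ ?_ ?_
  · rintro ⟨x, hx⟩
    obtain ⟨-, y, hy, h⟩ := id hx
    have h1 : 𝒞.i y ∈ 𝒞.pieceD p' q' := by
      have := 𝒞.i_mem hy
      rwa [show p + (m + 1 : ℕ) + 1 - 1 = p' by push_cast; lia,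
        show q - (m + 1 : ℕ) + 1 = q' by push_cast; lia] at this
    refine (𝒞.diff_toTerm m hp hq _ h1 ?_).trans ?_
    · rw [← Module.End.mul_apply, ← pow_succ, h]
      rfl
    · rw [toTerm_eq_zero_iff]
      change 𝒞.j (𝒞.i y) ∈ _
      rw [𝒞.j_i]
      exact Submodule.zero_mem _
  · intro x hx
    obtain ⟨x, rfl⟩ := Submodule.mkQ_surjective _ x
    obtain ⟨y, hy, h⟩ := 𝒞.exists_of_cyc m hp hq x
    have hx : 𝒞.diff m hp hq (𝒞.toTerm m p q x) = 0 := hx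
    rw [𝒞.diff_toTerm m hp hq x hy h, toTerm_eq_zero_iff] at hx
    obtain ⟨y', ⟨hy', h'⟩, hj⟩ := 𝒞.mem_bdy.1 hx
    -- The class of j y vanishes, so j y = j y' with i^m y' = 0. Then y − y' = i z, and k x = i^m y
    -- = i^{m+1} z shows that x is a cycle of the next page.
    obtain ⟨z, hz, hzy⟩ := 𝒞.exact_j (sub_mem hy hy') (by rw [map_sub, hj, sub_self])
    refine ⟨⟨x.1, x.2.1, z, ?_, ?_⟩, rfl⟩
    · rwa [show p + (m + 1 : ℕ) + 1 = p' + 1 by push_cast; lia,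
        show q - (m + 1 : ℕ) = q' - 1 by push_cast; lia]
    · rw [pow_succ, Module.End.mul_apply, hzy, map_sub, h, h', sub_zero]
  · rintro ⟨z, hz⟩
    have hbdy : (⟨z, hz⟩ : 𝒞.cyc (m + 1) p q) ∈ (𝒞.bdy (m + 1) p q).submoduleOf
        (𝒞.cyc (m + 1) p q) ↔ z ∈ 𝒞.bdy (m + 1) p q := Iff.rfl
    rw [hbdy]
    constructor
    · rintro ⟨x, hx⟩
      obtain ⟨x, rfl⟩ := Submodule.mkQ_surjective _ x
      obtain ⟨y, hy, h⟩ := 𝒞.exists_of_cyc m hp₀ hq₀ x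
      have hx := (𝒞.diff_toTerm m hp₀ hq₀ x hy h).symm.trans hx
      -- j y and z differ by a boundary j y'. So z = j (y − y'), and i^{m+1} kills y − y' because i
      -- ∘ k = 0.
      have h2 := (𝒞.toTerm_eq_zero_iff m p q _).1
        ((map_sub (𝒞.toTerm m p q) _ _).trans (sub_eq_zero.2 hx))
      obtain ⟨y', ⟨hy', h'⟩, hj⟩ := 𝒞.mem_bdy.1 h2
      have hj : 𝒞.j y' = 𝒞.j y - z := hj
      refine 𝒞.mem_bdy.2 ⟨y - y', ⟨sub_mem hy hy', ?_⟩, by rw [map_sub, hj, sub_sub_cancel]⟩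
      rw [map_sub, pow_succ', Module.End.mul_apply, Module.End.mul_apply, h, h', 𝒞.i_k, map_zero,
        sub_zero]
    · intro h
      obtain ⟨y, ⟨hy, h1⟩, rfl⟩ := 𝒞.mem_bdy.1 h
      rw [pow_succ', Module.End.mul_apply] at h1
      -- i kills i^m y, so i^m y = k x for some x, and by construction the differential sends the
      -- class of x to that of j y.
      obtain ⟨x, hx, hxy⟩ := 𝒞.exact_i (𝒞.i_pow_mem m hy) h1
      have hx' : x ∈ 𝒞.pieceE p₀ q₀ := by
        rwa [show p - m - 1 = p₀ by lia, show q + m = q₀ by lia] at hx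
      have hy' : y ∈ 𝒞.pieceD (p₀ + m + 1) (q₀ - m) := by rwa [hp₀, hq₀]
      exact ⟨𝒞.toTerm m p₀ q₀ ⟨x, hx', y, hy', hxy.symm⟩,
        𝒞.diff_toTerm m hp₀ hq₀ _ hy hxy.symm⟩

/-- The pages of the spectral sequence. -/
noncomputable def page (r : ℤ) (hr : 2 ≤ r) :
    HomologicalComplex (ModuleCat.{u} k) (ComplexShape.up' ((r, 1 - r) : ℤ × ℤ)) where
  -- `Term m` belongs to page m + 1. As r ≥ 2, the truncation in `toNat` has no effect.
  X pq := ModuleCat.of k (𝒞.Term (r - 1).toNat pq.1 pq.2)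
  d pq pq' := if h : pq + (r, 1 - r) = pq' then
      ModuleCat.ofHom (𝒞.diff (r - 1).toNat (p := pq.1) (q := pq.2) (p' := pq'.1) (q' := pq'.2)
        (by rw [← h, Prod.fst_add]; lia) (by rw [← h, Prod.snd_add]; lia)) else 0
  shape pq pq' h := dif_neg h
  d_comp_d' pq pq' pq'' h h' := by
    have h : pq + (r, 1 - r) = pq' := h
    have h' : pq' + (r, 1 - r) = pq'' := h'
    rw [dif_pos h, dif_pos h']
    exact ModuleCat.hom_ext (LinearMap.ext (𝒞.diff_diff (r - 1).toNat
      (by rw [← h, Prod.fst_add]; lia) (by rw [← h, Prod.snd_add]; lia)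
      (by rw [← h', Prod.fst_add]; lia) (by rw [← h', Prod.snd_add]; lia)))

lemma page_d (r : ℤ) (hr : 2 ≤ r) (pq pq' : ℤ × ℤ) (h : pq + (r, 1 - r) = pq') :
    (𝒞.page r hr).d pq pq' = ModuleCat.ofHom (𝒞.diff (r - 1).toNat (p := pq.1) (q := pq.2)
      (p' := pq'.1) (q' := pq'.2) (by rw [← h, Prod.fst_add]; lia)
        (by rw [← h, Prod.snd_add]; lia)) := dif_pos h

lemma nonempty_pageIso (r r' : ℤ) (pq : ℤ × ℤ) (h : r + 1 = r') (hr : 2 ≤ r) (hr' : 2 ≤ r') :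
    Nonempty ((𝒞.page r hr).homology pq ≅ (𝒞.page r' hr').X pq) := by
  have h0 : pq - (r, 1 - r) + (r, 1 - r) = pq := sub_add_cancel _ _
  have h1 : pq + (r, 1 - r) = pq + (r, 1 - r) := rfl
  obtain ⟨e⟩ := 𝒞.nonempty_homologyIso_term (r - 1).toNat (p₀ := (pq - (r, 1 - r)).1)
    (q₀ := (pq - (r, 1 - r)).2) (p := pq.1) (q := pq.2) (p' := (pq + (r, 1 - r)).1)
    (q' := (pq + (r, 1 - r)).2) (by rw [Prod.fst_sub]; lia) (by rw [Prod.snd_sub]; lia)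
    (by rw [Prod.fst_add]; lia) (by rw [Prod.snd_add]; lia)
    ((𝒞.page r hr).sc' (pq - (r, 1 - r)) pq (pq + (r, 1 - r))) (by
      dsimp only [HomologicalComplex.sc', HomologicalComplex.shortComplexFunctor']
      congr 1
      · exact 𝒞.page_d r hr _ _ h0
      · exact 𝒞.page_d r hr _ _ h1)
  have h2 : (r - 1).toNat + 1 = (r' - 1).toNat := by lia
  rw [h2] at e
  exact ⟨ShortComplex.homologyMapIso ((𝒞.page r hr).isoSc' _ _ _
    ((ComplexShape.up' _).prev_eq' h0) ((ComplexShape.up' _).next_eq' h1)) ≪≫ e⟩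

/-- The spectral sequence of an exact couple. -/
noncomputable def spectralSequence : E₂CohomologicalSpectralSequence (ModuleCat.{u} k) where
  page := 𝒞.page
  iso r r' pq h hr := (𝒞.nonempty_pageIso r r' pq h hr (by lia)).some

lemma isZero_term (m : ℕ) (p q : ℤ) (h : 𝒞.cyc m p q ≤ 𝒞.bdy m p q) :
    IsZero (ModuleCat.of k (𝒞.Term m p q)) := by
  have : Subsingleton (𝒞.Term m p q) := by
    refine subsingleton_of_forall_eq 0 fun x => ?_
    obtain ⟨x, rfl⟩ := Submodule.mkQ_surjective _ x
    exact (𝒞.toTerm_eq_zero_iff m p q x).2 (h x.2)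
  exact ModuleCat.isZero_of_subsingleton _

/-- For large m, a cycle x has k x in the image under i^m of a column of D that is zero, so x = j z.
Moreover i^m z lies in a zero column, so j z is a boundary. -/
lemma convergesToZero (N : ℤ) (h : ∀ p q, N < |p| → 𝒞.pieceD p q = ⊥) :
    ConvergesToZero 𝒞.spectralSequence := by
  rintro ⟨p, q⟩
  -- From this r on, p + r exceeds N and p − (r − 1) is less than −N, so that both columns of D
  -- involved are zero.
  refine ⟨|p| + N + 2, fun r hr h1 => 𝒞.isZero_term _ _ _ ?_⟩
  have h2 := neg_abs_le p
  have h3 := le_abs_self p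
  have hm : ((r - 1).toNat : ℤ) = r - 1 := by lia
  rintro x ⟨hx, y, hy, hyx⟩
  dsimp only at hx hy
  rw [h _ _ (lt_of_lt_of_le (by lia) (le_abs_self _))] at hy
  rw [(Submodule.mem_bot k).1 hy, map_zero] at hyx
  obtain ⟨z, hz, rfl⟩ := 𝒞.exact_k hx hyx.symm
  have h4 := 𝒞.i_pow_mem (r - 1).toNat hz
  rw [h _ _ (lt_of_lt_of_le (by lia) (neg_le_abs _))] at h4
  exact ⟨z, ⟨hz, (Submodule.mem_bot k).1 h4⟩, rfl⟩

lemma isZero_secondPage (p q : ℤ) (h : 𝒞.pieceE p q = ⊥) :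
    IsZero ((𝒞.spectralSequence.page 2 le_rfl).X (p, q)) := by
  refine 𝒞.isZero_term _ _ _ fun x hx => ?_
  have h1 : x ∈ 𝒞.pieceE p q := hx.1
  rw [h] at h1
  rw [(Submodule.mem_bot k).1 h1]
  exact Submodule.zero_mem _

/-- By exactness at the source of j, the image of i is the kernel of j. Thus the second page is the
homology of the first with respect to j ∘ k. -/
lemma mem_cyc_one {p q : ℤ} {x : 𝒞.E} :
    x ∈ 𝒞.cyc 1 p q ↔ x ∈ 𝒞.pieceE p q ∧ 𝒞.j (𝒞.k x) = 0 := by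
  rw [mem_cyc, pow_one]
  refine and_congr_right fun hx => ⟨?_, fun h => ?_⟩
  · rintro ⟨y, -, h⟩
    rw [← h, 𝒞.j_i]
  · obtain ⟨y, hy, h⟩ := 𝒞.exact_j (𝒞.k_mem hx) h
    refine ⟨y, ?_, h⟩
    rwa [Nat.cast_one]

lemma mem_bdy_one {p q : ℤ} {x : 𝒞.E} :
    x ∈ 𝒞.bdy 1 p q ↔ ∃ y ∈ 𝒞.pieceE (p - 1) q, 𝒞.j (𝒞.k y) = x := by
  rw [mem_bdy, pow_one]
  constructor
  · rintro ⟨y, ⟨hy, h⟩, rfl⟩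
    obtain ⟨z, hz, rfl⟩ := 𝒞.exact_i hy h
    exact ⟨z, hz, rfl⟩
  · rintro ⟨y, hy, rfl⟩
    refine ⟨𝒞.k y, ⟨?_, 𝒞.i_k y⟩, rfl⟩
    have := 𝒞.k_mem hy
    rwa [sub_add_cancel] at this

variable {M M' : Type u} [AddCommGroup M] [Module k M] [AddCommGroup M'] [Module k M']

/-- As the column to the left vanishes, there are no boundaries; φ and φ' identify j ∘ k with f. -/
lemma nonempty_secondPage_iso_ker {p q : ℤ} (h : 𝒞.pieceE (p - 1) q = ⊥)
    (φ : M →ₗ[k] 𝒞.E) (hφ : Function.Injective φ) (hφr : LinearMap.range φ = 𝒞.pieceE p q)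
    (φ' : M' →ₗ[k] 𝒞.E) (hφ' : Function.Injective φ') (f : M →ₗ[k] M')
    (hf : ∀ x, φ' (f x) = 𝒞.j (𝒞.k (φ x))) :
    Nonempty ((𝒞.spectralSequence.page 2 le_rfl).X (p, q) ≅
      ModuleCat.of k (LinearMap.ker f)) := by
  have hmem : ∀ x : LinearMap.ker f, φ x.1 ∈ 𝒞.cyc 1 p q := fun x => by
    refine 𝒞.mem_cyc_one.2 ⟨?_, ?_⟩
    · rw [← hφr]
      exact ⟨_, rfl⟩
    · rw [← hf, x.2, map_zero]
  let g : LinearMap.ker f →ₗ[k] 𝒞.Term 1 p q :=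
    𝒞.toTerm 1 p q ∘ₗ (φ ∘ₗ (LinearMap.ker f).subtype).codRestrict _ hmem
  have hg : Function.Bijective g := by
    constructor
    · refine (injective_iff_map_eq_zero _).2 fun x hx => ?_
      obtain ⟨y, hy, h1⟩ := 𝒞.mem_bdy_one.1 ((𝒞.toTerm_eq_zero_iff 1 p q _).1 hx)
      rw [h] at hy
      rw [(Submodule.mem_bot k).1 hy, map_zero, map_zero] at h1
      refine Subtype.ext (hφ ?_)
      exact h1.symm.trans (map_zero φ).symm
    · intro y
      obtain ⟨⟨y, hy⟩, rfl⟩ := Submodule.mkQ_surjective _ y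
      obtain ⟨hy1, hy2⟩ := 𝒞.mem_cyc_one.1 hy
      rw [← hφr] at hy1
      obtain ⟨x, rfl⟩ := hy1
      refine ⟨⟨x, hφ' ?_⟩, rfl⟩
      rw [hf, hy2, map_zero]
  exact ⟨(LinearEquiv.ofBijective g hg).symm.toModuleIso⟩

/-- As the column to the right vanishes, every element is a cycle, and only the boundaries j (k (φ
y)) have to be divided out. -/
lemma nonempty_secondPage_iso_coker {p q : ℤ} (h : 𝒞.pieceE (p + 1) q = ⊥)
    (φ : M →ₗ[k] 𝒞.E) (hφr : LinearMap.range φ = 𝒞.pieceE (p - 1) q)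
    (φ' : M' →ₗ[k] 𝒞.E) (hφ' : Function.Injective φ') (hφr' : LinearMap.range φ' = 𝒞.pieceE p q)
    (f : M →ₗ[k] M') (hf : ∀ x, φ' (f x) = 𝒞.j (𝒞.k (φ x))) :
    Nonempty ((𝒞.spectralSequence.page 2 le_rfl).X (p, q) ≅
      ModuleCat.of k (M' ⧸ LinearMap.range f)) := by
  have hcyc : ∀ x ∈ 𝒞.pieceE p q, x ∈ 𝒞.cyc 1 p q := fun x hx => by
    refine 𝒞.mem_cyc_one.2 ⟨hx, ?_⟩
    have := 𝒞.j_mem (𝒞.k_mem hx)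
    rw [h] at this
    exact (Submodule.mem_bot k).1 this
  have hmem : ∀ x, φ' x ∈ 𝒞.cyc 1 p q := fun x => hcyc _ (hφr' ▸ ⟨x, rfl⟩)
  let g : M' →ₗ[k] 𝒞.Term 1 p q := 𝒞.toTerm 1 p q ∘ₗ φ'.codRestrict _ hmem
  obtain ⟨e⟩ := nonempty_quotientEquiv g (fun y => by
    obtain ⟨⟨y, hy⟩, rfl⟩ := Submodule.mkQ_surjective _ y
    have hy1 := (𝒞.mem_cyc_one.1 hy).1
    rw [← hφr'] at hy1
    obtain ⟨x, rfl⟩ := hy1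
    exact ⟨x, rfl⟩) (LinearMap.range f) fun x => by
      refine (𝒞.toTerm_eq_zero_iff 1 p q _).trans (𝒞.mem_bdy_one.trans ?_)
      rw [← hφr]
      constructor
      · rintro ⟨_, ⟨y, rfl⟩, hy⟩
        exact ⟨y, hφ' ((hf y).trans hy)⟩
      · rintro ⟨y, rfl⟩
        exact ⟨_, ⟨y, rfl⟩, (hf y).symm⟩
  exact ⟨e.symm.toModuleIso⟩

end ExactCouple
end TripleLink

/-! ### The exact couple of an acyclic complex of complexes -/

namespace TripleLink

section PiPiece

variable (k : Type u) [Field k] {V : ℤ × ℤ → Type u} [∀ pq, AddCommGroup (V pq)]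
  [∀ pq, Module k (V pq)]

/-- The elements of a product that are concentrated in one bidegree. -/
def piPiece (p q : ℤ) : Submodule k (∀ pq, V pq) where
  carrier := {f | ∀ pq, pq ≠ (p, q) → f pq = 0}
  zero_mem' _ _ := rfl
  add_mem' hf hg pq h := by rw [Pi.add_apply, hf pq h, hg pq h, add_zero]
  smul_mem' c f hf pq h := by rw [Pi.smul_apply, hf pq h, smul_zero]

lemma range_single (p q : ℤ) :
    LinearMap.range (LinearMap.single k V (p, q)) = piPiece k p q := by
  ext f
  constructor
  · rintro ⟨x, rfl⟩ pq h
    exact Pi.single_eq_of_ne h x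
  · intro h
    refine ⟨f (p, q), funext fun pq => ?_⟩
    by_cases h0 : pq = (p, q)
    · subst h0
      exact Pi.single_eq_same _ _
    · exact (Pi.single_eq_of_ne h0 _).trans (h pq h0).symm

lemma single_mem_piPiece (p q : ℤ) (x : V (p, q)) :
    LinearMap.single k V (p, q) x ∈ piPiece k p q :=
  range_single k (V := V) p q ▸ ⟨x, rfl⟩

lemma piPiece_eq_bot (p q : ℤ) (h : Subsingleton (V (p, q))) : piPiece k (V := V) p q = ⊥ := by
  rw [← range_single, LinearMap.range_eq_bot]
  exact LinearMap.ext fun x => by rw [Subsingleton.elim x 0, map_zero, map_zero]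

end PiPiece

section CycleSequence

variable {k : Type u} [Field k] (K : Bicomplex k)

/-- The short exact sequence of the cycles of an acyclic complex. -/
noncomputable def cycleSequence (p p' : ℤ) : ShortComplex (CochainComplex (ModuleCat.{u} k) ℤ) :=
  ShortComplex.mk (K.iCycles p) (K.toCycles p p') (by
    rw [← cancel_mono (K.iCycles p'), Category.assoc, K.toCycles_i, K.iCycles_d, zero_comp])

variable (hK : ∀ p, K.ExactAt p)

-- The kernel of `K.toCycles p p'` is that of the differential. It is surjective because its
-- cokernel is the homology at p', which vanishes.
include hK in
lemma cycleSequence_shortExact {p p' : ℤ} (h : p + 1 = p') : (cycleSequence K p p').ShortExact where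
  mono_f := inferInstanceAs (Mono (K.iCycles p))
  epi_g := by
    have h2 := (K.exactAt_iff_isZero_homology p').1 (hK p')
    have h3 := (K.homologyIsCokernel p p' ((ComplexShape.up ℤ).prev_eq' h))
    exact Preadditive.epi_of_isZero_cokernel' _ h3 h2
  exact := by
    refine ShortComplex.exact_of_f_is_kernel _ ?_
    exact isKernelOfComp (f := K.toCycles p p') (K.iCycles p') (K.d p p')
      (K.cyclesIsKernel p p' ((ComplexShape.up ℤ).next_eq' h)) _ (K.toCycles_i p p')

/-- The connecting homomorphisms of `cycleSequence`. -/
noncomputable def cycleDelta {p p' q q' : ℤ} (hp : p + 1 = p') (hq : q + 1 = q') :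
    (K.cycles p').homology q ⟶ (K.cycles p).homology q' :=
  (cycleSequence_shortExact K hK hp).δ q q' hq

/-- The spaces of the exact couple of an acyclic complex. -/
abbrev CoupleD (pq : ℤ × ℤ) : Type u := (K.cycles pq.1).homology pq.2

/-- The spaces of the exact couple of an acyclic complex. -/
abbrev CoupleE (pq : ℤ × ℤ) : Type u := (K.X pq.1).homology pq.2

/-- This and the next two lemmas are the exactness of the long homology sequence of `cycleSequence`,
which supplies the exactness axioms of the couple. -/
lemma exists_of_cycleDelta_eq_zero {p p' q q' : ℤ} (hp : p + 1 = p') (hq : q + 1 = q')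
    (x : CoupleD K (p', q)) (h : (cycleDelta K hK hp hq).hom x = 0) : ∃ z : CoupleE K (p, q),
      (HomologicalComplex.homologyMap (K.toCycles p p') q).hom z = x :=
  (ShortComplex.moduleCat_exact_iff _).1
    ((cycleSequence_shortExact K hK hp).homology_exact₃ q q' hq) x h

include hK in
lemma exists_of_iCycles_eq_zero {p p' q q' : ℤ} (hp : p + 1 = p') (hq : q + 1 = q')
    (x : CoupleD K (p, q')) (h : (HomologicalComplex.homologyMap (K.iCycles p) q').hom x = 0) :
    ∃ z : CoupleD K (p', q), (cycleDelta K hK hp hq).hom z = x :=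
  (ShortComplex.moduleCat_exact_iff _).1
    ((cycleSequence_shortExact K hK hp).homology_exact₁ q q' hq) x h

include hK in
lemma exists_of_toCycles_eq_zero {p p' : ℤ} (hp : p + 1 = p') (q : ℤ) (x : CoupleE K (p, q))
    (h : (HomologicalComplex.homologyMap (K.toCycles p p') q).hom x = 0) :
    ∃ z : CoupleD K (p, q), (HomologicalComplex.homologyMap (K.iCycles p) q).hom z = x :=
  (ShortComplex.moduleCat_exact_iff _).1
    ((cycleSequence_shortExact K hK hp).homology_exact₂ q) x h

/-- The first map of the exact couple. -/
noncomputable def coupleI : (∀ pq, CoupleD K pq) →ₗ[k] (∀ pq, CoupleD K pq) :=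
  LinearMap.pi fun pq => (cycleDelta K hK (p := pq.1) (p' := pq.1 + 1) (q := pq.2 - 1)
    (q' := pq.2) rfl (sub_add_cancel _ _)).hom ∘ₗ LinearMap.proj (pq.1 + 1, pq.2 - 1)

/-- The second map of the exact couple. -/
noncomputable def coupleJ : (∀ pq, CoupleD K pq) →ₗ[k] (∀ pq, CoupleE K pq) :=
  LinearMap.pi fun pq => (HomologicalComplex.homologyMap (K.iCycles pq.1) pq.2).hom ∘ₗ
    LinearMap.proj pq

/-- The third map of the exact couple. -/
noncomputable def coupleK : (∀ pq, CoupleE K pq) →ₗ[k] (∀ pq, CoupleD K pq) :=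
  LinearMap.pi fun pq => (HomologicalComplex.homologyMap (K.toCycles (pq.1 - 1) pq.1) pq.2).hom ∘ₗ
    LinearMap.proj (pq.1 - 1, pq.2)

/-- `coupleI` is defined with fixed index expressions; here the indices are only tied by equations,
so that no transport is needed later. -/
lemma coupleI_apply (f : ∀ pq, CoupleD K pq) {p p' q q' : ℤ} (hp : p + 1 = p') (hq : q + 1 = q') :
    coupleI K hK f (p, q') = (cycleDelta K hK hp hq).hom (f (p', q)) := by
  obtain rfl : q = q' - 1 := by lia
  subst hp
  rfl

lemma coupleJ_apply (f : ∀ pq, CoupleD K pq) (p q : ℤ) :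
    coupleJ K f (p, q) = (HomologicalComplex.homologyMap (K.iCycles p) q).hom (f (p, q)) := rfl

lemma coupleK_apply (f : ∀ pq, CoupleE K pq) {p p' : ℤ} (hp : p + 1 = p') (q : ℤ) :
    coupleK K f (p', q) =
      (HomologicalComplex.homologyMap (K.toCycles p p') q).hom (f (p, q)) := by
  obtain rfl : p = p' - 1 := by lia
  rfl

/-- The exact couple of an acyclic complex of complexes. -/
noncomputable def coupleOfAcyclic : ExactCouple k where
  D := ∀ pq, CoupleD K pq
  E := ∀ pq, CoupleE K pq
  pieceD := piPiece k
  pieceE := piPiece k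
  i := coupleI K hK
  j := coupleJ K
  k := coupleK K
  i_mem {p q f} hf := fun ⟨a, b⟩ h => by
    rw [coupleI_apply K hK f rfl (sub_add_cancel b 1), hf (a + 1, b - 1), map_zero]
    rintro h1
    obtain ⟨h2, h3⟩ := Prod.ext_iff.1 h1
    exact h (Prod.ext (by lia) (by lia))
  j_mem {p q f} hf := fun ⟨a, b⟩ h => by rw [coupleJ_apply, hf _ h, map_zero]
  k_mem {p q f} hf := fun ⟨a, b⟩ h => by
    rw [coupleK_apply K f (sub_add_cancel a 1) b, hf (a - 1, b), map_zero]
    rintro h1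
    obtain ⟨h2, h3⟩ := Prod.ext_iff.1 h1
    exact h (Prod.ext (by lia) h3)
  i_k f := funext fun ⟨a, b⟩ => by
    rw [coupleI_apply K hK _ rfl (sub_add_cancel b 1), coupleK_apply K f rfl]
    exact ConcreteCategory.congr_hom ((cycleSequence_shortExact K hK rfl).comp_δ (b - 1) b
      (sub_add_cancel b 1)) (f (a, b - 1))
  j_i f := funext fun ⟨a, b⟩ => by
    rw [coupleJ_apply, coupleI_apply K hK _ rfl (sub_add_cancel b 1)]
    exact ConcreteCategory.congr_hom ((cycleSequence_shortExact K hK rfl).δ_comp (b - 1) b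
      (sub_add_cancel b 1)) (f (a + 1, b - 1))
  k_j f := funext fun ⟨a, b⟩ => by
    rw [coupleK_apply K _ (sub_add_cancel a 1) b, coupleJ_apply]
    have h1 : HomologicalComplex.homologyMap (K.iCycles (a - 1)) b ≫
        HomologicalComplex.homologyMap (K.toCycles (a - 1) a) b = 0 := by
      rw [← HomologicalComplex.homologyMap_comp]
      exact (congrArg (HomologicalComplex.homologyMap · b) (cycleSequence K (a - 1) a).zero).trans
        (HomologicalComplex.homologyMap_zero _ _ _)
    exact ConcreteCategory.congr_hom h1 (f (a - 1, b))
  exact_i {p q f} hf h := by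
    have h1 := congrFun h (p - 1, q + 1)
    rw [coupleI_apply K hK f (sub_add_cancel p 1) rfl] at h1
    obtain ⟨z, hz⟩ := exists_of_cycleDelta_eq_zero K hK _ _ _ h1
    refine ⟨LinearMap.single k (CoupleE K) (p - 1, q) z, single_mem_piPiece k _ _ _, ?_⟩
    refine funext fun ⟨a, b⟩ => ?_
    rw [coupleK_apply K _ (sub_add_cancel a 1) b]
    by_cases h0 : (a, b) = (p, q)
    · obtain ⟨rfl, rfl⟩ := Prod.ext_iff.1 h0
      have h2 : LinearMap.single k (CoupleE K) (a - 1, b) z (a - 1, b) = z :=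
        Pi.single_eq_same _ _
      rw [h2, hz]
    · have h2 : LinearMap.single k (CoupleE K) (p - 1, q) z (a - 1, b) = 0 :=
        single_mem_piPiece k (V := CoupleE K) _ _ z _ fun h2 => h0 (by
          obtain ⟨h3, h4⟩ := Prod.ext_iff.1 h2
          exact Prod.ext (by lia) h4)
      rw [h2, map_zero, hf _ h0]
  exact_j {p q f} hf h := by
    have h1 := congrFun h (p, q)
    rw [coupleJ_apply] at h1
    obtain ⟨z, hz⟩ := exists_of_iCycles_eq_zero K hK rfl (sub_add_cancel q 1) _ h1
    refine ⟨LinearMap.single k (CoupleD K) (p + 1, q - 1) z, single_mem_piPiece k _ _ _, ?_⟩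
    refine funext fun ⟨a, b⟩ => ?_
    rw [coupleI_apply K hK _ rfl (sub_add_cancel b 1)]
    by_cases h0 : (a, b) = (p, q)
    · obtain ⟨rfl, rfl⟩ := Prod.ext_iff.1 h0
      have h2 : LinearMap.single k (CoupleD K) (a + 1, b - 1) z (a + 1, b - 1) = z :=
        Pi.single_eq_same _ _
      rw [h2, hz]
    · have h2 : LinearMap.single k (CoupleD K) (p + 1, q - 1) z (a + 1, b - 1) = 0 :=
        single_mem_piPiece k (V := CoupleD K) _ _ z _ fun h2 => h0 (by
          obtain ⟨h3, h4⟩ := Prod.ext_iff.1 h2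
          exact Prod.ext (by lia) (by lia))
      rw [h2, map_zero, hf _ h0]
  exact_k {p q f} hf h := by
    have h1 := congrFun h (p + 1, q)
    rw [coupleK_apply K _ rfl] at h1
    obtain ⟨z, hz⟩ := exists_of_toCycles_eq_zero K hK rfl _ _ h1
    refine ⟨LinearMap.single k (CoupleD K) (p, q) z, single_mem_piPiece k _ _ _, ?_⟩
    refine funext fun ⟨a, b⟩ => ?_
    rw [coupleJ_apply]
    by_cases h0 : (a, b) = (p, q)
    · obtain ⟨rfl, rfl⟩ := Prod.ext_iff.1 h0
      have h2 : LinearMap.single k (CoupleD K) (a, b) z (a, b) = z := Pi.single_eq_same _ _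
      rw [h2, hz]
    · have h2 : LinearMap.single k (CoupleD K) (p, q) z (a, b) = 0 :=
        single_mem_piPiece k (V := CoupleD K) _ _ z _ h0
      rw [h2, map_zero, hf _ h0]

/-- The differential of K factors as `toCycles` followed by `iCycles`, whose maps in homology are
the components of `coupleK` and `coupleJ`. -/
lemma couple_first_differential {p p' : ℤ} (h : p + 1 = p') (q : ℤ) (x : CoupleE K (p, q)) :
    LinearMap.single k (CoupleE K) (p', q) ((HomologicalComplex.homologyMap (K.d p p') q).hom x) =
      coupleJ K (coupleK K (LinearMap.single k (CoupleE K) (p, q) x)) := by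
  refine funext fun ⟨a, b⟩ => ?_
  rw [coupleJ_apply]
  by_cases h0 : (a, b) = (p', q)
  · obtain ⟨rfl, rfl⟩ := Prod.ext_iff.1 h0
    have h2 : LinearMap.single k (CoupleE K) (p, b) x (p, b) = x := Pi.single_eq_same _ _
    rw [coupleK_apply K _ h, h2, ← K.toCycles_i p a, HomologicalComplex.homologyMap_comp]
    exact Pi.single_eq_same (M := CoupleE K) (a, b) _
  · have h2 : LinearMap.single k (CoupleE K) (p, q) x (a - 1, b) = 0 :=
      single_mem_piPiece k (V := CoupleE K) _ _ x _ fun h2 => h0 (by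
        obtain ⟨h3, h4⟩ := Prod.ext_iff.1 h2
        exact Prod.ext (by lia) h4)
    rw [coupleK_apply K _ (sub_add_cancel a 1) b, h2, map_zero, map_zero]
    exact single_mem_piPiece k (V := CoupleE K) _ _ _ _ h0

/-- The spectral sequence of an acyclic complex of complexes. -/
noncomputable def acyclicSpectralSequence : E₂CohomologicalSpectralSequence (ModuleCat.{u} k) :=
  (coupleOfAcyclic K hK).spectralSequence

lemma acyclicSpectralSequence_convergesToZero (N : ℤ) (h : ∀ p, N < |p| → IsZero (K.X p)) :
    ConvergesToZero (acyclicSpectralSequence K hK) := by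
  refine (coupleOfAcyclic K hK).convergesToZero N fun p q hp =>
    piPiece_eq_bot k (V := CoupleD K) p q ?_
  have h1 : IsZero (K.cycles p) := (h p hp).of_mono (K.iCycles p)
  have h2 : IsZero ((K.cycles p).homology q) :=
    ShortComplex.isZero_homology_of_isZero_X₂ _
      ((HomologicalComplex.eval (ModuleCat.{u} k) (ComplexShape.up ℤ) q).map_isZero h1)
  exact ModuleCat.subsingleton_of_isZero h2

lemma acyclicSpectralSequence_isZero (p q : ℤ) (h : IsZero ((K.X p).homology q)) :
    IsZero (((acyclicSpectralSequence K hK).page 2 le_rfl).X (p, q)) :=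
  (coupleOfAcyclic K hK).isZero_secondPage p q
    (piPiece_eq_bot k (V := CoupleE K) p q (ModuleCat.subsingleton_of_isZero h))

lemma acyclicSpectralSequence_kernel {p₀ p p' : ℤ} (hp₀ : p₀ + 1 = p) (hp : p + 1 = p') (q : ℤ)
    (h : IsZero ((K.X p₀).homology q)) :
    Nonempty (((acyclicSpectralSequence K hK).page 2 le_rfl).X (p, q) ≅
      kernel (HomologicalComplex.homologyMap (K.d p p') q)) := by
  obtain rfl : p₀ = p - 1 := by lia
  obtain ⟨e⟩ := (coupleOfAcyclic K hK).nonempty_secondPage_iso_ker (p := p) (q := q)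
    (piPiece_eq_bot k (V := CoupleE K) _ _ (ModuleCat.subsingleton_of_isZero h))
    (LinearMap.single k (CoupleE K) (p, q)) (Pi.single_injective _) (range_single k p q)
    (LinearMap.single k (CoupleE K) (p', q)) (Pi.single_injective _)
    (HomologicalComplex.homologyMap (K.d p p') q).hom (couple_first_differential K hp q)
  exact ⟨e ≪≫ (ModuleCat.kernelIsoKer _).symm⟩

lemma acyclicSpectralSequence_cokernel {p p' p'' : ℤ} (hp : p + 1 = p') (hp' : p' + 1 = p'')
    (q : ℤ) (h : IsZero ((K.X p'').homology q)) :
    Nonempty (((acyclicSpectralSequence K hK).page 2 le_rfl).X (p', q) ≅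
      cokernel (HomologicalComplex.homologyMap (K.d p p') q)) := by
  obtain rfl : p = p' - 1 := by lia
  subst hp'
  obtain ⟨e⟩ := (coupleOfAcyclic K hK).nonempty_secondPage_iso_coker (p := p') (q := q)
    (piPiece_eq_bot k (V := CoupleE K) _ _ (ModuleCat.subsingleton_of_isZero h))
    (LinearMap.single k (CoupleE K) (p' - 1, q)) (range_single k _ q)
    (LinearMap.single k (CoupleE K) (p', q)) (Pi.single_injective _) (range_single k p' q)
    (HomologicalComplex.homologyMap (K.d (p' - 1) p') q).hom (couple_first_differential K hp q)
  exact ⟨e ≪≫ (ModuleCat.cokernelIsoRangeQuotient _).symm⟩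

end CycleSequence
end TripleLink

/-! ### A long exact sequence as one complex indexed by the integers -/

namespace TripleLink

section Triangles

/-- The successor function of `ℤ × Fin 3`, ordered lexicographically. -/
def triSucc : ℤ × Fin 3 → ℤ × Fin 3
  | (h, 0) => (h, 1)
  | (h, 1) => (h, 2)
  | (h, 2) => (h + 1, 0)

/-- Quotient and remainder of the division by 3. -/
def triIndex (p : ℤ) : ℤ × Fin 3 := (p / 3, ⟨(p % 3).toNat, by lia⟩)

lemma triIndex_eq (h : ℤ) (r : Fin 3) : triIndex (3 * h + (r : ℕ)) = (h, r) := by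
  have hr := r.2
  refine Prod.ext ?_ (Fin.ext ?_)
  · change (3 * h + (r : ℕ)) / 3 = h
    lia
  · change ((3 * h + (r : ℕ)) % 3).toNat = r
    lia

lemma exists_eq_triIndex (p : ℤ) : ∃ (h : ℤ) (r : Fin 3), p = 3 * h + (r : ℕ) :=
  ⟨p / 3, ⟨(p % 3).toNat, by lia⟩, by dsimp only; lia⟩

lemma triIndex_succ (p : ℤ) : triIndex (p + 1) = triSucc (triIndex p) := by
  obtain ⟨h, r, rfl⟩ := exists_eq_triIndex p
  rw [triIndex_eq]
  fin_cases r
  · exact (congrArg triIndex (by simp)).trans (triIndex_eq h 1)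
  · exact (congrArg triIndex (add_assoc (3 * h) 1 1)).trans (triIndex_eq h 2)
  · exact (congrArg triIndex (by simp; ring)).trans (triIndex_eq (h + 1) 0)

variable {A : Type*} [Category A] [Abelian A] {X Y Z : ℤ → A}
  (f : ∀ h, X h ⟶ Y h) (g : ∀ h, Y h ⟶ Z h) (δ : ∀ h, Z h ⟶ X (h + 1))

variable (X Y Z) in
/-- The terms of a long exact sequence. -/
def triX : ℤ × Fin 3 → A
  | (h, 0) => X h
  | (h, 1) => Y h
  | (h, 2) => Z h

/-- The maps of a long exact sequence. -/
def triD : ∀ x, triX X Y Z x ⟶ triX X Y Z (triSucc x)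
  | (h, 0) => f h
  | (h, 1) => g h
  | (h, 2) => δ h

variable (h₁ : ∀ h, f h ≫ g h = 0) (h₂ : ∀ h, g h ≫ δ h = 0) (h₃ : ∀ h, δ h ≫ f (h + 1) = 0)

include h₁ h₂ h₃ in
lemma triD_comp : ∀ x, triD f g δ x ≫ triD f g δ (triSucc x) = 0
  | (h, 0) => h₁ h
  | (h, 1) => h₂ h
  | (h, 2) => h₃ h

/-- The maps of a long exact sequence, indexed by the integers. -/
noncomputable def triMap (p : ℤ) : triX X Y Z (triIndex p) ⟶ triX X Y Z (triIndex (p + 1)) :=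
  triD f g δ (triIndex p) ≫ eqToHom (congrArg _ (triIndex_succ p).symm)

include h₁ h₂ h₃ in
lemma triMap_comp (p : ℤ) : triMap f g δ p ≫ triMap f g δ (p + 1) = 0 := by
  -- The indices are generalized to variables, so that the transports `eqToHom` disappear after
  -- substitution.
  have : ∀ (x y z : ℤ × Fin 3) (hy : y = triSucc x) (hz : z = triSucc y),
      (triD f g δ x ≫ eqToHom (congrArg _ hy.symm)) ≫
        (triD f g δ y ≫ eqToHom (congrArg _ hz.symm)) = 0 := by
    rintro x y z rfl rfl
    rw [eqToHom_refl, eqToHom_refl, Category.comp_id, Category.comp_id]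
    exact triD_comp f g δ h₁ h₂ h₃ x
  exact this _ _ _ (triIndex_succ p) (triIndex_succ (p + 1))

/-- A long exact sequence as a complex. -/
noncomputable def triComplex : CochainComplex A ℤ :=
  CochainComplex.of (fun p => triX X Y Z (triIndex p)) (triMap f g δ) (triMap_comp f g δ h₁ h₂ h₃)

lemma triComplex_d (p : ℤ) : (triComplex f g δ h₁ h₂ h₃).d p (p + 1) = triMap f g δ p :=
  CochainComplex.of_d (fun p => triX X Y Z (triIndex p)) (triMap f g δ) p

lemma triComplex_exactAt (e₁ : ∀ h, (ShortComplex.mk _ _ (h₁ h)).Exact)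
    (e₂ : ∀ h, (ShortComplex.mk _ _ (h₂ h)).Exact) (e₃ : ∀ h, (ShortComplex.mk _ _ (h₃ h)).Exact)
    (p : ℤ) : (triComplex f g δ h₁ h₂ h₃).ExactAt p := by
  have e : ∀ x, (ShortComplex.mk _ _ (triD_comp f g δ h₁ h₂ h₃ x)).Exact
    | (h, 0) => e₁ h
    | (h, 1) => e₂ h
    | (h, 2) => e₃ h
  have e' : ∀ (x y z : ℤ × Fin 3) (hy : y = triSucc x) (hz : z = triSucc y) (h0),
      (ShortComplex.mk (triD f g δ x ≫ eqToHom (congrArg _ hy.symm))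
        (triD f g δ y ≫ eqToHom (congrArg _ hz.symm)) h0).Exact := by
    rintro x y z rfl rfl h0
    simp only [eqToHom_refl, Category.comp_id]
    exact e x
  have e'' : ∀ {X₁ X₂ X₃ : A} (a a' : X₁ ⟶ X₂) (b b' : X₂ ⟶ X₃) (h0 h0') (_ : a = a')
      (_ : b = b'), (ShortComplex.mk a b h0).Exact → (ShortComplex.mk a' b' h0').Exact := by
    rintro _ _ _ a _ b _ _ _ rfl rfl h
    exact h
  obtain ⟨p, rfl⟩ : ∃ p', p = p' + 1 := ⟨p - 1, (sub_add_cancel p 1).symm⟩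
  rw [HomologicalComplex.exactAt_iff' _ p (p + 1) (p + 1 + 1) ((ComplexShape.up ℤ).prev_eq' rfl)
    ((ComplexShape.up ℤ).next_eq' rfl)]
  exact e'' _ _ _ _ _ _ (triComplex_d f g δ h₁ h₂ h₃ p).symm
    (triComplex_d f g δ h₁ h₂ h₃ (p + 1)).symm
      (e' _ _ _ (triIndex_succ p) (triIndex_succ (p + 1)) (triMap_comp f g δ h₁ h₂ h₃ p))

lemma triComplex_X (h : ℤ) (r : Fin 3) :
    (triComplex f g δ h₁ h₂ h₃).X (3 * h + (r : ℕ)) = triX X Y Z (h, r) :=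
  congrArg (triX X Y Z) (triIndex_eq h r)

/-- Only the first of the three kinds of arrows has to be identified, since this one alone
determines the second page. -/
lemma triComplex_arrow (h p p' : ℤ) (hp : 3 * h = p) (hp' : p + 1 = p') :
    ∃ (a : (triComplex f g δ h₁ h₂ h₃).X p ≅ X h) (b : (triComplex f g δ h₁ h₂ h₃).X p' ≅ Y h),
      (triComplex f g δ h₁ h₂ h₃).d p p' ≫ b.hom = a.hom ≫ f h := by
  subst hp'
  have e : ∀ (x y : ℤ × Fin 3) (hx : x = (h, 0)) (hy : y = triSucc x),
      ∃ (a : triX X Y Z x ≅ X h) (b : triX X Y Z y ≅ Y h),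
        (triD f g δ x ≫ eqToHom (congrArg _ hy.symm)) ≫ b.hom = a.hom ≫ f h := by
    rintro _ _ rfl rfl
    refine ⟨Iso.refl _, Iso.refl _, ?_⟩
    rw [eqToHom_refl, Category.comp_id]
    exact (Category.comp_id _).trans (Category.id_comp _).symm
  have h1 : triIndex p = (h, 0) := by
    rw [← triIndex_eq h 0, ← hp]
    simp
  rw [triComplex_d]
  exact e _ _ h1 (triIndex_succ p)

end Triangles

/-! ### Horizontal homology of a short exact sequence of bicomplexes -/

section Rows

variable (k : Type u) [Field k]

/-- The vertical complexes of the horizontal homology spaces. -/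
noncomputable abbrev rowHomology (h : ℤ) : Bicomplex k ⥤ CochainComplex (ModuleCat.{u} k) ℤ :=
  (HomologicalComplex.homologyFunctor (ModuleCat.{u} k) (ComplexShape.up ℤ) h).mapHomologicalComplex
    (ComplexShape.up ℤ)

variable {k} {T : ShortComplex (Bicomplex k)} (hT : T.ShortExact)

include hT in
lemma shortExact_row (j : ℤ) :
    (T.map (HomologicalComplex.eval (CochainComplex (ModuleCat.{u} k) ℤ) (ComplexShape.up ℤ)
      j)).ShortExact :=
  hT.map_of_exact _

/-- The connecting homomorphism of the horizontal homology. -/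
noncomputable def rowDelta (h : ℤ) :
    (rowHomology k h).obj T.X₃ ⟶ (rowHomology k (h + 1)).obj T.X₁ where
  f j := (shortExact_row hT j).δ h (h + 1) rfl
  -- The vertical differential is a morphism between the short exact sequences of two rows, and the
  -- connecting homomorphism is natural.
  comm' j j' _ := (HomologicalComplex.HomologySequence.δ_naturality
    (T.mapNatTrans (F := HomologicalComplex.eval _ _ j) (G := HomologicalComplex.eval _ _ j')
      { app := fun C => C.d j j'
        naturality := fun _ _ f => f.comm j j' }) (shortExact_row hT j) (shortExact_row hT j') h (h + 1) rfl)

include hT in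
lemma rowHomology_exact₁ (h : ℤ) : ∃ h0, (ShortComplex.mk ((rowHomology k h).map T.f)
    ((rowHomology k h).map T.g) h0).Exact :=
  ⟨by rw [← Functor.map_comp, T.zero, Functor.map_zero],
    HomologicalComplex.exact_of_degreewise_exact _ fun j =>
      (shortExact_row hT j).homology_exact₂ h⟩

lemma rowHomology_exact₂ (h : ℤ) : ∃ h0, (ShortComplex.mk ((rowHomology k h).map T.g)
    (rowDelta hT h) h0).Exact :=
  ⟨HomologicalComplex.hom_ext _ _ fun j => (shortExact_row hT j).comp_δ h (h + 1) rfl,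
    HomologicalComplex.exact_of_degreewise_exact _ fun j =>
      (shortExact_row hT j).homology_exact₃ h (h + 1) rfl⟩

lemma rowHomology_exact₃ (h : ℤ) : ∃ h0, (ShortComplex.mk (rowDelta hT h)
    ((rowHomology k (h + 1)).map T.f) h0).Exact :=
  ⟨HomologicalComplex.hom_ext _ _ fun j => (shortExact_row hT j).δ_comp h (h + 1) rfl,
    HomologicalComplex.exact_of_degreewise_exact _ fun j =>
      (shortExact_row hT j).homology_exact₁ h (h + 1) rfl⟩

lemma Bicomplex.isZero_rowHomology {C : Bicomplex k} {N : ℤ}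
    (hC : ∀ j i : ℤ, (N < |j| ∨ N < |i|) → IsZero ((C.X j).X i)) (h : ℤ) (hh : N < |h|) :
    IsZero ((rowHomology k h).obj C) := by
  refine (IsZero.iff_id_eq_zero _).2 (HomologicalComplex.hom_ext _ _ fun j => ?_)
  exact (ShortComplex.isZero_homology_of_isZero_X₂ _ (hC j h (Or.inr hh))).eq_of_src _ _

end Rows

end TripleLink

/-! ### H_hv on bicomplexes, and contractibility of the cokernel -/

namespace TripleLink

section RowHomology

variable (k : Type u) [Field k]

/-- On bicomplexes, `H_{hv}` is the homology of the complex of horizontal homology spaces. -/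
noncomputable def toKDCompHhv [HasDerivedCategory.{w} (ModuleCat.{u} k)] (i j : ℤ) :
    toKD.{w} k ⋙ Hhv.{w} k i j ≅
      rowHomology k (-i) ⋙ HomologicalComplex.homologyFunctor _ (ComplexShape.up ℤ) j :=
  Functor.isoWhiskerLeft ((DerivedCategory.Q (C := ModuleCat.{u} k)).mapHomologicalComplex
      (ComplexShape.up ℤ))
    (Functor.isoWhiskerRight ((DerivedCategory.homologyFunctor (ModuleCat.{u} k)
        (-i)).mapHomotopyCategoryFactors (ComplexShape.up ℤ))
      (HomotopyCategory.homologyFunctor _ _ j) ≪≫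
    Functor.isoWhiskerLeft ((DerivedCategory.homologyFunctor (ModuleCat.{u} k)
        (-i)).mapHomologicalComplex (ComplexShape.up ℤ))
      (HomotopyCategory.homologyFunctorFactors _ _ j)) ≪≫
  Functor.isoWhiskerRight (NatIso.mapHomologicalComplex
    (DerivedCategory.homologyFunctorFactors (ModuleCat.{u} k) (-i)) (ComplexShape.up ℤ))
      (HomologicalComplex.homologyFunctor _ (ComplexShape.up ℤ) j)

variable {k}

/-- Horizontal homology is an additive functor on rows, so it carries the vertical contraction to a
contraction of the complex of homology spaces. -/
lemma isZero_homology_rowHomology_of_homotopy {C : Bicomplex k} (e : Homotopy (𝟙 C) 0) (h j : ℤ) :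
    IsZero (((rowHomology k h).obj C).homology j) := by
  have h1 := (Functor.mapHomotopy (HomologicalComplex.homologyFunctor (ModuleCat.{u} k)
    (ComplexShape.up ℤ) h) e).homologyMap_eq j
  refine (IsZero.iff_id_eq_zero _).2 ?_
  refine (HomologicalComplex.homologyMap_id _ j).symm.trans ?_
  refine (congrArg (fun f => HomologicalComplex.homologyMap f j)
    ((rowHomology k h).map_id C)).symm.trans (h1.trans ?_)
  exact (congrArg (fun f => HomologicalComplex.homologyMap f j)
    ((rowHomology k h).map_zero C C)).trans (HomologicalComplex.homologyMap_zero _ _ j)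

namespace FreeBicomplex

variable {Q : Type u} [CommRing Q] [Algebra k Q] {𝒜 : ℤ → Submodule k Q}
  [SetLike.GradedMonoid 𝒜]

/-- The contraction of the tensor product with the cone of an identity map. -/
def contraction (P : FreeBicomplex 𝒜) : (P.B × Fin 2 → Q) →ₗ[k] (P.B × Fin 2 → Q) where
  toFun f x := if x.2 = 0 then (((P.vdeg x.1).negOnePow : ℤ) : Q) * f (x.1, 1) else 0
  map_add' f g := by
    ext x
    by_cases h : x.2 = 0 <;> simp [h, mul_add]
  map_smul' c f := by
    ext x
    by_cases h : x.2 = 0 <;> simp [h]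

omit [SetLike.GradedMonoid 𝒜] in
lemma contraction_zero (P : FreeBicomplex 𝒜) (f : P.B × Fin 2 → Q) (b : P.B) :
    P.contraction (k := k) f (b, 0) = (((P.vdeg b).negOnePow : ℤ) : Q) * f (b, 1) :=
  rfl

omit [SetLike.GradedMonoid 𝒜] in
lemma contraction_one (P : FreeBicomplex 𝒜) (f : P.B × Fin 2 → Q) (b : P.B) :
    P.contraction (k := k) f (b, 1) = 0 := rfl

omit [SetLike.GradedMonoid 𝒜] in
lemma dh_mulVec_sign (P : FreeBicomplex 𝒜) (f : P.B → Q) (b : P.B) :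
    P.dh.mulVec (fun b => (((P.vdeg b).negOnePow : ℤ) : Q) * f b) b =
      (((P.vdeg b).negOnePow : ℤ) : Q) * P.dh.mulVec f b := by
  simp only [Matrix.mulVec, dotProduct, Finset.mul_sum]
  refine Finset.sum_congr rfl fun b' _ => ?_
  by_cases h : P.dh b b' = 0
  · simp [h]
  · have := P.dh_deg _ _ h
    rw [show P.vdeg b' = P.vdeg b by lia]
    ring

omit [SetLike.GradedMonoid 𝒜] in
lemma dv_mulVec_sign (P : FreeBicomplex 𝒜) (f : P.B → Q) (b : P.B) :
    P.dv.mulVec (fun b => (((P.vdeg b).negOnePow : ℤ) : Q) * f b) b =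
      -((((P.vdeg b).negOnePow : ℤ) : Q) * P.dv.mulVec f b) := by
  simp only [Matrix.mulVec, dotProduct, Finset.mul_sum, ← Finset.sum_neg_distrib]
  refine Finset.sum_congr rfl fun b' _ => ?_
  by_cases h : P.dv b b' = 0
  · simp [h]
  · have := P.dv_deg _ _ h
    rw [show P.vdeg b = P.vdeg b' + 1 by lia, Int.negOnePow_succ]
    push_cast
    ring

lemma sign_mul_sign (n : ℤ) (x : Q) :
    ((n.negOnePow : ℤ) : Q) * (((n.negOnePow : ℤ) : Q) * x) = x := by
  rw [← mul_assoc, ← Int.cast_mul, ← Units.val_mul, Int.units_mul_self, Units.val_one,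
    Int.cast_one, one_mul]

omit [SetLike.GradedMonoid 𝒜] in
lemma intCast_mul_mem {n m : ℤ} {x : Q} (h : x ∈ 𝒜 n) : ((m : ℤ) : Q) * x ∈ 𝒜 n := by
  rw [← zsmul_eq_mul]
  exact zsmul_mem h m

/-- The tensor product with the cone of an identity map is contractible. -/
noncomputable def tensorIdTwoTermHomotopy (P : FreeBicomplex 𝒜) (a n : ℤ) :
    Homotopy (𝟙 ((P.tensor (idTwoTerm 𝒜 a)).toBicomplex n)) 0 := by
  let M := (P.tensor (idTwoTerm 𝒜 a)).toBigraded n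
  have hc : ∀ c : Fin 2, c = 0 ∨ c = 1 := by decide
  let e : BigradedModule.Hom M M := ⟨LinearMap.id, id, fun _ => rfl, fun _ => rfl⟩
  let z : BigradedModule.Hom M M :=
    ⟨0, fun _ => Submodule.zero_mem _, fun _ => (map_zero M.dh).symm, fun _ => (map_zero M.dv).symm⟩
  refine (Homotopy.ofEq ?_).trans ((BigradedModule.Hom.homotopy e z P.contraction ?_ ?_ ?_).trans
    (Homotopy.ofEq ?_))
  · rfl
  · rintro j i x hx ⟨b, c⟩
    rcases hc c with rfl | rfl
    · have h1 := hx (b, (1 : Fin 2))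
      change (((P.vdeg b).negOnePow : ℤ) : Q) * x (b, (1 : Fin 2)) ∈ _ ∧
        ((((P.vdeg b).negOnePow : ℤ) : Q) * x (b, (1 : Fin 2)) ≠ 0 → _)
      refine ⟨intCast_mul_mem h1.1, fun h => ?_⟩
      have h2 : P.vdeg b + 1 = j + 1 ∧ P.hdeg b + 0 = i := h1.2 (right_ne_zero_of_mul h)
      exact ⟨(add_zero (P.vdeg b)).trans (by lia), h2.2⟩
    · exact ⟨(contraction_one (k := k) P x b).symm ▸ Submodule.zero_mem _,
        fun h => (h (contraction_one (k := k) P x b)).elim⟩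
  · intro (x : P.B × Fin 2 → Q)
    refine funext fun ⟨b, c⟩ => ?_
    rcases hc c with rfl | rfl
    · exact (contraction_zero P _ b).trans ((congrArg (fun y => (((P.vdeg b).negOnePow : ℤ) : Q) * y)
        (tensor_idTwoTerm_dh P a x b 1)).trans ((P.dh_mulVec_sign (fun b => x (b, (1 : Fin 2))) b).symm.trans
          (tensor_idTwoTerm_dh P a (P.contraction (k := k) x) b 0).symm))
    · exact (contraction_one P _ b).trans ((congrFun (Matrix.mulVec_zero P.dh) b).symm.trans
        (tensor_idTwoTerm_dh P a (P.contraction (k := k) x) b 1).symm)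
  · intro (x : P.B × Fin 2 → Q)
    refine funext fun ⟨b, c⟩ => ?_
    rcases hc c with rfl | rfl
    · have h1 : P.contraction (k := k) (M.dv x) (b, 0) = _ := (contraction_zero P (M.dv x) b).trans
        (congrArg (fun y => (((P.vdeg b).negOnePow : ℤ) : Q) * y) (tensor_idTwoTerm_dv_one P a x b))
      have h2 : M.dv (P.contraction (k := k) x) (b, (0 : Fin 2)) = _ :=
        (tensor_idTwoTerm_dv_zero P a (P.contraction (k := k) x) b).trans
          (P.dv_mulVec_sign (fun b => x (b, (1 : Fin 2))) b)
      refine Eq.trans ?_ (congrArg₂ (fun y z => y + z + (0 : Q)) h1 h2).symm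
      rw [mul_add, sign_mul_sign]
      change x (b, (0 : Fin 2)) = _
      ring
    · have h1 : P.contraction (k := k) (M.dv x) (b, 1) = 0 := contraction_one P (M.dv x) b
      have h2 : M.dv (P.contraction (k := k) x) (b, (1 : Fin 2)) = x (b, (1 : Fin 2)) :=
        (tensor_idTwoTerm_dv_one P a (P.contraction (k := k) x) b).trans
          ((congrArg₂ (fun y z => y + z) (congrFun (Matrix.mulVec_zero P.dv) b)
            (sign_mul_sign (P.vdeg b) (x (b, (1 : Fin 2))))).trans (zero_add _))
      exact ((congrArg₂ (fun y z => y + z + (0 : Q)) h1 h2).trans (by rw [zero_add, add_zero]; rfl)).symm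
  · rfl

end FreeBicomplex

end RowHomology

end TripleLink

/-! ### The spectral sequence of the move -/

namespace TripleLink

section LongExact

variable {k : Type u} [Field k] {T : ShortComplex (Bicomplex k)} (hT : T.ShortExact)

/-- The long exact sequence of horizontal homology, as a complex of vertical complexes. -/
noncomputable def longExact : Bicomplex k :=
  triComplex (fun h => (rowHomology k h).map T.f) (fun h => (rowHomology k h).map T.g)
    (rowDelta hT) (fun h => (rowHomology_exact₁ hT h).choose)
    (fun h => (rowHomology_exact₂ hT h).choose) (fun h => (rowHomology_exact₃ hT h).choose)

lemma longExact_exactAt (p : ℤ) : (longExact hT).ExactAt p :=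
  triComplex_exactAt _ _ _ _ _ _ (fun h => (rowHomology_exact₁ hT h).choose_spec)
    (fun h => (rowHomology_exact₂ hT h).choose_spec)
    (fun h => (rowHomology_exact₃ hT h).choose_spec) p

lemma longExact_X (p h : ℤ) (r : Fin 3) (hp : p = 3 * h + (r : ℕ)) :
    (longExact hT).X p = triX (fun h => (rowHomology k h).obj T.X₁)
      (fun h => (rowHomology k h).obj T.X₂) (fun h => (rowHomology k h).obj T.X₃) (h, r) := by
  subst hp
  exact triComplex_X _ _ _ _ _ _ h r

lemma longExact_isZero {N : ℤ} (h₁ : ∀ j i : ℤ, (N < |j| ∨ N < |i|) → IsZero ((T.X₁.X j).X i))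
    (h₂ : ∀ j i : ℤ, (N < |j| ∨ N < |i|) → IsZero ((T.X₂.X j).X i))
    (h₃ : ∀ j i : ℤ, (N < |j| ∨ N < |i|) → IsZero ((T.X₃.X j).X i)) (p : ℤ)
    (hp : 3 * N + 2 < |p|) : IsZero ((longExact hT).X p) := by
  obtain ⟨h, r, hr⟩ := exists_eq_triIndex p
  -- With p = 3h + r and r ≤ 2 one has |p| ≤ 3|h| + 2, which explains the bound 3N + 2.
  have hh : N < |h| := by
    have := r.2
    rcases abs_cases p with h1 | h1 <;> rcases abs_cases h with h2 | h2 <;>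
      rw [h1.1] at hp <;> rw [h2.1] <;> omega
  rw [longExact_X hT p h r hr]
  match r with
  | 0 => exact Bicomplex.isZero_rowHomology h₁ h hh
  | 1 => exact Bicomplex.isZero_rowHomology h₂ h hh
  | 2 => exact Bicomplex.isZero_rowHomology h₃ h hh

lemma longExact_isZero_homology (h₃ : ∀ h j, IsZero (((rowHomology k h).obj T.X₃).homology j))
    (p h q : ℤ) (hp : p = 3 * h + 2) : IsZero (((longExact hT).X p).homology q) := by
  rw [longExact_X hT p h 2 hp]
  exact h₃ h q

lemma longExact_d (h p p' : ℤ) (hp : 3 * h = p) (hp' : p + 1 = p') (q : ℤ) :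
    ∃ (a : ((longExact hT).X p).homology q ≅ ((rowHomology k h).obj T.X₁).homology q)
      (b : ((longExact hT).X p').homology q ≅ ((rowHomology k h).obj T.X₂).homology q),
      HomologicalComplex.homologyMap ((longExact hT).d p p') q ≫ b.hom =
        a.hom ≫ HomologicalComplex.homologyMap ((rowHomology k h).map T.f) q := by
  obtain ⟨a, b, hab⟩ := triComplex_arrow (fun h => (rowHomology k h).map T.f)
    (fun h => (rowHomology k h).map T.g) (rowDelta hT)
    (fun h => (rowHomology_exact₁ hT h).choose) (fun h => (rowHomology_exact₂ hT h).choose)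
    (fun h => (rowHomology_exact₃ hT h).choose) h p p' hp hp'
  refine ⟨(HomologicalComplex.homologyFunctor _ _ q).mapIso a,
    (HomologicalComplex.homologyFunctor _ _ q).mapIso b, ?_⟩
  exact (HomologicalComplex.homologyMap_comp _ _ q).symm.trans
    ((congrArg (fun f => HomologicalComplex.homologyMap f q) hab).trans
      (HomologicalComplex.homologyMap_comp _ _ q))

include hT in
/-- The spectral sequence of a short exact sequence of bounded bicomplexes whose third term has
vanishing `H_{hv}`. -/
lemma exists_spectralSequence {N : ℤ}
    (h₁ : ∀ j i : ℤ, (N < |j| ∨ N < |i|) → IsZero ((T.X₁.X j).X i))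
    (h₂ : ∀ j i : ℤ, (N < |j| ∨ N < |i|) → IsZero ((T.X₂.X j).X i))
    (h₃ : ∀ j i : ℤ, (N < |j| ∨ N < |i|) → IsZero ((T.X₃.X j).X i))
    (h₀ : ∀ h j, IsZero (((rowHomology k h).obj T.X₃).homology j)) :
    ∃ E : E₂CohomologicalSpectralSequence (ModuleCat.{u} k),
      (∀ i j : ℤ, IsZero ((E.page 2 le_rfl).X (-3 * i + 2, j))) ∧ ConvergesToZero E ∧
      (∀ i j : ℤ, Nonempty ((E.page 2 le_rfl).X (-3 * i, j) ≅
        kernel (HomologicalComplex.homologyMap ((rowHomology k (-i)).map T.f) j))) ∧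
      (∀ i j : ℤ, Nonempty ((E.page 2 le_rfl).X (-3 * i + 1, j) ≅
        cokernel (HomologicalComplex.homologyMap ((rowHomology k (-i)).map T.f) j))) := by
  refine ⟨acyclicSpectralSequence _ (longExact_exactAt hT), fun i j => ?_,
    acyclicSpectralSequence_convergesToZero _ _ (3 * N + 2) (longExact_isZero hT h₁ h₂ h₃),
    fun i j => ?_, fun i j => ?_⟩
  -- The column −3i + 2 = 3(−i) + 2 carries the horizontal homology of the third term in
  -- cohomological degree −i.
  · exact acyclicSpectralSequence_isZero _ _ _ _
      (longExact_isZero_homology hT h₀ _ (-i) j (by lia))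
  -- The column to the left is −3i − 1 = 3(−i − 1) + 2, again one of the third term, so only the
  -- kernel is taken here.
  · obtain ⟨e⟩ := acyclicSpectralSequence_kernel _ (longExact_exactAt hT) (p₀ := -3 * i - 1)
      (p := -3 * i) (p' := -3 * i + 1) (by lia) rfl j
      (longExact_isZero_homology hT h₀ _ (-i - 1) j (by lia))
    obtain ⟨a, b, hab⟩ := longExact_d hT (-i) (-3 * i) (-3 * i + 1) (by lia) rfl j
    exact ⟨e ≪≫ kernel.mapIso _ _ a b hab⟩
  -- The column to the right, −3i + 2, belongs to the third term, so only the cokernel is taken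
  -- here.
  · obtain ⟨e⟩ := acyclicSpectralSequence_cokernel _ (longExact_exactAt hT) (p := -3 * i)
      (p' := -3 * i + 1) (p'' := -3 * i + 2) rfl (by lia) j
      (longExact_isZero_homology hT h₀ _ (-i) j (by lia))
    obtain ⟨a, b, hab⟩ := longExact_d hT (-i) (-3 * i) (-3 * i + 1) (by lia) rfl j
    exact ⟨e ≪≫ cokernel.mapIso _ _ a b hab⟩

end LongExact

section Injection

variable {k : Type u} [Field k] [HasDerivedCategory.{w} (ModuleCat.{u} k)] {W : TangleDiagram 2}
  {s : Bool} {n : ℤ} (I : IIbInjection.{w} k W s n)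

/-- The short exact sequence of an injection of bicomplexes. -/
noncomputable abbrev IIbInjection.shortComplex : ShortComplex (Bicomplex k) :=
  ShortComplex.mk I.ι (cokernel.π I.ι) (cokernel.condition I.ι)

lemma IIbInjection.shortExact : I.shortComplex.ShortExact :=
  have := I.mono
  { exact := ShortComplex.exact_cokernel I.ι }

lemma IIbInjection.isBounded_cokernel : (cokernel I.ι).IsBounded := by
  obtain ⟨e⟩ := I.coker
  obtain ⟨N, hN⟩ := (FreeBicomplex.isBounded_toBigraded (W.cokernelComplex k) n).toBicomplex
  exact ⟨N, fun j i h => (hN j i h).of_iso ((HomologicalComplex.eval _ _ i).mapIso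
    ((HomologicalComplex.eval _ _ j).mapIso e))⟩

/-- This uses only that the cokernel is isomorphic to the tensor product with an identity map, which
is contractible; hence it applies to every admissible ι. -/
lemma IIbInjection.isZero_homology_cokernel (h j : ℤ) :
    IsZero (((rowHomology k h).obj (cokernel I.ι)).homology j) := by
  obtain ⟨e⟩ := I.coker
  exact (isZero_homology_rowHomology_of_homotopy
    (FreeBicomplex.tensorIdTwoTermHomotopy _ (-2) n) h j).of_iso
      ((HomologicalComplex.homologyFunctor _ _ j).mapIso ((rowHomology k h).mapIso e))

/-- By naturality of `toKDCompHhv`, the map computed on the representatives C and C' agrees with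
H_hv(ι) after conjugation with `repr` and `repr'`. Kernels and cokernels are thereby transported to
the homology of the links. -/
lemma IIbInjection.map_arrow (i j : ℤ) :
    ∃ (a : ((rowHomology k (-i)).obj I.C).homology j ≅ linkHomology.{w} k W.closeTrivial n i j)
      (b : ((rowHomology k (-i)).obj I.C').homology j ≅
        linkHomology.{w} k (W.closeBigon s) n i j),
      HomologicalComplex.homologyMap ((rowHomology k (-i)).map I.ι) j ≫ b.hom =
        a.hom ≫ I.map i j := by
  refine ⟨((toKDCompHhv.{w} k i j).app I.C).symm ≪≫ (Hhv.{w} k i j).mapIso I.repr,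
    ((toKDCompHhv.{w} k i j).app I.C').symm ≪≫ (Hhv.{w} k i j).mapIso I.repr', ?_⟩
  have h1 := (toKDCompHhv.{w} k i j).inv.naturality I.ι
  refine (Category.assoc _ _ _).symm.trans ((congrArg (· ≫ (Hhv.{w} k i j).map I.repr'.hom)
    h1).trans ((Category.assoc _ _ _).trans (Eq.trans ?_ (Category.assoc _ _ _).symm)))
  refine congrArg (fun f => (toKDCompHhv.{w} k i j).inv.app I.C ≫ f) ?_
  refine ((Hhv.{w} k i j).map_comp _ _).symm.trans (Eq.trans ?_ ((Hhv.{w} k i j).map_comp _ _))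
  refine congrArg (fun f => (Hhv.{w} k i j).map f) ?_
  exact (Iso.hom_inv_id_assoc I.repr _).symm

/-- The spectral sequence of a IIb move. -/
lemma IIbInjection.exists_spectralSequence :
    ∃ (E : E₂CohomologicalSpectralSequence (ModuleCat.{u} k))
      (_ : ∀ i j : ℤ, (E.page 2 le_rfl).X (-3 * i, j) ≅ kernel (I.map i j))
      (_ : ∀ i j : ℤ, (E.page 2 le_rfl).X (-3 * i + 1, j) ≅ cokernel (I.map i j)),
      (∀ i j : ℤ, IsZero ((E.page 2 le_rfl).X (-3 * i + 2, j))) ∧ ConvergesToZero E := by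
  obtain ⟨N₁, h₁⟩ := I.bounded
  obtain ⟨N₂, h₂⟩ := I.bounded'
  obtain ⟨N₃, h₃⟩ := I.isBounded_cokernel
  obtain ⟨E, hz, hE, eKer, eCoker⟩ := TripleLink.exists_spectralSequence I.shortExact
    (N := max N₁ (max N₂ N₃)) (fun j i h => h₁ j i (by lia)) (fun j i h => h₂ j i (by lia))
    (fun j i h => h₃ j i (by lia)) I.isZero_homology_cokernel
  choose a b hab using I.map_arrow
  exact ⟨E, fun i j => (eKer i j).some ≪≫ kernel.mapIso _ _ (a i j) (b i j) (hab i j),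
    fun i j => (eCoker i j).some ≪≫ cokernel.mapIso _ _ (a i j) (b i j) (hab i j), hz, hE⟩

end Injection

end TripleLink

theorem proposition3p5 (k : Type u) [Field k] [HasDerivedCategory.{w} (ModuleCat.{u} k)]
    (W : TripleLink.TangleDiagram 2) (s : Bool) (n : ℤ) :
    -- the injection exists
    Nonempty (TripleLink.IIbInjection.{w} k W s n) ∧
    -- and every such injection gives a spectral sequence as follows
    ∀ I : TripleLink.IIbInjection.{w} k W s n,
      ∃ (E : E₂CohomologicalSpectralSequence (ModuleCat.{u} k))
        (eKer : ∀ i j : ℤ, (E.page 2 le_rfl).X (-3 * i, j) ≅ kernel (I.map i j))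
        (eCoker : ∀ i j : ℤ, (E.page 2 le_rfl).X (-3 * i + 1, j) ≅ cokernel (I.map i j)),
        (∀ i j : ℤ, IsZero ((E.page 2 le_rfl).X (-3 * i + 2, j))) ∧
        TripleLink.ConvergesToZero E ∧
        ∃ α : ∀ i j : ℤ, TripleLink.linkHomology.{w} k (W.closeBigon s) n i j ⟶
            TripleLink.linkHomology.{w} k W.closeTrivial n (i - 1) (j - 1),
          (∀ i j : ℤ, α i j = cokernel.π (I.map i j) ≫ (eCoker i j).inv ≫
            (E.page 2 le_rfl).d (-3 * i + 1, j) (-3 * (i - 1), j - 1) ≫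
              (eKer (i - 1) (j - 1)).hom ≫ kernel.ι (I.map (i - 1) (j - 1))) ∧
          ∃ (h₁ : ∀ i j : ℤ, I.map i j ≫ α i j = 0)
            (h₂ : ∀ i j : ℤ, α i j ≫ I.map (i - 1) (j - 1) = 0),
            ((∀ i j : ℤ, (ShortComplex.mk _ _ (h₁ i j)).Exact ∧
                (ShortComplex.mk _ _ (h₂ i j)).Exact) ↔
              TripleLink.CollapsesAt E 3) := by
  refine ⟨W.nonempty_iibInjection k s n, fun I => ?_⟩
  obtain ⟨E, eKer, eCoker, hz, hE⟩ := I.exists_spectralSequence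
  exact ⟨E, eKer, eCoker, hz, hE, TripleLink.connecting E I.map eKer eCoker, fun _ _ => rfl,
    TripleLink.comp_connecting E I.map eKer eCoker, TripleLink.connecting_comp E I.map eKer eCoker,
    TripleLink.exact_iff_collapsesAt E hz I.map eKer eCoker hE⟩
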